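/- **Model.** Let $r\in\mathbb N$ be fixed and $y_{it}=\lambda_i'f_t+u_{it}$, where $\lambda_i\in\mathbb R^r$ ($i\ge 1$) are nonrandom loadings and $\{(f_t,u_t)\}_{t\in\mathbb Z}$, $f_t\in\mathbb R^r$, $u_t=(u_{it})_{i\ge1}$, is a random process; only $y_{it}$, $i\le N$, $t\le T$, is observed. For given $N$ write (with $u_t$ also denoting $(u_{1t},\dots,u_{Nt})'$) $\Lambda=(\lambda_1,\dots,\lambda_N)'$, $\Sigma_u=\mathrm{cov}(u_t)$, $\Lambda'\Sigma_u^{-1}=(\xi_1,\dots,\xi_N)$, $e_t=\Sigma_u^{-1}u_t$, $Y=(y_{it})_{i\le N,t\le T}$, $\omega_T=\sqrt{\log N/T}+1/\sqrt N$, and for $q\in[0,1/2)$, $m_N=\max_{i\le N}\sum_{j\le N}|\Sigma_{u,ij}|^q$ (with $0^q:=0$). $\|\cdot\|$ is the Euclidean norm. **Assumptions on the model.** (A1) $\{(f_t,u_t)\}$ is strictly stationary, $Eu_{it}=0$, $Ef_t=0$, $E u_{it}f_{jt}=0$. There are $c_1,c_2>0$ such that for all $N$ the eigenvalues of $\Sigma_u$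 and those of $\mathrm{cov}(f_t)$ lie in $(c_2,c_1)$ and $\|\lambda_j\|<c_1$ for all $j$. There are $r_1,r_2,b_1,b_2>0$ with $P(|u_{it}|>s)\le e^{-(s/b_1)^{r_1}}$ and $P(|f_{jt}|>s)\le e^{-(s/b_2)^{r_2}}$ for all $s>0$ and all $i,j$. There are $r_3,c>0$ with $|P(A)P(B)-P(A\cap B)|\le e^{-ck^{r_3}}$ for all integers $k\ge1$, $A\in\sigma((f_t,u_t):t\le0)$, $B\in\sigma((f_t,u_t):t\ge k)$. (A2) The eigenvalues of $\Lambda'\Lambda/N$ are bounded away from $0$ and $\infty$ as $N\to\infty$. (A3) $\max_{i\le N}\sum_{j\le N}|(\Sigma_u^{-1})_{ij}|=O(1)$. **Assumptions along the sample sizes.** $N,T,K\to\infty$ jointly along a sequence, with, for some $q\in[0,1/2)$: $K=o(\min\{T^{1/4},N^{1/4}\})$, $N^{1/(2-2q)}\log N=o(T)$, $T=o(N^2)$, $\sqrt N\,m_N^2\,\omega_T^{2-2q}=o(1)$, and: (B1) for each $t$, $E\|\frac1{\sqrt{NT}}\sum_{s\le T}f_s(u_s'\Sigma_u^{-1}u_t-Eu_s'\Sigma_u^{-1}u_t)\|^2=O(1)$;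 for each $i$, $E\|\frac1{\sqrt{NT}}\sum_{t\le T}\sum_{j\le N}\xi_j(u_{jt}u_{it}-Eu_{jt}u_{it})\|=O(1)$; for each $l\le r$, $E\|\frac1{\sqrt{NT}}\sum_{t\le T}\sum_{j\le N}\xi_ju_{jt}f_{lt}\|=O(1)$; for some $\delta\ge4$, $B>0$, eventually $E|\frac1{\sqrt N}(u_s'\Sigma_u^{-1}u_t-Eu_s'\Sigma_u^{-1}u_t)|^\delta<B$ and $E\|\frac1{\sqrt N}\Lambda'\Sigma_u^{-1}u_t\|^\delta<B$ for all $s,t\le T$. (B2) $\Lambda'\Sigma_u^{-1}\Lambda/N\to\Sigma_{\Lambda,e}$ for some $r\times r$ matrix $\Sigma_{\Lambda,e}$; the eigenvalues of $\Sigma_{\Lambda,e}\mathrm{cov}(f_t)$ are distinct; for each $t$, $(\Lambda'\Sigma_u^{-1}\Lambda)^{-1/2}\Lambda'\Sigma_u^{-1}u_t\to^d\mathcal N(0,I_r)$. (B3) $m_N=o(\min\{N^{-1/4}(T/\log N)^{(1-q)/2},N^{1/4-q/2}\})$, and there is a partition $\{1,\dots,N\}^2=S_L\cup S_U$ with all $(i,i)\in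 S_U$, $\#\{(i,j)\in S_U:i\ne j\}=O(N)$, $\sum_{S_L}|\Sigma_{u,ij}|=O(1)$, $\max_{S_L}|\Sigma_{u,ij}|=O(\omega_T)$, $\omega_T=O(\min_{S_U}|\Sigma_{u,ij}|)$. (B4) For each $t$ and $k\le r$, with $\zeta_{ij}=\sum_{s\le T}(u_{is}u_{js}-Eu_{is}u_{js})$, each of the following is $o_p(1)$: $\frac1{T\sqrt N}\sum_{i\le N}\zeta_{ii}\xi_ie_{it}$; $\frac1{NT\sqrt N}\sum_{i,j\le N}\zeta_{ij}\lambda_j\lambda_i'e_{it}\xi_{ik}$; $\frac1{T\sqrt N}\sum_{i\ne j,(i,j)\in S_U}\zeta_{ij}\xi_ie_{jt}$; $\frac1{NT\sqrt N}\sum_{i\ne j,(i,j)\in S_U}\sum_{v\le N}\zeta_{iv}\xi_{ik}e_{jt}\lambda_v\lambda_j'$. **Limits.** $V_e$ is the diagonal matrix of the eigenvalues, in decreasing order, of $\Sigma_{\Lambda,e}^{1/2}\mathrm{cov}(f_t)\Sigma_{\Lambda,e}^{1/2}$, $\Gamma_e$ an orthogonal matrix of corresponding eigenvectors, $Q_e=V_e^{1/2}\Gamma_e'\Sigma_{\Lambda,e}^{-1/2}$,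 $\Phi_j=E(f_1f_1'u_{j1}^2)+\sum_{h\ge1}E[(f_1f_{1+h}'+f_{1+h}f_1')u_{j1}u_{j,1+h}]$, $\Xi_e=(\Lambda'\Sigma_u^{-1}\Lambda/N)^{-1}$ (depending on $N$), $\Omega_i=\mathrm{cov}(f_t)^{-1}\Phi_i\mathrm{cov}(f_t)^{-1}$. **Estimators.** $S_y=YY'/T$ has decreasing eigenvalues $\nu_k$ and orthonormal eigenvectors $\eta_k$; $R=S_y-\sum_{k\le r}\nu_k\eta_k\eta_k'$. $\widehat\Sigma_u$ has diagonal entries $R_{ii}$ and off-diagonal entries $s_{ij}(R_{ij})$, where $s_{ij}=s_{ji}$ is a thresholding function with threshold $\tau_{ij}=C\sqrt{R_{ii}R_{jj}}\,\omega_T$: $s_{ij}(z)=0$ if $|z|<\tau_{ij}$, $|s_{ij}(z)-z|\le\tau_{ij}$, and $|s_{ij}(z)-z|\le a\tau_{ij}^2$ if $|z|>b\tau_{ij}$, for constants $a>0$, $b>1$. The columns of the $T\times r$ matrix $\widehat F^e/\sqrt T=(\widehat f_1^e,\dots,\widehat f_T^e)'/\sqrt T$ are orthonormal eigenvectors for the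 $r$ largest eigenvalues of $Y'\widehat\Sigma_u^{-1}Y$ (in decreasing order; any choice of eigenvectors), $\widehat V$ is the diagonal matrix of the $r$ largest eigenvalues of $Y'\widehat\Sigma_u^{-1}Y/(TN)$, $\widehat\Lambda^e=T^{-1}Y\widehat F^e=(\widehat\lambda_1^e,\dots,\widehat\lambda_N^e)'$, $\widehat u_{jt}=y_{jt}-\widehat\lambda_j^{e\prime}\widehat f_t^e$, $$\widehat V_e^{-1}=\tfrac1N\widehat V^{-1}\widehat\Lambda^{e\prime}\widehat\Sigma_u^{-1}\widehat\Lambda^e\widehat V^{-1},\qquad \widehat\Theta_{1i}=\tfrac1N\widehat\lambda_i^{e\prime}\widehat V^{-1}\widehat\Lambda^{e\prime}\widehat\Sigma_u^{-1}\widehat\Lambda^e\widehat V^{-1}\widehat\lambda_i^e,\qquad \widehat\Theta_{2,it}=\widehat f_t^{e\prime}\widehat\Psi_i\widehat f_t^e,$$ $$\widehat\Psi_j=\frac1T\sum_{t=1}^T\widehat u_{jt}^2\widehat f_t^e\widehat f_t^{e\prime}+\sum_{l=1}^K\Big(1-\frac l{K+1}\Big)\frac1T\sum_{t=l+1}^T\widehat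 u_{jt}\widehat u_{j,t-l}\big(\widehat f_t^e\widehat f_{t-l}^{e\prime}+\widehat f_{t-l}^e\widehat f_t^{e\prime}\big).$$ **Theorem.** Under (A1)–(A3) there is a constant $C_0>0$ such that for every threshold constant $C\ge C_0$, every family of thresholding functions and all sequences $N,T,K\to\infty$ satisfying the above conditions including (B1)–(B4), the following holds. The series defining $\Phi_j$ converges for every $j$, and $$\widehat V_e^{-1}\to^pV_e^{-1},\qquad D\widehat\Psi_jD\to^pQ_e'^{-1}\Phi_jQ_e^{-1}\ \text{ for each }j,$$ for some (random, sample-dependent) diagonal matrices $D$ with diagonal entries $\pm1$ not depending on $j$ (they align the arbitrary signs of the columns of $\widehat F^e$ with those of $\Gamma_e$), and, for each $i$ and $t$, $$\widehat\Theta_{1i}-\lambda_i'\Xi_e\lambda_i\to^p0,\qquad\widehat\Theta_{2,it}\to^pf_t'\Omega_if_t.$$ -/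

import Mathlib

open MeasureTheory ProbabilityTheory Filter Asymptotics Matrix
open scoped Topology

noncomputable section

/-! ### Linear algebra -/

/-- The `k`-th largest eigenvalue (`k = 0, 1, …`, counted with multiplicity) of a real symmetric
matrix; zero if the matrix is not symmetric or has no `k`-th eigenvalue. -/
def eigDesc {m : Type*} [Fintype m] [DecidableEq m] (A : Matrix m m ℝ) (k : ℕ) : ℝ :=
  open Classical in
  if h : A.IsHermitian ∧ k < Fintype.card m then h.1.eigenvalues₀ ⟨k, h.2⟩ else 0

/-- The columns of `U` are orthonormal eigenvectors of the symmetric matrix `A`, the `k`-th column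
belonging to the `k`-th largest eigenvalue. -/
structure IsTopEigenvectors {m : Type*} [Fintype m] [DecidableEq m] {r : ℕ}
    (A : Matrix m m ℝ) (U : Matrix m (Fin r) ℝ) : Prop where
  orthonormal : Uᵀ * U = 1
  eigen : ∀ k : Fin r, A *ᵥ (fun i => U i k) = eigDesc A k • (fun i => U i k)

/-- The symmetric square root of a positive semidefinite matrix (functional calculus). -/
def matSqrt {m : Type*} [Fintype m] [DecidableEq m] (A : Matrix m m ℝ) : Matrix m m ℝ :=
  cfc Real.sqrt A

/-- Euclidean norm of a coordinate vector. -/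
def vnorm {m : Type*} [Fintype m] (v : m → ℝ) : ℝ := Real.sqrt (∑ i, v i ^ 2)

/-- Entrywise convergence in probability of random matrices of a fixed size to a fixed matrix. -/
def MatTendstoInProb {Ω m k : Type*} [MeasurableSpace Ω] (P : Measure Ω)
    (X : ℕ → Ω → Matrix m k ℝ) (A : Matrix m k ℝ) : Prop :=
  ∀ i j, TendstoInMeasure P (fun n ω => X n ω i j) atTop (fun _ => A i j)

/-! ### The approximate factor model

Cross-sectional units are numbered `0, 1, 2, …` and times are integers; the sample of size
`(N, T)` consists of the units `0, …, N - 1` at the times `0, …, T - 1`. -/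

/-- Loadings `lam i`, factors `f k t` (`k`-th factor at time `t`), and idiosyncratic components
`u i t` (unit `i` at time `t`). -/
structure FactorModel (r : ℕ) (Ω : Type*) where
  lam : ℕ → Fin r → ℝ
  f : Fin r → ℤ → Ω → ℝ
  u : ℕ → ℤ → Ω → ℝ

namespace FactorModel

variable {r : ℕ} {Ω : Type*} [MeasurableSpace Ω]

/-- The vector of factors at time `t`. -/
def fvec (M : FactorModel r Ω) (t : ℤ) (ω : Ω) : Fin r → ℝ := fun k => M.f k t ω

/-- The vector of the first `N` idiosyncratic components at time `t`. -/
def uvec (M : FactorModel r Ω) (N : ℕ) (t : ℤ) (ω : Ω) : Fin N → ℝ := fun i => M.u i t ω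

/-- The observations `y i t = lam i ⬝ f t + u i t`. -/
def y (M : FactorModel r Ω) (ω : Ω) (i t : ℕ) : ℝ :=
  M.lam i ⬝ᵥ M.fvec t ω + M.u i t ω

/-- The state `(f_t, u_t)` of the process at time `t`. -/
def state (M : FactorModel r Ω) (t : ℤ) (ω : Ω) : (Fin r → ℝ) × (ℕ → ℝ) :=
  (fun k => M.f k t ω, fun i => M.u i t ω)

/-- The `σ`-algebra generated by `(f_t, u_t)`, `t ≤ 0`. -/
@[reducible] def past (M : FactorModel r Ω) : MeasurableSpace Ω :=
  ⨆ t : {t : ℤ // t ≤ 0}, MeasurableSpace.comap (M.state t) inferInstance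

/-- The `σ`-algebra generated by `(f_t, u_t)`, `k ≤ t`. -/
@[reducible] def future (M : FactorModel r Ω) (k : ℤ) : MeasurableSpace Ω :=
  ⨆ t : {t : ℤ // k ≤ t}, MeasurableSpace.comap (M.state t) inferInstance

/-- `Λ`, with rows `lam 0, …, lam (N - 1)`. -/
def Lam (M : FactorModel r Ω) (N : ℕ) : Matrix (Fin N) (Fin r) ℝ := Matrix.of fun i k => M.lam i k

/-- `cov(u_t)` for the first `N` units. -/
def SigmaU (M : FactorModel r Ω) (P : Measure Ω) (N : ℕ) : Matrix (Fin N) (Fin N) ℝ :=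
  Matrix.of fun i j => cov[M.u i 0, M.u j 0; P]

/-- `cov(f_t)`. -/
def SigmaF (M : FactorModel r Ω) (P : Measure Ω) : Matrix (Fin r) (Fin r) ℝ :=
  Matrix.of fun k l => cov[M.f k 0, M.f l 0; P]

/-- The optimal weight matrix `W = Σ_u⁻¹`. -/
def W (M : FactorModel r Ω) (P : Measure Ω) (N : ℕ) : Matrix (Fin N) (Fin N) ℝ :=
  (M.SigmaU P N)⁻¹

/-- `Λ' Σ_u⁻¹`; its columns are the vectors `ξ_1, …, ξ_N`. -/
def xi (M : FactorModel r Ω) (P : Measure Ω) (N : ℕ) : Matrix (Fin r) (Fin N) ℝ :=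
  (M.Lam N)ᵀ * M.W P N

/-- `e_t = Σ_u⁻¹ u_t`. -/
def e (M : FactorModel r Ω) (P : Measure Ω) (N : ℕ) (t : ℤ) (ω : Ω) : Fin N → ℝ :=
  M.W P N *ᵥ M.uvec N t ω

/-- `u_{is} u_{jt} - E u_{is} u_{jt}`. -/
def uu (M : FactorModel r Ω) (P : Measure Ω) (i : ℕ) (s : ℤ) (j : ℕ) (t : ℤ) (ω : Ω) : ℝ :=
  M.u i s ω * M.u j t ω - ∫ ω', M.u i s ω' * M.u j t ω' ∂P

/-- `u_s' Σ_u⁻¹ u_t`. -/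
def quad (M : FactorModel r Ω) (P : Measure Ω) (N : ℕ) (s t : ℤ) (ω : Ω) : ℝ :=
  M.uvec N s ω ⬝ᵥ (M.W P N *ᵥ M.uvec N t ω)

/-- `u_s' Σ_u⁻¹ u_t - E u_s' Σ_u⁻¹ u_t`. -/
def quadC (M : FactorModel r Ω) (P : Measure Ω) (N : ℕ) (s t : ℤ) (ω : Ω) : ℝ :=
  M.quad P N s t ω - ∫ ω', M.quad P N s t ω' ∂P

/-- The `h`-th term, `h = 1, 2, …`, of the series in the long-run covariance:
`E[(f_0 f_h' + f_h f_0') u_{j0} u_{jh}]`. -/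
def PhiTerm (M : FactorModel r Ω) (P : Measure Ω) (j : ℕ) (h : ℕ) : Matrix (Fin r) (Fin r) ℝ :=
  Matrix.of fun k l =>
    ∫ ω, (M.f k 0 ω * M.f l h ω + M.f k h ω * M.f l 0 ω) * M.u j 0 ω * M.u j h ω ∂P

/-- The long-run covariance matrix `Φ_j` of `f_t u_{jt}`. -/
def Phi (M : FactorModel r Ω) (P : Measure Ω) (j : ℕ) : Matrix (Fin r) (Fin r) ℝ :=
  (Matrix.of fun k l => ∫ ω, M.f k 0 ω * M.f l 0 ω * M.u j 0 ω ^ 2 ∂P)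
    + ∑' h : ℕ, M.PhiTerm P j (h + 1)

/-- `Ω_i = cov(f_t)⁻¹ Φ_i cov(f_t)⁻¹`. -/
def OmegaMat (M : FactorModel r Ω) (P : Measure Ω) (i : ℕ) : Matrix (Fin r) (Fin r) ℝ :=
  (M.SigmaF P)⁻¹ * M.Phi P i * (M.SigmaF P)⁻¹

/-- `Λ' Σ_u⁻¹ Λ / N`. -/
def weightedLam (M : FactorModel r Ω) (P : Measure Ω) (N : ℕ) : Matrix (Fin r) (Fin r) ℝ :=
  (1 / (N : ℝ)) • ((M.Lam N)ᵀ * M.W P N * M.Lam N)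

/-- `Ξ_e = (Λ' Σ_u⁻¹ Λ / N)⁻¹`. -/
def XiE (M : FactorModel r Ω) (P : Measure Ω) (N : ℕ) : Matrix (Fin r) (Fin r) ℝ :=
  (M.weightedLam P N)⁻¹

/-- Measurability, strict stationarity, moment, eigenvalue, tail and mixing conditions. -/
structure Regular (M : FactorModel r Ω) (P : Measure Ω) : Prop where
  measurable_f : ∀ k t, Measurable (M.f k t)
  measurable_u : ∀ i t, Measurable (M.u i t)
  stationary : ∀ h : ℤ,
    P.map (fun ω (t : ℤ) => M.state (t + h) ω) = P.map (fun ω (t : ℤ) => M.state t ω)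
  mean_u : ∀ i t, ∫ ω, M.u i t ω ∂P = 0
  mean_f : ∀ k t, ∫ ω, M.f k t ω ∂P = 0
  mean_uf : ∀ i k t, ∫ ω, M.u i t ω * M.f k t ω ∂P = 0
  bounds : ∃ c₁ > 0, ∃ c₂ > 0,
    (∀ N : ℕ, ∀ x ∈ spectrum ℝ (M.SigmaU P N), c₂ < x ∧ x < c₁) ∧
    (∀ j : ℕ, vnorm (M.lam j) < c₁) ∧
    (∀ x ∈ spectrum ℝ (M.SigmaF P), c₂ < x ∧ x < c₁)
  tails : ∃ r₁ > 0, ∃ r₂ > 0, ∃ b₁ > 0, ∃ b₂ > 0,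
    (∀ i t, ∀ s > 0, P.real {ω | s < |M.u i t ω|} ≤ Real.exp (-(s / b₁) ^ (r₁ : ℝ))) ∧
    (∀ k t, ∀ s > 0, P.real {ω | s < |M.f k t ω|} ≤ Real.exp (-(s / b₂) ^ (r₂ : ℝ)))
  mixing : ∃ r₃ > 0, ∃ c > 0, ∀ k : ℕ, 0 < k → ∀ A B : Set Ω,
    MeasurableSet[M.past] A → MeasurableSet[M.future k] B →
      |P.real A * P.real B - P.real (A ∩ B)| ≤ Real.exp (-c * (k : ℝ) ^ (r₃ : ℝ))

/-- The eigenvalues of `Λ'Λ/N` are bounded away from zero and infinity as `N → ∞`. -/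
def Pervasive (M : FactorModel r Ω) : Prop :=
  ∃ a > 0, ∃ b : ℝ, ∀ᶠ N : ℕ in atTop,
    ∀ x ∈ spectrum ℝ ((1 / (N : ℝ)) • ((M.Lam N)ᵀ * M.Lam N)), a ≤ x ∧ x ≤ b

/-- The absolute row sums of `Σ_u⁻¹` are bounded uniformly in `N`. -/
def BoundedRowSums (M : FactorModel r Ω) (P : Measure Ω) : Prop :=
  ∃ B : ℝ, ∀ N : ℕ, ∀ i : Fin N, ∑ j, |M.W P N i j| ≤ B

/-- Moment conditions along sample sizes `(N n, T n)`, with the weight matrix `Σ_u⁻¹`. -/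
structure MomentConditions (M : FactorModel r Ω) (P : Measure Ω) (N T : ℕ → ℕ) : Prop where
  factor_quad : ∀ t : ℕ, (fun n => ∫ ω, vnorm (fun k : Fin r =>
      1 / √((N n : ℝ) * T n) * ∑ s ∈ Finset.range (T n),
        M.f k s ω * M.quadC P (N n) s t ω) ^ 2 ∂P) =O[atTop] (fun _ => (1 : ℝ))
  cross_product : ∀ i : ℕ, (fun n => ∫ ω, vnorm (fun k : Fin r =>
      1 / √((N n : ℝ) * T n) * ∑ t ∈ Finset.range (T n), ∑ j : Fin (N n),
        M.xi P (N n) k j * M.uu P j t i t ω) ∂P) =O[atTop] (fun _ => (1 : ℝ))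
  factor_error : ∀ l : Fin r, (fun n => ∫ ω, vnorm (fun k : Fin r =>
      1 / √((N n : ℝ) * T n) * ∑ t ∈ Finset.range (T n), ∑ j : Fin (N n),
        M.xi P (N n) k j * M.u j t ω * M.f l t ω) ∂P) =O[atTop] (fun _ => (1 : ℝ))
  higher : ∃ δ ≥ (4 : ℝ), ∃ B > (0 : ℝ), ∀ᶠ n in atTop, ∀ s < T n, ∀ t < T n,
    (∫ ω, |1 / √(N n : ℝ) * M.quadC P (N n) s t ω| ^ δ ∂P) < B ∧
    (∫ ω, vnorm ((1 / √(N n : ℝ)) • (M.xi P (N n) *ᵥ M.uvec (N n) t ω)) ^ δ ∂P) < B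

/-- `Λ' Σ_u⁻¹ Λ / N → SigLam`, the eigenvalues of `SigLam cov(f_t)` are distinct, and the
standardized `Λ' Σ_u⁻¹ u_t` is asymptotically `N(0, I_r)`; with `W = Σ_u⁻¹`. -/
structure LimitConditions (M : FactorModel r Ω) (P : Measure Ω) [IsProbabilityMeasure P]
    (N : ℕ → ℕ) (SigLam : Matrix (Fin r) (Fin r) ℝ) : Prop where
  tendsto : Tendsto (fun n => M.weightedLam P (N n)) atTop (𝓝 SigLam)
  distinct : (SigLam * M.SigmaF P).charpoly.roots.Nodup
  clt : ∀ t : ℕ, TendstoInDistribution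
    (fun n ω => (matSqrt ((M.Lam (N n))ᵀ * M.W P (N n) * M.SigmaU P (N n) * M.W P (N n)
      * M.Lam (N n)))⁻¹ *ᵥ (M.xi P (N n) *ᵥ M.uvec (N n) t ω))
    atTop (id : (Fin r → ℝ) → (Fin r → ℝ)) (fun _ => P)
    (Measure.pi fun _ : Fin r => gaussianReal 0 1)

/-- The sparsity measure `m_N = max_i ∑_j |Σ_{u,ij}|^q`, where zero entries contribute zero also
when `q = 0`. -/
def sparsity (M : FactorModel r Ω) (P : Measure Ω) (q : ℝ) (N : ℕ) : ℝ :=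
  ⨆ i : Fin N, ∑ j : Fin N, if M.SigmaU P N i j = 0 then 0 else |M.SigmaU P N i j| ^ q

end FactorModel

/-- `ω_T = √(log N / T) + 1 / √N`. -/
def omegaRate (N T : ℕ) : ℝ := √(Real.log N / T) + 1 / √(N : ℝ)

namespace FactorModel

variable {r : ℕ} {Ω : Type*} [MeasurableSpace Ω]

/-- Conditional sparsity of `Σ_u`: `SU n` is the set of indices of the large elements, its
complement the set of indices of the small elements. -/
structure CondSparse (M : FactorModel r Ω) (P : Measure Ω) (q : ℝ) (N T : ℕ → ℕ)
    (SU : ∀ n, Finset (Fin (N n) × Fin (N n))) : Prop where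
  q_nonneg : 0 ≤ q
  q_lt : q < 1 / 2
  rate : (fun n => M.sparsity P q (N n)) =o[atTop] fun n =>
    min (1 / (N n : ℝ) ^ (1 / 4 : ℝ) * ((T n : ℝ) / Real.log (N n)) ^ ((1 - q) / 2))
      ((N n : ℝ) ^ (1 / 4 - q / 2))
  diag : ∀ n i, (i, i) ∈ SU n
  card_large : (fun n => (((SU n).filter fun p => p.1 ≠ p.2).card : ℝ)) =O[atTop]
    fun n => (N n : ℝ)
  sum_small : (fun n => ∑ p ∈ (SU n)ᶜ, |M.SigmaU P (N n) p.1 p.2|) =O[atTop] fun _ => (1 : ℝ)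
  max_small : ∃ a : ℝ, ∀ᶠ n in atTop, ∀ p ∉ SU n,
    |M.SigmaU P (N n) p.1 p.2| ≤ a * omegaRate (N n) (T n)
  min_large : ∃ a : ℝ, ∀ᶠ n in atTop, ∀ p ∈ SU n,
    omegaRate (N n) (T n) ≤ a * |M.SigmaU P (N n) p.1 p.2|

/-- The technical conditions for the weighted convergence of the estimated weight matrix. -/
structure WeightedConditions (M : FactorModel r Ω) (P : Measure Ω) (N T : ℕ → ℕ)
    (SU : ∀ n, Finset (Fin (N n) × Fin (N n))) : Prop where
  diag : ∀ (t : ℕ) (a : Fin r), TendstoInMeasure P (fun n ω =>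
      1 / ((T n : ℝ) * √(N n : ℝ)) * ∑ i : Fin (N n), ∑ s ∈ Finset.range (T n),
        M.uu P i s i s ω * M.xi P (N n) a i * M.e P (N n) t ω i) atTop (fun _ => 0)
  diag_loading : ∀ (t : ℕ) (k a b : Fin r), TendstoInMeasure P (fun n ω =>
      1 / ((N n : ℝ) * T n * √(N n : ℝ)) *
        ∑ i : Fin (N n), ∑ s ∈ Finset.range (T n), ∑ j : Fin (N n),
          M.uu P j s i s ω * M.lam j a * M.lam i b * M.e P (N n) t ω i * M.xi P (N n) k i)
      atTop (fun _ => 0)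
  offdiag : ∀ (t : ℕ) (a : Fin r), TendstoInMeasure P (fun n ω =>
      1 / ((T n : ℝ) * √(N n : ℝ)) *
        ∑ p ∈ (SU n).filter (fun p => p.1 ≠ p.2), ∑ s ∈ Finset.range (T n),
          M.uu P p.1 s p.2 s ω * M.xi P (N n) a p.1 * M.e P (N n) t ω p.2) atTop (fun _ => 0)
  offdiag_loading : ∀ (t : ℕ) (k a b : Fin r), TendstoInMeasure P (fun n ω =>
      1 / ((N n : ℝ) * T n * √(N n : ℝ)) *
        ∑ p ∈ (SU n).filter (fun p => p.1 ≠ p.2), ∑ v : Fin (N n), ∑ s ∈ Finset.range (T n),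
          M.uu P p.1 s v s ω * M.xi P (N n) k p.1 * M.e P (N n) t ω p.2
            * M.lam v a * M.lam p.2 b) atTop (fun _ => 0)

/-- The limit matrix `Σ_Λ^{1/2} cov(f_t) Σ_Λ^{1/2}`. -/
def limitMat (M : FactorModel r Ω) (P : Measure Ω) (SigLam : Matrix (Fin r) (Fin r) ℝ) :
    Matrix (Fin r) (Fin r) ℝ :=
  matSqrt SigLam * M.SigmaF P * matSqrt SigLam

/-- `V_e`, the diagonal matrix of the eigenvalues of `limitMat` in decreasing order. -/
def Ve (M : FactorModel r Ω) (P : Measure Ω) (SigLam : Matrix (Fin r) (Fin r) ℝ) :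
    Matrix (Fin r) (Fin r) ℝ :=
  Matrix.diagonal fun k => eigDesc (M.limitMat P SigLam) k

/-- `Q_e = V_e^{1/2} Γ_e' Σ_Λ^{-1/2}`. -/
def Qe (M : FactorModel r Ω) (P : Measure Ω) (SigLam Γ : Matrix (Fin r) (Fin r) ℝ) :
    Matrix (Fin r) (Fin r) ℝ :=
  matSqrt (M.Ve P SigLam) * Γᵀ * (matSqrt SigLam)⁻¹

end FactorModel

/-! ### The estimators, as functions of the data `y i t`, `i < N`, `t < T` -/

/-- A symmetric family of thresholding functions; `s i j τ` is the function applied to the entry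
`(i, j)` when the threshold is `τ`. -/
structure IsThresholding (s : ℕ → ℕ → ℝ → ℝ → ℝ) : Prop where
  symm : ∀ i j, s i j = s j i
  zero : ∀ i j τ z, 0 < τ → |z| < τ → s i j τ z = 0
  close : ∀ i j τ z, 0 < τ → |s i j τ z - z| ≤ τ
  large : ∃ a > 0, ∃ b > 1, ∀ i j τ z, 0 < τ → b * τ < |z| → |s i j τ z - z| ≤ a * τ ^ 2

/-- The `N × T` data matrix. -/
def dataMat (y : ℕ → ℕ → ℝ) (N T : ℕ) : Matrix (Fin N) (Fin T) ℝ := Matrix.of fun i t => y i t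

/-- Sample covariance `T⁻¹ Y Y'` of the (mean zero) data. -/
def sampleCov (y : ℕ → ℕ → ℝ) (N T : ℕ) : Matrix (Fin N) (Fin N) ℝ :=
  (1 / (T : ℝ)) • (dataMat y N T * (dataMat y N T)ᵀ)

/-- `R = S_y - ∑_{k<r} ν_k ξ_k ξ_k'`, where the columns of `E` are the leading eigenvectors `ξ_k`
of `S_y`. -/
def residCov {r : ℕ} (y : ℕ → ℕ → ℝ) (N T : ℕ) (E : Matrix (Fin N) (Fin r) ℝ) :
    Matrix (Fin N) (Fin N) ℝ :=
  sampleCov y N T -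
    E * Matrix.diagonal (fun k : Fin r => eigDesc (sampleCov y N T) k) * Eᵀ

/-- The thresholded estimator of `Σ_u`, with thresholds `C √(R_ii R_jj) ω_T`. -/
def sigmaHat {r : ℕ} (s : ℕ → ℕ → ℝ → ℝ → ℝ) (C : ℝ) (y : ℕ → ℕ → ℝ) (N T : ℕ)
    (E : Matrix (Fin N) (Fin r) ℝ) : Matrix (Fin N) (Fin N) ℝ :=
  Matrix.of fun i j =>
    if i = j then residCov y N T E i i
    else s i j (C * √(residCov y N T E i i * residCov y N T E j j) * omegaRate N T)
      (residCov y N T E i j)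

/-- `F t`, `t < T`, are the weighted principal component factor estimates for the weight matrix
`S⁻¹`: the columns of the `T × r` matrix `F / √T` are the eigenvectors of the `r` largest
eigenvalues of `Y' S⁻¹ Y`. -/
def IsWPC {r : ℕ} (y : ℕ → ℕ → ℝ) (N T : ℕ) (S : Matrix (Fin N) (Fin N) ℝ)
    (F : ℕ → Fin r → ℝ) : Prop :=
  IsTopEigenvectors ((dataMat y N T)ᵀ * S⁻¹ * dataMat y N T)
    (Matrix.of fun (t : Fin T) (k : Fin r) => F t k / √(T : ℝ))

/-- The diagonal matrix of the `r` largest eigenvalues of `Y' S⁻¹ Y / (T N)`. -/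
def Vhat (r : ℕ) (y : ℕ → ℕ → ℝ) (N T : ℕ) (S : Matrix (Fin N) (Fin N) ℝ) :
    Matrix (Fin r) (Fin r) ℝ :=
  Matrix.diagonal fun k => eigDesc
    ((1 / ((T : ℝ) * N)) • ((dataMat y N T)ᵀ * S⁻¹ * dataMat y N T)) k

/-- Estimated loading of unit `j`, the `j`-th row of `T⁻¹ Y F`. -/
def lamHat {r : ℕ} (y : ℕ → ℕ → ℝ) (T : ℕ) (F : ℕ → Fin r → ℝ) (j : ℕ) : Fin r → ℝ :=
  fun k => 1 / (T : ℝ) * ∑ t ∈ Finset.range T, y j t * F t k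

/-- The matrix of estimated loadings of the units `0, …, N - 1`. -/
def LamHat {r : ℕ} (y : ℕ → ℕ → ℝ) (N T : ℕ) (F : ℕ → Fin r → ℝ) : Matrix (Fin N) (Fin r) ℝ :=
  Matrix.of fun i k => lamHat y T F i k

/-- Estimated error term. -/
def uHat {r : ℕ} (y : ℕ → ℕ → ℝ) (T : ℕ) (F : ℕ → Fin r → ℝ) (j t : ℕ) : ℝ :=
  y j t - lamHat y T F j ⬝ᵥ F t

/-- The estimator `N⁻¹ V̂⁻¹ Λ̂' S⁻¹ Λ̂ V̂⁻¹` of `V_e⁻¹`. -/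
def VeInvHat {r : ℕ} (y : ℕ → ℕ → ℝ) (N T : ℕ) (S : Matrix (Fin N) (Fin N) ℝ)
    (F : ℕ → Fin r → ℝ) : Matrix (Fin r) (Fin r) ℝ :=
  (1 / (N : ℝ)) • ((Vhat r y N T S)⁻¹ * (LamHat y N T F)ᵀ * S⁻¹ * LamHat y N T F
    * (Vhat r y N T S)⁻¹)

/-- The Newey–West estimator with bandwidth `K`. -/
def hac {r : ℕ} (y : ℕ → ℕ → ℝ) (T K : ℕ) (F : ℕ → Fin r → ℝ) (j : ℕ) :
    Matrix (Fin r) (Fin r) ℝ :=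
  (1 / (T : ℝ)) • ∑ t ∈ Finset.range T, uHat y T F j t ^ 2 • vecMulVec (F t) (F t)
    + ∑ l ∈ Finset.Icc 1 K, (1 - (l : ℝ) / (K + 1)) • (1 / (T : ℝ)) •
        ∑ t ∈ Finset.Ico l T, (uHat y T F j t * uHat y T F j (t - l)) •
          (vecMulVec (F t) (F (t - l)) + vecMulVec (F (t - l)) (F t))

/-- `N⁻¹ λ̂_i' V̂⁻¹ Λ̂' S⁻¹ Λ̂ V̂⁻¹ λ̂_i`. -/
def Theta1Hat {r : ℕ} (y : ℕ → ℕ → ℝ) (N T : ℕ) (S : Matrix (Fin N) (Fin N) ℝ)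
    (F : ℕ → Fin r → ℝ) (i : ℕ) : ℝ :=
  lamHat y T F i ⬝ᵥ (VeInvHat y N T S F *ᵥ lamHat y T F i)

/-- `f̂_t' Ψ̂_i f̂_t`. -/
def Theta2Hat {r : ℕ} (y : ℕ → ℕ → ℝ) (T K : ℕ) (F : ℕ → Fin r → ℝ) (i t : ℕ) : ℝ :=
  F t ⬝ᵥ (hac y T K F i *ᵥ F t)

end

/-! Write the scaled data as `L * Xᵀ + U` with `L = Λ/√N`, `X = F/√T` and `U = u/√(NT)`. Then `L`
and `X` have norm of order one, and `U` is small with high probability. Principal components are a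
perturbation problem: if `Z` holds the top eigenvectors of `Y'WY` and `v` their eigenvalues, the
eigenvalue equation reads `Z = X Bᵀ + E`, where `B` is a rotation and `E` is bounded by `‖U'WL‖ +
‖U‖²` up to constants (`IsApproxPC.Z_eq`, `IsApproxPC.norm_pcErr`).

Probability enters mainly through second moments. Mixing and light tails give moderate deviations
for sums of products (`IsMixing.moderate_deviation`, by blocking, truncation and an exponential
inequality), and a union bound over all pairs of components makes sample covariances accurate at
rate `√(log N / T)` uniformly (`exists_sample_moment_deviation`). Hence `‖U‖²` has order `ω_T`.

In the first estimation stage the weight is the identity. The residual covariances are entrywise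
within a constant times `ω_T` of `Σ_u` (`IsSample.abs_resid_cov_sub_le`): the error of the fitted
factors has order `√ω_T` but enters squared, while the linear terms are pairings with errors that
are uncorrelated with the factors. If `C` is large, thresholding kills the noise and Schur's test
turns the entrywise bound into an operator bound of order `m_N ω_T^(1-q)`
(`PopBounds.norm_sigmaHat_sub_le`). The rate condition on `√N m_N² ω_T^(2-2q)` says exactly that
this is `o(N^(-1/4))`.

In the second stage the weight is the estimate of `Σ_u⁻¹`. With the true weight, `‖U'WL‖` has order
`N^(-1/2)` by a variance computation; replacing the weight costs `‖U‖` times `o(N^(-1/4))`. Thus all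
errors are at most of order `min(N,T)^(-19/40)`, the square root rate up to a power that absorbs
logarithms (`FirstStage.exists_isPCSample`).

The limits follow. With `H = ZᵀX`, one has `HᵀH → cov(f)` and `diag(v) - H (L'WL) Hᵀ → 0`. Two
quadratic forms with distinct relative eigenvalues are diagonalized simultaneously by a matrix that
is unique up to signs of rows, so `v → V_e` and `H → Q_e` after a sign change, and the rotation of
the factors tends to `(Q_eᵀ)⁻¹` (`tendsto_simultaneous_diagonalization`, `FirstStage.secondStage`).
The estimator of `V_e⁻¹` is algebraically the inverse of the matrix of sample eigenvalues, and
estimated loadings are `H λ_i` plus a small term, which settles the first variance component.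

For the long-run covariance, the Newey–West sum is a bilinear form in the scores. On true scores it
converges by covariance summability and a variance bound of order `K³/T` (`IsMixing.tendsto_nwSum`).
Replacing estimated scores by rotated true ones costs at most `K b³ min(N,T)^(-19/40)` up to
constants, where `b = min(N,T)^(1/40)` bounds all components (`GoodSample.abs_hac_sub_le`). Finally
the fitted factors at a fixed time converge to the rotated true ones, which gives the second
variance component.

Convergence in probability is expressed as convergence along the filter `whp P`, so that limit
algebra and compactness apply to it directly. -/

set_option linter.unusedSectionVars false

/-! ### Strong mixing -/

section Mixing

variable {Ω : Type*} {mΩ : MeasurableSpace Ω} {P : Measure Ω} [IsProbabilityMeasure P]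

/-- An integrable variable whose integrals over the events of a `σ`-algebra are small is nearly
orthogonal to the bounded variables measurable with respect to that `σ`-algebra. -/
lemma abs_integral_mul_le_of_setIntegral {𝓜 : MeasurableSpace Ω} (h𝓜 : 𝓜 ≤ mΩ) {Z W : Ω → ℝ}
    {a c : ℝ} (ha : 0 ≤ a) (hZ : Measurable[𝓜] Z) (hZa : ∀ ω, |Z ω| ≤ a) (hW : Integrable W P)
    (hc : ∀ A, MeasurableSet[𝓜] A → |∫ ω in A, W ω ∂P| ≤ c) :
    |∫ ω, Z ω * W ω ∂P| ≤ 2 * a * c := by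
  -- A factor measurable with respect to the `σ`-algebra only sees the conditional expectation of
  -- `W`.
  have h1 : ∫ ω, Z ω * W ω ∂P = ∫ ω, Z ω * (P[W|𝓜]) ω ∂P := by
    have := condExp_stronglyMeasurable_mul_of_bound (μ := P) h𝓜 hZ.stronglyMeasurable hW a
      (ae_of_all _ hZa)
    calc ∫ ω, Z ω * W ω ∂P = ∫ ω, (P[Z * W|𝓜]) ω ∂P := (integral_condExp h𝓜).symm
      _ = _ := integral_congr_ae this
  have hη : Integrable (P[W|𝓜]) P := integrable_condExp
  -- The set where the conditional expectation is nonnegative belongs to the `σ`-algebra, so the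
  -- hypothesis applies to it and to its complement; together they give the `L¹` norm, whence the
  -- factor 2.
  set A : Set Ω := {ω | 0 ≤ (P[W|𝓜]) ω} with hA
  have hAm : MeasurableSet[𝓜] A :=
    stronglyMeasurable_condExp.measurable measurableSet_Ici
  have h2 : ∫ ω, |(P[W|𝓜]) ω| ∂P ≤ 2 * c := by
    rw [← integral_add_compl (h𝓜 _ hAm) hη.abs]
    have e1 : ∫ ω in A, |(P[W|𝓜]) ω| ∂P = ∫ ω in A, W ω ∂P := by
      rw [← setIntegral_condExp h𝓜 hW hAm]
      exact setIntegral_congr_fun (h𝓜 _ hAm) fun ω hω => abs_of_nonneg hω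
    have e2 : ∫ ω in Aᶜ, |(P[W|𝓜]) ω| ∂P = -∫ ω in Aᶜ, W ω ∂P := by
      rw [← setIntegral_condExp h𝓜 hW hAm.compl, ← integral_neg]
      exact setIntegral_congr_fun (h𝓜 _ hAm).compl fun ω hω => abs_of_neg (not_le.1 hω)
    rw [e1, e2]
    have := abs_le.1 (hc A hAm)
    have := abs_le.1 (hc Aᶜ hAm.compl)
    linarith
  rw [h1]
  calc |∫ ω, Z ω * (P[W|𝓜]) ω ∂P| ≤ ∫ ω, |Z ω * (P[W|𝓜]) ω| ∂P := abs_integral_le_integral_abs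
    _ ≤ ∫ ω, a * |(P[W|𝓜]) ω| ∂P := by
      refine integral_mono_of_nonneg (ae_of_all _ fun _ => abs_nonneg _) (hη.abs.const_mul a)
        (ae_of_all _ fun ω => ?_)
      simp only [abs_mul]
      exact mul_le_mul_of_nonneg_right (hZa ω) (abs_nonneg _)
    _ = a * ∫ ω, |(P[W|𝓜]) ω| ∂P := integral_const_mul _ _
    _ ≤ 2 * a * c := by nlinarith

lemma integrable_of_abs_le {f : Ω → ℝ} (hf : Measurable f) {a : ℝ} (h : ∀ ω, |f ω| ≤ a) :
    Integrable f P :=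
  Integrable.of_bound hf.aestronglyMeasurable a (ae_of_all _ h)

/-- Covariance inequality for bounded variables. -/
lemma abs_cov_le_of_bounded {𝓜 𝓖 : MeasurableSpace Ω} (h𝓜 : 𝓜 ≤ mΩ) (h𝓖 : 𝓖 ≤ mΩ) {α : ℝ}
    (hmix : ∀ A B, MeasurableSet[𝓜] A → MeasurableSet[𝓖] B →
      |P.real A * P.real B - P.real (A ∩ B)| ≤ α)
    {Z W : Ω → ℝ} {a b : ℝ} (ha : 0 ≤ a) (hb : 0 ≤ b) (hZ : Measurable[𝓜] Z)
    (hZa : ∀ ω, |Z ω| ≤ a) (hW : Measurable[𝓖] W) (hWb : ∀ ω, |W ω| ≤ b) :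
    |∫ ω, Z ω * W ω ∂P - (∫ ω, Z ω ∂P) * ∫ ω, W ω ∂P| ≤ 4 * a * b * α := by
  have hWi : Integrable W P := integrable_of_abs_le (hW.mono h𝓖 le_rfl) hWb
  have hZi : Integrable Z P := integrable_of_abs_le (hZ.mono h𝓜 le_rfl) hZa
  -- The preceding lemma is used twice: here for `W` against the centred indicator of `A`, and below
  -- for `Z` against the centred `W`. Each use contributes a factor 2.
  have hset : ∀ A, MeasurableSet[𝓜] A →
      |∫ ω in A, (W ω - ∫ ω', W ω' ∂P) ∂P| ≤ 2 * b * α := by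
    intro A hA
    have hA' := h𝓜 _ hA
    have hi : Integrable (fun ω => A.indicator (fun _ => (1 : ℝ)) ω - P.real A) P :=
      ((integrable_const 1).indicator hA').sub (integrable_const _)
    have := abs_integral_mul_le_of_setIntegral (P := P) h𝓖 (c := α) hb hW hWb hi ?_
    · convert this using 2
      rw [integral_sub hWi.integrableOn (integrable_const _)]
      simp_rw [mul_sub]
      rw [integral_sub _ (hWi.mul_const _), integral_mul_const, setIntegral_const, smul_eq_mul,
        mul_comm (P.real A)]
      · congr 1
        rw [← integral_indicator hA']
        congr 1; ext ω
        by_cases h : ω ∈ A <;> simp [h]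
      · have : (fun ω => W ω * A.indicator (fun _ => (1 : ℝ)) ω) = A.indicator W := by
          ext ω; by_cases h : ω ∈ A <;> simp [h]
        rw [this]; exact hWi.indicator hA'
    · intro B hB
      rw [integral_sub ((integrable_const (1 : ℝ)).indicator hA').integrableOn (integrable_const _),
        setIntegral_indicator hA', setIntegral_const, setIntegral_const]
      have := hmix A B hA hB
      rw [abs_sub_comm] at this
      simpa [Set.inter_comm, mul_comm] using this
  have := abs_integral_mul_le_of_setIntegral (P := P) h𝓜 ha hZ hZa
    (hWi.sub (integrable_const (∫ ω', W ω' ∂P))) hset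
  have e : ∫ ω, Z ω * (W - fun _ : Ω => ∫ ω', W ω' ∂P) ω ∂P
      = ∫ ω, Z ω * W ω ∂P - (∫ ω, Z ω ∂P) * ∫ ω, W ω ∂P := by
    simp only [Pi.sub_apply, mul_sub]
    rw [integral_sub _ (hZi.mul_const _), integral_mul_const]
    exact hWi.bdd_mul (hZ.mono h𝓜 le_rfl).aestronglyMeasurable (ae_of_all _ hZa)
  rw [e] at this
  linarith

/-- Truncation of a real number at level `a`. -/
noncomputable def trunc (a x : ℝ) : ℝ := if |x| ≤ a then x else 0

lemma abs_trunc_le {a : ℝ} (ha : 0 ≤ a) (x : ℝ) : |trunc a x| ≤ a := by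
  unfold trunc; split_ifs with h <;> simp [h, ha]

lemma abs_trunc_le_abs (a x : ℝ) : |trunc a x| ≤ |x| := by
  unfold trunc; split_ifs with h <;> simp

lemma measurable_trunc (a : ℝ) : Measurable (trunc a) :=
  Measurable.ite (measurableSet_le measurable_abs measurable_const) measurable_id measurable_const

/-- Pointwise Markov inequality: the truncation error is zero unless `a < |x|`, and then it equals
`|x|`. -/
lemma mul_abs_sub_trunc_le {a : ℝ} (ha : 0 ≤ a) (x : ℝ) (k : ℕ) :
    a ^ k * |x - trunc a x| ≤ |x| ^ (k + 1) := by
  unfold trunc; split_ifs with h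
  · simp only [sub_self, abs_zero, mul_zero]; positivity
  · rw [sub_zero, pow_succ]
    exact mul_le_mul_of_nonneg_right (pow_le_pow_left₀ ha (not_le.1 h).le _) (abs_nonneg _)

/-- One factor is truncated at a time; `a` times a truncation error is at most a square, and the
resulting cubic terms are dominated by fourth powers. -/
lemma mul_abs_mul_sub_trunc_le {a : ℝ} (ha : 0 ≤ a) (x y : ℝ) :
    a * |x * y - trunc a x * trunc a y| ≤ 2 * (1 + x ^ 4 + y ^ 4) := by
  have h1 := mul_abs_sub_trunc_le ha x 1
  have h2 := mul_abs_sub_trunc_le ha y 1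
  have h3 := abs_trunc_le_abs a x
  have e : x * y - trunc a x * trunc a y = (x - trunc a x) * y + trunc a x * (y - trunc a y) := by
    ring
  have h4 : |x * y - trunc a x * trunc a y| ≤ |x - trunc a x| * |y| + |x| * |y - trunc a y| := by
    rw [e]
    refine (abs_add_le _ _).trans ?_
    rw [abs_mul, abs_mul]
    gcongr
  have h5 : a * |x * y - trunc a x * trunc a y| ≤ |x| ^ 2 * |y| + |x| * |y| ^ 2 := by
    calc _ ≤ a * (|x - trunc a x| * |y| + |x| * |y - trunc a y|) := by gcongr
      _ = (a ^ 1 * |x - trunc a x|) * |y| + |x| * (a ^ 1 * |y - trunc a y|) := by ring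
      _ ≤ _ := by gcongr
  have hx : |x| ^ 4 = x ^ 4 := by rw [← abs_pow]; exact abs_of_nonneg (by positivity)
  have hy : |y| ^ 4 = y ^ 4 := by rw [← abs_pow]; exact abs_of_nonneg (by positivity)
  rw [← hx, ← hy]
  nlinarith [sq_nonneg (|x| ^ 2 - |y|), sq_nonneg (|y| ^ 2 - |x|), sq_nonneg (|x| ^ 2 - 1),
    sq_nonneg (|y| ^ 2 - 1)]

/-- Covariance inequality for variables with bounded fourth moments. -/
lemma abs_cov_le_of_moment {𝓜 𝓖 : MeasurableSpace Ω} (h𝓜 : 𝓜 ≤ mΩ) (h𝓖 : 𝓖 ≤ mΩ) {α : ℝ}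
    (hmix : ∀ A B, MeasurableSet[𝓜] A → MeasurableSet[𝓖] B →
      |P.real A * P.real B - P.real (A ∩ B)| ≤ α)
    {X Y : Ω → ℝ} {C a : ℝ} (ha : 0 < a) (hX : Measurable[𝓜] X) (hY : Measurable[𝓖] Y)
    (hX4 : Integrable (fun ω => X ω ^ 4) P) (hY4 : Integrable (fun ω => Y ω ^ 4) P)
    (hXC : ∫ ω, X ω ^ 4 ∂P ≤ C) (hYC : ∫ ω, Y ω ^ 4 ∂P ≤ C) :
    |∫ ω, X ω * Y ω ∂P - (∫ ω, X ω ∂P) * ∫ ω, Y ω ∂P|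
      ≤ 4 * a ^ 2 * α + 6 * (1 + C) ^ 2 / a := by
  have hXm := hX.mono h𝓜 le_rfl
  have hYm := hY.mono h𝓖 le_rfl
  have hC : 0 ≤ C := (integral_nonneg fun ω => by positivity).trans hXC
  have hdom : ∀ x : ℝ, |x| ≤ 1 + x ^ 4 := fun x => by
    rw [abs_le]; constructor <;> nlinarith [sq_nonneg (x ^ 2 - 1 / 2), sq_nonneg (x - 1 / 2), sq_nonneg (x + 1 / 2)]
  have hdom2 : ∀ x y : ℝ, |x * y| ≤ 1 + x ^ 4 + y ^ 4 := fun x y => by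
    rw [abs_le]; constructor <;> nlinarith [sq_nonneg (x - y), sq_nonneg (x + y), sq_nonneg (x ^ 2 - 1), sq_nonneg (y ^ 2 - 1)]
  have hi1 : Integrable (fun ω => 1 + X ω ^ 4 + Y ω ^ 4) P :=
    ((integrable_const 1).add hX4).add hY4
  have hXi : Integrable X P := ((integrable_const 1).add hX4).mono' hXm.aestronglyMeasurable
    (ae_of_all _ fun ω => hdom (X ω))
  have hYi : Integrable Y P := ((integrable_const 1).add hY4).mono' hYm.aestronglyMeasurable
    (ae_of_all _ fun ω => hdom (Y ω))
  have hXYi : Integrable (fun ω => X ω * Y ω) P := hi1.mono' (hXm.mul hYm).aestronglyMeasurable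
    (ae_of_all _ fun ω => hdom2 (X ω) (Y ω))
  have mX : Measurable[𝓜] fun ω => trunc a (X ω) := (measurable_trunc a).comp hX
  have mY : Measurable[𝓖] fun ω => trunc a (Y ω) := (measurable_trunc a).comp hY
  have hXt : Integrable (fun ω => trunc a (X ω)) P :=
    integrable_of_abs_le (mX.mono h𝓜 le_rfl) fun ω => abs_trunc_le ha.le _
  have hYt : Integrable (fun ω => trunc a (Y ω)) P :=
    integrable_of_abs_le (mY.mono h𝓖 le_rfl) fun ω => abs_trunc_le ha.le _
  have hXYt : Integrable (fun ω => trunc a (X ω) * trunc a (Y ω)) P :=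
    hYt.bdd_mul (mX.mono h𝓜 le_rfl).aestronglyMeasurable
      (ae_of_all _ fun ω => abs_trunc_le ha.le _)
  -- The bounded inequality is applied to the truncations at level `a`. Truncating the mixed moment
  -- (`d1`) and the two means (`d2`, `d4`) costs order `1/a`, since fourth moments are bounded.
  have hcov := abs_cov_le_of_bounded (P := P) h𝓜 h𝓖 hmix ha.le ha.le mX
    (fun ω => abs_trunc_le ha.le _) mY (fun ω => abs_trunc_le ha.le _)
  have d1 : |∫ ω, X ω * Y ω ∂P - ∫ ω, trunc a (X ω) * trunc a (Y ω) ∂P| ≤ 2 * (1 + 2 * C) / a := by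
    rw [← integral_sub hXYi hXYt, le_div_iff₀ ha]
    calc _ ≤ (∫ ω, |X ω * Y ω - trunc a (X ω) * trunc a (Y ω)| ∂P) * a := by
          gcongr; exact abs_integral_le_integral_abs
      _ = ∫ ω, a * |X ω * Y ω - trunc a (X ω) * trunc a (Y ω)| ∂P := by
          rw [integral_const_mul, mul_comm]
      _ ≤ ∫ ω, 2 * (1 + X ω ^ 4 + Y ω ^ 4) ∂P :=
          integral_mono ((hXYi.sub hXYt).abs.const_mul a) (hi1.const_mul 2)
            fun ω => mul_abs_mul_sub_trunc_le ha.le _ _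
      _ ≤ 2 * (1 + 2 * C) := by
          have e1 := integral_add ((integrable_const (1 : ℝ)).add hX4) hY4
          have e2 := integral_add (integrable_const (μ := P) (1 : ℝ)) hX4
          simp only [Pi.add_apply] at e1
          rw [integral_const_mul, e1, e2]
          simp; linarith
  have d2 : ∀ X : Ω → ℝ, Integrable X P → Integrable (fun ω => trunc a (X ω)) P →
      Integrable (fun ω => X ω ^ 4) P → ∫ ω, X ω ^ 4 ∂P ≤ C →
      |∫ ω, X ω ∂P - ∫ ω, trunc a (X ω) ∂P| ≤ (1 + C) / a := by
    intro X hXi hXt hX4 hXC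
    rw [← integral_sub hXi hXt, le_div_iff₀ ha]
    calc _ ≤ (∫ ω, |X ω - trunc a (X ω)| ∂P) * a := by
          gcongr; exact abs_integral_le_integral_abs
      _ = ∫ ω, a * |X ω - trunc a (X ω)| ∂P := by
          rw [integral_const_mul, mul_comm]
      _ ≤ ∫ ω, (1 + X ω ^ 4) ∂P := by
          refine integral_mono ((hXi.sub hXt).abs.const_mul a) ((integrable_const 1).add hX4)
            fun ω => ?_
          have := mul_abs_sub_trunc_le ha.le (X ω) 1
          simp only [pow_one, one_add_one_eq_two, sq_abs] at this
          refine this.trans ?_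
          nlinarith [sq_nonneg (X ω ^ 2 - 1 / 2)]
      _ ≤ 1 + C := by
          rw [integral_add (integrable_const 1) hX4]
          simp; linarith
  have d3 : ∀ X : Ω → ℝ, (∀ ω, |X ω| ≤ 1 + X ω ^ 4) → Integrable X P →
      Integrable (fun ω => X ω ^ 4) P → ∫ ω, X ω ^ 4 ∂P ≤ C → ∫ ω, |X ω| ∂P ≤ 1 + C := by
    intro X _ hXi hX4 hXC
    calc ∫ ω, |X ω| ∂P ≤ ∫ ω, (1 + X ω ^ 4) ∂P :=
          integral_mono hXi.abs ((integrable_const 1).add hX4) fun ω => hdom _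
      _ ≤ 1 + C := by
          rw [integral_add (integrable_const 1) hX4]
          simp; linarith
  have eX := d2 X hXi hXt hX4 hXC
  have eY := d2 Y hYi hYt hY4 hYC
  have bY : |∫ ω, Y ω ∂P| ≤ 1 + C :=
    abs_integral_le_integral_abs.trans (d3 Y (fun ω => hdom _) hYi hY4 hYC)
  have bX : |∫ ω, trunc a (X ω) ∂P| ≤ 1 + C := by
    refine abs_integral_le_integral_abs.trans (le_trans ?_ (d3 X (fun ω => hdom _) hXi hX4 hXC))
    exact integral_mono hXt.abs hXi.abs fun ω => abs_trunc_le_abs _ _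
  set x := ∫ ω, X ω ∂P
  set y := ∫ ω, Y ω ∂P
  set x' := ∫ ω, trunc a (X ω) ∂P
  set y' := ∫ ω, trunc a (Y ω) ∂P
  have d4 : |x' * y' - x * y| ≤ 2 * ((1 + C) / a * (1 + C)) := by
    have e : x' * y' - x * y = -((x - x') * y + x' * (y - y')) := by ring
    rw [e, abs_neg]
    refine (abs_add_le _ _).trans ?_
    rw [abs_mul, abs_mul]
    have : |x - x'| * |y| ≤ (1 + C) / a * (1 + C) := by gcongr
    have : |x'| * |y - y'| ≤ (1 + C) * ((1 + C) / a) := by gcongr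
    linarith
  have e6 : 6 * (1 + C) ^ 2 / a = 2 * (1 + 2 * C) / a + 2 * ((1 + C) / a * (1 + C))
      + (2 + 4 * C + 4 * C ^ 2) / a := by ring
  have : 0 ≤ (2 + 4 * C + 4 * C ^ 2) / a := by positivity
  set p := ∫ ω, X ω * Y ω ∂P
  set p' := ∫ ω, trunc a (X ω) * trunc a (Y ω) ∂P
  have tri : |p - x * y| ≤ |p - p'| + |p' - x' * y'| + |x' * y' - x * y| := by
    have : p - x * y = (p - p') + (p' - x' * y') + (x' * y' - x * y) := by ring
    rw [this]; exact abs_add_three _ _ _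
  rw [e6]
  have : 4 * a * a * α = 4 * a ^ 2 * α := by ring
  linarith

end Mixing

/-! ### Moderate deviations of sums of mixing sequences -/

section ModerateDeviations

variable {Ω : Type*} {mΩ : MeasurableSpace Ω} {P : Measure Ω} [IsProbabilityMeasure P]

/-- The exponentials of the partial sums of `B`, frozen as soon as they exceed `c`. -/
noncomputable def frozenExp (c l : ℝ) (B : ℕ → Ω → ℝ) : ℕ → Ω → ℝ
  | 0 => fun _ => 1
  | k + 1 => fun ω =>
      if frozenExp c l B k ω ≤ c then frozenExp c l B k ω * Real.exp (l * B k ω)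
      else frozenExp c l B k ω

lemma frozenExp_pos (c l : ℝ) (B : ℕ → Ω → ℝ) (k : ℕ) (ω : Ω) : 0 < frozenExp c l B k ω := by
  induction k with
  | zero => simp [frozenExp]
  | succ k ih => simp only [frozenExp]; split_ifs <;> positivity

/-- A factor is applied only to a value that is at most `c`; from then on the process either is
still at most `c` or never moves again. -/
lemma frozenExp_le {c l b : ℝ} {B : ℕ → Ω → ℝ} (hc : 1 ≤ c) (hl : 0 ≤ l) (hb : 0 ≤ b)
    (hB : ∀ k ω, |B k ω| ≤ b) (k : ℕ) (ω : Ω) :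
    frozenExp c l B k ω ≤ c * Real.exp (l * b) := by
  have h1 : (1 : ℝ) ≤ Real.exp (l * b) := Real.one_le_exp (by positivity)
  induction k with
  | zero => simp only [frozenExp]; nlinarith
  | succ k ih =>
    simp only [frozenExp]
    split_ifs with h
    · have := (abs_le.1 (hB k ω)).2
      have : Real.exp (l * B k ω) ≤ Real.exp (l * b) :=
        Real.exp_le_exp.2 (mul_le_mul_of_nonneg_left this hl)
      have := frozenExp_pos c l B k ω
      gcongr
    · exact ih

lemma frozenExp_eq_or_lt (c l : ℝ) (B : ℕ → Ω → ℝ) (k : ℕ) (ω : Ω) :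
    c < frozenExp c l B k ω ∨
      frozenExp c l B k ω = Real.exp (l * ∑ i ∈ Finset.range k, B i ω) := by
  induction k with
  | zero => right; simp [frozenExp]
  | succ k ih =>
    simp only [frozenExp]
    split_ifs with h
    · rcases ih with ih | ih
      · exact absurd h (not_le.2 ih)
      · right; rw [ih, Finset.sum_range_succ, mul_add, Real.exp_add]
    · exact Or.inl (not_le.1 h)

lemma measurable_frozenExp {c l : ℝ} {B : ℕ → Ω → ℝ} {𝓜 : ℕ → MeasurableSpace Ω}
    (h𝓜 : Monotone 𝓜) (hB : ∀ k, Measurable[𝓜 (k + 1)] (B k)) (k : ℕ) :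
    Measurable[𝓜 k] (frozenExp c l B k) := by
  induction k with
  | zero => exact measurable_const
  | succ k ih =>
    have ih' : Measurable[𝓜 (k + 1)] (frozenExp c l B k) := ih.mono (h𝓜 k.le_succ) le_rfl
    exact Measurable.ite (ih' measurableSet_Iic)
      (ih'.mul (Real.measurable_exp.comp ((hB k).const_mul l))) ih'

/-- Exponential inequality for sums of bounded variables each of which is nearly independent of
the preceding ones. -/
lemma measure_lt_sum_le_of_nearly_indep {B : ℕ → Ω → ℝ} {𝓜 : ℕ → MeasurableSpace Ω}
    (h𝓜 : Monotone 𝓜) (h𝓜le : ∀ k, 𝓜 k ≤ mΩ) (hBm : ∀ k, Measurable[𝓜 (k + 1)] (B k))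
    {b l v α x : ℝ} (hb : 0 ≤ b) (hl : 0 < l) (hv : 0 ≤ v) (hα : 0 ≤ α) (hx : 0 ≤ x)
    (hB : ∀ k ω, |B k ω| ≤ b) (hexp : ∀ k, ∫ ω, Real.exp (l * B k ω) ∂P ≤ Real.exp v)
    (hcov : ∀ k (Z : Ω → ℝ) (a : ℝ), 0 ≤ a → Measurable[𝓜 k] Z → (∀ ω, |Z ω| ≤ a) →
      |∫ ω, Z ω * Real.exp (l * B k ω) ∂P - (∫ ω, Z ω ∂P) * ∫ ω, Real.exp (l * B k ω) ∂P|
        ≤ 4 * a * Real.exp (l * b) * α) (n : ℕ) :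
    P.real {ω | x < ∑ k ∈ Finset.range n, B k ω}
      ≤ Real.exp (n * v) * (Real.exp (-(l * x)) + 4 * n * Real.exp (l * b) * α) := by
  set c := Real.exp (l * x) with hc
  have hc1 : 1 ≤ c := Real.one_le_exp (by positivity)
  have hZm : ∀ k, Measurable (frozenExp c l B k) := fun k =>
    (measurable_frozenExp h𝓜 hBm k).mono (h𝓜le k) le_rfl
  have hZi : ∀ k, Integrable (frozenExp c l B k) P := fun k =>
    integrable_of_abs_le (hZm k) (a := c * Real.exp (l * b)) fun ω => by
      rw [abs_of_pos (frozenExp_pos c l B k ω)]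
      exact frozenExp_le hc1 hl.le hb hB k ω
  -- The cost of one step of near independence, for a variable bounded by `c`.
  set err := 4 * c * Real.exp (l * b) * α with herr
  have herr0 : 0 ≤ err := by positivity
  have step : ∀ k, ∫ ω, frozenExp c l B (k + 1) ω ∂P
      ≤ Real.exp v * ∫ ω, frozenExp c l B k ω ∂P + err := by
    intro k
    have hset : MeasurableSet[𝓜 k] {ω | frozenExp c l B k ω ≤ c} :=
      measurable_frozenExp h𝓜 hBm k measurableSet_Iic
    set s := {ω | frozenExp c l B k ω ≤ c} with hs
    have hs' := h𝓜le k _ hset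
    -- The live part `Zl` is bounded by `c` and gets multiplied; the frozen part `Zh` stays
    -- unchanged. Without freezing, the sup norm in the covariance bound would grow geometrically
    -- with the number of steps.
    set Zl := s.indicator (frozenExp c l B k) with hZl
    set Zh := sᶜ.indicator (frozenExp c l B k) with hZh
    have hZlm : Measurable[𝓜 k] Zl := (measurable_frozenExp h𝓜 hBm k).indicator hset
    have hZl0 : ∀ ω, 0 ≤ Zl ω := fun ω =>
      Set.indicator_nonneg (fun ω _ => (frozenExp_pos c l B k ω).le) ω
    have hZh0 : ∀ ω, 0 ≤ Zh ω := fun ω =>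
      Set.indicator_nonneg (fun ω _ => (frozenExp_pos c l B k ω).le) ω
    have hZla : ∀ ω, |Zl ω| ≤ c := fun ω => by
      rw [abs_of_nonneg (hZl0 ω)]
      by_cases h : ω ∈ s
      · have h' : frozenExp c l B k ω ≤ c := h
        simpa only [hZl, Set.indicator_of_mem h] using h'
      · simp only [hZl, h, not_false_eq_true, Set.indicator_of_notMem]; linarith
    have hBm' : Measurable (B k) := (hBm k).mono (h𝓜le _) le_rfl
    have hZli : Integrable Zl P := (hZi k).indicator hs'
    have hZhi : Integrable Zh P := (hZi k).indicator hs'.compl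
    have hei : Integrable (fun ω => Real.exp (l * B k ω)) P :=
      integrable_of_abs_le (Real.measurable_exp.comp (hBm'.const_mul l)) (a := Real.exp (l * b))
        fun ω => by
          rw [abs_of_pos (Real.exp_pos _)]
          exact Real.exp_le_exp.2 (mul_le_mul_of_nonneg_left (abs_le.1 (hB k ω)).2 hl.le)
    have hprod : Integrable (fun ω => Zl ω * Real.exp (l * B k ω)) P :=
      hei.bdd_mul (hZlm.mono (h𝓜le k) le_rfl).aestronglyMeasurable (ae_of_all _ hZla)
    have e1 : ∀ ω, frozenExp c l B (k + 1) ω = Zh ω + Zl ω * Real.exp (l * B k ω) := by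
      intro ω
      simp only [frozenExp]
      split_ifs with h
      · have h' : ω ∈ s := h
        simp [hZl, hZh, h']
      · have h' : ω ∉ s := h
        simp [hZl, hZh, h']
    have e2 : ∀ ω, frozenExp c l B k ω = Zh ω + Zl ω := by
      intro ω
      by_cases h : ω ∈ s <;> simp [hZl, hZh, h]
    have h1 := (abs_le.1 (hcov k Zl c (by linarith) hZlm hZla)).2
    have h2 : (∫ ω, Zl ω ∂P) * ∫ ω, Real.exp (l * B k ω) ∂P ≤ (∫ ω, Zl ω ∂P) * Real.exp v :=
      mul_le_mul_of_nonneg_left (hexp k) (integral_nonneg hZl0)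
    have h3 : ∫ ω, Zh ω ∂P ≤ Real.exp v * ∫ ω, Zh ω ∂P :=
      le_mul_of_one_le_left (integral_nonneg hZh0) (Real.one_le_exp hv)
    simp_rw [e1, e2]
    rw [integral_add hZhi hprod, integral_add hZhi hZli]
    linarith
  have hind : ∀ k : ℕ, ∫ ω, frozenExp c l B k ω ∂P ≤ Real.exp (k * v) * (1 + k * err) := by
    intro k
    induction k with
    | zero => simp [frozenExp]
    | succ k ih =>
      have e : Real.exp (((k + 1 : ℕ) : ℝ) * v) = Real.exp v * Real.exp (k * v) := by
        rw [← Real.exp_add]; congr 1; push_cast; ring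
      have h1 : (1 : ℝ) ≤ Real.exp v * Real.exp (k * v) := by
        rw [← e]; exact Real.one_le_exp (by positivity)
      calc _ ≤ _ := step k
        _ ≤ Real.exp v * (Real.exp (k * v) * (1 + k * err)) + err := by gcongr
        _ ≤ Real.exp v * Real.exp (k * v) * (1 + k * err) + Real.exp v * Real.exp (k * v) * err := by
            nlinarith
        _ = _ := by rw [e]; push_cast; ring
  have hsub : {ω | x < ∑ k ∈ Finset.range n, B k ω} ⊆ {ω | c ≤ frozenExp c l B n ω} := by
    intro ω hω
    rcases frozenExp_eq_or_lt c l B n ω with h | h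
    · exact h.le
    · simp only [Set.mem_ofPred_eq] at hω ⊢
      rw [h]
      exact Real.exp_le_exp.2 (mul_le_mul_of_nonneg_left hω.le hl.le)
  -- Markov at level `c = exp (l x)`; the division by `c` cancels the factor `c` contained in `err`.
  have hmarkov := mul_meas_ge_le_integral_of_nonneg
    (ae_of_all P fun ω => (frozenExp_pos c l B n ω).le) (hZi n) c
  have h1 : P.real {ω | x < ∑ k ∈ Finset.range n, B k ω} ≤ P.real {ω | c ≤ frozenExp c l B n ω} :=
    measureReal_mono hsub
  have hcpos : 0 < c := by linarith
  have h2 : P.real {ω | c ≤ frozenExp c l B n ω} ≤ c⁻¹ * (Real.exp (n * v) * (1 + n * err)) := by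
    rw [inv_mul_eq_div, le_div_iff₀ hcpos, mul_comm]
    exact hmarkov.trans (hind n)
  refine h1.trans (h2.trans (le_of_eq ?_))
  rw [Real.exp_neg, ← hc, herr]
  field_simp

/-- The past and future `σ`-algebras `ℱ n` and `𝓖 (n + k)` are nearly independent. -/
structure IsMixing (P : Measure Ω) (ℱ 𝓖 : ℕ → MeasurableSpace Ω) (α : ℕ → ℝ) : Prop where
  past_le : ∀ n, ℱ n ≤ mΩ
  future_le : ∀ n, 𝓖 n ≤ mΩ
  past_mono : Monotone ℱ
  future_anti : Antitone 𝓖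
  mixing : ∀ n k, 0 < k → ∀ A B, MeasurableSet[ℱ n] A → MeasurableSet[𝓖 (n + k)] B →
    |P.real A * P.real B - P.real (A ∩ B)| ≤ α k

lemma IsMixing.nonneg {ℱ 𝓖 : ℕ → MeasurableSpace Ω} {α : ℕ → ℝ} (h : IsMixing P ℱ 𝓖 α)
    {k : ℕ} (hk : 0 < k) : 0 ≤ α k :=
  (abs_nonneg _).trans (h.mixing 0 k hk ∅ ∅ (@MeasurableSet.empty _ (ℱ 0)) (@MeasurableSet.empty _ (𝓖 (0 + k))))

/-- One-sided tail bound for a sum of well-separated blocks. -/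
lemma measure_lt_sum_blocks_le {ℱ 𝓖 : ℕ → MeasurableSpace Ω} {α : ℕ → ℝ}
    (h : IsMixing P ℱ 𝓖 α) {X : ℕ → Ω → ℝ} (hP : ∀ t, Measurable[ℱ t] (X t))
    (hG : ∀ t, Measurable[𝓖 t] (X t)) {L δ V l x : ℝ} {p : ℕ} (hp : 0 < p) (hL : 0 ≤ L)
    (hδ : 0 ≤ δ) (hV : 0 ≤ V) (hl : 0 < l) (hx : 0 ≤ x) (hXL : ∀ t ω, |X t ω| ≤ L)
    (hXδ : ∀ t, |∫ ω, X t ω ∂P| ≤ δ)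
    (hXV : ∀ s, ∫ ω, (∑ i ∈ Finset.range p, X (s + i) ω) ^ 2 ∂P ≤ V * p)
    (hlb : l * (p * L) ≤ 1) (s₀ n : ℕ) :
    P.real {ω | x < ∑ k ∈ Finset.range n, ∑ i ∈ Finset.range p, X (s₀ + 2 * p * k + i) ω}
      ≤ Real.exp (n * (l * p * δ + l ^ 2 * V * p)) *
        (Real.exp (-(l * x)) + 4 * n * Real.exp 1 * α p) := by
  set B : ℕ → Ω → ℝ := fun k ω => ∑ i ∈ Finset.range p, X (s₀ + 2 * p * k + i) ω with hBdef
  -- Block `k` occupies `p` times starting at `s₀ + 2pk`, so `p` time units separate the recorded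
  -- past from the start of the next block. Before the first block nothing is known, hence the
  -- trivial `σ`-algebra at 0.
  set 𝓜 : ℕ → MeasurableSpace Ω := fun k => match k with
    | 0 => ⊥
    | k + 1 => ℱ (s₀ + 2 * p * k + p) with h𝓜def
  have h𝓜mono : Monotone 𝓜 := monotone_nat_of_le_succ fun k => by
    cases k with
    | zero => exact bot_le
    | succ k => exact h.past_mono (by nlinarith)
  have h𝓜le : ∀ k, 𝓜 k ≤ mΩ := fun k => by
    cases k with
    | zero => exact bot_le
    | succ k => exact h.past_le _
  have hXm : ∀ t, Measurable (X t) := fun t => (hP t).mono (h.past_le t) le_rfl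
  have hXi : ∀ t, Integrable (X t) P := fun t => integrable_of_abs_le (hXm t) (hXL t)
  have hBm : ∀ k, Measurable[𝓜 (k + 1)] (B k) := fun k =>
    Finset.measurable_sum _ fun i hi => (hP _).mono (h.past_mono (by
      have := Finset.mem_range.1 hi; omega)) le_rfl
  have hBG : ∀ k, Measurable[𝓖 (s₀ + 2 * p * k)] (B k) := fun k =>
    Finset.measurable_sum _ fun i hi => (hG _).mono (h.future_anti (by omega)) le_rfl
  have hBb : ∀ k ω, |B k ω| ≤ p * L := fun k ω => by
    refine (Finset.abs_sum_le_sum_abs _ _).trans ?_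
    refine (Finset.sum_le_sum fun i _ => hXL _ ω).trans ?_
    simp
  have hBi : ∀ k, Integrable (B k) P := fun k => integrable_finsetSum _ fun i _ => hXi _
  have hBmΩ : ∀ k, Measurable (B k) := fun k => (hBm k).mono (h𝓜le (k + 1)) le_rfl
  have hB2i : ∀ k, Integrable (fun ω => B k ω ^ 2) P := fun k =>
    integrable_of_abs_le ((hBmΩ k).pow_const 2) (a := (p * L) ^ 2) fun ω => by
      rw [abs_pow]; exact pow_le_pow_left₀ (abs_nonneg _) (hBb k ω) 2
  have hl0 : 0 ≤ l * (p * L) := by positivity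
  have hv : 0 ≤ l * p * δ + l ^ 2 * V * p := by positivity
  -- From `e^z ≤ 1 + z + z²` for `|z| ≤ 1`, which `hlb` permits, followed by `1 + y ≤ e^y`.
  have hexp : ∀ k, ∫ ω, Real.exp (l * B k ω) ∂P ≤ Real.exp (l * p * δ + l ^ 2 * V * p) := by
    intro k
    have hi2 : Integrable (fun ω => 1 + l * B k ω + l ^ 2 * B k ω ^ 2) P :=
      ((integrable_const 1).add ((hBi k).const_mul l)).add ((hB2i k).const_mul _)
    have e : ∫ ω, (1 + l * B k ω + l ^ 2 * B k ω ^ 2) ∂P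
        = 1 + l * ∫ ω, B k ω ∂P + l ^ 2 * ∫ ω, B k ω ^ 2 ∂P := by
      have e1 := integral_add ((integrable_const (μ := P) (1 : ℝ)).add ((hBi k).const_mul l))
        ((hB2i k).const_mul (l ^ 2))
      have e2 := integral_add (integrable_const (μ := P) (1 : ℝ)) ((hBi k).const_mul l)
      simp only [Pi.add_apply] at e1
      rw [e1, e2, integral_const_mul, integral_const_mul]; simp
    have hmean : ∫ ω, B k ω ∂P ≤ p * δ := by
      rw [integral_finsetSum _ fun i _ => hXi _]
      refine (Finset.sum_le_sum fun i _ => (abs_le.1 (hXδ _)).2).trans ?_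
      simp
    have hmono : ∫ ω, Real.exp (l * B k ω) ∂P ≤ ∫ ω, (1 + l * B k ω + l ^ 2 * B k ω ^ 2) ∂P := by
      refine integral_mono_of_nonneg (ae_of_all _ fun ω => (Real.exp_pos _).le) hi2
        (ae_of_all _ fun ω => ?_)
      have hle : |l * B k ω| ≤ 1 := by
        rw [abs_mul, abs_of_pos hl]
        exact (mul_le_mul_of_nonneg_left (hBb k ω) hl.le).trans hlb
      have := (abs_le.1 (Real.abs_exp_sub_one_sub_id_le hle)).2
      simp only
      nlinarith
    have hVk : ∫ ω, B k ω ^ 2 ∂P ≤ V * p := hXV _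
    rw [e] at hmono
    have : l * ∫ ω, B k ω ∂P ≤ l * (p * δ) := by gcongr
    have : l ^ 2 * ∫ ω, B k ω ^ 2 ∂P ≤ l ^ 2 * (V * p) := by gcongr
    have := Real.add_one_le_exp (l * p * δ + l ^ 2 * V * p)
    linarith
  have hcov : ∀ k (Z : Ω → ℝ) (a : ℝ), 0 ≤ a → Measurable[𝓜 k] Z → (∀ ω, |Z ω| ≤ a) →
      |∫ ω, Z ω * Real.exp (l * B k ω) ∂P - (∫ ω, Z ω ∂P) * ∫ ω, Real.exp (l * B k ω) ∂P|
        ≤ 4 * a * Real.exp (l * (p * L)) * α p := by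
    intro k Z a ha hZ hZa
    refine abs_cov_le_of_bounded (P := P) (h𝓜le k) (h.future_le (s₀ + 2 * p * k)) ?_ ha
      (Real.exp_pos _).le hZ hZa (Real.measurable_exp.comp ((hBG k).const_mul l)) ?_
    · intro A C hA hC
      cases k with
      | zero =>
        rcases MeasurableSpace.measurableSet_bot_iff.1 hA with rfl | rfl
        · simpa using h.nonneg hp
        · simpa using h.nonneg hp
      | succ k =>
        refine h.mixing _ p hp A C hA ?_
        convert hC using 2
        ring
    · intro ω
      rw [abs_of_pos (Real.exp_pos _)]
      exact Real.exp_le_exp.2 (mul_le_mul_of_nonneg_left (abs_le.1 (hBb k ω)).2 hl.le)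
  have main := measure_lt_sum_le_of_nearly_indep (P := P) h𝓜mono h𝓜le hBm (by positivity) hl hv
    (h.nonneg hp) hx hBb hexp hcov n
  refine main.trans ?_
  have := h.nonneg hp
  gcongr

/-- Consecutive blocks are dealt alternately to two families, so that within each family the blocks
are separated by gaps of length `p`. The summand `0` keeps the two families in the same form. -/
lemma sum_range_two_mul_blocks (f : ℕ → ℝ) (p n : ℕ) :
    ∑ t ∈ Finset.range (2 * p * n), f t
      = ∑ k ∈ Finset.range n, ∑ i ∈ Finset.range p, f (0 + 2 * p * k + i)
        + ∑ k ∈ Finset.range n, ∑ i ∈ Finset.range p, f (p + 2 * p * k + i) := by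
  induction n with
  | zero => simp
  | succ n ih =>
    rw [show 2 * p * (n + 1) = 2 * p * n + p + p by ring, Finset.sum_range_add,
      Finset.sum_range_add, ih, Finset.sum_range_succ, Finset.sum_range_succ]
    have e1 : ∀ i, 2 * p * n + p + i = p + 2 * p * n + i := fun i => by ring
    simp_rw [e1, zero_add]
    ring

/-- Two-sided tail bound for sums of bounded mixing variables. -/
lemma measure_lt_abs_sum_le {ℱ 𝓖 : ℕ → MeasurableSpace Ω} {α : ℕ → ℝ}
    (h : IsMixing P ℱ 𝓖 α) {X : ℕ → Ω → ℝ} (hP : ∀ t, Measurable[ℱ t] (X t))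
    (hG : ∀ t, Measurable[𝓖 t] (X t)) {L δ V l x : ℝ} {p : ℕ} (hp : 0 < p) (hL : 0 ≤ L)
    (hδ : 0 ≤ δ) (hV : 0 ≤ V) (hl : 0 < l) (hx : 0 ≤ x) (hXL : ∀ t ω, |X t ω| ≤ L)
    (hXδ : ∀ t, |∫ ω, X t ω ∂P| ≤ δ)
    (hXV : ∀ s, ∫ ω, (∑ i ∈ Finset.range p, X (s + i) ω) ^ 2 ∂P ≤ V * p)
    (hlb : l * (p * L) ≤ 1) (n : ℕ) :
    P.real {ω | 2 * x < |∑ t ∈ Finset.range (2 * p * n), X t ω|}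
      ≤ 4 * (Real.exp (n * (l * p * δ + l ^ 2 * V * p)) *
        (Real.exp (-(l * x)) + 4 * n * Real.exp 1 * α p)) := by
  set b := Real.exp (n * (l * p * δ + l ^ 2 * V * p)) *
        (Real.exp (-(l * x)) + 4 * n * Real.exp 1 * α p) with hb
  have hneg : ∀ s₀, P.real {ω | x < -∑ k ∈ Finset.range n, ∑ i ∈ Finset.range p,
      X (s₀ + 2 * p * k + i) ω} ≤ b := by
    intro s₀
    have := measure_lt_sum_blocks_le (P := P) h (X := fun t ω => -X t ω) (fun t => (hP t).neg)
      (fun t => (hG t).neg) hp hL hδ hV hl hx (fun t ω => by simpa using hXL t ω)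
      (fun t => by simpa [integral_neg] using hXδ t)
      (fun s => by simpa [Finset.sum_neg_distrib] using hXV s) hlb s₀ n
    simpa [Finset.sum_neg_distrib] using this
  have hpos : ∀ s₀, P.real {ω | x < ∑ k ∈ Finset.range n, ∑ i ∈ Finset.range p,
      X (s₀ + 2 * p * k + i) ω} ≤ b := fun s₀ =>
    measure_lt_sum_blocks_le (P := P) h hP hG hp hL hδ hV hl hx hXL hXδ hXV hlb s₀ n
  set S : ℕ → Ω → ℝ := fun s₀ ω =>
    ∑ k ∈ Finset.range n, ∑ i ∈ Finset.range p, X (s₀ + 2 * p * k + i) ω with hS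
  -- A deviation of the total by more than `2x` forces one of the two families to deviate by more
  -- than `x` in one of the two directions: four one-sided events.
  have hsub : {ω | 2 * x < |∑ t ∈ Finset.range (2 * p * n), X t ω|} ⊆
      ({ω | x < S 0 ω} ∪ {ω | x < -S 0 ω}) ∪ ({ω | x < S p ω} ∪ {ω | x < -S p ω}) := by
    intro ω hω
    simp only [Set.mem_ofPred_eq, Set.mem_union] at hω ⊢
    rw [sum_range_two_mul_blocks (fun t => X t ω)] at hω
    by_contra! hcon
    obtain ⟨⟨h1, h2⟩, h3, h4⟩ := hcon
    have : |S 0 ω + S p ω| ≤ 2 * x := abs_le.2 ⟨by linarith, by linarith⟩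
    exact absurd hω (not_lt.2 this)
  have h1 := measureReal_mono (μ := P) hsub
  have h2 := measureReal_union_le (μ := P) ({ω | x < S 0 ω} ∪ {ω | x < -S 0 ω})
    ({ω | x < S p ω} ∪ {ω | x < -S p ω})
  have h3 := measureReal_union_le (μ := P) {ω | x < S 0 ω} {ω | x < -S 0 ω}
  have h4 := measureReal_union_le (μ := P) {ω | x < S p ω} {ω | x < -S p ω}
  have := hpos 0
  have := hpos p
  have := hneg 0
  have := hneg p
  linarith

end ModerateDeviations

/-! ### Second moments under summable covariances, and the moderate deviation bound. -/

section ModerateDeviations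

/-- Each row of the double sum meets every lag at most once on either side of the diagonal. The
diagonal is counted on both sides, which is harmless since `g` is nonnegative. -/
lemma sum_sum_range_le {f : ℕ → ℕ → ℝ} {g : ℕ → ℝ} {p : ℕ} (hg : ∀ d, 0 ≤ g d)
    (h1 : ∀ i < p, ∀ j ≤ i, f i j ≤ g (i - j)) (h2 : ∀ i j, f i j = f j i) :
    ∑ i ∈ Finset.range p, ∑ j ∈ Finset.range p, f i j ≤ 2 * p * ∑ d ∈ Finset.range p, g d := by
  have key : ∀ i < p, ∑ j ∈ Finset.range p, (if j ≤ i then g (i - j) else 0)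
      ≤ ∑ d ∈ Finset.range p, g d := by
    intro i hi
    rw [← Finset.sum_filter]
    have e : (Finset.range p).filter (fun j => j ≤ i) = Finset.range (i + 1) := by
      ext j; simp; omega
    have e2 := Finset.sum_range_reflect g (i + 1)
    simp only [Nat.add_sub_cancel] at e2
    rw [e, e2]
    exact Finset.sum_le_sum_of_subset_of_nonneg
      (Finset.range_subset_range.2 (by omega)) fun d _ _ => hg d
  have hpt : ∀ i ∈ Finset.range p, ∀ j ∈ Finset.range p,
      f i j ≤ (if j ≤ i then g (i - j) else 0) + (if i ≤ j then g (j - i) else 0) := by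
    intro i hi j hj
    rw [Finset.mem_range] at hi hj
    rcases le_total j i with h | h
    · rw [if_pos h]
      have := h1 i hi j h
      split_ifs
      · linarith [hg (j - i)]
      · linarith
    · rw [if_pos h, h2]
      have := h1 j hj i h
      split_ifs
      · linarith [hg (i - j)]
      · linarith
  calc _ ≤ ∑ i ∈ Finset.range p, ∑ j ∈ Finset.range p,
        ((if j ≤ i then g (i - j) else 0) + (if i ≤ j then g (j - i) else 0)) :=
        Finset.sum_le_sum fun i hi => Finset.sum_le_sum fun j hj => hpt i hi j hj
    _ = ∑ i ∈ Finset.range p, ∑ j ∈ Finset.range p, (if j ≤ i then g (i - j) else 0)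
        + ∑ j ∈ Finset.range p, ∑ i ∈ Finset.range p, (if i ≤ j then g (j - i) else 0) := by
        simp_rw [Finset.sum_add_distrib]
        congr 1
        exact Finset.sum_comm
    _ ≤ ∑ i ∈ Finset.range p, ∑ d ∈ Finset.range p, g d
        + ∑ i ∈ Finset.range p, ∑ d ∈ Finset.range p, g d := by
        exact add_le_add (Finset.sum_le_sum fun i hi => key i (Finset.mem_range.1 hi))
          (Finset.sum_le_sum fun i hi => key i (Finset.mem_range.1 hi))
    _ = _ := by simp; ring

variable {Ω : Type*} {mΩ : MeasurableSpace Ω} {P : Measure Ω} [IsProbabilityMeasure P]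

/-- Second moment of a sum whose terms have summable covariances. -/
lemma integral_sq_sum_le {X : ℕ → Ω → ℝ} {g : ℕ → ℝ} (hg : ∀ d, 0 ≤ g d)
    (hi : ∀ s t, Integrable (fun ω => X s ω * X t ω) P)
    (h : ∀ s d, ∫ ω, X s ω * X (s + d) ω ∂P ≤ g d) (s p : ℕ) :
    ∫ ω, (∑ i ∈ Finset.range p, X (s + i) ω) ^ 2 ∂P ≤ 2 * p * ∑ d ∈ Finset.range p, g d := by
  have e : ∀ ω, (∑ i ∈ Finset.range p, X (s + i) ω) ^ 2
      = ∑ i ∈ Finset.range p, ∑ j ∈ Finset.range p, X (s + i) ω * X (s + j) ω := fun ω => by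
    rw [sq, Finset.sum_mul_sum]
  simp_rw [e]
  rw [integral_finsetSum _ fun i _ => integrable_finsetSum _ fun j _ => hi _ _]
  simp_rw [integral_finsetSum _ fun j _ => hi _ _]
  refine sum_sum_range_le hg ?_ ?_
  · intro i _ j hj
    have := h (s + j) (i - j)
    rw [show s + j + (i - j) = s + i by omega] at this
    simpa [mul_comm] using this
  · intro i j; simp_rw [mul_comm]

/-- The mixing rate `exp (-c k ^ r)`. -/
noncomputable def expRate (c r : ℝ) (k : ℕ) : ℝ := Real.exp (-c * (k : ℝ) ^ r)

lemma expRate_pos (c r : ℝ) (k : ℕ) : 0 < expRate c r k := Real.exp_pos _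

lemma expRate_zero (c : ℝ) {r : ℝ} (hr : 0 < r) : expRate c r 0 = 1 := by
  simp [expRate, hr.ne']

lemma tendsto_rpow_mul_exp_neg {c r : ℝ} (hc : 0 < c) (hr : 0 < r) (b : ℝ) :
    Tendsto (fun T : ℕ => (T : ℝ) ^ b * Real.exp (-c * (T : ℝ) ^ r)) atTop (𝓝 0) := by
  have h1 : Tendsto (fun T : ℕ => (T : ℝ) ^ r) atTop atTop :=
    (tendsto_rpow_atTop hr).comp tendsto_natCast_atTop_atTop
  have h2 := (tendsto_rpow_mul_exp_neg_mul_atTop_nhds_zero (b / r) c hc).comp h1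
  refine h2.congr' ?_
  filter_upwards with T
  simp only [Function.comp]
  rw [← Real.rpow_mul (Nat.cast_nonneg T), mul_div_cancel₀ _ hr.ne']

lemma summable_expRate {c r : ℝ} (hc : 0 < c) (hr : 0 < r) : Summable (expRate c r) := by
  have h := tendsto_rpow_mul_exp_neg hc hr 2
  have h1 : ∀ᶠ T : ℕ in atTop, ‖expRate c r T‖ ≤ 1 / (T : ℝ) ^ 2 := by
    filter_upwards [h.eventually (gt_mem_nhds one_pos), eventually_gt_atTop 0] with T hT hT0
    have : (0 : ℝ) < T := by exact_mod_cast hT0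
    rw [Real.norm_of_nonneg (expRate_pos c r T).le, le_div_iff₀ (by positivity), mul_comm]
    rw [Real.rpow_ofNat] at hT
    exact hT.le
  exact summable_of_isBigO_nat (Real.summable_one_div_nat_pow.2 one_lt_two)
    (IsBigO.of_bound 1 (h1.mono fun T hT => by
      rw [one_mul]; exact hT.trans (le_abs_self _)))

/-- Covariance inequality under exponential mixing. -/
lemma IsMixing.abs_cov_le {ℱ 𝓖 : ℕ → MeasurableSpace Ω} {c r : ℝ}
    (h : IsMixing P ℱ 𝓖 (expRate c r)) {X Y : Ω → ℝ} {C : ℝ} {n k : ℕ} (hk : 0 < k)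
    (hX : Measurable[ℱ n] X) (hY : Measurable[𝓖 (n + k)] Y)
    (hX4 : Integrable (fun ω => X ω ^ 4) P) (hY4 : Integrable (fun ω => Y ω ^ 4) P)
    (hXC : ∫ ω, X ω ^ 4 ∂P ≤ C) (hYC : ∫ ω, Y ω ^ 4 ∂P ≤ C) :
    |∫ ω, X ω * Y ω ∂P - (∫ ω, X ω ∂P) * ∫ ω, Y ω ∂P|
      ≤ (4 + 6 * (1 + C) ^ 2) * expRate (c / 3) r k := by
  set z := (k : ℝ) ^ r
  -- The truncation level `exp (c k^r / 3)` balances the two terms: `a²` times the mixing rate and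
  -- `1/a` are then equal.
  have := abs_cov_le_of_moment (P := P) (h.past_le n) (h.future_le _) (h.mixing n k hk)
    (Real.exp_pos (c / 3 * z)) hX hY hX4 hY4 hXC hYC
  refine this.trans (le_of_eq ?_)
  have e1 : Real.exp (c / 3 * z) ^ 2 * Real.exp (-c * z) = Real.exp (-(c / 3) * z) := by
    rw [sq, ← Real.exp_add, ← Real.exp_add]; congr 1; ring
  have e2 : (Real.exp (c / 3 * z))⁻¹ = Real.exp (-(c / 3) * z) := by
    rw [← Real.exp_neg]; congr 1; ring
  have e3 : expRate (c / 3) r k = Real.exp (-(c / 3) * z) := rfl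
  have e4 : expRate c r k = Real.exp (-c * z) := rfl
  rw [e3, e4, mul_assoc, e1, div_eq_mul_inv _ (Real.exp (c / 3 * z)), e2]
  ring

set_option maxHeartbeats 1600000 in
/-- Moderate deviations of the partial sums of mixing sequences with given moment bounds. -/
theorem IsMixing.moderate_deviation {ℱ 𝓖 : ℕ → MeasurableSpace Ω} {c r : ℝ} (hc : 0 < c)
    (hr : 0 < r) (h : IsMixing P ℱ 𝓖 (expRate c r)) (C : ℕ → ℝ) (a : ℕ) :
    ∃ κ > 0, ∀ᶠ T : ℕ in atTop, ∀ X : ℕ → Ω → ℝ, (∀ t, Measurable[ℱ t] (X t)) →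
      (∀ t, Measurable[𝓖 t] (X t)) → (∀ t, ∫ ω, X t ω ∂P = 0) →
      (∀ k t, Integrable (fun ω => |X t ω| ^ k) P) → (∀ k t, ∫ ω, |X t ω| ^ k ∂P ≤ C k) →
      P.real {ω | κ * √(T * Real.log T) < |∑ t ∈ Finset.range T, X t ω|} ≤ 1 / (T : ℝ) ^ a := by
  set D := 4 + 6 * (1 + C 4) ^ 2 with hD
  have hD4 : 4 ≤ D := by rw [hD]; nlinarith [sq_nonneg (1 + C 4)]
  set G := ∑' k, expRate (c / 3) r k with hG
  have hsum := summable_expRate (c := c / 3) (by positivity) hr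
  have hG0 : 0 ≤ G := tsum_nonneg fun k => (expRate_pos _ _ k).le
  -- `V` bounds the variance of a block per unit of length; the `+ 1` leaves room for the bias of
  -- truncation.
  set V := 2 * (D * G + 1) with hV
  have hV0 : 0 ≤ V := by positivity
  -- The exponential inequality loses a factor `T^V` and gains `T^(-κ)`, so this choice leaves
  -- `T^(-a-1)`.
  set κ := V + a + 1 with hκ
  have hκ0 : 0 < κ := by positivity
  set A := C 9 with hA
  set A' := C (8 * (a + 2)) with hA'
  refine ⟨2 * κ, by positivity, ?_⟩
  -- asymptotic facts
  have hcast : Tendsto (fun T : ℕ => (T : ℝ)) atTop atTop := tendsto_natCast_atTop_atTop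
  have f1 : ∀ᶠ T : ℕ in atTop, A ^ 2 ≤ T := hcast.eventually_ge_atTop _
  have flog : Tendsto (fun T : ℕ => Real.log T / (T : ℝ)) atTop (𝓝 0) := by
    have := (Real.isLittleO_log_id_atTop.tendsto_div_nhds_zero).comp hcast
    exact this
  have f2 : ∀ᶠ T : ℕ in atTop, √(Real.log T / T) * A ≤ 1 := by
    have : Tendsto (fun T : ℕ => √(Real.log T / T) * A) atTop (𝓝 0) := by
      have := (flog.sqrt).mul_const A
      simpa using this
    exact (this.eventually (gt_mem_nhds one_pos)).mono fun T hT => hT.le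
  have f3 : ∀ᶠ T : ℕ in atTop, √(Real.log T / T) * (2 * (T : ℝ) ^ (1 / 8 : ℝ) * (T : ℝ) ^ (1 / 8 : ℝ)) ≤ 1 := by
    have h1 : Tendsto (fun T : ℕ => Real.log T / (T : ℝ) ^ (1 / 2 : ℝ)) atTop (𝓝 0) := by
      have := ((isLittleO_log_rpow_atTop (r := 1 / 2) (by norm_num)).tendsto_div_nhds_zero).comp hcast
      exact this
    have h2 : Tendsto (fun T : ℕ => 2 * √(Real.log T / (T : ℝ) ^ (1 / 2 : ℝ))) atTop (𝓝 0) := by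
      have := (h1.sqrt).const_mul 2
      simpa using this
    filter_upwards [h2.eventually (gt_mem_nhds one_pos), eventually_gt_atTop 0] with T hT hT0
    have hT0' : (0 : ℝ) < T := by exact_mod_cast hT0
    refine le_trans (le_of_eq ?_) hT.le
    have e1 : (T : ℝ) ^ (1 / 8 : ℝ) * (T : ℝ) ^ (1 / 8 : ℝ) = √((T : ℝ) ^ (1 / 2 : ℝ)) := by
      rw [← Real.rpow_add hT0', Real.sqrt_eq_rpow, ← Real.rpow_mul hT0'.le]; norm_num
    have e2 : Real.log T / (T : ℝ) ^ (1 / 2 : ℝ) = Real.log T / T * (T : ℝ) ^ (1 / 2 : ℝ) := by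
      rw [div_mul_eq_mul_div, div_eq_div_iff (by positivity) (by positivity), mul_assoc,
        ← Real.rpow_add hT0']
      norm_num
    rw [e2, Real.sqrt_mul' _ (by positivity), ← e1]; ring
  have f4 : ∀ᶠ T : ℕ in atTop, 12 * Real.exp 1 ≤ T := hcast.eventually_ge_atTop _
  have f5 : ∀ᶠ T : ℕ in atTop, 48 * Real.exp 1 ^ 2 * ((T : ℝ) ^ (V + 1 + a)
      * Real.exp (-c * (T : ℝ) ^ (r / 8))) ≤ 1 := by
    have := (tendsto_rpow_mul_exp_neg hc (r := r / 8) (by positivity) (V + 1 + a)).const_mul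
      (48 * Real.exp 1 ^ 2)
    rw [mul_zero] at this
    exact (this.eventually (gt_mem_nhds one_pos)).mono fun T hT => hT.le
  have f6 : ∀ᶠ T : ℕ in atTop, 3 * A' ≤ T := hcast.eventually_ge_atTop _
  have f7 : ∀ᶠ T : ℕ in atTop, 4 * (T : ℝ) ^ (1 / 8 : ℝ) ≤ T := by
    have h1 : Tendsto (fun T : ℕ => (T : ℝ) ^ (7 / 8 : ℝ)) atTop atTop :=
      (tendsto_rpow_atTop (by norm_num)).comp hcast
    filter_upwards [h1.eventually_ge_atTop 4, eventually_gt_atTop 0] with T hT hT0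
    have hT0' : (0 : ℝ) < T := by exact_mod_cast hT0
    calc 4 * (T : ℝ) ^ (1 / 8 : ℝ) ≤ (T : ℝ) ^ (7 / 8 : ℝ) * (T : ℝ) ^ (1 / 8 : ℝ) := by gcongr
      _ = T := by rw [← Real.rpow_add hT0']; norm_num
  filter_upwards [f1, f2, f3, f4, f5, f6, f7, eventually_ge_atTop 3] with T f1 f2 f3 f4 f5 f6 f7 hT3
    X hXP hXG hX0 hXi hXC
  have hT0 : (0 : ℝ) < T := by exact_mod_cast (by omega : 0 < T)
  have hT1 : (1 : ℝ) < T := by exact_mod_cast (by omega : 1 < T)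
  have hlog : 0 < Real.log T := Real.log_pos hT1
  -- `T^(1/8)` serves both as truncation level and, rounded up, as block length. A block sum is then
  -- of order `T^(1/4)`, so with `l = √(log T / T)` the exponent `l p L` stays below 1, while the
  -- mixing error `exp (-c T^(r/8))` beats every power of `T`.
  set L := (T : ℝ) ^ (1 / 8 : ℝ) with hL
  have hL1 : 1 ≤ L := Real.one_le_rpow hT1.le (by norm_num)
  have hL8 : L ^ 8 = T := by
    rw [hL, ← Real.rpow_natCast, ← Real.rpow_mul hT0.le]; norm_num
  set p := ⌈L⌉₊ with hp
  have hpL : L ≤ p := Nat.le_ceil _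
  have hp2L : (p : ℝ) ≤ 2 * L := (Nat.ceil_lt_add_one (by positivity)).le.trans (by linarith)
  have hp0 : 0 < p := Nat.ceil_pos.2 (by positivity)
  set l := √(Real.log T / T) with hl
  have hl0 : 0 < l := Real.sqrt_pos.2 (by positivity)
  set x := κ * √(T * Real.log T) with hx
  have hlx : l * x = κ * Real.log T := by
    have : l * √(T * Real.log T) = Real.log T := by
      rw [hl, ← Real.sqrt_mul (by positivity)]
      rw [show Real.log T / T * (T * Real.log T) = Real.log T ^ 2 by field_simp]
      exact Real.sqrt_sq hlog.le
    rw [hx, mul_left_comm, this]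
  have hl2 : l ^ 2 = Real.log T / T := Real.sq_sqrt (by positivity)
  -- Enough pairs of blocks to cover all `T` times; the sequence is continued by zero beyond `T`.
  set n := T / (2 * p) + 1 with hn
  have hnT : T ≤ 2 * p * n := by
    have := Nat.lt_mul_div_succ T (b := 2 * p) (by omega)
    rw [hn]; exact this.le
  have hnp : (n : ℝ) * p ≤ T := by
    have h1 : 2 * p * (T / (2 * p)) ≤ T := Nat.mul_div_le T (2 * p)
    have h1' : (2 : ℝ) * p * ((T / (2 * p) : ℕ) : ℝ) ≤ T := by exact_mod_cast h1
    have : (n : ℝ) = ((T / (2 * p) : ℕ) : ℝ) + 1 := by rw [hn]; push_cast; ring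
    rw [this]
    nlinarith
  have hnle : (n : ℝ) ≤ T := by
    have : (1 : ℝ) ≤ p := by exact_mod_cast hp0
    have : (0 : ℝ) ≤ n := Nat.cast_nonneg _
    nlinarith
  -- moments
  have hXm : ∀ t, Measurable (X t) := fun t => (hXP t).mono (h.past_le t) le_rfl
  have hXint : ∀ t, Integrable (X t) P := fun t => by
    have := hXi 1 t
    simp only [pow_one] at this
    exact (integrable_norm_iff (hXm t).aestronglyMeasurable).1 this
  have hA0 : 0 ≤ A := (integral_nonneg fun ω => by positivity).trans (hXC 9 0)
  have hA0' : 0 ≤ A' := (integral_nonneg fun ω => by positivity).trans (hXC (8 * (a + 2)) 0)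
  -- Bound for the mean of a truncated variable: since `L^8 = T`, the ninth moment controls the
  -- truncation error by `A / T`.
  set δ := A / T with hδ
  -- truncated and padded sequence
  set Y : ℕ → Ω → ℝ := fun t ω => if t < T then trunc L (X t ω) else 0 with hY
  have hYP : ∀ t, Measurable[ℱ t] (Y t) := fun t => by
    by_cases ht : t < T
    · simp only [hY, ht, if_true]; exact (measurable_trunc L).comp (hXP t)
    · simp only [hY, ht, if_false]; exact measurable_const
  have hYG : ∀ t, Measurable[𝓖 t] (Y t) := fun t => by
    by_cases ht : t < T
    · simp only [hY, ht, if_true]; exact (measurable_trunc L).comp (hXG t)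
    · simp only [hY, ht, if_false]; exact measurable_const
  have hYL : ∀ t ω, |Y t ω| ≤ L := fun t ω => by
    simp only [hY]; split_ifs
    · exact abs_trunc_le (by positivity) _
    · simp only [abs_zero]; positivity
  have hYX : ∀ t ω, |Y t ω| ≤ |X t ω| := fun t ω => by
    simp only [hY]; split_ifs
    · exact abs_trunc_le_abs _ _
    · simp
  have hYm : ∀ t, Measurable (Y t) := fun t => (hYP t).mono (h.past_le t) le_rfl
  have hYint : ∀ t, Integrable (Y t) P := fun t => integrable_of_abs_le (hYm t) (hYL t)
  have hYδ : ∀ t, |∫ ω, Y t ω ∂P| ≤ δ := by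
    intro t
    by_cases ht : t < T
    · have e : ∫ ω, Y t ω ∂P = -∫ ω, (X t ω - trunc L (X t ω)) ∂P := by
        have hti : Integrable (fun ω => trunc L (X t ω)) P := by
          have := hYint t
          simpa only [hY, ht, if_true] using this
        rw [integral_sub (hXint t) hti, hX0]
        simp [hY, ht]
      rw [e, abs_neg, hδ, le_div_iff₀ hT0, ← hL8, mul_comm]
      have hti : Integrable (fun ω => X t ω - trunc L (X t ω)) P := by
        have h2 := hYint t
        simp only [hY, ht, if_true] at h2
        exact (hXint t).sub h2
      calc L ^ 8 * |∫ ω, (X t ω - trunc L (X t ω)) ∂P|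
          ≤ L ^ 8 * ∫ ω, |X t ω - trunc L (X t ω)| ∂P := by
            gcongr; exact abs_integral_le_integral_abs
        _ = ∫ ω, L ^ 8 * |X t ω - trunc L (X t ω)| ∂P := (integral_const_mul _ _).symm
        _ ≤ ∫ ω, |X t ω| ^ 9 ∂P := integral_mono (hti.abs.const_mul _) (hXi 9 t)
            fun ω => mul_abs_sub_trunc_le (by positivity) _ 8
        _ ≤ A := hXC 9 t
    · simp only [hY, ht, if_false, integral_zero, abs_zero]; positivity
  have hX4 : ∀ t, Integrable (fun ω => X t ω ^ 4) P := fun t => by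
    have := hXi 4 t
    simp_rw [Even.pow_abs (show Even 4 by decide)] at this
    exact this
  have hY4 : ∀ t, Integrable (fun ω => Y t ω ^ 4) P := fun t =>
    integrable_of_abs_le ((hYm t).pow_const 4) (a := L ^ 4) fun ω => by
      rw [abs_pow]; exact pow_le_pow_left₀ (abs_nonneg _) (hYL t ω) 4
  have hY4C : ∀ t, ∫ ω, Y t ω ^ 4 ∂P ≤ C 4 := fun t => by
    refine le_trans (integral_mono (hY4 t) (hXi 4 t) fun ω => ?_) (hXC 4 t)
    have := pow_le_pow_left₀ (abs_nonneg _) (hYX t ω) 4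
    rwa [← abs_pow, abs_of_nonneg (by positivity)] at this
  have hC4 : 0 ≤ C 4 := (integral_nonneg fun ω => by positivity).trans (hXC 4 0)
  have hYY : ∀ s t, Integrable (fun ω => Y s ω * Y t ω) P := fun s t =>
    (hYint t).bdd_mul (hYm s).aestronglyMeasurable (ae_of_all _ (hYL s))
  have hδ0 : 0 ≤ δ := by positivity
  have hcovY : ∀ s d, ∫ ω, Y s ω * Y (s + d) ω ∂P ≤ D * expRate (c / 3) r d + δ ^ 2 := by
    intro s d
    rcases Nat.eq_zero_or_pos d with rfl | hd
    · rw [expRate_zero _ hr, mul_one]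
      have : ∫ ω, Y s ω * Y (s + 0) ω ∂P ≤ 1 + C 4 := by
        have e := integral_add (integrable_const (μ := P) (1 : ℝ)) (hY4 s)
        calc _ ≤ ∫ ω, (1 + Y s ω ^ 4) ∂P :=
              integral_mono (hYY s s) ((integrable_const 1).add (hY4 s)) fun ω => by
                simp only; nlinarith only [sq_nonneg (Y s ω ^ 2 - 1 / 2)]
          _ ≤ 1 + C 4 := by rw [e]; simp; linarith [hY4C s]
      have h1D : 1 + C 4 ≤ D := by rw [hD]; nlinarith only [hC4, sq_nonneg (C 4)]
      have := sq_nonneg δ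
      linarith only [this, h1D, this, ‹∫ ω, Y s ω * Y (s + 0) ω ∂P ≤ 1 + C 4›]
    · have h1 := (abs_le.1 (h.abs_cov_le hd (hYP s) (hYG (s + d)) (hY4 s) (hY4 _) (hY4C s)
        (hY4C _))).2
      have h2 : (∫ ω, Y s ω ∂P) * ∫ ω, Y (s + d) ω ∂P ≤ δ ^ 2 := by
        refine (le_abs_self _).trans ?_
        rw [abs_mul, sq]
        exact mul_le_mul (hYδ _) (hYδ _) (abs_nonneg _) hδ0
      linarith
  have hpT : (p : ℝ) ≤ T := by linarith
  -- Truncated variables are not centred, which adds `δ²` to each covariance bound; summed over a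
  -- block this is at most `A²/T ≤ 1`.
  have hYV : ∀ s, ∫ ω, (∑ i ∈ Finset.range p, Y (s + i) ω) ^ 2 ∂P ≤ V * p := by
    intro s
    refine (integral_sq_sum_le (g := fun d => D * expRate (c / 3) r d + δ ^ 2)
      (fun d => by have := (expRate_pos (c / 3) r d).le; positivity) hYY hcovY s p).trans ?_
    rw [Finset.sum_add_distrib, ← Finset.mul_sum]
    have h1 : ∑ d ∈ Finset.range p, expRate (c / 3) r d ≤ G :=
      hsum.sum_le_tsum _ fun d _ => (expRate_pos _ _ d).le
    have h2 : ∑ d ∈ Finset.range p, δ ^ 2 ≤ 1 := by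
      rw [Finset.sum_const, Finset.card_range, nsmul_eq_mul]
      calc (p : ℝ) * δ ^ 2 ≤ T * δ ^ 2 := by gcongr
        _ = A ^ 2 / T := by rw [hδ]; field_simp
        _ ≤ 1 := by rw [div_le_one hT0]; exact f1
    have h3 : D * ∑ d ∈ Finset.range p, expRate (c / 3) r d ≤ D * G := by gcongr
    rw [hV]
    calc _ ≤ 2 * (p : ℝ) * (D * G + 1) := by gcongr
      _ = _ := by ring
  have hlb : l * (p * L) ≤ 1 := by
    refine le_trans ?_ f3
    gcongr
  have key := measure_lt_abs_sum_le (P := P) h hYP hYG hp0 (by positivity) hδ0 hV0 hl0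
    (by positivity) hYL hYδ hYV hlb n (x := x)
  -- the sum of the padded sequence
  have hsumY : ∀ ω, ∑ t ∈ Finset.range (2 * p * n), Y t ω
      = ∑ t ∈ Finset.range T, trunc L (X t ω) := by
    intro ω
    simp only [hY]
    rw [← Finset.sum_filter]
    congr 1
    ext t; simp; omega
  have hsub : {ω | 2 * κ * √(T * Real.log T) < |∑ t ∈ Finset.range T, X t ω|} ⊆
      {ω | 2 * x < |∑ t ∈ Finset.range (2 * p * n), Y t ω|} ∪
        ⋃ t ∈ Finset.range T, {ω | L ^ (8 * (a + 2)) ≤ |X t ω| ^ (8 * (a + 2))} := by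
    intro ω hω
    by_cases hcase : ∃ t ∈ Finset.range T, L < |X t ω|
    · right
      obtain ⟨t, ht, hlt⟩ := hcase
      simp only [Set.mem_iUnion]
      exact ⟨t, ht, pow_le_pow_left₀ (by positivity) hlt.le _⟩
    · left
      push Not at hcase
      simp only [Set.mem_ofPred_eq] at hω ⊢
      rw [hsumY, Finset.sum_congr rfl fun t ht => show trunc L (X t ω) = X t ω by
        simp [trunc, hcase t ht], hx, ← mul_assoc]
      exact hω
  -- The exponent is chosen so that `L ^ (8 * (a + 2)) = T ^ (a + 2)`: a union over `T` times still
  -- leaves a spare factor `1/T`.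
  have htail : ∀ t, P.real {ω | L ^ (8 * (a + 2)) ≤ |X t ω| ^ (8 * (a + 2))} ≤ A' / T ^ (a + 2) := by
    intro t
    have h1 := mul_meas_ge_le_integral_of_nonneg (ae_of_all P fun ω => by positivity)
      (hXi (8 * (a + 2)) t) (L ^ (8 * (a + 2)))
    have e : L ^ (8 * (a + 2)) = (T : ℝ) ^ (a + 2) := by rw [pow_mul, hL8]
    rw [le_div_iff₀ (by positivity), mul_comm]
    nth_rewrite 1 [← e]
    exact h1.trans (hXC _ t)
  have hunion : P.real (⋃ t ∈ Finset.range T, {ω | L ^ (8 * (a + 2)) ≤ |X t ω| ^ (8 * (a + 2))})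
      ≤ (1 / 3) / T ^ a := by
    refine (measureReal_biUnion_finset_le _ _).trans ?_
    refine (Finset.sum_le_sum fun t _ => htail t).trans ?_
    rw [Finset.sum_const, Finset.card_range, nsmul_eq_mul]
    have : (T : ℝ) * (A' / T ^ (a + 2)) = (A' / T) / T ^ a := by
      rw [pow_add]; field_simp
    rw [this]
    refine div_le_div_of_nonneg_right ?_ (by positivity)
    rw [div_le_div_iff₀ hT0 (by norm_num)]
    linarith
  have hTV : ∀ z : ℝ, Real.exp (z * Real.log T) = (T : ℝ) ^ z := fun z => by
    rw [Real.rpow_def_of_pos hT0, mul_comm]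
  have hexp : Real.exp (n * (l * p * δ + l ^ 2 * V * p)) ≤ Real.exp 1 * (T : ℝ) ^ V := by
    rw [← hTV, ← Real.exp_add]
    apply Real.exp_le_exp.2
    have e1 : n * (l * p * δ + l ^ 2 * V * p) = (n * p) * (l * δ + l ^ 2 * V) := by ring
    rw [e1]
    calc (n * p : ℝ) * (l * δ + l ^ 2 * V) ≤ T * (l * δ + l ^ 2 * V) := by gcongr
      _ = l * A + V * Real.log T := by rw [hl2, hδ]; field_simp
      _ ≤ _ := by linarith
  have hα : expRate c r p ≤ Real.exp (-c * (T : ℝ) ^ (r / 8)) := by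
    apply Real.exp_le_exp.2
    have : (T : ℝ) ^ (r / 8) ≤ (p : ℝ) ^ r := by
      calc (T : ℝ) ^ (r / 8) = L ^ r := by rw [hL, ← Real.rpow_mul hT0.le]; congr 1; ring
        _ ≤ (p : ℝ) ^ r := Real.rpow_le_rpow (by positivity) hpL hr.le
    nlinarith
  -- The Gaussian part contributes `T^V T^(-κ) = T^(-a-1)` and the mixing part is smaller than any
  -- power; each takes a third of the final bound, the remaining third being the truncation event.
  have hkeyb : 4 * (Real.exp (n * (l * p * δ + l ^ 2 * V * p)) *
      (Real.exp (-(l * x)) + 4 * n * Real.exp 1 * expRate c r p)) ≤ (2 / 3) / T ^ a := by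
    have hx1 : Real.exp (-(l * x)) = (T : ℝ) ^ (-κ) := by
      rw [hlx, ← neg_mul, hTV]
    have t1 : (T : ℝ) ^ V * (T : ℝ) ^ (-κ) = 1 / (T * T ^ a) := by
      rw [← Real.rpow_add hT0, hκ, show V + -(V + a + 1) = -((a : ℝ) + 1) by ring,
        Real.rpow_neg hT0.le, Real.rpow_add hT0, Real.rpow_natCast, Real.rpow_one, mul_comm,
        one_div]
    have t2 : (T : ℝ) ^ V * T * T ^ a = (T : ℝ) ^ (V + 1 + a) := by
      rw [Real.rpow_add hT0, Real.rpow_add hT0, Real.rpow_one, Real.rpow_natCast]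
    set q := Real.exp (-c * (T : ℝ) ^ (r / 8)) with hq
    have hTa : (0 : ℝ) < T ^ a := by positivity
    calc _ ≤ 4 * ((Real.exp 1 * (T : ℝ) ^ V) * ((T : ℝ) ^ (-κ) + 4 * T * Real.exp 1 * q)) := by
          rw [hx1]
          have := (expRate_pos c r p).le
          gcongr
      _ = 4 * Real.exp 1 * ((T : ℝ) ^ V * (T : ℝ) ^ (-κ))
          + 16 * Real.exp 1 ^ 2 * ((T : ℝ) ^ V * T * q) := by ring
      _ ≤ (1 / 3) / T ^ a + (1 / 3) / T ^ a := by
          gcongr ?_ + ?_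
          · rw [t1, mul_one_div, div_le_div_iff₀ (by positivity) hTa]
            nlinarith
          · rw [le_div_iff₀ hTa]
            have : 16 * Real.exp 1 ^ 2 * ((T : ℝ) ^ V * T * q) * T ^ a
                = (1 / 3) * (48 * Real.exp 1 ^ 2 * (((T : ℝ) ^ V * T * T ^ a) * q)) := by ring
            rw [this, t2]
            linarith
      _ = _ := by ring
  calc _ ≤ _ := measureReal_mono hsub
    _ ≤ _ := measureReal_union_le _ _
    _ ≤ (2 / 3) / T ^ a + (1 / 3) / T ^ a := add_le_add (key.trans hkeyb) hunion
    _ = _ := by ring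

end ModerateDeviations

/-! ### Events of probability tending to one -/

section HighProbability

variable {Ω : Type*} {mΩ : MeasurableSpace Ω}

/-- The filter on `ℕ × Ω` of the sequences of events whose probability tends to one. Convergence
in probability is convergence along this filter. -/
def whp (P : Measure Ω) : Filter (ℕ × Ω) where
  sets := {s | Tendsto (fun n => P {ω | (n, ω) ∉ s}) atTop (𝓝 0)}
  univ_sets := by simp
  sets_of_superset {s t} hs hst :=
    tendsto_of_tendsto_of_tendsto_of_le_of_le tendsto_const_nhds hs (fun _ => zero_le)
      fun n => measure_mono fun ω hω h => hω (hst h)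
  inter_sets {s t} hs ht := by
    have h := Tendsto.add hs ht
    rw [add_zero] at h
    refine tendsto_of_tendsto_of_tendsto_of_le_of_le tendsto_const_nhds h (fun _ => zero_le)
      fun n => ?_
    refine le_trans (measure_mono ?_) (measure_union_le _ _)
    intro ω hω
    by_contra hcon
    simp only [Set.mem_union, Set.mem_ofPred_eq, not_or, not_not] at hcon
    exact hω ⟨hcon.1, hcon.2⟩

variable {P : Measure Ω}

lemma eventually_whp {p : ℕ × Ω → Prop} :
    (∀ᶠ x in whp P, p x) ↔ Tendsto (fun n => P {ω | ¬ p (n, ω)}) atTop (𝓝 0) := Iff.rfl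

lemma tendsto_fst_whp : Tendsto (Prod.fst : ℕ × Ω → ℕ) (whp P) atTop := by
  intro s hs
  refine tendsto_nhds_of_eventually_eq ?_
  filter_upwards [hs] with n hn
  have : {ω : Ω | (n, ω) ∉ Prod.fst ⁻¹' s} = ∅ := by
    ext ω; simpa using hn
  rw [this, measure_empty]

lemma eventually_whp_of_forall {q : ℕ → Ω → Prop} (h : ∀ᶠ n in atTop, ∀ ω, q n ω) :
    ∀ᶠ x in whp P, q x.1 x.2 :=
  (tendsto_fst_whp.eventually h).mono fun x hx => hx x.2

lemma eventually_whp_of_real_le [IsFiniteMeasure P] {q : ℕ → Ω → Prop} {a : ℕ → ℝ}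
    (ha : Tendsto a atTop (𝓝 0)) (h : ∀ᶠ n in atTop, P.real {ω | ¬ q n ω} ≤ a n) :
    ∀ᶠ x in whp P, q x.1 x.2 := by
  rw [eventually_whp]
  have h1 : Tendsto (fun n => P.real {ω | ¬ q n ω}) atTop (𝓝 0) :=
    squeeze_zero' (Eventually.of_forall fun n => measureReal_nonneg) h ha
  have h2 := ENNReal.tendsto_ofReal h1
  simpa [ofReal_measureReal] using h2

/-- This makes convergence in probability an ordinary `Tendsto`, to which algebra of limits,
continuity, squeezing and ultrafilter arguments apply. -/
lemma tendstoInMeasure_iff_whp {X : ℕ → Ω → ℝ} {g : Ω → ℝ} :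
    TendstoInMeasure P X atTop g ↔ Tendsto (fun x : ℕ × Ω => X x.1 x.2 - g x.2) (whp P) (𝓝 0) := by
  constructor
  · intro h
    rw [Metric.tendsto_nhds]
    intro ε hε
    rw [eventually_whp]
    have := h (ENNReal.ofReal ε) (by simpa using hε)
    refine this.congr fun n => ?_
    congr 1; ext ω
    simp [edist_dist, Real.dist_eq, ENNReal.ofReal_le_ofReal_iff]
  · intro h ε hε
    rcases eq_or_ne ε ⊤ with rfl | hε'
    · have : ∀ n, {ω | ⊤ ≤ edist (X n ω) (g ω)} = ∅ := fun n => by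
        ext ω; simp [edist_ne_top]
      simp only [this, measure_empty]; exact tendsto_const_nhds
    · have hpos : 0 < ε.toReal := ENNReal.toReal_pos hε.ne' hε'
      have := (Metric.tendsto_nhds.1 h) ε.toReal hpos
      rw [eventually_whp] at this
      refine this.congr fun n => ?_
      congr 1; ext ω
      simp only [Set.mem_ofPred_eq, dist_zero_right, Real.norm_eq_abs, not_lt]
      rw [edist_dist, Real.dist_eq, ENNReal.le_ofReal_iff_toReal_le hε' (abs_nonneg _)]

lemma tendstoInMeasure_const_iff_whp {X : ℕ → Ω → ℝ} {c : ℝ} :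
    TendstoInMeasure P X atTop (fun _ => c)
      ↔ Tendsto (fun x : ℕ × Ω => X x.1 x.2) (whp P) (𝓝 c) := by
  rw [tendstoInMeasure_iff_whp]
  exact tendsto_sub_nhds_zero_iff

/-- A nonnegative sequence is eventually below any sequence that dominates its expectations. -/
lemma eventually_whp_le_of_integral [IsFiniteMeasure P] {X : ℕ → Ω → ℝ} {c : ℕ → ℝ}
    (hX : ∀ᶠ n in atTop, ∀ ω, 0 ≤ X n ω) (hXi : ∀ᶠ n in atTop, Integrable (X n) P)
    (hc : ∀ᶠ n in atTop, 0 < c n)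
    (h : Tendsto (fun n => (∫ ω, X n ω ∂P) / c n) atTop (𝓝 0)) :
    ∀ᶠ x in whp P, X x.1 x.2 ≤ c x.1 := by
  refine eventually_whp_of_real_le (q := fun n ω => X n ω ≤ c n) h ?_
  filter_upwards [hX, hXi, hc] with n h0 hi hc
  rw [le_div_iff₀ hc, mul_comm]
  refine le_trans (mul_le_mul_of_nonneg_left ?_ hc.le)
    (mul_meas_ge_le_integral_of_nonneg (ae_of_all P h0) hi (c n))
  exact measureReal_mono fun ω hω => (not_le.1 hω).le

lemma tendsto_whp_zero_of_integral_sq [IsFiniteMeasure P] {X : ℕ → Ω → ℝ}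
    (hXi : ∀ᶠ n in atTop, Integrable (fun ω => X n ω ^ 2) P)
    (h : Tendsto (fun n => ∫ ω, X n ω ^ 2 ∂P) atTop (𝓝 0)) :
    Tendsto (fun x : ℕ × Ω => X x.1 x.2) (whp P) (𝓝 0) := by
  rw [Metric.tendsto_nhds]
  intro ε hε
  have := eventually_whp_le_of_integral (P := P) (X := fun n ω => X n ω ^ 2)
    (c := fun _ => (ε / 2) ^ 2) (Eventually.of_forall fun n ω => by positivity) hXi
    (Eventually.of_forall fun n => by positivity) (by simpa using h.div_const _)
  filter_upwards [this] with x hx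
  rw [dist_zero_right, Real.norm_eq_abs]
  have := abs_le_of_sq_le_sq hx (by positivity)
  linarith

/-- A sequence tending to zero in probability times a fixed random variable. -/
lemma tendsto_whp_mul_fixed [IsFiniteMeasure P] {X : ℕ × Ω → ℝ} {Y : Ω → ℝ} (hY : Measurable Y)
    (h : Tendsto X (whp P) (𝓝 0)) : Tendsto (fun x => X x * Y x.2) (whp P) (𝓝 0) := by
  -- A single random variable is tight: off an event of small probability it is bounded by a
  -- constant `m`.
  have htail : Tendsto (fun m : ℕ => P {ω | (m : ℝ) < |Y ω|}) atTop (𝓝 0) := by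
    have : (⋂ m : ℕ, {ω | (m : ℝ) < |Y ω|}) = ∅ := by
      ext ω
      simp only [Set.mem_iInter, Set.mem_ofPred_eq, Set.mem_empty_iff_false, iff_false, not_forall,
        not_lt]
      obtain ⟨m, hm⟩ := exists_nat_ge |Y ω|
      exact ⟨m, hm⟩
    have h2 := tendsto_measure_iInter_atTop (μ := P) (s := fun m : ℕ => {ω | (m : ℝ) < |Y ω|})
      (fun m => (measurableSet_lt measurable_const hY.abs).nullMeasurableSet)
      (fun a b hab ω (hω : (b : ℝ) < |Y ω|) => show (a : ℝ) < |Y ω| from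
        lt_of_le_of_lt (Nat.cast_le.2 hab) hω) ⟨0, measure_ne_top _ _⟩
    rwa [this, measure_empty] at h2
  rw [Metric.tendsto_nhds]
  intro ε hε
  rw [eventually_whp, ENNReal.tendsto_nhds_zero]
  intro δ hδ
  have hδ2 : 0 < δ / 2 := ENNReal.half_pos hδ.ne'
  obtain ⟨m, hm⟩ := ((ENNReal.tendsto_nhds_zero.1 htail) (δ / 2) hδ2).exists
  have h1 := (Metric.tendsto_nhds.1 h) (ε / (m + 1)) (by positivity)
  rw [eventually_whp] at h1
  filter_upwards [(ENNReal.tendsto_nhds_zero.1 h1) (δ / 2) hδ2] with n hn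
  rw [← ENNReal.add_halves δ]
  refine le_trans (le_trans (measure_mono ?_) (measure_union_le _ _)) (add_le_add hn hm)
  intro ω hω
  simp only [Set.mem_union, Set.mem_ofPred_eq, dist_zero_right, Real.norm_eq_abs, not_lt,
    abs_mul] at hω ⊢
  by_contra! hcon
  obtain ⟨h1, h2⟩ := hcon
  have hm0 : (0 : ℝ) ≤ m := Nat.cast_nonneg m
  rw [lt_div_iff₀ (by positivity)] at h1
  have : |X (n, ω)| * |Y ω| ≤ |X (n, ω)| * (m + 1) :=
    mul_le_mul_of_nonneg_left (by linarith) (abs_nonneg _)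
  linarith

end HighProbability

/-! ### Operator norms of real matrices -/

section MatrixNorms

open scoped Matrix.Norms.L2Operator

variable {m n k : Type*} [Fintype m] [Fintype n] [Fintype k] [DecidableEq m] [DecidableEq n]
  [DecidableEq k]

lemma l2_norm_transpose (A : Matrix m n ℝ) : ‖Aᵀ‖ = ‖A‖ := by
  rw [← conjTranspose_eq_transpose_of_trivial, l2_opNorm_conjTranspose]

lemma norm_transpose_mul_self (A : Matrix m n ℝ) : ‖Aᵀ * A‖ = ‖A‖ ^ 2 := by
  rw [← conjTranspose_eq_transpose_of_trivial, l2_opNorm_conjTranspose_mul_self, sq]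

lemma norm_mul_transpose_self (A : Matrix m n ℝ) : ‖A * Aᵀ‖ = ‖A‖ ^ 2 := by
  have := norm_transpose_mul_self Aᵀ
  rwa [transpose_transpose, l2_norm_transpose] at this

lemma norm_one_le : ‖(1 : Matrix m m ℝ)‖ ≤ 1 := by
  rw [← diagonal_one, l2_opNorm_diagonal]
  exact (pi_norm_le_iff_of_nonneg zero_le_one).2 fun i => by simp

lemma norm_le_one_of_orthonormal {Z : Matrix m n ℝ} (h : Zᵀ * Z = 1) : ‖Z‖ ≤ 1 := by
  have h1 := norm_transpose_mul_self Z
  rw [h] at h1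
  have := norm_one_le (m := n)
  nlinarith [norm_nonneg Z]

/-- The Euclidean norm of `A x` in coordinates. -/
lemma sum_sq_mulVec_le (A : Matrix m n ℝ) (x : n → ℝ) :
    ∑ i, (A *ᵥ x) i ^ 2 ≤ ‖A‖ ^ 2 * ∑ j, x j ^ 2 := by
  have := l2_opNorm_mulVec A (WithLp.toLp 2 x)
  have h2 := pow_le_pow_left₀ (norm_nonneg _) this 2
  rw [mul_pow, EuclideanSpace.real_norm_sq_eq, EuclideanSpace.real_norm_sq_eq] at h2
  simpa using h2

lemma norm_le_of_sum_sq_mulVec {A : Matrix m n ℝ} {c : ℝ} (hc : 0 ≤ c)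
    (h : ∀ x : n → ℝ, ∑ i, (A *ᵥ x) i ^ 2 ≤ c ^ 2 * ∑ j, x j ^ 2) : ‖A‖ ≤ c := by
  rw [l2_opNorm_def]
  refine ContinuousLinearMap.opNorm_le_bound _ hc fun x => ?_
  have := h x.ofLp
  rw [← EuclideanSpace.real_norm_sq_eq] at this
  refine le_of_sq_le_sq ?_ (by positivity)
  rw [mul_pow, EuclideanSpace.real_norm_sq_eq]
  simpa using this

/-- The operator norm is at most the Frobenius norm. -/
lemma norm_sq_le_sum_sq (A : Matrix m n ℝ) : ‖A‖ ^ 2 ≤ ∑ i, ∑ j, A i j ^ 2 := by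
  have h0 : 0 ≤ ∑ i, ∑ j, A i j ^ 2 := by positivity
  have : ‖A‖ ≤ √(∑ i, ∑ j, A i j ^ 2) := by
    refine norm_le_of_sum_sq_mulVec (Real.sqrt_nonneg _) fun x => ?_
    rw [Real.sq_sqrt h0, Finset.sum_mul]
    refine Finset.sum_le_sum fun i _ => ?_
    exact Finset.sum_mul_sq_le_sq_mul_sq _ _ _
  calc ‖A‖ ^ 2 ≤ √(∑ i, ∑ j, A i j ^ 2) ^ 2 := by gcongr
    _ = _ := Real.sq_sqrt h0

lemma sum_sq_col_le (A : Matrix m n ℝ) (j : n) : ∑ i, A i j ^ 2 ≤ ‖A‖ ^ 2 := by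
  have := sum_sq_mulVec_le A (Pi.single j 1)
  simpa [Pi.single_apply, ite_pow] using this

lemma sum_sq_row_le (A : Matrix m n ℝ) (i : m) : ∑ j, A i j ^ 2 ≤ ‖A‖ ^ 2 := by
  have := sum_sq_col_le Aᵀ i
  simpa [l2_norm_transpose] using this

lemma abs_entry_le (A : Matrix m n ℝ) (i : m) (j : n) : |A i j| ≤ ‖A‖ := by
  refine abs_le_of_sq_le_sq' ?_ (norm_nonneg _) |> abs_le.2
  refine le_trans ?_ (sum_sq_row_le A i)
  exact Finset.single_le_sum (f := fun j => A i j ^ 2) (fun j _ => sq_nonneg _) (Finset.mem_univ j)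

lemma norm_le_of_abs_entry_le {A : Matrix m n ℝ} {c : ℝ} (hc : 0 ≤ c) (h : ∀ i j, |A i j| ≤ c) :
    ‖A‖ ≤ √(Fintype.card m * Fintype.card n) * c := by
  refine le_of_sq_le_sq ?_ (by positivity)
  refine (norm_sq_le_sum_sq A).trans ?_
  rw [mul_pow, Real.sq_sqrt (by positivity)]
  calc ∑ i, ∑ j, A i j ^ 2 ≤ ∑ i : m, ∑ j : n, c ^ 2 := by
        refine Finset.sum_le_sum fun i _ => Finset.sum_le_sum fun j _ => ?_
        rw [← sq_abs]; exact pow_le_pow_left₀ (abs_nonneg _) (h i j) 2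
    _ = _ := by simp; ring

/-- Schur's test. -/
lemma norm_le_of_row_sum_le {A : Matrix m m ℝ} (hA : Aᵀ = A) {c : ℝ} (hc : 0 ≤ c)
    (h : ∀ i, ∑ j, |A i j| ≤ c) : ‖A‖ ≤ c := by
  have hsymm : ∀ i j, A i j = A j i := fun i j => by
    conv_lhs => rw [← hA]
    rfl
  refine norm_le_of_sum_sq_mulVec hc fun x => ?_
  -- Cauchy–Schwarz after splitting `|A i j|` into two square roots. Summing over `i` then needs
  -- column sums, which equal row sums by symmetry.
  have h1 : ∀ i, (A *ᵥ x) i ^ 2 ≤ c * ∑ j, |A i j| * x j ^ 2 := by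
    intro i
    have hcs := Finset.sum_mul_sq_le_sq_mul_sq Finset.univ (fun j => √|A i j|)
      (fun j => √|A i j| * |x j|)
    have e1 : ∀ j, √|A i j| * (√|A i j| * |x j|) = |A i j| * |x j| := fun j => by
      rw [← mul_assoc, Real.mul_self_sqrt (abs_nonneg _)]
    have e2 : ∀ j, √|A i j| ^ 2 = |A i j| := fun j => Real.sq_sqrt (abs_nonneg _)
    have e3 : ∀ j, (√|A i j| * |x j|) ^ 2 = |A i j| * x j ^ 2 := fun j => by
      rw [mul_pow, e2, sq_abs]
    simp only [e1, e2, e3] at hcs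
    have h2 : (A *ᵥ x) i ^ 2 ≤ (∑ j, |A i j| * |x j|) ^ 2 := by
      rw [← sq_abs]
      refine pow_le_pow_left₀ (abs_nonneg _) ?_ 2
      refine (Finset.abs_sum_le_sum_abs _ _).trans (le_of_eq ?_)
      simp_rw [abs_mul]
    refine h2.trans (hcs.trans ?_)
    exact mul_le_mul_of_nonneg_right (h i) (by positivity)
  calc ∑ i, (A *ᵥ x) i ^ 2 ≤ ∑ i, c * ∑ j, |A i j| * x j ^ 2 := Finset.sum_le_sum fun i _ => h1 i
    _ = c * ∑ j, (∑ i, |A j i|) * x j ^ 2 := by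
        rw [← Finset.mul_sum, Finset.sum_comm]
        congr 1
        refine Finset.sum_congr rfl fun j _ => ?_
        rw [Finset.sum_mul]
        exact Finset.sum_congr rfl fun i _ => by rw [hsymm i j]
    _ ≤ c * ∑ j, c * x j ^ 2 := by gcongr with j _; exact h j
    _ = _ := by rw [← Finset.mul_sum]; ring

/-- The `i`-th row of a matrix. -/
def rowM (A : Matrix m n ℝ) (i : m) : Matrix Unit n ℝ := Matrix.of fun _ j => A i j

lemma rowM_mul (A : Matrix m n ℝ) (B : Matrix n k ℝ) (i : m) :
    rowM (A * B) i = rowM A i * B := by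
  ext a b; simp [rowM, Matrix.mul_apply]

lemma rowM_add (A B : Matrix m n ℝ) (i : m) : rowM (A + B) i = rowM A i + rowM B i := rfl

/-- For a single row the operator norm and the Euclidean norm agree, so rows can be multiplied by
matrices and estimated in the same norm. -/
lemma norm_rowM_sq (A : Matrix m n ℝ) (i : m) : ‖rowM A i‖ ^ 2 = ∑ j, A i j ^ 2 := by
  refine le_antisymm ?_ ?_
  · simpa [rowM] using norm_sq_le_sum_sq (rowM A i)
  · simpa [rowM] using sum_sq_row_le (rowM A i) ()

lemma norm_rowM_le (A : Matrix m n ℝ) (i : m) : ‖rowM A i‖ ≤ ‖A‖ := by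
  refine le_of_sq_le_sq ?_ (norm_nonneg _)
  rw [norm_rowM_sq]; exact sum_sq_row_le A i

lemma mul_transpose_apply_eq_rowM (A : Matrix m n ℝ) (B : Matrix k n ℝ) (i : m) (j : k) :
    (A * Bᵀ) i j = (rowM A i * (rowM B j)ᵀ) () () := by
  simp [rowM, Matrix.mul_apply]

lemma l2_norm_mul_le_of_le {A : Matrix m n ℝ} {B : Matrix n k ℝ} {a b : ℝ} (hA : ‖A‖ ≤ a)
    (hB : ‖B‖ ≤ b) : ‖A * B‖ ≤ a * b :=
  (l2_opNorm_mul A B).trans (mul_le_mul hA hB (norm_nonneg _) ((norm_nonneg _).trans hA))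

/-- Diagonalization of a real symmetric matrix. -/
lemma exists_orthogonal_diagonalization {A : Matrix m m ℝ} (hA : A.IsHermitian) :
    ∃ (U : Matrix m m ℝ) (v : m → ℝ), Uᵀ * U = 1 ∧ U * Uᵀ = 1 ∧ A = U * diagonal v * Uᵀ ∧
      ∀ i, v i ∈ spectrum ℝ A := by
  refine ⟨hA.eigenvectorUnitary, hA.eigenvalues, ?_, ?_, ?_, fun i =>
    hA.eigenvalues_mem_spectrum_real i⟩
  · have := (Matrix.mem_unitaryGroup_iff' (A := (hA.eigenvectorUnitary : Matrix m m ℝ))).1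
      hA.eigenvectorUnitary.2
    rwa [star_eq_conjTranspose, conjTranspose_eq_transpose_of_trivial] at this
  · have := (Matrix.mem_unitaryGroup_iff (A := (hA.eigenvectorUnitary : Matrix m m ℝ))).1
      hA.eigenvectorUnitary.2
    rwa [star_eq_conjTranspose, conjTranspose_eq_transpose_of_trivial] at this
  · have := hA.spectral_theorem
    rw [Unitary.conjStarAlgAut_apply, star_eq_conjTranspose,
      conjTranspose_eq_transpose_of_trivial] at this
    exact this

lemma norm_conj_diagonal_le {U : Matrix m m ℝ} (h : Uᵀ * U = 1) {v : m → ℝ} {c : ℝ} (hc : 0 ≤ c)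
    (hv : ∀ i, |v i| ≤ c) : ‖U * diagonal v * Uᵀ‖ ≤ c := by
  have h1 := norm_le_one_of_orthonormal h
  have h2 : ‖(diagonal v : Matrix m m ℝ)‖ ≤ c := by
    rw [l2_opNorm_diagonal]; exact (pi_norm_le_iff_of_nonneg hc).2 hv
  have h3 := l2_norm_mul_le_of_le (l2_norm_mul_le_of_le h1 h2) ((l2_norm_transpose U).trans_le h1)
  linarith

/-- Norms of a symmetric matrix with positive spectrum and of its inverse. -/
lemma symm_norm_bounds {A : Matrix m m ℝ} (hA : A.IsHermitian) {a b : ℝ} (ha : 0 < a)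
    (h : ∀ x ∈ spectrum ℝ A, a ≤ x ∧ x ≤ b) :
    IsUnit A.det ∧ (0 ≤ b → ‖A‖ ≤ b) ∧ ‖A⁻¹‖ ≤ 1 / a ∧
      ∀ x : m → ℝ, a * (x ⬝ᵥ x) ≤ x ⬝ᵥ (A *ᵥ x) := by
  obtain ⟨U, v, hU, hU', hAU, hv⟩ := exists_orthogonal_diagonalization hA
  have hvpos : ∀ i, 0 < v i := fun i => ha.trans_le (h _ (hv i)).1
  have hinv : A * (U * diagonal (fun i => (v i)⁻¹) * Uᵀ) = 1 := by
    rw [hAU]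
    calc U * diagonal v * Uᵀ * (U * diagonal (fun i => (v i)⁻¹) * Uᵀ)
        = U * diagonal v * (Uᵀ * U) * diagonal (fun i => (v i)⁻¹) * Uᵀ := by
          simp only [Matrix.mul_assoc]
      _ = U * (diagonal v * diagonal (fun i => (v i)⁻¹)) * Uᵀ := by
          rw [hU, Matrix.mul_one]; simp only [Matrix.mul_assoc]
      _ = 1 := by
          rw [diagonal_mul_diagonal]
          have : (fun i => v i * (v i)⁻¹) = fun _ => 1 := by
            ext i; exact mul_inv_cancel₀ (hvpos i).ne'
          rw [this, diagonal_one, Matrix.mul_one, hU']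
  have hdet : IsUnit A.det := by
    have := congrArg Matrix.det hinv
    rw [det_mul, det_one] at this
    exact IsUnit.of_mul_eq_one _ this
  refine ⟨hdet, fun hb => ?_, ?_, fun x => ?_⟩
  · rw [hAU]
    exact norm_conj_diagonal_le hU hb fun i => by
      rw [abs_of_pos (hvpos i)]; exact (h _ (hv i)).2
  · rw [Matrix.inv_eq_right_inv hinv]
    exact norm_conj_diagonal_le hU (by positivity) fun i => by
      rw [abs_of_pos (by have := hvpos i; positivity), one_div]
      exact inv_anti₀ ha (h _ (hv i)).1
  · set z := Uᵀ *ᵥ x with hz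
    have e1 : x ⬝ᵥ x = z ⬝ᵥ z := by
      rw [hz, Matrix.dotProduct_mulVec, ← Matrix.mulVec_transpose, transpose_transpose,
        Matrix.mulVec_mulVec, hU', Matrix.one_mulVec]
    have e2 : x ⬝ᵥ (A *ᵥ x) = z ⬝ᵥ (diagonal v *ᵥ z) := by
      rw [hAU, hz, ← Matrix.mulVec_mulVec, ← Matrix.mulVec_mulVec, Matrix.dotProduct_mulVec,
        ← Matrix.mulVec_transpose]
    rw [e1, e2, dotProduct, dotProduct, Finset.mul_sum]
    refine Finset.sum_le_sum fun i _ => ?_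
    rw [mulVec_diagonal]
    have := (h _ (hv i)).1
    nlinarith [mul_self_nonneg (z i)]

/-- Perturbation of an inverse. -/
lemma inv_perturbation {A B : Matrix m m ℝ} (hA : IsUnit A.det) {c d : ℝ} (hc : ‖A⁻¹‖ ≤ c)
    (hd : ‖B - A‖ ≤ d) (hcd : c * d ≤ 1 / 2) :
    IsUnit B.det ∧ ‖B⁻¹‖ ≤ 2 * c ∧ ‖B⁻¹ - A⁻¹‖ ≤ 2 * c ^ 2 * d := by
  have hc0 : 0 ≤ c := (norm_nonneg _).trans hc
  have hd0 : 0 ≤ d := (norm_nonneg _).trans hd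
  have hA1 : A * A⁻¹ = 1 := Matrix.mul_nonsing_inv A hA
  have hA2 : A⁻¹ * A = 1 := Matrix.nonsing_inv_mul A hA
  -- Neumann series: `B` is `A` times a perturbation of the identity of norm less than one.
  have hB : B = A * (1 - (-(A⁻¹ * (B - A)))) := by
    rw [sub_neg_eq_add, Matrix.mul_add, Matrix.mul_one, ← Matrix.mul_assoc, hA1, Matrix.one_mul]
    abel
  have hsmall : ‖-(A⁻¹ * (B - A))‖ < 1 := by
    rw [norm_neg]
    have := l2_norm_mul_le_of_le hc hd
    linarith
  have hu : IsUnit (1 - (-(A⁻¹ * (B - A)))) := isUnit_one_sub_of_norm_lt_one hsmall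
  have hBdet : IsUnit B.det := by
    rw [hB, det_mul]
    exact hA.mul ((Matrix.isUnit_iff_isUnit_det _).1 hu)
  have hB1 : B⁻¹ * B = 1 := Matrix.nonsing_inv_mul B hBdet
  have hdiff : B⁻¹ - A⁻¹ = -(B⁻¹ * (B - A) * A⁻¹) := by
    rw [Matrix.mul_sub, hB1, Matrix.sub_mul, Matrix.mul_assoc, hA1]; simp
  have h1 : ‖B⁻¹ - A⁻¹‖ ≤ ‖B⁻¹‖ * d * c := by
    rw [hdiff, norm_neg]
    exact l2_norm_mul_le_of_le (l2_norm_mul_le_of_le le_rfl hd) hc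
  -- The bound for `B⁻¹` contains `‖B⁻¹‖` itself with coefficient `c d ≤ 1/2`, which is absorbed on
  -- the left.
  have h2 : ‖B⁻¹‖ ≤ 2 * c := by
    have : ‖B⁻¹‖ ≤ ‖B⁻¹ - A⁻¹‖ + ‖A⁻¹‖ := by
      have := norm_add_le (B⁻¹ - A⁻¹) A⁻¹
      simpa using this
    nlinarith [norm_nonneg B⁻¹]
  refine ⟨hBdet, h2, h1.trans ?_⟩
  have : ‖B⁻¹‖ * d * c ≤ 2 * c * d * c := by gcongr
  linarith

end MatrixNorms

/-! ### Ordered eigenvalues -/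

section OrderedEigenvalues

open Polynomial in
lemma charpoly_conj_diagonal {m : Type*} [Fintype m] [DecidableEq m] {U : Matrix m m ℝ}
    (h : Uᵀ * U = 1) (v : m → ℝ) :
    (U * diagonal v * Uᵀ).charpoly = ∏ i, (X - C (v i)) := by
  rw [Matrix.mul_assoc, charpoly_mul_comm, Matrix.mul_assoc, h, Matrix.mul_one, charpoly_diagonal]

-- The product determines the multiset of roots, and a multiset has only one decreasing enumeration.
-- Ordered eigenvalues are identified in this way through characteristic polynomials.
open Polynomial in
lemma antitone_eq_of_prod_eq {r : ℕ} {v w : Fin r → ℝ} (hv : Antitone v) (hw : Antitone w)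
    (h : ∏ i, (X - C (v i)) = ∏ i, (X - C (w i))) : v = w := by
  have h1 := congrArg Polynomial.roots h
  have e : ∀ u : Fin r → ℝ, (∏ i, (X - C (u i))).roots = Finset.univ.val.map u := fun u => by
    rw [← roots_multiset_prod_X_sub_C (Finset.univ.val.map u), Multiset.map_map]
    rfl
  rw [e, e, Fin.univ_val_map, Fin.univ_val_map, Multiset.coe_eq_coe] at h1
  have := h1.eq_of_pairwise' (r := (· ≥ ·)) ?_ ?_
  · exact List.ofFn_injective this
  · rw [← List.sortedGE_iff_pairwise]; exact hv.sortedGE_ofFn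
  · rw [← List.sortedGE_iff_pairwise]; exact hw.sortedGE_ofFn

variable {m : Type*} [Fintype m] [DecidableEq m]

lemma eigDesc_of_lt {A : Matrix m m ℝ} (hA : A.IsHermitian) {k : ℕ} (hk : k < Fintype.card m) :
    eigDesc A k = hA.eigenvalues₀ ⟨k, hk⟩ := by
  have h : A.IsHermitian ∧ k < Fintype.card m := ⟨hA, hk⟩
  rw [eigDesc, dif_pos h]

lemma eigDesc_antitone {A : Matrix m m ℝ} (hA : A.IsHermitian) {j k : ℕ} (hjk : j ≤ k)
    (hk : k < Fintype.card m) : eigDesc A k ≤ eigDesc A j := by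
  rw [eigDesc_of_lt hA hk, eigDesc_of_lt hA (hjk.trans_lt hk)]
  exact hA.eigenvalues₀_antitone hjk

lemma exists_eigDesc_diagonalization {A : Matrix m m ℝ} (hA : A.IsHermitian) :
    ∃ (U : Matrix m m ℝ) (σ : m ≃ Fin (Fintype.card m)), Uᵀ * U = 1 ∧ U * Uᵀ = 1 ∧
      A = U * diagonal (fun i => eigDesc A (σ i)) * Uᵀ := by
  refine ⟨hA.eigenvectorUnitary, (Fintype.equivOfCardEq (Fintype.card_fin _)).symm, ?_, ?_, ?_⟩
  · have := (Matrix.mem_unitaryGroup_iff' (A := (hA.eigenvectorUnitary : Matrix m m ℝ))).1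
      hA.eigenvectorUnitary.2
    rwa [star_eq_conjTranspose, conjTranspose_eq_transpose_of_trivial] at this
  · have := (Matrix.mem_unitaryGroup_iff (A := (hA.eigenvectorUnitary : Matrix m m ℝ))).1
      hA.eigenvectorUnitary.2
    rwa [star_eq_conjTranspose, conjTranspose_eq_transpose_of_trivial] at this
  · have := hA.spectral_theorem
    rw [Unitary.conjStarAlgAut_apply, star_eq_conjTranspose,
      conjTranspose_eq_transpose_of_trivial] at this
    conv_lhs => rw [this]
    congr 2
    ext i
    simp only [eigDesc_of_lt hA (Fin.is_lt _)]
    rfl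

/-- Any orthogonal diagonalization has the right characteristic polynomial, so once its entries are
listed in decreasing order they are the ordered eigenvalues. -/
lemma eigDesc_eq_of_diagonalization {U : Matrix m m ℝ} (hU : Uᵀ * U = 1)
    {f : Fin (Fintype.card m) → ℝ} (hf : Antitone f) (σ : m ≃ Fin (Fintype.card m))
    (k : Fin (Fintype.card m)) :
    eigDesc (U * diagonal (fun i => f (σ i)) * Uᵀ) k = f k := by
  have hH : (U * diagonal (fun i => f (σ i)) * Uᵀ).IsHermitian := by
    rw [Matrix.IsHermitian, conjTranspose_eq_transpose_of_trivial, transpose_mul, transpose_mul,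
      transpose_transpose, diagonal_transpose, Matrix.mul_assoc]
  have h1 := charpoly_conj_diagonal hU (fun i => f (σ i))
  have h2 := hH.charpoly_eq
  rw [eigDesc_of_lt hH k.2]
  refine congrFun (antitone_eq_of_prod_eq hH.eigenvalues₀_antitone hf ?_) k
  rw [← Equiv.prod_comp σ fun i => Polynomial.X - Polynomial.C (f i), ← h1, h2]
  exact (Equiv.prod_comp (Fintype.equivOfCardEq (Fintype.card_fin (Fintype.card m))).symm
    fun i => Polynomial.X - Polynomial.C (hH.eigenvalues₀ i)).symm

lemma eigDesc_smul {A : Matrix m m ℝ} (hA : A.IsHermitian) {c : ℝ} (hc : 0 ≤ c) {k : ℕ}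
    (hk : k < Fintype.card m) : eigDesc (c • A) k = c * eigDesc A k := by
  obtain ⟨U, σ, hU, -, hAU⟩ := exists_eigDesc_diagonalization hA
  have := eigDesc_eq_of_diagonalization hU
    (f := fun i : Fin (Fintype.card m) => c * eigDesc A i)
    (fun i j hij => mul_le_mul_of_nonneg_left (eigDesc_antitone hA hij j.2) hc) σ ⟨k, hk⟩
  have e : c • A = U * diagonal (fun i => c * eigDesc A (σ i)) * Uᵀ := by
    conv_lhs => rw [hAU]
    rw [show (fun i => c * eigDesc A (σ i)) = c • fun i => eigDesc A (σ i) from rfl,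
      diagonal_smul, Matrix.mul_smul, Matrix.smul_mul]
  rw [e]; exact this

/-- Lower bound for the leading eigenvalues by a test subspace. -/
lemma le_eigDesc_of_test_subspace {A : Matrix m m ℝ} (hA : A.IsHermitian) {r : ℕ}
    {M : Matrix m (Fin r) ℝ} {γ : ℝ} (hinj : ∀ c, M *ᵥ c = 0 → c = 0)
    (h : ∀ c, γ * ((M *ᵥ c) ⬝ᵥ (M *ᵥ c)) ≤ (M *ᵥ c) ⬝ᵥ (A *ᵥ (M *ᵥ c))) {k : ℕ} (hk : k < r)
    (hkm : k < Fintype.card m) : γ ≤ eigDesc A k := by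
  by_contra! hlt
  obtain ⟨U, σ, hU, hU', hAU⟩ := exists_eigDesc_diagonalization hA
  -- `g` records the components along the top `k` eigenvectors. As `k < r`, some nonzero vector of
  -- the test space is orthogonal to all of them, and on it the form is at most the eigenvalue with
  -- index `k`.
  set g : (Fin r → ℝ) →ₗ[ℝ] (Fin k → ℝ) :=
    LinearMap.pi fun j => (LinearMap.proj (σ.symm ⟨j, j.2.trans hkm⟩)).comp
      (Matrix.mulVecLin (Uᵀ * M)) with hg
  have hker : LinearMap.ker g ≠ ⊥ := LinearMap.ker_ne_bot_of_finrank_lt (by simpa using hk)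
  obtain ⟨c, hcker, hc⟩ := (Submodule.ne_bot_iff _).1 hker
  set x := M *ᵥ c with hx
  set z := Uᵀ *ᵥ x with hz
  have hz0 : ∀ i, (σ i : ℕ) < k → z i = 0 := by
    intro i hi
    have := congrFun (LinearMap.mem_ker.1 hcker) ⟨σ i, hi⟩
    simp only [hg, LinearMap.pi_apply, LinearMap.comp_apply, LinearMap.proj_apply,
      Matrix.mulVecLin_apply, Fin.eta, Equiv.symm_apply_apply, Pi.zero_apply] at this
    rw [← Matrix.mulVec_mulVec] at this
    exact this
  have e1 : x ⬝ᵥ x = z ⬝ᵥ z := by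
    rw [hz, Matrix.dotProduct_mulVec (Uᵀ *ᵥ x), ← Matrix.mulVec_transpose, transpose_transpose,
      Matrix.mulVec_mulVec, hU', Matrix.one_mulVec]
  have e2 : x ⬝ᵥ (A *ᵥ x) = ∑ i, eigDesc A (σ i) * (z i * z i) := by
    conv_lhs => rw [hAU]
    rw [← Matrix.mulVec_mulVec, ← Matrix.mulVec_mulVec, Matrix.dotProduct_mulVec,
      ← Matrix.mulVec_transpose, dotProduct]
    exact Finset.sum_congr rfl fun i _ => by rw [mulVec_diagonal]; ring
  have hxx : 0 < x ⬝ᵥ x := by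
    refine lt_of_le_of_ne (by rw [dotProduct]; exact Finset.sum_nonneg fun i _ => mul_self_nonneg _) ?_
    intro h0
    exact hc (hinj c (dotProduct_self_eq_zero.1 h0.symm))
  have e3 : ∑ i, eigDesc A (σ i) * (z i * z i) ≤ eigDesc A k * (z ⬝ᵥ z) := by
    rw [dotProduct, Finset.mul_sum]
    refine Finset.sum_le_sum fun i _ => ?_
    rcases lt_or_ge (σ i : ℕ) k with hi | hi
    · simp [hz0 i hi]
    · exact mul_le_mul_of_nonneg_right (eigDesc_antitone hA hi (σ i).2) (mul_self_nonneg _)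
  have := h c
  rw [← hx, e2] at this
  rw [← e1] at e3
  nlinarith

lemma IsTopEigenvectors.mul_eq {r : ℕ} {A : Matrix m m ℝ} {U : Matrix m (Fin r) ℝ}
    (h : IsTopEigenvectors A U) :
    A * U = U * diagonal (fun k : Fin r => eigDesc A k) := by
  ext i k
  have := congrFun (h.eigen k) i
  rw [mul_diagonal]
  simpa [Matrix.mul_apply, mulVec, dotProduct, mul_comm] using this

end OrderedEigenvalues

/-! ### Principal components of a perturbed low-rank matrix -/

section PrincipalComponents

open scoped Matrix.Norms.L2Operator

lemma norm_replicateCol_sq {m : Type*} [Fintype m] [DecidableEq m] (x : m → ℝ) :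
    ‖replicateCol Unit x‖ ^ 2 = x ⬝ᵥ x := by
  have h : replicateCol Unit x = (rowM (Matrix.of fun (_ : Unit) i => x i) ())ᵀ := rfl
  rw [h, l2_norm_transpose, norm_rowM_sq, dotProduct]
  exact Finset.sum_congr rfl fun i _ => by simp [sq]

/-- A test subspace on which a low-rank matrix is bounded below is still good for small
perturbations of that matrix. -/
lemma dotProduct_self_le_of_perturbation {m n : Type*} [Fintype m] [DecidableEq m] [Fintype n]
    [DecidableEq n] {r : ℕ} {Y G : Matrix m n ℝ} {M : Matrix n (Fin r) ℝ} {J : Matrix n m ℝ}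
    {j u : ℝ} (hJ : ‖J‖ ≤ j) (hu : ‖Y - G‖ ≤ u) (hju : j * u ≤ 1 / 2) (hJM : J * G * M = M)
    (c : Fin r → ℝ) :
    (M *ᵥ c) ⬝ᵥ (M *ᵥ c) ≤ 4 * j ^ 2 * ((Y *ᵥ (M *ᵥ c)) ⬝ᵥ (Y *ᵥ (M *ᵥ c))) := by
  set x := M *ᵥ c with hx
  -- `J` inverts `G` on the test space, so `x` is `J Y x` minus an error of norm at most half that
  -- of `x`.
  have e1 : replicateCol Unit x = J * (Y * replicateCol Unit x)
      - J * ((Y - G) * replicateCol Unit x) := by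
    have : J * (Y * replicateCol Unit x) - J * ((Y - G) * replicateCol Unit x)
        = J * G * replicateCol Unit x := by
      rw [Matrix.sub_mul, Matrix.mul_sub, Matrix.mul_assoc]; abel
    rw [this, hx, Matrix.replicateCol_mulVec, ← Matrix.mul_assoc, hJM]
  have hj0 : 0 ≤ j := (norm_nonneg _).trans hJ
  have h1 : ‖replicateCol Unit x‖ ≤ j * ‖Y * replicateCol Unit x‖
      + j * (u * ‖replicateCol Unit x‖) := by
    conv_lhs => rw [e1]
    refine (norm_sub_le _ _).trans (add_le_add ?_ ?_)
    · exact l2_norm_mul_le_of_le hJ le_rfl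
    · exact l2_norm_mul_le_of_le hJ (l2_norm_mul_le_of_le hu le_rfl)
  have h2 : ‖replicateCol Unit x‖ ≤ 2 * j * ‖Y * replicateCol Unit x‖ := by
    nlinarith [norm_nonneg (replicateCol Unit x)]
  have h3 := pow_le_pow_left₀ (norm_nonneg _) h2 2
  rw [mul_pow, ← Matrix.replicateCol_mulVec, norm_replicateCol_sq, norm_replicateCol_sq] at h3
  linarith

/-- On the range of `M` the matrix `Y` shrinks lengths by a factor of at most `2j`, and the weight
is bounded below by `w`; the range of `M` is then a test subspace. -/
lemma le_eigDesc_of_perturbation {m n : Type*} [Fintype m] [DecidableEq m] [Fintype n]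
    [DecidableEq n] {r : ℕ} {Y G : Matrix m n ℝ} {M : Matrix n (Fin r) ℝ} {J : Matrix n m ℝ}
    {W : Matrix m m ℝ} (hW : Wᵀ = W) {j u w : ℝ} (hj : 0 < j) (hJ : ‖J‖ ≤ j) (hu : ‖Y - G‖ ≤ u)
    (hju : j * u ≤ 1 / 2) (hJM : J * G * M = M) (hinj : ∀ c, M *ᵥ c = 0 → c = 0) (hw : 0 ≤ w)
    (hWw : ∀ x, w * (x ⬝ᵥ x) ≤ x ⬝ᵥ (W *ᵥ x)) {k : ℕ} (hk : k < r) (hkn : k < Fintype.card n) :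
    w / (4 * j ^ 2) ≤ eigDesc (Yᵀ * W * Y) k := by
  have hH : (Yᵀ * W * Y).IsHermitian := by
    rw [Matrix.IsHermitian, conjTranspose_eq_transpose_of_trivial, transpose_mul, transpose_mul,
      transpose_transpose, hW, Matrix.mul_assoc]
  refine le_eigDesc_of_test_subspace hH hinj (fun c => ?_) hk hkn
  have h1 := dotProduct_self_le_of_perturbation hJ hu hju hJM c
  have h2 := hWw (Y *ᵥ (M *ᵥ c))
  have e : (M *ᵥ c) ⬝ᵥ ((Yᵀ * W * Y) *ᵥ (M *ᵥ c))
      = (Y *ᵥ (M *ᵥ c)) ⬝ᵥ (W *ᵥ (Y *ᵥ (M *ᵥ c))) := by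
    rw [← Matrix.mulVec_mulVec, ← Matrix.mulVec_mulVec, Matrix.dotProduct_mulVec (M *ᵥ c) Yᵀ,
      ← Matrix.mulVec_transpose, transpose_transpose]
  rw [e]
  refine le_trans ?_ h2
  rw [div_mul_eq_mul_div, div_le_iff₀ (by positivity)]
  nlinarith

variable {N T r : ℕ}

/-- The columns of `Z` are orthonormal eigenvectors, with eigenvalues `v`, of `Y' W Y` for the
perturbed low-rank matrix `Y = L X' + U`; the constant `c` controls all norms. -/
structure IsApproxPC (c : ℝ) (L : Matrix (Fin N) (Fin r) ℝ) (X : Matrix (Fin T) (Fin r) ℝ)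
    (U : Matrix (Fin N) (Fin T) ℝ) (W : Matrix (Fin N) (Fin N) ℝ) (Z : Matrix (Fin T) (Fin r) ℝ)
    (v : Fin r → ℝ) : Prop where
  one_le : 1 ≤ c
  norm_L : ‖L‖ ≤ c
  norm_X : ‖X‖ ≤ c
  norm_U : ‖U‖ ≤ 1
  norm_W : ‖W‖ ≤ c
  symm : Wᵀ = W
  orth : Zᵀ * Z = 1
  eigen : (L * Xᵀ + U)ᵀ * W * (L * Xᵀ + U) * Z = Z * diagonal v
  val : ∀ k, 1 / c ≤ v k

/-- The rotation relating the estimated to the true factors. -/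
noncomputable def rotB (L : Matrix (Fin N) (Fin r) ℝ) (X : Matrix (Fin T) (Fin r) ℝ)
    (U : Matrix (Fin N) (Fin T) ℝ) (W : Matrix (Fin N) (Fin N) ℝ) (Z : Matrix (Fin T) (Fin r) ℝ)
    (v : Fin r → ℝ) : Matrix (Fin r) (Fin r) ℝ :=
  diagonal (fun k => (v k)⁻¹) * ((L * Xᵀ + U) * Z)ᵀ * W * L

/-- The error of the estimated factors. -/
noncomputable def pcErr (L : Matrix (Fin N) (Fin r) ℝ) (X : Matrix (Fin T) (Fin r) ℝ)
    (U : Matrix (Fin N) (Fin T) ℝ) (W : Matrix (Fin N) (Fin N) ℝ) (Z : Matrix (Fin T) (Fin r) ℝ)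
    (v : Fin r → ℝ) : Matrix (Fin T) (Fin r) ℝ :=
  Uᵀ * W * ((L * Xᵀ + U) * Z) * diagonal (fun k => (v k)⁻¹)

namespace IsApproxPC

variable {c : ℝ} {L : Matrix (Fin N) (Fin r) ℝ} {X : Matrix (Fin T) (Fin r) ℝ}
  {U : Matrix (Fin N) (Fin T) ℝ} {W : Matrix (Fin N) (Fin N) ℝ} {Z : Matrix (Fin T) (Fin r) ℝ}
  {v : Fin r → ℝ}

section

variable (h : IsApproxPC c L X U W Z v)
include h

lemma c_pos : 0 < c := one_pos.trans_le h.one_le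

lemma v_pos (k : Fin r) : 0 < v k := (by have := h.c_pos; positivity : 0 < 1 / c).trans_le (h.val k)

lemma diag_mul_inv : diagonal v * diagonal (fun k => (v k)⁻¹) = 1 := by
  rw [diagonal_mul_diagonal, ← diagonal_one]
  congr 1; ext k; exact mul_inv_cancel₀ (h.v_pos k).ne'

lemma norm_inv : ‖diagonal (fun k => (v k)⁻¹)‖ ≤ c := by
  rw [l2_opNorm_diagonal]
  refine (pi_norm_le_iff_of_nonneg h.c_pos.le).2 fun k => ?_
  rw [Real.norm_of_nonneg (inv_nonneg.2 (h.v_pos k).le)]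
  have := inv_anti₀ (by have := h.c_pos; positivity) (h.val k)
  simpa using this

lemma norm_Z : ‖Z‖ ≤ 1 := norm_le_one_of_orthonormal h.orth

lemma norm_H : ‖Zᵀ * X‖ ≤ c := by
  have := l2_norm_mul_le_of_le ((l2_norm_transpose Z).trans_le h.norm_Z) h.norm_X
  linarith

lemma norm_Y : ‖L * Xᵀ + U‖ ≤ 2 * c ^ 2 := by
  have h1 := l2_norm_mul_le_of_le h.norm_L ((l2_norm_transpose X).trans_le h.norm_X)
  have := norm_add_le (L * Xᵀ) U
  nlinarith [h.norm_U, h.one_le]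

lemma norm_YZ : ‖(L * Xᵀ + U) * Z‖ ≤ 2 * c ^ 2 := by
  have := l2_norm_mul_le_of_le h.norm_Y h.norm_Z
  linarith

lemma norm_B : ‖rotB L X U W Z v‖ ≤ 2 * c ^ 5 := by
  have := l2_norm_mul_le_of_le (l2_norm_mul_le_of_le (l2_norm_mul_le_of_le h.norm_inv
    ((l2_norm_transpose _).trans_le h.norm_YZ)) h.norm_W) h.norm_L
  exact this.trans (le_of_eq (by ring))

/-- The eigenvalue equation is solved for `Z`, and only the first of the two data matrices is split:
its signal part gives `X` times a rotation, its noise part is the error. -/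
lemma Z_eq : Z = X * (rotB L X U W Z v)ᵀ + pcErr L X U W Z v := by
  have h1 : (L * Xᵀ + U)ᵀ * W * ((L * Xᵀ + U) * Z) * diagonal (fun k => (v k)⁻¹) = Z := by
    rw [← Matrix.mul_assoc, h.eigen, Matrix.mul_assoc, h.diag_mul_inv, Matrix.mul_one]
  conv_lhs => rw [← h1]
  rw [rotB, pcErr, transpose_mul, transpose_mul, transpose_mul, transpose_transpose,
    diagonal_transpose, h.symm]
  simp only [transpose_add, transpose_mul, transpose_transpose, Matrix.add_mul, Matrix.mul_add,
    Matrix.mul_assoc]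
  abel

lemma pcErr_eq : pcErr L X U W Z v
    = (Uᵀ * W * L * (Zᵀ * X)ᵀ + Uᵀ * W * U * Z) * diagonal (fun k => (v k)⁻¹) := by
  rw [pcErr]
  simp only [transpose_mul, transpose_transpose, Matrix.add_mul, Matrix.mul_add, Matrix.mul_assoc]

/-- Splitting the second data matrix as well leaves only the cross term `U'WL` and a term quadratic
in `U`. The cross term is kept unexpanded because it can be much smaller than `‖U‖`. -/
lemma norm_pcErr : ‖pcErr L X U W Z v‖ ≤ c ^ 2 * (‖Uᵀ * W * L‖ + ‖U‖ ^ 2) := by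
  rw [h.pcErr_eq]
  have h1 : ‖Uᵀ * W * L * (Zᵀ * X)ᵀ‖ ≤ ‖Uᵀ * W * L‖ * c :=
    l2_norm_mul_le_of_le le_rfl ((l2_norm_transpose _).trans_le h.norm_H)
  have h2 : ‖Uᵀ * W * U * Z‖ ≤ ‖U‖ * c * ‖U‖ * 1 :=
    l2_norm_mul_le_of_le (l2_norm_mul_le_of_le (l2_norm_mul_le_of_le (l2_norm_transpose _).le
      h.norm_W) le_rfl) h.norm_Z
  have h3 := l2_norm_mul_le_of_le ((norm_add_le _ _).trans (add_le_add h1 h2)) h.norm_inv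
  exact h3.trans (le_of_eq (by ring))

/-- Multiply `Z = X Bᵀ + E` by `Zᵀ` and use orthonormality. -/
lemma norm_one_sub_HB : ‖1 - Zᵀ * X * (rotB L X U W Z v)ᵀ‖ ≤ ‖pcErr L X U W Z v‖ := by
  have e : 1 - Zᵀ * X * (rotB L X U W Z v)ᵀ = Zᵀ * pcErr L X U W Z v := by
    have h1 : Zᵀ * Z = Zᵀ * (X * (rotB L X U W Z v)ᵀ + pcErr L X U W Z v) := by
      rw [← h.Z_eq]
    rw [h.orth, Matrix.mul_add, ← Matrix.mul_assoc] at h1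
    rw [h1]; abel
  rw [e]
  have := l2_norm_mul_le_of_le ((l2_norm_transpose Z).trans_le h.norm_Z)
    (le_refl ‖pcErr L X U W Z v‖)
  linarith

/-- Rotation matrices are nearly inverse to each other, and the true factors are close to the
span of the estimated ones. -/
lemma rotation (hε : ‖pcErr L X U W Z v‖ ≤ 1 / 2) :
    IsUnit (Zᵀ * X).det ∧ ‖(Zᵀ * X)⁻¹‖ ≤ 4 * c ^ 5 ∧
    ‖(rotB L X U W Z v)ᵀ * (Zᵀ * X) - 1‖ ≤ 4 * c ^ 6 * ‖pcErr L X U W Z v‖ ∧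
    ‖X - Z * (Zᵀ * X)‖ ≤ 5 * c ^ 7 * ‖pcErr L X U W Z v‖ := by
  set H := Zᵀ * X with hH
  set B := rotB L X U W Z v with hB
  set E := pcErr L X U W Z v with hE
  have hc1 := h.one_le
  have hE0 := norm_nonneg E
  -- The product in this order is close to the identity; since the matrices are square, `H` is
  -- invertible, and conjugation by `H` handles the other order.
  have h1 : ‖H * Bᵀ - 1‖ ≤ ‖E‖ := by rw [norm_sub_rev]; exact h.norm_one_sub_HB
  obtain ⟨hu, hinv, -⟩ := inv_perturbation (A := (1 : Matrix (Fin r) (Fin r) ℝ)) (B := H * Bᵀ)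
    (c := 1) (d := ‖E‖) (by simp) (by rw [inv_one]; exact norm_one_le) h1 (by linarith)
  have hHu : IsUnit H.det := by
    rw [det_mul] at hu
    exact isUnit_of_mul_isUnit_left hu
  have hHi : H⁻¹ = Bᵀ * (H * Bᵀ)⁻¹ := by
    refine Matrix.inv_eq_right_inv ?_
    rw [← Matrix.mul_assoc, Matrix.mul_nonsing_inv _ hu]
  have hHn : ‖H⁻¹‖ ≤ 4 * c ^ 5 := by
    rw [hHi]
    refine (l2_norm_mul_le_of_le ((l2_norm_transpose _).trans_le h.norm_B) hinv).trans
      (le_of_eq (by ring))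
  have hBH : ‖Bᵀ * H - 1‖ ≤ 4 * c ^ 6 * ‖E‖ := by
    have e : Bᵀ * H - 1 = H⁻¹ * (H * Bᵀ - 1) * H := by
      rw [Matrix.mul_sub, ← Matrix.mul_assoc H⁻¹ H, Matrix.nonsing_inv_mul _ hHu, Matrix.one_mul,
        Matrix.mul_one, Matrix.sub_mul, Matrix.nonsing_inv_mul _ hHu]
    rw [e]
    refine (l2_norm_mul_le_of_le (l2_norm_mul_le_of_le hHn h1) h.norm_H).trans
      (le_of_eq (by ring))
  refine ⟨hHu, hHn, hBH, ?_⟩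
  -- Substituting `Z = X Bᵀ + E` reduces the distance of `X` from the span of `Z` to the two errors
  -- already bounded.
  have e : X - Z * H = -(X * (Bᵀ * H - 1)) - E * H := by
    conv_lhs => rw [h.Z_eq]
    rw [Matrix.add_mul, Matrix.mul_sub, Matrix.mul_one, Matrix.mul_assoc]
    abel
  rw [e]
  refine (norm_sub_le _ _).trans ?_
  rw [norm_neg]
  have a1 := l2_norm_mul_le_of_le h.norm_X hBH
  have a2 := l2_norm_mul_le_of_le (le_refl ‖E‖) h.norm_H
  have : c ≤ c ^ 7 := by simpa using pow_le_pow_right₀ hc1 (show 1 ≤ 7 by norm_num)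
  nlinarith

lemma norm_row_mul_Z (u : Matrix Unit (Fin T) ℝ) :
    ‖u * Z‖ ≤ 2 * c ^ 5 * ‖u * X‖ + ‖u * pcErr L X U W Z v‖ := by
  have e : u * Z = u * X * (rotB L X U W Z v)ᵀ + u * pcErr L X U W Z v := by
    conv_lhs => rw [h.Z_eq]
    rw [Matrix.mul_add, Matrix.mul_assoc]
  rw [e]
  refine (norm_add_le _ _).trans ?_
  have := l2_norm_mul_le_of_le (le_refl ‖u * X‖) ((l2_norm_transpose _).trans_le h.norm_B)
  linarith

end

/-- Residual of the projection on the estimated factors, minus the error term. -/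
noncomputable def residDiff (X Z : Matrix (Fin T) (Fin r) ℝ) (l : Matrix Unit (Fin r) ℝ)
    (u : Matrix Unit (Fin T) ℝ) : Matrix Unit (Fin T) ℝ :=
  l * (X - Z * (Zᵀ * X))ᵀ - u * Z * Zᵀ

lemma resid_eq (l : Matrix Unit (Fin r) ℝ) (u : Matrix Unit (Fin T) ℝ) :
    (l * Xᵀ + u) * (1 - Z * Zᵀ) = u + residDiff X Z l u := by
  simp only [residDiff, transpose_sub, transpose_mul, transpose_transpose, Matrix.mul_sub,
    Matrix.mul_one, Matrix.add_mul, Matrix.mul_assoc]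
  abel

lemma norm_residDiff (h : IsApproxPC c L X U W Z v) (l : Matrix Unit (Fin r) ℝ)
    (u : Matrix Unit (Fin T) ℝ) :
    ‖residDiff X Z l u‖ ≤ ‖l‖ * ‖X - Z * (Zᵀ * X)‖ + ‖u * Z‖ := by
  rw [residDiff]
  refine (norm_sub_le _ _).trans (add_le_add ?_ ?_)
  · exact l2_norm_mul_le_of_le le_rfl (l2_norm_transpose _).le
  · have := l2_norm_mul_le_of_le (le_refl ‖u * Z‖) ((l2_norm_transpose Z).trans_le h.norm_Z)
    linarith

/-- The pairing with `w` is carried out before taking norms: `w X` and `w Z` are small when `w` is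
nearly orthogonal to the factors, although `w` itself is not small. -/
lemma norm_residDiff_mul (h : IsApproxPC c L X U W Z v) (l : Matrix Unit (Fin r) ℝ)
    (u w : Matrix Unit (Fin T) ℝ) :
    ‖residDiff X Z l u * wᵀ‖ ≤ ‖l‖ * (‖w * X‖ + ‖w * Z‖ * c) + ‖u * Z‖ * ‖w * Z‖ := by
  have e : residDiff X Z l u * wᵀ = l * (w * X - w * Z * (Zᵀ * X))ᵀ - u * Z * (w * Z)ᵀ := by
    simp only [residDiff, transpose_sub, transpose_mul, transpose_transpose, Matrix.mul_sub,
      Matrix.sub_mul, Matrix.mul_assoc]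
  rw [e]
  refine (norm_sub_le _ _).trans (add_le_add ?_ ?_)
  · refine l2_norm_mul_le_of_le le_rfl ?_
    rw [l2_norm_transpose]
    exact (norm_sub_le _ _).trans (add_le_add le_rfl (l2_norm_mul_le_of_le le_rfl h.norm_H))
  · exact l2_norm_mul_le_of_le le_rfl (l2_norm_transpose _).le

/-- Entries of the residual covariance matrix. -/
lemma abs_resid_cov_sub_le (h : IsApproxPC c L X U W Z v) {l l' : Matrix Unit (Fin r) ℝ}
    {u u' : Matrix Unit (Fin T) ℝ} {a δ w : ℝ} (hl : ‖l‖ ≤ a) (hl' : ‖l'‖ ≤ a)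
    (hX : ‖X - Z * (Zᵀ * X)‖ ≤ δ) (huX : ‖u * X‖ ≤ w) (huX' : ‖u' * X‖ ≤ w) (huZ : ‖u * Z‖ ≤ w)
    (huZ' : ‖u' * Z‖ ≤ w) :
    |((l * Xᵀ + u) * (1 - Z * Zᵀ) * (l' * Xᵀ + u')ᵀ : Matrix Unit Unit ℝ) () ()
        - (u * u'ᵀ : Matrix Unit Unit ℝ) () ()|
      ≤ 2 * (a * (w + w * c) + w * w) + (a * δ + w) * (a * δ + w) := by
  have hQ : (1 - Z * Zᵀ) * (1 - Z * Zᵀ)ᵀ = 1 - Z * Zᵀ := by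
    simp only [transpose_sub, transpose_mul, transpose_transpose, transpose_one, Matrix.mul_sub,
      Matrix.sub_mul, Matrix.mul_one, Matrix.one_mul]
    rw [show Z * Zᵀ * (Z * Zᵀ) = Z * (Zᵀ * Z) * Zᵀ by simp only [Matrix.mul_assoc], h.orth,
      Matrix.mul_one]
    abel
  -- As `1 - Z Zᵀ` is an orthogonal projection, both sides can be projected. The two linear terms
  -- pair a residual difference with an error row; the last term is a product of two residual
  -- differences.
  have e : (l * Xᵀ + u) * (1 - Z * Zᵀ) * (l' * Xᵀ + u')ᵀ - u * u'ᵀ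
      = residDiff X Z l u * u'ᵀ + (residDiff X Z l' u' * uᵀ)ᵀ
        + residDiff X Z l u * (residDiff X Z l' u')ᵀ := by
    have : (l * Xᵀ + u) * (1 - Z * Zᵀ) * (l' * Xᵀ + u')ᵀ
        = ((l * Xᵀ + u) * (1 - Z * Zᵀ)) * ((l' * Xᵀ + u') * (1 - Z * Zᵀ))ᵀ := by
      conv_lhs => rw [← hQ]
      rw [transpose_mul (l' * Xᵀ + u')]
      simp only [Matrix.mul_assoc]
    rw [this, resid_eq, resid_eq]
    simp only [transpose_add, transpose_mul, transpose_transpose, Matrix.add_mul, Matrix.mul_add]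
    abel
  have ha : 0 ≤ a := (norm_nonneg _).trans hl
  have hw : 0 ≤ w := (norm_nonneg _).trans huX
  have hc := h.c_pos
  have b1 : ‖residDiff X Z l u * u'ᵀ‖ ≤ a * (w + w * c) + w * w :=
    (h.norm_residDiff_mul l u u').trans (by gcongr)
  have b2 : ‖residDiff X Z l' u' * uᵀ‖ ≤ a * (w + w * c) + w * w :=
    (h.norm_residDiff_mul l' u' u).trans (by gcongr)
  have b3 : ‖residDiff X Z l u‖ ≤ a * δ + w := (h.norm_residDiff l u).trans (by gcongr)
  have b4 : ‖residDiff X Z l' u'‖ ≤ a * δ + w := (h.norm_residDiff l' u').trans (by gcongr)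
  rw [← Matrix.sub_apply, e]
  refine (abs_entry_le _ _ _).trans ((norm_add_le _ _).trans (add_le_add ((norm_add_le _ _).trans ?_) ?_))
  · rw [l2_norm_transpose]; linarith
  · exact l2_norm_mul_le_of_le b3 ((l2_norm_transpose _).trans_le b4)

end IsApproxPC

end PrincipalComponents

/-! ### Probabilistic properties of the factor model -/

section Moments

variable {Ω : Type*} {mΩ : MeasurableSpace Ω} {P : Measure Ω} [IsProbabilityMeasure P]

/-- Moments of all orders of a variable with stretched exponential tails. -/
lemma exists_moment_bound {r b : ℝ} (hr : 0 < r) (hb : 0 < b) :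
    ∃ C : ℕ → ℝ, ∀ X : Ω → ℝ, Measurable X →
      (∀ s > 0, P.real {ω | s < |X ω|} ≤ Real.exp (-(s / b) ^ r)) →
      ∀ k, Integrable (fun ω => |X ω| ^ k) P ∧ ∫ ω, |X ω| ^ k ∂P ≤ C k := by
  set g : ℕ → ℝ → ℝ := fun k s => s ^ ((k : ℝ) - 1) * Real.exp (-(b ^ (-r)) * s ^ r) with hg
  -- The layer-cake formula for moments with the tail bound inserted. At `k = 0` the moment is the
  -- total mass, and the formula does not apply.
  refine ⟨fun k => if k = 0 then 1 else k * ∫ s in Set.Ioi 0, g k s, fun X hX ht k => ?_⟩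
  rcases Nat.eq_zero_or_pos k with rfl | hk
  · simp
  have hk' : (0 : ℝ) < k := by exact_mod_cast hk
  have hgi : IntegrableOn (g k) (Set.Ioi 0) :=
    integrableOn_rpow_mul_exp_neg_mul_rpow (by linarith) hr (by positivity)
  have hg0 : ∀ s ∈ Set.Ioi (0 : ℝ), 0 ≤ g k s := fun s hs => by
    have : (0 : ℝ) < s := hs
    positivity
  have h1 := lintegral_rpow_eq_lintegral_meas_lt_mul P (f := fun ω => |X ω|)
    (ae_of_all _ fun ω => abs_nonneg _) hX.abs.aemeasurable hk'
  have h2 : ∫⁻ t in Set.Ioi (0 : ℝ), P {a | t < |X a|} * ENNReal.ofReal (t ^ ((k : ℝ) - 1))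
      ≤ ∫⁻ t in Set.Ioi (0 : ℝ), ENNReal.ofReal (g k t) := by
    refine setLIntegral_mono' measurableSet_Ioi fun s hs => ?_
    have hs' : (0 : ℝ) < s := hs
    have e : Real.exp (-(s / b) ^ r) = Real.exp (-(b ^ (-r)) * s ^ r) := by
      rw [Real.div_rpow hs'.le hb.le, Real.rpow_neg hb.le]
      congr 1; ring
    have h3 := ht s hs'
    rw [e] at h3
    have e2 : g k s = Real.exp (-(b ^ (-r)) * s ^ r) * s ^ ((k : ℝ) - 1) := mul_comm _ _
    rw [e2, ENNReal.ofReal_mul (Real.exp_pos _).le]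
    gcongr
    rw [← ofReal_measureReal]
    exact ENNReal.ofReal_le_ofReal h3
  rw [← ofReal_integral_eq_lintegral_ofReal hgi
    ((ae_restrict_iff' measurableSet_Ioi).2 (ae_of_all _ hg0))] at h2
  have h3 : ∫⁻ ω, ENNReal.ofReal (|X ω| ^ k) ∂P
      ≤ ENNReal.ofReal (k * ∫ s in Set.Ioi 0, g k s) := by
    rw [ENNReal.ofReal_mul hk'.le]
    refine le_trans (le_of_eq ?_) (h1.trans_le (mul_le_mul_right h2 _))
    simp_rw [Real.rpow_natCast]
  have hint0 : 0 ≤ k * ∫ s in Set.Ioi 0, g k s :=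
    mul_nonneg hk'.le (setIntegral_nonneg measurableSet_Ioi hg0)
  have hi : Integrable (fun ω => |X ω| ^ k) P := by
    refine ⟨(hX.abs.pow_const k).aestronglyMeasurable, ?_⟩
    rw [hasFiniteIntegral_iff_ofReal (ae_of_all _ fun ω => by positivity)]
    exact h3.trans_lt ENNReal.ofReal_lt_top
  refine ⟨hi, ?_⟩
  simp only [hk.ne', if_false]
  rw [← ofReal_integral_eq_lintegral_ofReal hi (ae_of_all _ fun ω => by positivity)] at h3
  exact (ENNReal.ofReal_le_ofReal_iff hint0).1 h3

/-- Moment bounds for centred products. -/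
lemma moment_mul_sub {X Y : Ω → ℝ} {C : ℕ → ℝ} {e D : ℝ} (hX : Measurable X) (hY : Measurable Y)
    (hXC : ∀ k, Integrable (fun ω => |X ω| ^ k) P ∧ ∫ ω, |X ω| ^ k ∂P ≤ C k)
    (hYC : ∀ k, Integrable (fun ω => |Y ω| ^ k) P ∧ ∫ ω, |Y ω| ^ k ∂P ≤ C k) (he : |e| ≤ D) (k : ℕ) :
    Integrable (fun ω => |X ω * Y ω - e| ^ k) P ∧
      ∫ ω, |X ω * Y ω - e| ^ k ∂P ≤ 2 ^ (k - 1) * (2 * C (2 * k) + D ^ k) := by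
  have hpt : ∀ ω, |X ω * Y ω - e| ^ k
      ≤ 2 ^ (k - 1) * (|X ω| ^ (2 * k) + |Y ω| ^ (2 * k) + D ^ k) := by
    intro ω
    have h1 : |X ω * Y ω - e| ≤ |X ω * Y ω| + |e| := abs_sub _ _
    refine (pow_le_pow_left₀ (abs_nonneg _) h1 k).trans
      ((add_pow_le (abs_nonneg _) (abs_nonneg _) k).trans ?_)
    gcongr
    rw [abs_mul, mul_pow, pow_mul', pow_mul']
    nlinarith [sq_nonneg (|X ω| ^ k - |Y ω| ^ k), sq_nonneg (|X ω| ^ k), sq_nonneg (|Y ω| ^ k)]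
  have hi : Integrable (fun ω => 2 ^ (k - 1) * (|X ω| ^ (2 * k) + |Y ω| ^ (2 * k) + D ^ k)) P :=
    ((((hXC (2 * k)).1.add (hYC (2 * k)).1).add (integrable_const (D ^ k))).const_mul _)
  have hm : Measurable fun ω => |X ω * Y ω - e| ^ k :=
    (((hX.mul hY).sub_const e).abs.pow_const k)
  have hi' : Integrable (fun ω => |X ω * Y ω - e| ^ k) P :=
    hi.mono' hm.aestronglyMeasurable (ae_of_all _ fun ω => by
      rw [Real.norm_of_nonneg (by positivity)]; exact hpt ω)
  refine ⟨hi', (integral_mono hi' hi hpt).trans ?_⟩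
  have e1 := integral_add ((hXC (2 * k)).1.add (hYC (2 * k)).1) (integrable_const (μ := P) (D ^ k))
  have e2 := integral_add (hXC (2 * k)).1 (hYC (2 * k)).1
  simp only [Pi.add_apply] at e1
  rw [integral_const_mul, e1, e2]
  gcongr
  · linarith [(hXC (2 * k)).2, (hYC (2 * k)).2]
  · simp

end Moments

namespace FactorModel

variable {r : ℕ} {Ω : Type*} [mΩ : MeasurableSpace Ω] {P : Measure Ω} [IsProbabilityMeasure P]
  {M : FactorModel r Ω}

/-- The `σ`-algebra generated by the states up to time `n`. -/
@[reducible] def pastUpTo (M : FactorModel r Ω) (n : ℕ) : MeasurableSpace Ω :=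
  ⨆ t : {t : ℤ // t ≤ n}, MeasurableSpace.comap (M.state t) inferInstance

/-- The path of the process, shifted by `h`. -/
def path (M : FactorModel r Ω) (h : ℤ) (ω : Ω) : ℤ → (Fin r → ℝ) × (ℕ → ℝ) :=
  fun t => M.state (t + h) ω

namespace Regular

variable (hM : M.Regular P)
include hM

lemma measurable_state (t : ℤ) : Measurable (M.state t) :=
  (measurable_pi_lambda _ fun k => hM.measurable_f k t).prodMk
    (measurable_pi_lambda _ fun i => hM.measurable_u i t)

lemma measurable_path (h : ℤ) : Measurable (M.path h) :=
  measurable_pi_lambda _ fun _ => hM.measurable_state _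

lemma map_path (h : ℤ) : P.map (M.path h) = P.map (M.path 0) := by
  have := hM.stationary h
  have e : M.path 0 = fun ω (t : ℤ) => M.state t ω := by
    ext1 ω; ext1 t; simp [path]
  rw [e]; exact this

lemma integral_path (h : ℤ) {g : (ℤ → (Fin r → ℝ) × (ℕ → ℝ)) → ℝ} (hg : Measurable g) :
    ∫ ω, g (M.path h ω) ∂P = ∫ ω, g (M.path 0 ω) ∂P := by
  rw [← integral_map (hM.measurable_path h).aemeasurable hg.aestronglyMeasurable, hM.map_path h,
    integral_map (hM.measurable_path 0).aemeasurable hg.aestronglyMeasurable]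

lemma real_path_preimage (h : ℤ) {s : Set (ℤ → (Fin r → ℝ) × (ℕ → ℝ))} (hs : MeasurableSet s) :
    P.real (M.path h ⁻¹' s) = P.real (M.path 0 ⁻¹' s) := by
  rw [← map_measureReal_apply (hM.measurable_path h) hs, hM.map_path h,
    map_measureReal_apply (hM.measurable_path 0) hs]

omit hM [IsProbabilityMeasure P] in
lemma pastUpTo_eq_comap (n : ℕ) : M.pastUpTo n = MeasurableSpace.comap (M.path n)
    (⨆ t : {t : ℤ // t ≤ 0}, MeasurableSpace.comap (fun p => p t.1) inferInstance) := by
  rw [MeasurableSpace.comap_iSup]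
  simp_rw [MeasurableSpace.comap_comp]
  refine le_antisymm (iSup_le fun t => ?_) (iSup_le fun t => ?_)
  · refine le_trans (le_of_eq ?_) (le_iSup _ ⟨t.1 - n, by have := t.2; omega⟩)
    congr 1
    ext1 ω; simp [path]
  · exact le_iSup (fun t : {t : ℤ // t ≤ n} => MeasurableSpace.comap (M.state t) inferInstance)
      ⟨t.1 + n, by have := t.2; omega⟩

omit hM [IsProbabilityMeasure P] in
lemma future_eq_comap (n k : ℕ) : M.future ((n + k : ℕ) : ℤ) = MeasurableSpace.comap (M.path n)
    (⨆ t : {t : ℤ // (k : ℤ) ≤ t}, MeasurableSpace.comap (fun p => p t.1) inferInstance) := by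
  rw [MeasurableSpace.comap_iSup]
  simp_rw [MeasurableSpace.comap_comp]
  refine le_antisymm (iSup_le fun t => ?_) (iSup_le fun t => ?_)
  · refine le_trans (le_of_eq ?_) (le_iSup _ ⟨t.1 - n, by have := t.2; push_cast at this; omega⟩)
    congr 1
    ext1 ω; simp [path]
  · exact le_iSup (fun t : {t : ℤ // ((n + k : ℕ) : ℤ) ≤ t} =>
      MeasurableSpace.comap (M.state t) inferInstance) ⟨t.1 + n, by have := t.2; push_cast; omega⟩

/-- Mixing is assumed at time zero only. Events before `n` and after `n + k` are preimages under the
path shifted by `n` of events around time zero, and by stationarity the shifted path has the same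
law. -/
lemma isMixing : ∃ ρ > 0, ∃ c > 0,
    IsMixing P M.pastUpTo (fun n => M.future (n : ℤ)) (expRate c ρ) := by
  obtain ⟨ρ, hρ, c, hc, hmix⟩ := hM.mixing
  refine ⟨ρ, hρ, c, hc, ⟨fun n => ?_, fun n => ?_, fun a b hab => ?_, fun a b hab => ?_, ?_⟩⟩
  · exact iSup_le fun t => (hM.measurable_state t).comap_le
  · exact iSup_le fun t => (hM.measurable_state t).comap_le
  · exact iSup_le fun t => le_iSup (fun t : {t : ℤ // t ≤ b} =>
      MeasurableSpace.comap (M.state t) inferInstance) ⟨t.1, t.2.trans (by exact_mod_cast hab)⟩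
  · exact iSup_le fun t => le_iSup (fun t : {t : ℤ // (a : ℤ) ≤ t} =>
      MeasurableSpace.comap (M.state t) inferInstance)
        ⟨t.1, le_trans (by exact_mod_cast hab) t.2⟩
  · intro n k hk A B hA hB
    rw [pastUpTo_eq_comap] at hA
    rw [future_eq_comap] at hB
    obtain ⟨A', hA', rfl⟩ := hA
    obtain ⟨B', hB', rfl⟩ := hB
    have le1 : (⨆ t : {t : ℤ // t ≤ 0}, MeasurableSpace.comap
        (fun p : ℤ → (Fin r → ℝ) × (ℕ → ℝ) => p t.1) inferInstance) ≤ MeasurableSpace.pi :=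
      iSup_le fun t => (measurable_pi_apply _).comap_le
    have le2 : (⨆ t : {t : ℤ // (k : ℤ) ≤ t}, MeasurableSpace.comap
        (fun p : ℤ → (Fin r → ℝ) × (ℕ → ℝ) => p t.1) inferInstance) ≤ MeasurableSpace.pi :=
      iSup_le fun t => (measurable_pi_apply _).comap_le
    have mA := le1 _ hA'
    have mB := le2 _ hB'
    have hA0 : MeasurableSet[M.past] (M.path 0 ⁻¹' A') := by
      have e := pastUpTo_eq_comap (M := M) 0
      have : MeasurableSet[M.pastUpTo 0] (M.path 0 ⁻¹' A') := by rw [e]; exact ⟨A', hA', rfl⟩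
      exact this
    have hB0 : MeasurableSet[M.future k] (M.path 0 ⁻¹' B') := by
      have e := future_eq_comap (M := M) 0 k
      rw [zero_add] at e
      rw [e]; exact ⟨B', hB', rfl⟩
    have := hmix k hk _ _ hA0 hB0
    rw [← Set.preimage_inter, hM.real_path_preimage n mA, hM.real_path_preimage n mB,
      hM.real_path_preimage n (mA.inter mB)]
    exact this

omit hM [IsProbabilityMeasure P] in
lemma measurable_state_past {t : ℤ} {n : ℕ} (h : t ≤ n) : Measurable[M.pastUpTo n] (M.state t) :=
  Measurable.of_comap_le (le_iSup (fun t : {t : ℤ // t ≤ n} =>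
    MeasurableSpace.comap (M.state t) inferInstance) ⟨t, h⟩)

omit hM [IsProbabilityMeasure P] in
lemma measurable_state_future {t : ℤ} {n : ℤ} (h : n ≤ t) : Measurable[M.future n] (M.state t) :=
  Measurable.of_comap_le (le_iSup (fun t : {t : ℤ // n ≤ t} =>
    MeasurableSpace.comap (M.state t) inferInstance) ⟨t, h⟩)

omit hM [IsProbabilityMeasure P] in
lemma measurable_f_of_state {𝓜 : MeasurableSpace Ω} {t : ℤ} (h : Measurable[𝓜] (M.state t))
    (k : Fin r) : Measurable[𝓜] (M.f k t) :=
  ((measurable_pi_apply k).comp measurable_fst).comp h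

omit hM [IsProbabilityMeasure P] in
lemma measurable_u_of_state {𝓜 : MeasurableSpace Ω} {t : ℤ} (h : Measurable[𝓜] (M.state t))
    (i : ℕ) : Measurable[𝓜] (M.u i t) :=
  ((measurable_pi_apply i).comp measurable_snd).comp h

/-- Uniform moment bounds. -/
lemma exists_moments : ∃ C : ℕ → ℝ,
    (∀ i t k, Integrable (fun ω => |M.u i t ω| ^ k) P ∧ ∫ ω, |M.u i t ω| ^ k ∂P ≤ C k) ∧
    (∀ l t k, Integrable (fun ω => |M.f l t ω| ^ k) P ∧ ∫ ω, |M.f l t ω| ^ k ∂P ≤ C k) := by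
  obtain ⟨r₁, hr₁, r₂, hr₂, b₁, hb₁, b₂, hb₂, hu, hf⟩ := hM.tails
  obtain ⟨C₁, h₁⟩ := exists_moment_bound (P := P) hr₁ hb₁
  obtain ⟨C₂, h₂⟩ := exists_moment_bound (P := P) hr₂ hb₂
  refine ⟨fun k => max (C₁ k) (C₂ k), fun i t k => ?_, fun l t k => ?_⟩
  · have := h₁ (M.u i t) (hM.measurable_u i t) (hu i t) k
    exact ⟨this.1, this.2.trans (le_max_left _ _)⟩
  · have := h₂ (M.f l t) (hM.measurable_f l t) (hf l t) k
    exact ⟨this.1, this.2.trans (le_max_right _ _)⟩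

lemma memLp_u (i : ℕ) (t : ℤ) : MemLp (M.u i t) 2 P := by
  obtain ⟨C, h, -⟩ := hM.exists_moments
  have := (h i t 2).1
  simp only [sq_abs] at this
  exact (memLp_two_iff_integrable_sq (hM.measurable_u i t).aestronglyMeasurable).2 this

lemma memLp_f (k : Fin r) (t : ℤ) : MemLp (M.f k t) 2 P := by
  obtain ⟨C, -, h⟩ := hM.exists_moments
  have := (h k t 2).1
  simp only [sq_abs] at this
  exact (memLp_two_iff_integrable_sq (hM.measurable_f k t).aestronglyMeasurable).2 this

lemma sigmaU_eq {N : ℕ} (i j : Fin N) (t : ℤ) :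
    M.SigmaU P N i j = ∫ ω, M.u i t ω * M.u j t ω ∂P := by
  have h1 : M.SigmaU P N i j = ∫ ω, M.u i 0 ω * M.u j 0 ω ∂P := by
    simp only [SigmaU, Matrix.of_apply]
    rw [covariance_eq_sub (hM.memLp_u i 0) (hM.memLp_u j 0), hM.mean_u, hM.mean_u]
    simp
  have h2 := hM.integral_path t (g := fun p => (p 0).2 i * (p 0).2 j) (by fun_prop)
  simp only [path, state, zero_add] at h2
  rw [h1, ← h2]

lemma sigmaF_eq (k l : Fin r) (t : ℤ) :
    M.SigmaF P k l = ∫ ω, M.f k t ω * M.f l t ω ∂P := by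
  have h1 : M.SigmaF P k l = ∫ ω, M.f k 0 ω * M.f l 0 ω ∂P := by
    simp only [SigmaF, Matrix.of_apply]
    rw [covariance_eq_sub (hM.memLp_f k 0) (hM.memLp_f l 0), hM.mean_f, hM.mean_f]
    simp
  have h2 := hM.integral_path t (g := fun p => (p 0).1 k * (p 0).1 l) (by fun_prop)
  simp only [path, state, zero_add] at h2
  rw [h1, ← h2]

end Regular

end FactorModel

/-- Both sample sizes tend to infinity and are polynomially related. -/
structure PolyGrowth (N T : ℕ → ℕ) : Prop where
  tendsto_N : Tendsto N atTop atTop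
  tendsto_T : Tendsto T atTop atTop
  N_le : ∀ᶠ n in atTop, N n ≤ T n ^ 2
  T_le : ∀ᶠ n in atTop, T n ≤ N n ^ 2

/-- The rate `√(log N / T)`. -/
noncomputable def logRate (N T : ℕ) : ℝ := √(Real.log N / T)

/-! ### Union bounds over polynomially many variables. -/

section Families

variable {Ω : Type*} {mΩ : MeasurableSpace Ω} {P : Measure Ω} [IsProbabilityMeasure P]

/-- Simultaneous moderate deviations of polynomially many mixing sequences. -/
lemma IsMixing.exists_uniform_deviation {ℱ 𝓖 : ℕ → MeasurableSpace Ω} {c r : ℝ} (hc : 0 < c)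
    (hr : 0 < r) (h : IsMixing P ℱ 𝓖 (expRate c r)) (C : ℕ → ℝ) :
    ∃ κ > 0, ∀ (N T : ℕ → ℕ), PolyGrowth N T → ∀ (ι : Type) (X : ι → ℕ → Ω → ℝ),
      (∀ a t, Measurable[ℱ t] (X a t)) → (∀ a t, Measurable[𝓖 t] (X a t)) →
      (∀ a t, ∫ ω, X a t ω ∂P = 0) → (∀ a k t, Integrable (fun ω => |X a t ω| ^ k) P) →
      (∀ a k t, ∫ ω, |X a t ω| ^ k ∂P ≤ C k) →
      ∀ (I : ℕ → Finset ι) (D : ℝ), (∀ᶠ n in atTop, ((I n).card : ℝ) ≤ D * (T n : ℝ) ^ 4) →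
      ∀ᶠ x in whp P, ∀ a ∈ I x.1,
        |1 / (T x.1 : ℝ) * ∑ t ∈ Finset.range (T x.1), X a t x.2| ≤ κ * logRate (N x.1) (T x.1) := by
  -- The exponent 5 beats a union over at most `D T^4` sequences and leaves `D / T`.
  obtain ⟨κ, hκ, hdev⟩ := h.moderate_deviation hc hr C 5
  refine ⟨κ * √2, by positivity, fun N T hNT ι X hP hG h0 hi hC I D hI => ?_⟩
  refine eventually_whp_of_real_le (a := fun n => D / (T n : ℝ))
    (q := fun n ω => ∀ a ∈ I n, |1 / (T n : ℝ) * ∑ t ∈ Finset.range (T n), X a t ω|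
      ≤ κ * √2 * logRate (N n) (T n)) ?_ ?_
  · exact tendsto_const_nhds.div_atTop (tendsto_natCast_atTop_atTop.comp hNT.tendsto_T)
  filter_upwards [hNT.tendsto_T.eventually hdev, hI, hNT.T_le, hNT.tendsto_T.eventually_ge_atTop 2,
    hNT.tendsto_N.eventually_ge_atTop 2] with n hn hcard hTN hT2 hN2
  have hT0 : (0 : ℝ) < T n := by exact_mod_cast (by omega : 0 < T n)
  have hN0 : (0 : ℝ) < N n := by exact_mod_cast (by omega : 0 < N n)
  -- The deviation bound is in terms of `log T`; polynomial growth converts it to `log N` at the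
  -- price of the factor `√2`.
  have hlog : Real.log (T n) ≤ 2 * Real.log (N n) := by
    have h1 : (T n : ℝ) ≤ (N n : ℝ) ^ 2 := by exact_mod_cast hTN
    have := Real.log_le_log hT0 h1
    rwa [Real.log_pow, Nat.cast_ofNat] at this
  have hsub : {ω | ¬ ∀ a ∈ I n, |1 / (T n : ℝ) * ∑ t ∈ Finset.range (T n), X a t ω|
      ≤ κ * √2 * logRate (N n) (T n)} ⊆ ⋃ a ∈ I n,
      {ω | κ * √(T n * Real.log (T n)) < |∑ t ∈ Finset.range (T n), X a t ω|} := by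
    intro ω hω
    simp only [Set.mem_ofPred_eq, not_forall, not_le] at hω
    obtain ⟨a, ha, hlt⟩ := hω
    simp only [Set.mem_iUnion]
    refine ⟨a, ha, ?_⟩
    simp only [Set.mem_ofPred_eq]
    rw [abs_mul, abs_of_pos (by positivity), one_div_mul_eq_div, lt_div_iff₀ hT0] at hlt
    refine lt_of_le_of_lt ?_ hlt
    have e1 : √2 * logRate (N n) (T n) * T n = √(T n * (2 * Real.log (N n))) := by
      have : (T n : ℝ) = √((T n : ℝ) ^ 2) := (Real.sqrt_sq hT0.le).symm
      have hl : 0 ≤ Real.log (N n) := Real.log_natCast_nonneg _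
      rw [logRate]
      nth_rewrite 2 [this]
      rw [← Real.sqrt_mul (by norm_num), ← Real.sqrt_mul (by positivity)]
      congr 1
      field_simp
    rw [mul_assoc, mul_assoc, ← mul_assoc (√2), e1]
    gcongr
  refine (measureReal_mono hsub (measure_ne_top _ _)).trans ((measureReal_biUnion_finset_le _ _).trans ?_)
  calc _ ≤ ∑ a ∈ I n, 1 / (T n : ℝ) ^ 5 :=
        Finset.sum_le_sum fun a _ => hn (X a) (hP a) (hG a) (h0 a) (hi a) (hC a)
    _ = (I n).card / (T n : ℝ) ^ 5 := by simp [div_eq_mul_inv]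
    _ ≤ D * (T n : ℝ) ^ 4 / (T n : ℝ) ^ 5 := by gcongr
    _ = D / T n := by field_simp

/-- Simultaneous bounds for polynomially many variables with bounded moments. -/
lemma eventually_whp_abs_le_rpow {C : ℕ → ℝ} {m : ℕ → ℕ} (hm : Tendsto m atTop atTop)
    {ι : Type} {X : ι → Ω → ℝ}
    (hX : ∀ a k, Integrable (fun ω => |X a ω| ^ k) P ∧ ∫ ω, |X a ω| ^ k ∂P ≤ C k)
    {I : ℕ → Finset ι} {D : ℝ} (hI : ∀ᶠ n in atTop, ((I n).card : ℝ) ≤ D * (m n : ℝ) ^ 4) :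
    ∀ᶠ x in whp P, ∀ a ∈ I x.1, |X a x.2| ≤ (m x.1 : ℝ) ^ (1 / 40 : ℝ) := by
  -- The moment of order 200 suffices because `(m^(1/40))^200 = m^5`, which beats a union over `D
  -- m^4` variables.
  refine eventually_whp_of_real_le (a := fun n => D * |C 200| / (m n : ℝ))
    (q := fun n ω => ∀ a ∈ I n, |X a ω| ≤ (m n : ℝ) ^ (1 / 40 : ℝ)) ?_ ?_
  · exact tendsto_const_nhds.div_atTop (tendsto_natCast_atTop_atTop.comp hm)
  filter_upwards [hI, hm.eventually_ge_atTop 1] with n hcard hm1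
  have hm0 : (0 : ℝ) < m n := by exact_mod_cast (by omega : 0 < m n)
  have hsub : {ω | ¬ ∀ a ∈ I n, |X a ω| ≤ (m n : ℝ) ^ (1 / 40 : ℝ)} ⊆
      ⋃ a ∈ I n, {ω | (m n : ℝ) ^ 5 ≤ |X a ω| ^ 200} := by
    intro ω hω
    simp only [Set.mem_ofPred_eq, not_forall, not_le] at hω
    obtain ⟨a, ha, hlt⟩ := hω
    simp only [Set.mem_iUnion]
    refine ⟨a, ha, ?_⟩
    have e : (m n : ℝ) ^ 5 = ((m n : ℝ) ^ (1 / 40 : ℝ)) ^ 200 := by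
      rw [← Real.rpow_natCast ((m n : ℝ) ^ (1 / 40 : ℝ)), ← Real.rpow_mul hm0.le]
      norm_num
    simp only [Set.mem_ofPred_eq]
    rw [e]
    exact pow_le_pow_left₀ (by positivity) hlt.le _
  have htail : ∀ a, P.real {ω | (m n : ℝ) ^ 5 ≤ |X a ω| ^ 200} ≤ |C 200| / (m n : ℝ) ^ 5 := fun a => by
    rw [le_div_iff₀ (by positivity), mul_comm]
    exact (mul_meas_ge_le_integral_of_nonneg (ae_of_all P fun ω => by positivity)
      (hX a 200).1 _).trans ((hX a 200).2.trans (le_abs_self _))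
  refine (measureReal_mono hsub (measure_ne_top _ _)).trans ((measureReal_biUnion_finset_le _ _).trans ?_)
  calc _ ≤ ∑ a ∈ I n, |C 200| / (m n : ℝ) ^ 5 := Finset.sum_le_sum fun a _ => htail a
    _ = (I n).card * |C 200| / (m n : ℝ) ^ 5 := by simp [div_eq_mul_inv, mul_assoc]
    _ ≤ D * (m n : ℝ) ^ 4 * |C 200| / (m n : ℝ) ^ 5 := by gcongr
    _ = D * |C 200| / m n := by field_simp

end Families

/-! ### Uniform bounds for sample moments and for the components of the process. -/

namespace FactorModel

variable {r : ℕ} {Ω : Type*} [mΩ : MeasurableSpace Ω] {P : Measure Ω} [IsProbabilityMeasure P]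
  {M : FactorModel r Ω}

/-- All components of the process: the idiosyncratic ones and the factors. -/
def comp (M : FactorModel r Ω) : ℕ ⊕ Fin r → ℤ → Ω → ℝ := Sum.elim M.u M.f

/-- The indices of the components in a sample of `N` units. -/
def compIndex (r N : ℕ) : Finset (ℕ ⊕ Fin r) := (Finset.range N).disjSum Finset.univ

lemma card_compIndex (r N : ℕ) : (compIndex r N).card = N + r := by
  simp [compIndex, Finset.card_disjSum]

lemma inl_mem_compIndex {i N : ℕ} : (Sum.inl i : ℕ ⊕ Fin r) ∈ compIndex r N ↔ i < N := by
  simp [compIndex]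

lemma inr_mem_compIndex {N : ℕ} (k : Fin r) : (Sum.inr k : ℕ ⊕ Fin r) ∈ compIndex r N := by
  simp [compIndex]

namespace Regular

variable (hM : M.Regular P)
include hM

lemma measurable_comp (a : ℕ ⊕ Fin r) (t : ℤ) : Measurable (M.comp a t) := by
  cases a with
  | inl i => exact hM.measurable_u i t
  | inr k => exact hM.measurable_f k t

omit hM [IsProbabilityMeasure P] in
lemma measurable_comp_of_state {𝓜 : MeasurableSpace Ω} {t : ℤ} (h : Measurable[𝓜] (M.state t))
    (a : ℕ ⊕ Fin r) : Measurable[𝓜] (M.comp a t) := by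
  cases a with
  | inl i => exact measurable_u_of_state h i
  | inr k => exact measurable_f_of_state h k

lemma exists_moments_comp : ∃ C : ℕ → ℝ, ∀ a t k,
    Integrable (fun ω => |M.comp a t ω| ^ k) P ∧ ∫ ω, |M.comp a t ω| ^ k ∂P ≤ C k := by
  obtain ⟨C, hu, hf⟩ := hM.exists_moments
  refine ⟨C, fun a t k => ?_⟩
  cases a with
  | inl i => exact hu i t k
  | inr l => exact hf l t k

lemma integral_comp_mul (a b : ℕ ⊕ Fin r) (t : ℤ) :
    ∫ ω, M.comp a t ω * M.comp b t ω ∂P = ∫ ω, M.comp a 0 ω * M.comp b 0 ω ∂P := by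
  have key : ∀ a : ℕ ⊕ Fin r, ∃ g : (Fin r → ℝ) × (ℕ → ℝ) → ℝ, Measurable g ∧
      ∀ t ω, M.comp a t ω = g (M.state t ω) := by
    rintro (i | k)
    · exact ⟨fun p => p.2 i, by fun_prop, fun t ω => rfl⟩
    · exact ⟨fun p => p.1 k, by fun_prop, fun t ω => rfl⟩
  obtain ⟨g, hg, hga⟩ := key a
  obtain ⟨g', hg', hgb⟩ := key b
  have := hM.integral_path t (g := fun p => g (p 0) * g' (p 0))
    ((hg.comp (measurable_pi_apply 0)).mul (hg'.comp (measurable_pi_apply 0)))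
  simp only [path, zero_add] at this
  simp only [hga, hgb, this]

/-- Sample second moments of all components converge uniformly at the rate `√(log N / T)`. -/
lemma exists_sample_moment_deviation : ∃ κ > 0, ∀ N T : ℕ → ℕ, PolyGrowth N T →
    ∀ᶠ x in whp P, ∀ a ∈ compIndex r (N x.1), ∀ b ∈ compIndex r (N x.1),
      |1 / (T x.1 : ℝ) * ∑ t ∈ Finset.range (T x.1), (M.comp a t x.2 * M.comp b t x.2
        - ∫ ω, M.comp a 0 ω * M.comp b 0 ω ∂P)| ≤ κ * logRate (N x.1) (T x.1) := by
  obtain ⟨ρ, hρ, c, hc, hmix⟩ := hM.isMixing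
  obtain ⟨C, hC⟩ := hM.exists_moments_comp
  have hbound : ∀ a b, |∫ ω, M.comp a 0 ω * M.comp b 0 ω ∂P| ≤ C 2 := by
    intro a b
    refine abs_integral_le_integral_abs.trans ?_
    have hi := ((hC a 0 2).1.add (hC b 0 2).1).div_const 2
    have h2 : ∫ ω, |M.comp a 0 ω * M.comp b 0 ω| ∂P
        ≤ ∫ ω, (|M.comp a 0 ω| ^ 2 + |M.comp b 0 ω| ^ 2) / 2 ∂P := by
      refine integral_mono_of_nonneg (ae_of_all _ fun ω => abs_nonneg _) hi (ae_of_all _ fun ω => ?_)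
      simp only [abs_mul]
      nlinarith [sq_nonneg (|M.comp a 0 ω| - |M.comp b 0 ω|)]
    rw [integral_div, integral_add (hC a 0 2).1 (hC b 0 2).1] at h2
    linarith [(hC a 0 2).2, (hC b 0 2).2]
  obtain ⟨κ, hκ, h⟩ := hmix.exists_uniform_deviation hc hρ
    (fun k => 2 ^ (k - 1) * (2 * C (2 * k) + C 2 ^ k))
  refine ⟨κ, hκ, fun N T hNT => ?_⟩
  have hmom := fun (p : (ℕ ⊕ Fin r) × (ℕ ⊕ Fin r)) (k : ℕ) (t : ℕ) =>
    moment_mul_sub (hM.measurable_comp p.1 t) (hM.measurable_comp p.2 t) (hC p.1 t) (hC p.2 t)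
      (hbound p.1 p.2) k
  have := h N T hNT ((ℕ ⊕ Fin r) × (ℕ ⊕ Fin r)) (fun p t ω => M.comp p.1 t ω * M.comp p.2 t ω
    - ∫ ω, M.comp p.1 0 ω * M.comp p.2 0 ω ∂P) (fun p t => ?_) (fun p t => ?_) (fun p t => ?_)
    (fun p k t => (hmom p k t).1) (fun p k t => (hmom p k t).2)
    (fun n => compIndex r (N n) ×ˢ compIndex r (N n)) ((1 + r) ^ 2) ?_
  · filter_upwards [this] with x hx a ha b hb
    exact hx (a, b) (Finset.mem_product.2 ⟨ha, hb⟩)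
  · exact ((measurable_comp_of_state (measurable_state_past le_rfl) _).mul
      (measurable_comp_of_state (measurable_state_past le_rfl) _)).sub_const _
  · exact ((measurable_comp_of_state (measurable_state_future le_rfl) _).mul
      (measurable_comp_of_state (measurable_state_future le_rfl) _)).sub_const _
  · have hi := (moment_mul_sub (hM.measurable_comp p.1 t) (hM.measurable_comp p.2 t) (hC p.1 t)
      (hC p.2 t) (e := 0) (D := 0) (by simp) 1).1
    simp only [sub_zero, pow_one] at hi
    have hi' : Integrable (fun ω => M.comp p.1 t ω * M.comp p.2 t ω) P :=
      (integrable_norm_iff ((hM.measurable_comp p.1 t).mul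
        (hM.measurable_comp p.2 t)).aestronglyMeasurable).1 hi
    rw [integral_sub hi' (integrable_const _), hM.integral_comp_mul]
    simp
  -- There are `(N + r)²` pairs, and `N ≤ T²` makes this at most a constant times `T^4`.
  · filter_upwards [hNT.N_le, hNT.tendsto_T.eventually_ge_atTop 1] with n h1 h2
    rw [Finset.card_product, card_compIndex]
    have h3 : (N n : ℝ) ≤ (T n : ℝ) ^ 2 := by exact_mod_cast h1
    have h4 : (1 : ℝ) ≤ (T n : ℝ) ^ 2 := one_le_pow₀ (by exact_mod_cast h2)
    have h5 : ((N n + r : ℕ) : ℝ) ≤ (1 + r) * (T n : ℝ) ^ 2 := by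
      push_cast
      nlinarith [(Nat.cast_nonneg r : (0 : ℝ) ≤ r)]
    push_cast at h5 ⊢
    calc _ ≤ ((1 + r) * (T n : ℝ) ^ 2) * ((1 + r) * (T n : ℝ) ^ 2) := by gcongr
      _ = _ := by ring

/-- All observed components are bounded by a small power of the sample size. -/
lemma eventually_abs_comp_le {N T : ℕ → ℕ} (hNT : PolyGrowth N T) :
    ∀ᶠ x in whp P, ∀ a ∈ compIndex r (N x.1), ∀ t < T x.1,
      |M.comp a t x.2| ≤ ((min (N x.1) (T x.1) : ℕ) : ℝ) ^ (1 / 40 : ℝ) := by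
  obtain ⟨C, hC⟩ := hM.exists_moments_comp
  have hm : Tendsto (fun n => min (N n) (T n)) atTop atTop :=
    tendsto_atTop.2 fun b => by
      filter_upwards [hNT.tendsto_N.eventually_ge_atTop b, hNT.tendsto_T.eventually_ge_atTop b]
        with n h1 h2 using le_min h1 h2
  have := eventually_whp_abs_le_rpow (P := P) hm (ι := (ℕ ⊕ Fin r) × ℕ)
    (X := fun p ω => M.comp p.1 p.2 ω) (C := C) (fun p k => hC p.1 p.2 k)
    (I := fun n => compIndex r (N n) ×ˢ Finset.range (T n)) (D := 1 + r) ?_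
  · filter_upwards [this] with x hx a ha t ht
    exact hx (a, t) (Finset.mem_product.2 ⟨ha, Finset.mem_range.2 ht⟩)
  · filter_upwards [hNT.N_le, hNT.T_le, hm.eventually_ge_atTop 1] with n h1 h2 h3
    -- Each of the two sample sizes is at most the square of the smaller one, so the number of
    -- observed components is of order at most the fourth power of the minimum.
    have hb : ∀ a b : ℕ, 1 ≤ min a b → a ≤ b ^ 2 → b ≤ a ^ 2 →
        a ≤ min a b ^ 2 ∧ b ≤ min a b ^ 2 := by
      intro a b h h1 h2
      rcases le_total a b with hab | hab
      · rw [min_eq_left hab] at h ⊢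
        exact ⟨by nlinarith, h2⟩
      · rw [min_eq_right hab] at h ⊢
        exact ⟨h1, by nlinarith⟩
    obtain ⟨e1, e2⟩ := hb _ _ h3 h1 h2
    rw [Finset.card_product, card_compIndex, Finset.card_range]
    set m := min (N n) (T n)
    have e1' : (N n : ℝ) ≤ (m : ℝ) ^ 2 := by exact_mod_cast e1
    have e2' : (T n : ℝ) ≤ (m : ℝ) ^ 2 := by exact_mod_cast e2
    have h4 : (1 : ℝ) ≤ (m : ℝ) ^ 2 := one_le_pow₀ (by exact_mod_cast h3)
    have h5 : ((N n + r : ℕ) : ℝ) ≤ (1 + r) * (m : ℝ) ^ 2 := by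
      push_cast
      nlinarith [(Nat.cast_nonneg r : (0 : ℝ) ≤ r)]
    push_cast at h5 ⊢
    calc _ ≤ ((1 + r) * (m : ℝ) ^ 2) * (m : ℝ) ^ 2 := by gcongr
      _ = _ := by ring

end Regular

end FactorModel

/-! ### Residual covariances after principal components -/

section ResidualCovariance

open scoped Matrix.Norms.L2Operator

variable {N T r : ℕ}

/-- Properties that scaled loadings `L`, factors `X` and errors `U` have with high probability,
where `ω` is the rate of convergence. -/
structure IsSample (c ω : ℝ) (L : Matrix (Fin N) (Fin r) ℝ) (X : Matrix (Fin T) (Fin r) ℝ)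
    (U : Matrix (Fin N) (Fin T) ℝ) (S : Matrix (Fin N) (Fin N) ℝ) : Prop where
  one_le : 1 ≤ c
  norm_L : ‖L‖ ≤ c
  norm_X : ‖X‖ ≤ c
  isUnit_L : IsUnit (Lᵀ * L).det
  isUnit_X : IsUnit (Xᵀ * X).det
  norm_inv_L : ‖(Lᵀ * L)⁻¹‖ ≤ c
  norm_inv_X : ‖(Xᵀ * X)⁻¹‖ ≤ c
  norm_S : ‖S‖ ≤ c
  row : ∀ i, ‖√(N : ℝ) • rowM L i‖ ≤ c
  cov : ∀ i j, |(N : ℝ) * (U * Uᵀ) i j - S i j| ≤ c * ω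
  cross : ∀ i, ‖√(N : ℝ) • rowM U i * X‖ ≤ c * ω
  inv_sqrt : 1 / √(N : ℝ) ≤ ω
  pos : 0 < N
  le_T : r ≤ T
  le_N : r ≤ N
  small : 64 * c ^ 17 * √(2 * c * ω) ≤ 1

namespace IsSample

variable {c ω : ℝ} {L : Matrix (Fin N) (Fin r) ℝ} {X : Matrix (Fin T) (Fin r) ℝ}
  {U : Matrix (Fin N) (Fin T) ℝ} {S : Matrix (Fin N) (Fin N) ℝ}

section

variable (h : IsSample c ω L X U S)
include h

lemma c_pos : 0 < c := one_pos.trans_le h.one_le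

lemma sqrt_pos : 0 < √(N : ℝ) := Real.sqrt_pos.2 (by exact_mod_cast h.pos)

lemma omega_pos : 0 < ω := lt_of_lt_of_le (by have := h.sqrt_pos; positivity) h.inv_sqrt

lemma sqrt_small {k : ℕ} (hk : k ≤ 17) : 64 * c ^ k * √(2 * c * ω) ≤ 1 := by
  refine le_trans ?_ h.small
  have := pow_le_pow_right₀ h.one_le hk
  gcongr

lemma sq_sqrt : √(2 * c * ω) ^ 2 = 2 * c * ω :=
  Real.sq_sqrt (by have := h.c_pos; have := h.omega_pos; positivity)

lemma omega_le : 2 * c * ω ≤ 1 := by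
  have := h.sqrt_small (k := 0) (by norm_num)
  have h0 := Real.sqrt_nonneg (2 * c * ω)
  rw [← h.sq_sqrt]; nlinarith

lemma omega_le_one : ω ≤ 1 := by
  have := h.omega_le
  have := h.one_le
  have := h.omega_pos
  nlinarith

/-- An entrywise error `c ω` costs a factor `N` in operator norm, which the scaling of `U`
compensates; `S` itself contributes `c / N`, at most `c ω` because `1/√N ≤ ω`. -/
lemma norm_mul_transpose : ‖U * Uᵀ‖ ≤ 2 * c * ω := by
  have hN := h.sqrt_pos
  have hN2 : √(N : ℝ) ^ 2 = N := Real.sq_sqrt (Nat.cast_nonneg _)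
  have hNp : (0 : ℝ) < N := by exact_mod_cast h.pos
  have h1 : ‖(N : ℝ) • (U * Uᵀ) - S‖ ≤ N * (c * ω) := by
    have := norm_le_of_abs_entry_le (A := (N : ℝ) • (U * Uᵀ) - S)
      (mul_nonneg h.c_pos.le h.omega_pos.le) (fun i j => by simpa using h.cov i j)
    simpa [Real.sqrt_mul_self] using this
  have h2 : ‖(N : ℝ) • (U * Uᵀ)‖ ≤ N * (c * ω) + c := by
    have := norm_add_le ((N : ℝ) • (U * Uᵀ) - S) S
    rw [sub_add_cancel] at this
    linarith [h.norm_S]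
  rw [norm_smul, Real.norm_of_nonneg hNp.le] at h2
  have h3 : (1 : ℝ) ≤ N * ω := by
    have := h.inv_sqrt
    rw [div_le_iff₀ hN] at this
    have h1 : 1 ≤ √(N : ℝ) := Real.one_le_sqrt.2 (by exact_mod_cast h.pos)
    nlinarith [h.omega_pos]
  have := h.c_pos
  have h4 : (N : ℝ) * ‖U * Uᵀ‖ ≤ N * (2 * c * ω) := by nlinarith
  exact le_of_mul_le_mul_left h4 hNp

lemma norm_U : ‖U‖ ≤ √(2 * c * ω) := by
  refine Real.le_sqrt_of_sq_le ?_
  rw [← norm_mul_transpose_self]; exact h.norm_mul_transpose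

lemma norm_U_le_one : ‖U‖ ≤ 1 := by
  have := h.sqrt_small (k := 0) (by norm_num)
  linarith [h.norm_U, Real.sqrt_nonneg (2 * c * ω)]

lemma norm_transpose_mul : ‖Uᵀ * L‖ ≤ c * √(2 * c * ω) := by
  have := l2_norm_mul_le_of_le ((l2_norm_transpose U).trans_le h.norm_U) h.norm_L
  linarith

/-- For one row, passing from entries to norm costs only `√N`. So, after scaling by `√N`, a row of
`U Uᵀ` is of order `ω`; this drives the rowwise estimates below. -/
lemma norm_row_mul_transpose (i : Fin N) : ‖√(N : ℝ) • rowM (U * Uᵀ) i‖ ≤ 2 * c * ω := by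
  have hN := h.sqrt_pos
  have hN2 : √(N : ℝ) * √(N : ℝ) = N := Real.mul_self_sqrt (Nat.cast_nonneg _)
  have e : √(N : ℝ) • rowM (U * Uᵀ) i
      = (1 / √(N : ℝ)) • (rowM ((N : ℝ) • (U * Uᵀ) - S) i + rowM S i) := by
    ext a b
    simp only [rowM, Matrix.smul_apply, Matrix.of_apply, Matrix.add_apply, Matrix.sub_apply,
      smul_eq_mul, sub_add_cancel]
    rw [one_div_mul_eq_div, eq_div_iff hN.ne', mul_right_comm, hN2]
  have h1 : ‖rowM ((N : ℝ) • (U * Uᵀ) - S) i‖ ≤ √(N : ℝ) * (c * ω) := by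
    have := norm_le_of_abs_entry_le (A := rowM ((N : ℝ) • (U * Uᵀ) - S) i)
      (mul_nonneg h.c_pos.le h.omega_pos.le) (fun _ j => by simpa [rowM] using h.cov i j)
    simpa using this
  have h2 := (norm_rowM_le S i).trans h.norm_S
  rw [e, norm_smul, Real.norm_of_nonneg (by positivity)]
  have h3 := h.inv_sqrt
  have hc := h.c_pos
  calc _ ≤ 1 / √(N : ℝ) * (√(N : ℝ) * (c * ω) + c) := by
        gcongr
        exact (norm_add_le _ _).trans (add_le_add h1 h2)
    _ = c * ω + 1 / √(N : ℝ) * c := by field_simp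
    _ ≤ c * ω + ω * c := by gcongr
    _ = _ := by ring

/-- The leading eigenvalues are bounded below, first for the `N × N` matrix. -/
lemma le_eigDesc_left {k : ℕ} (hk : k < r) :
    1 / (4 * c ^ 8) ≤ eigDesc ((L * Xᵀ + U) * (L * Xᵀ + U)ᵀ) k := by
  have hJ : ‖L * (Lᵀ * L)⁻¹ * (Xᵀ * X)⁻¹ * Xᵀ‖ ≤ c ^ 4 := by
    have := l2_norm_mul_le_of_le (l2_norm_mul_le_of_le (l2_norm_mul_le_of_le h.norm_L h.norm_inv_L)
      h.norm_inv_X) ((l2_norm_transpose X).trans_le h.norm_X)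
    exact this.trans (le_of_eq (by ring))
  -- The general bound for the transposed data with unit weight. The matrix `J` is built from the
  -- two inverse Gram matrices so that it inverts the signal on the span of `L`.
  have := le_eigDesc_of_perturbation (Y := (L * Xᵀ + U)ᵀ) (G := X * Lᵀ) (M := L)
    (J := L * (Lᵀ * L)⁻¹ * (Xᵀ * X)⁻¹ * Xᵀ) (W := 1) (by simp) (j := c ^ 4)
    (u := √(2 * c * ω)) (w := 1) (by have := h.c_pos; positivity) hJ ?_ ?_ ?_ ?_ zero_le_one
    (fun x => by simp) hk (by simpa using hk.trans_le h.le_N)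
  · simpa [← pow_mul] using this
  · have e : (L * Xᵀ + U)ᵀ - X * Lᵀ = Uᵀ := by
      simp only [transpose_add, transpose_mul, transpose_transpose]; abel
    rw [e, l2_norm_transpose]; exact h.norm_U
  · have := h.sqrt_small (k := 4) (by norm_num); linarith
  · calc L * (Lᵀ * L)⁻¹ * (Xᵀ * X)⁻¹ * Xᵀ * (X * Lᵀ) * L
        = L * (Lᵀ * L)⁻¹ * ((Xᵀ * X)⁻¹ * (Xᵀ * X)) * (Lᵀ * L) := by simp only [Matrix.mul_assoc]
      _ = L := by
        rw [Matrix.nonsing_inv_mul _ h.isUnit_X, Matrix.mul_one, Matrix.mul_assoc,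
          Matrix.nonsing_inv_mul _ h.isUnit_L, Matrix.mul_one]
  · intro x hx
    have h1 : (Lᵀ * L) *ᵥ x = 0 := by rw [← Matrix.mulVec_mulVec, hx, Matrix.mulVec_zero]
    have h2 : ((Lᵀ * L)⁻¹ * (Lᵀ * L)) *ᵥ x = 0 := by
      rw [← Matrix.mulVec_mulVec, h1, Matrix.mulVec_zero]
    rwa [Matrix.nonsing_inv_mul _ h.isUnit_L, Matrix.one_mulVec] at h2

/-- The leading eigenvalues of the weighted `T × T` matrix are bounded below. -/
lemma le_eigDesc_right {W : Matrix (Fin N) (Fin N) ℝ} (hW : Wᵀ = W) {w : ℝ} (hw : 0 ≤ w)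
    (hWw : ∀ x, w * (x ⬝ᵥ x) ≤ x ⬝ᵥ (W *ᵥ x)) {k : ℕ} (hk : k < r) :
    w / (4 * c ^ 8) ≤ eigDesc ((L * Xᵀ + U)ᵀ * W * (L * Xᵀ + U)) k := by
  have hJ : ‖X * (Xᵀ * X)⁻¹ * (Lᵀ * L)⁻¹ * Lᵀ‖ ≤ c ^ 4 := by
    have := l2_norm_mul_le_of_le (l2_norm_mul_le_of_le (l2_norm_mul_le_of_le h.norm_X h.norm_inv_X)
      h.norm_inv_L) ((l2_norm_transpose L).trans_le h.norm_L)
    exact this.trans (le_of_eq (by ring))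
  have := le_eigDesc_of_perturbation (Y := L * Xᵀ + U) (G := L * Xᵀ) (M := X)
    (J := X * (Xᵀ * X)⁻¹ * (Lᵀ * L)⁻¹ * Lᵀ) (W := W) hW (j := c ^ 4)
    (u := √(2 * c * ω)) (w := w) (by have := h.c_pos; positivity) hJ ?_ ?_ ?_ ?_ hw
    hWw hk (by simpa using hk.trans_le h.le_T)
  · simpa [← pow_mul] using this
  · rw [add_sub_cancel_left]; exact h.norm_U
  · have := h.sqrt_small (k := 4) (by norm_num); linarith
  · calc X * (Xᵀ * X)⁻¹ * (Lᵀ * L)⁻¹ * Lᵀ * (L * Xᵀ) * X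
        = X * (Xᵀ * X)⁻¹ * ((Lᵀ * L)⁻¹ * (Lᵀ * L)) * (Xᵀ * X) := by simp only [Matrix.mul_assoc]
      _ = X := by
        rw [Matrix.nonsing_inv_mul _ h.isUnit_L, Matrix.mul_one, Matrix.mul_assoc,
          Matrix.nonsing_inv_mul _ h.isUnit_X, Matrix.mul_one]
  · intro x hx
    have h1 : (Xᵀ * X) *ᵥ x = 0 := by rw [← Matrix.mulVec_mulVec, hx, Matrix.mulVec_zero]
    have h2 : ((Xᵀ * X)⁻¹ * (Xᵀ * X)) *ᵥ x = 0 := by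
      rw [← Matrix.mulVec_mulVec, h1, Matrix.mulVec_zero]
    rwa [Matrix.nonsing_inv_mul _ h.isUnit_X, Matrix.one_mulVec] at h2

/-- Weighted principal components of a sample. -/
lemma isApproxPC {W : Matrix (Fin N) (Fin N) ℝ} (hW : Wᵀ = W) {w C : ℝ} (hw : 0 < w)
    (hWw : ∀ x, w * (x ⬝ᵥ x) ≤ x ⬝ᵥ (W *ᵥ x)) (hcC : c ≤ C) (hWC : ‖W‖ ≤ C)
    (hwC : 4 * c ^ 8 / w ≤ C) {Z : Matrix (Fin T) (Fin r) ℝ}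
    (hZ : IsTopEigenvectors ((L * Xᵀ + U)ᵀ * W * (L * Xᵀ + U)) Z) :
    IsApproxPC C L X U W Z
      (fun k => eigDesc ((L * Xᵀ + U)ᵀ * W * (L * Xᵀ + U)) k) where
  one_le := h.one_le.trans hcC
  norm_L := h.norm_L.trans hcC
  norm_X := h.norm_X.trans hcC
  norm_U := h.norm_U_le_one
  norm_W := hWC
  symm := hW
  orth := hZ.orthonormal
  eigen := hZ.mul_eq
  val k := by
    refine le_trans ?_ (h.le_eigDesc_right hW hw.le hWw k.2)
    have := h.c_pos
    rw [div_le_div_iff₀ (this.trans_le hcC) (by positivity), one_mul]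
    rwa [div_le_iff₀ hw, mul_comm C] at hwC

/-- The factors associated with the leading eigenvectors of the `N × N` matrix. -/
lemma isApproxPC_dual {E : Matrix (Fin N) (Fin r) ℝ}
    (hE : IsTopEigenvectors ((L * Xᵀ + U) * (L * Xᵀ + U)ᵀ) E) :
    let v := fun k : Fin r => eigDesc ((L * Xᵀ + U) * (L * Xᵀ + U)ᵀ) k
    let Z := (L * Xᵀ + U)ᵀ * E * diagonal (fun k => (√(v k))⁻¹)
    IsApproxPC (4 * c ^ 8) L X U 1 Z v ∧
      (L * Xᵀ + U) * (L * Xᵀ + U)ᵀ - E * diagonal v * Eᵀ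
        = (L * Xᵀ + U) * (1 - Z * Zᵀ) * (L * Xᵀ + U)ᵀ := by
  -- Left singular vectors are turned into right ones: normalizing `Yᵀ E` by the singular values
  -- gives principal components with unit weight, and removing the leading components becomes
  -- projection by `1 - Z Zᵀ`.
  set Y := L * Xᵀ + U with hY
  intro v Z
  have hc := h.c_pos
  have hval : ∀ k : Fin r, 1 / (4 * c ^ 8) ≤ v k := fun k => h.le_eigDesc_left k.2
  have hvpos : ∀ k : Fin r, 0 < v k := fun k => lt_of_lt_of_le (by positivity) (hval k)
  have hs : ∀ k, √(v k) * √(v k) = v k := fun k => Real.mul_self_sqrt (hvpos k).le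
  have hsp : ∀ k, 0 < √(v k) := fun k => Real.sqrt_pos.2 (hvpos k)
  have hmul : Y * Yᵀ * E = E * diagonal v := hE.mul_eq
  have hcC : c ≤ 4 * c ^ 8 := by
    have := pow_le_pow_right₀ h.one_le (show 1 ≤ 8 by norm_num)
    rw [pow_one] at this
    nlinarith
  refine ⟨⟨h.one_le.trans hcC, h.norm_L.trans hcC, h.norm_X.trans hcC, h.norm_U_le_one,
    norm_one_le.trans (h.one_le.trans hcC), transpose_one, ?_, ?_, hval⟩, ?_⟩
  · calc Zᵀ * Z = diagonal (fun k => (√(v k))⁻¹) * (Eᵀ * (Y * Yᵀ * E))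
          * diagonal (fun k => (√(v k))⁻¹) := by
          simp only [Z, transpose_mul, transpose_transpose, diagonal_transpose, Matrix.mul_assoc]
      _ = diagonal (fun k => (√(v k))⁻¹) * diagonal v * diagonal (fun k => (√(v k))⁻¹) := by
          rw [hmul, ← Matrix.mul_assoc Eᵀ, hE.orthonormal, Matrix.one_mul]
      _ = 1 := by
          rw [diagonal_mul_diagonal, diagonal_mul_diagonal, ← diagonal_one]
          congr 1; ext k
          have := hsp k
          nth_rewrite 2 [← hs k]
          field_simp
  · calc Yᵀ * (1 : Matrix (Fin N) (Fin N) ℝ) * Y * Z = Yᵀ * (Y * Yᵀ * E) * diagonal (fun k => (√(v k))⁻¹) := by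
          simp only [Z, Matrix.mul_one, Matrix.mul_assoc]
      _ = Yᵀ * E * (diagonal v * diagonal (fun k => (√(v k))⁻¹)) := by
          rw [hmul]; simp only [Matrix.mul_assoc]
      _ = Z * diagonal v := by
          simp only [Z, Matrix.mul_assoc, diagonal_mul_diagonal]
          congr 3; ext k; ring
  · have e1 : Y * Z = E * diagonal (fun k => √(v k)) := by
      calc Y * Z = Y * Yᵀ * E * diagonal (fun k => (√(v k))⁻¹) := by
            simp only [Z, Matrix.mul_assoc]
        _ = _ := by
            rw [hmul, Matrix.mul_assoc, diagonal_mul_diagonal]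
            congr 2; ext k
            have := hsp k
            nth_rewrite 1 [← hs k]
            field_simp
    have e2 : Y * (1 - Z * Zᵀ) * Yᵀ = Y * Yᵀ - (Y * Z) * (Y * Z)ᵀ := by
      simp only [Matrix.mul_sub, Matrix.sub_mul, Matrix.mul_one, transpose_mul, Matrix.mul_assoc]
    rw [e2, e1, transpose_mul, diagonal_transpose]
    congr 1
    calc E * diagonal v * Eᵀ
        = E * (diagonal (fun k => √(v k)) * diagonal (fun k => √(v k))) * Eᵀ := by
          rw [diagonal_mul_diagonal]
          simp only [hs]
      _ = _ := by simp only [Matrix.mul_assoc]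

/-- The residual covariances are uniformly close to the error covariances. -/
lemma abs_resid_cov_sub_le {E : Matrix (Fin N) (Fin r) ℝ}
    (hE : IsTopEigenvectors ((L * Xᵀ + U) * (L * Xᵀ + U)ᵀ) E) (i j : Fin N) :
    |(N : ℝ) * ((L * Xᵀ + U) * (L * Xᵀ + U)ᵀ - E * diagonal
        (fun k : Fin r => eigDesc ((L * Xᵀ + U) * (L * Xᵀ + U)ᵀ) k) * Eᵀ) i j - S i j|
      ≤ 1000 * (4 * c ^ 8) ^ 23 * ω := by
  obtain ⟨hpc, hres⟩ := h.isApproxPC_dual hE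
  rw [hres]
  set v := fun k : Fin r => eigDesc ((L * Xᵀ + U) * (L * Xᵀ + U)ᵀ) k with hv
  set Z := (L * Xᵀ + U)ᵀ * E * diagonal (fun k => (√(v k))⁻¹) with hZ
  clear_value v
  set C := 4 * c ^ 8 with hC
  have hc := h.c_pos
  have hcC : c ≤ C := by
    have := pow_le_pow_right₀ h.one_le (show 1 ≤ 8 by norm_num)
    rw [pow_one] at this
    nlinarith
  have hC1 := hpc.one_le
  have hω := h.omega_pos
  have hω1 := h.omega_le_one
  set e := √(2 * c * ω) with he
  have he0 : 0 ≤ e := Real.sqrt_nonneg _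
  have he2 : e ^ 2 = 2 * c * ω := h.sq_sqrt
  have he1 : e ≤ 1 := by have := h.sqrt_small (k := 0) (by norm_num); linarith
  -- Only the crude order `e`, that is `√ω`, is claimed for the error of the factors; it suffices
  -- because this error enters the covariances squared.
  have hUL : ‖Uᵀ * (1 : Matrix (Fin N) (Fin N) ℝ) * L‖ + ‖U‖ ^ 2 ≤ 2 * c * e := by
    rw [Matrix.mul_one]
    have h1 := h.norm_transpose_mul
    have h2 := pow_le_pow_left₀ (norm_nonneg _) h.norm_U 2
    have h3 : e ^ 2 ≤ c * e := by nlinarith [h.one_le]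
    linarith
  have hErr : ‖pcErr L X U 1 Z v‖ ≤ C ^ 2 * (2 * c * e) :=
    hpc.norm_pcErr.trans (by gcongr)
  -- With `C = 4 c^8` the bound is half of `64 c^17 e`, which explains the exponent 17 in the
  -- smallness condition of `IsSample`.
  have hErr2 : ‖pcErr L X U 1 Z v‖ ≤ 1 / 2 := by
    refine hErr.trans ?_
    have := h.small
    rw [hC]
    have e1 : (4 * c ^ 8) ^ 2 * (2 * c * e) = (64 * c ^ 17 * e) / 2 := by ring
    rw [e1]; linarith
  obtain ⟨-, -, -, hXZ⟩ := hpc.rotation hErr2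
  have hXZ' : ‖X - Z * (Zᵀ * X)‖ ≤ 10 * C ^ 10 * e := by
    refine hXZ.trans ?_
    calc 5 * C ^ 7 * ‖pcErr L X U 1 Z v‖ ≤ 5 * C ^ 7 * (C ^ 2 * (2 * C * e)) := by
          gcongr
          exact hErr.trans (by gcongr)
      _ = _ := by ring
  have hrowU : ∀ i, √(N : ℝ) • rowM (U * Uᵀ) i = √(N : ℝ) • rowM U i * Uᵀ := fun i => by
    rw [rowM_mul, Matrix.smul_mul]
  -- Paired with an error row, the factor error improves from order `√ω` to order `ω`, because it
  -- begins with `Uᵀ` and a row of `U Uᵀ` is of order `ω`.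
  have hrE : ∀ i, ‖√(N : ℝ) • rowM U i * pcErr L X U 1 Z v‖ ≤ 4 * C ^ 4 * ω := by
    intro i
    have e1 : √(N : ℝ) • rowM U i * pcErr L X U 1 Z v
        = (√(N : ℝ) • rowM (U * Uᵀ) i * L * (Zᵀ * X)ᵀ + √(N : ℝ) • rowM (U * Uᵀ) i * U * Z)
          * diagonal (fun k => (v k)⁻¹) := by
      rw [hpc.pcErr_eq, hrowU]
      simp only [Matrix.mul_one, Matrix.mul_add, Matrix.add_mul, Matrix.mul_assoc]
    have a0 := h.norm_row_mul_transpose i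
    have a1 : ‖√(N : ℝ) • rowM (U * Uᵀ) i * L * (Zᵀ * X)ᵀ‖ ≤ 2 * c * ω * C * C :=
      l2_norm_mul_le_of_le (l2_norm_mul_le_of_le a0 hpc.norm_L)
        ((l2_norm_transpose _).trans_le hpc.norm_H)
    have a2 : ‖√(N : ℝ) • rowM (U * Uᵀ) i * U * Z‖ ≤ 2 * c * ω * 1 * 1 :=
      l2_norm_mul_le_of_le (l2_norm_mul_le_of_le a0 hpc.norm_U) hpc.norm_Z
    rw [e1]
    refine (l2_norm_mul_le_of_le ((norm_add_le _ _).trans (add_le_add a1 a2)) hpc.norm_inv).trans ?_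
    calc (2 * c * ω * C * C + 2 * c * ω * 1 * 1) * C
        ≤ (2 * C * ω * C * C + 2 * C * ω * C * C) * C := by gcongr
      _ = _ := by ring
  have hrX : ∀ i, ‖√(N : ℝ) • rowM U i * X‖ ≤ 6 * C ^ 6 * ω := fun i => by
    refine (h.cross i).trans ?_
    have : C ≤ C ^ 6 := by simpa using pow_le_pow_right₀ hC1 (show 1 ≤ 6 by norm_num)
    have : c ≤ 6 * C ^ 6 := by linarith
    gcongr
  have hrZ : ∀ i, ‖√(N : ℝ) • rowM U i * Z‖ ≤ 6 * C ^ 6 * ω := fun i => by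
    refine (hpc.norm_row_mul_Z _).trans ?_
    calc _ ≤ 2 * C ^ 5 * (C * ω) + 4 * C ^ 4 * ω := by
          gcongr
          · exact (h.cross i).trans (by gcongr)
          · exact hrE i
      _ = 2 * C ^ 6 * ω + 4 * C ^ 4 * ω := by ring
      _ ≤ 2 * C ^ 6 * ω + 4 * C ^ 6 * ω := by gcongr; norm_num [hC1]
      _ = _ := by ring
  have key := hpc.abs_resid_cov_sub_le (l := √(N : ℝ) • rowM L i) (l' := √(N : ℝ) • rowM L j)
    (u := √(N : ℝ) • rowM U i) (u' := √(N : ℝ) • rowM U j) ((h.row i).trans hcC)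
    ((h.row j).trans hcC) hXZ' (hrX i) (hrX j) (hrZ i) (hrZ j)
  have hN2 : √(N : ℝ) * √(N : ℝ) = N := Real.mul_self_sqrt (Nat.cast_nonneg _)
  have hrow : ∀ i, √(N : ℝ) • rowM L i * Xᵀ + √(N : ℝ) • rowM U i
      = √(N : ℝ) • rowM (L * Xᵀ + U) i := fun i => by
    rw [rowM_add, rowM_mul, smul_add, Matrix.smul_mul]
  have e1 : (√(N : ℝ) • rowM (L * Xᵀ + U) i * (1 - Z * Zᵀ) * (√(N : ℝ) • rowM (L * Xᵀ + U) j)ᵀ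
      : Matrix Unit Unit ℝ) () () = N * ((L * Xᵀ + U) * (1 - Z * Zᵀ : Matrix (Fin T) (Fin T) ℝ) * (L * Xᵀ + U)ᵀ) i j := by
    rw [mul_transpose_apply_eq_rowM ((L * Xᵀ + U) * (1 - Z * Zᵀ : Matrix (Fin T) (Fin T) ℝ)),
      rowM_mul, transpose_smul, Matrix.smul_mul, Matrix.smul_mul,
      Matrix.mul_smul, smul_smul, hN2]
    rfl
  have e2 : (√(N : ℝ) • rowM U i * (√(N : ℝ) • rowM U j)ᵀ : Matrix Unit Unit ℝ) () ()
      = N * (U * Uᵀ) i j := by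
    rw [mul_transpose_apply_eq_rowM U, transpose_smul, Matrix.smul_mul, Matrix.mul_smul, smul_smul,
      hN2]
    rfl
  rw [hrow, hrow, e1, e2] at key
  have hcov := h.cov i j
  -- All contributions are linear in `ω` once `e² = 2cω` and `ω² ≤ ω` are used; the largest power
  -- `C^23` comes from the squared factor error.
  have hfin : 2 * (C * (6 * C ^ 6 * ω + 6 * C ^ 6 * ω * C) + 6 * C ^ 6 * ω * (6 * C ^ 6 * ω))
      + (C * (10 * C ^ 10 * e) + 6 * C ^ 6 * ω) * (C * (10 * C ^ 10 * e) + 6 * C ^ 6 * ω) + c * ω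
      ≤ 1000 * C ^ 23 * ω := by
    have b1 : ω ^ 2 ≤ ω := by nlinarith
    have b2 : e ^ 2 ≤ 2 * C * ω := by rw [he2]; gcongr
    have b3 : (C * (10 * C ^ 10 * e) + 6 * C ^ 6 * ω) * (C * (10 * C ^ 10 * e) + 6 * C ^ 6 * ω)
        ≤ 2 * (100 * C ^ 22 * e ^ 2) + 2 * (36 * C ^ 12 * ω ^ 2) := by
      nlinarith [sq_nonneg (C * (10 * C ^ 10 * e) - 6 * C ^ 6 * ω)]
    have b4 : 2 * (100 * C ^ 22 * e ^ 2) + 2 * (36 * C ^ 12 * ω ^ 2)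
        ≤ 2 * (100 * C ^ 22 * (2 * C * ω)) + 2 * (36 * C ^ 12 * ω) := by gcongr
    have b5 : 6 * C ^ 6 * ω * (6 * C ^ 6 * ω) ≤ 36 * C ^ 12 * ω := by
      calc _ = 36 * C ^ 12 * ω ^ 2 := by ring
        _ ≤ _ := by gcongr
    have p : ∀ k, k ≤ 23 → C ^ k * ω ≤ C ^ 23 * ω := fun k hk => by
      have := pow_le_pow_right₀ hC1 hk
      gcongr
    have p7 := p 7 (by norm_num)
    have p8 := p 8 (by norm_num)
    have p12 := p 12 (by norm_num)
    have p1 := p 1 (by norm_num)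
    have pc : c * ω ≤ C ^ 1 * ω := by rw [pow_one]; gcongr
    have p0 : 0 ≤ C ^ 23 * ω := by positivity
    nlinarith
  refine le_trans ?_ hfin
  calc _ ≤ |(N : ℝ) * ((L * Xᵀ + U) * (1 - Z * Zᵀ : Matrix (Fin T) (Fin T) ℝ) * (L * Xᵀ + U)ᵀ) i j - N * (U * Uᵀ) i j|
        + |N * (U * Uᵀ) i j - S i j| := abs_sub_le _ _ _
    _ ≤ _ := add_le_add key hcov

end

end IsSample

end ResidualCovariance

/-! ### Comparison of the rates with powers of the smaller sample size. -/

lemma omegaRate_nonneg (N T : ℕ) : 0 ≤ omegaRate N T := by unfold omegaRate; positivity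

lemma logRate_le_omegaRate (N T : ℕ) : logRate N T ≤ omegaRate N T := by
  unfold omegaRate logRate
  have : 0 ≤ 1 / √(N : ℝ) := by positivity
  linarith

namespace PolyGrowth

variable {N T : ℕ → ℕ}

lemma tendsto_min (h : PolyGrowth N T) : Tendsto (fun n => min (N n) (T n)) atTop atTop :=
  tendsto_atTop.2 fun b => by
    filter_upwards [h.tendsto_N.eventually_ge_atTop b, h.tendsto_T.eventually_ge_atTop b]
      with n h1 h2 using le_min h1 h2

/-- Up to a small power, the rate of convergence is that of the square root of the smaller sample
size. -/
lemma omegaRate_le (h : PolyGrowth N T) : ∀ᶠ n in atTop,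
    omegaRate (N n) (T n) ≤ ((min (N n) (T n) : ℕ) : ℝ) ^ (-(19 / 40) : ℝ) := by
  -- The logarithm is absorbed by a power `m^(1/40)`, which turns the exponent `-1/2` into `-19/40`.
  have h1 : Tendsto (fun m : ℕ => (Real.log m) / (m : ℝ) ^ (1 / 40 : ℝ)) atTop (𝓝 0) :=
    (isLittleO_log_rpow_atTop (by norm_num : (0 : ℝ) < 1 / 40)).tendsto_div_nhds_zero.comp
      tendsto_natCast_atTop_atTop
  have h2 : Tendsto (fun m : ℕ => ((m : ℝ) ^ (1 / 40 : ℝ))) atTop atTop :=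
    (tendsto_rpow_atTop (by norm_num)).comp tendsto_natCast_atTop_atTop
  filter_upwards [h.tendsto_min.eventually (h1.eventually (gt_mem_nhds (by norm_num :
    (0 : ℝ) < 1 / 8))), h.tendsto_min.eventually (h2.eventually_ge_atTop 2),
    h.tendsto_min.eventually_ge_atTop 1, h.N_le] with n a1 a2 a3 a4
  set m := min (N n) (T n) with hm
  have hm0 : (0 : ℝ) < m := by exact_mod_cast a3
  have hmN : (m : ℝ) ≤ N n := by exact_mod_cast min_le_left _ _
  have hmT : (m : ℝ) ≤ T n := by exact_mod_cast min_le_right _ _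
  set b := (m : ℝ) ^ (1 / 40 : ℝ) with hb
  have hN : (N n : ℝ) ≤ (m : ℝ) ^ 2 := by
    rcases le_total (N n) (T n) with hab | hab
    · rw [hm, min_eq_left hab]
      have : (1 : ℝ) ≤ N n := by rw [hm, min_eq_left hab] at a3; exact_mod_cast a3
      nlinarith
    · rw [hm, min_eq_right hab]; exact_mod_cast a4
  have hlog : Real.log (N n) ≤ 2 * Real.log m := by
    have := Real.log_le_log (hm0.trans_le hmN) hN
    rwa [Real.log_pow, Nat.cast_ofNat] at this
  have hlogb : Real.log m ≤ 1 / 8 * b := by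
    rw [div_lt_iff₀ (by positivity)] at a1; exact a1.le
  have hsq : √(m : ℝ) = (m : ℝ) ^ (1 / 2 : ℝ) := Real.sqrt_eq_rpow _
  have e1 : (m : ℝ) ^ (-(19 / 40) : ℝ) = b / √(m : ℝ) := by
    rw [hsq, hb, ← Real.rpow_sub hm0]; norm_num
  rw [e1, omegaRate]
  have h3 : √(Real.log (N n) / T n) ≤ b / 2 / √(m : ℝ) := by
    rw [← Real.sqrt_sq (show 0 ≤ b / 2 by positivity), ← Real.sqrt_div (by positivity)]
    apply Real.sqrt_le_sqrt
    have : Real.log (N n) ≤ (b / 2) ^ 2 := by nlinarith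
    gcongr
  have h4 : 1 / √(N n : ℝ) ≤ b / 2 / √(m : ℝ) := by
    have : 1 ≤ b / 2 := by linarith
    gcongr
  calc _ ≤ b / 2 / √(m : ℝ) + b / 2 / √(m : ℝ) := add_le_add h3 h4
    _ = _ := by ring

lemma tendsto_min_rpow (h : PolyGrowth N T) {a : ℝ} (ha : 0 < a) :
    Tendsto (fun n => ((min (N n) (T n) : ℕ) : ℝ) ^ (-a)) atTop (𝓝 0) :=
  (tendsto_rpow_neg_atTop ha).comp (tendsto_natCast_atTop_atTop.comp h.tendsto_min)

lemma tendsto_omegaRate (h : PolyGrowth N T) :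
    Tendsto (fun n => omegaRate (N n) (T n)) atTop (𝓝 0) :=
  squeeze_zero' (Eventually.of_forall fun n => omegaRate_nonneg _ _) h.omegaRate_le
    (h.tendsto_min_rpow (by norm_num))

end PolyGrowth

/-! ### Scaled data matrices and their behaviour with high probability. -/

section SampleMatrices

open scoped Matrix.Norms.L2Operator

lemma abs_dotProduct_mulVec_le {m : Type*} [Fintype m] [DecidableEq m] (A : Matrix m m ℝ)
    (x : m → ℝ) : |x ⬝ᵥ (A *ᵥ x)| ≤ ‖A‖ * (x ⬝ᵥ x) := by
  have h1 := sum_sq_mulVec_le A x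
  have h2 : (x ⬝ᵥ (A *ᵥ x)) ^ 2 ≤ (∑ i, x i ^ 2) * ∑ i, (A *ᵥ x) i ^ 2 :=
    Finset.sum_mul_sq_le_sq_mul_sq _ _ _
  have e : x ⬝ᵥ x = ∑ i, x i ^ 2 := by simp [dotProduct, sq]
  rw [e]
  have h0 : 0 ≤ ∑ i, x i ^ 2 := by positivity
  refine abs_le_of_sq_le_sq ?_ (by positivity)
  nlinarith

namespace FactorModel

variable {r : ℕ} {Ω : Type*} [mΩ : MeasurableSpace Ω] {P : Measure Ω} [IsProbabilityMeasure P]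
  {M : FactorModel r Ω}

/-- Loadings scaled by `N ^ (-1/2)`. -/
noncomputable def scaledLam (M : FactorModel r Ω) (N : ℕ) : Matrix (Fin N) (Fin r) ℝ :=
  (1 / √(N : ℝ)) • M.Lam N

/-- Factors scaled by `T ^ (-1/2)`. -/
noncomputable def scaledFactor (M : FactorModel r Ω) (T : ℕ) (ω : Ω) :
    Matrix (Fin T) (Fin r) ℝ :=
  Matrix.of fun t k => M.f k (t : ℕ) ω / √(T : ℝ)

/-- Errors scaled by `(N T) ^ (-1/2)`. -/
noncomputable def scaledError (M : FactorModel r Ω) (N T : ℕ) (ω : Ω) :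
    Matrix (Fin N) (Fin T) ℝ :=
  Matrix.of fun i t => M.u i (t : ℕ) ω / (√(N : ℝ) * √(T : ℝ))

/-- The scaled data. -/
noncomputable def scaledData (M : FactorModel r Ω) (N T : ℕ) (ω : Ω) : Matrix (Fin N) (Fin T) ℝ :=
  M.scaledLam N * (M.scaledFactor T ω)ᵀ + M.scaledError N T ω

lemma dataMat_eq {N T : ℕ} (hN : 0 < N) (hT : 0 < T) (ω : Ω) :
    dataMat (M.y ω) N T = (√(N : ℝ) * √(T : ℝ)) • M.scaledData N T ω := by
  have h1 : 0 < √(N : ℝ) := Real.sqrt_pos.2 (by exact_mod_cast hN)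
  have h2 : 0 < √(T : ℝ) := Real.sqrt_pos.2 (by exact_mod_cast hT)
  ext i t
  simp only [dataMat, FactorModel.y, scaledData, scaledLam, scaledFactor, scaledError,
    Matrix.of_apply, Matrix.smul_apply, Matrix.add_apply, Matrix.mul_apply, transpose_apply,
    smul_eq_mul, Lam, fvec, dotProduct, mul_add, Finset.mul_sum]
  congr 1
  · refine Finset.sum_congr rfl fun k _ => ?_
    field_simp
  · field_simp

lemma sampleCov_eq {N T : ℕ} (hN : 0 < N) (hT : 0 < T) (ω : Ω) :
    sampleCov (M.y ω) N T = (N : ℝ) • (M.scaledData N T ω * (M.scaledData N T ω)ᵀ) := by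
  have hT' : (T : ℝ) ≠ 0 := by exact_mod_cast hT.ne'
  rw [sampleCov, dataMat_eq hN hT, transpose_smul, Matrix.smul_mul, Matrix.mul_smul, smul_smul,
    smul_smul]
  congr 1
  have h1 := Real.mul_self_sqrt (Nat.cast_nonneg N : (0 : ℝ) ≤ N)
  have h2 := Real.mul_self_sqrt (Nat.cast_nonneg T : (0 : ℝ) ≤ T)
  rw [show 1 / (T : ℝ) * (√(N : ℝ) * √(T : ℝ)) * (√(N : ℝ) * √(T : ℝ))
    = 1 / T * ((√(N : ℝ) * √(N : ℝ)) * (√(T : ℝ) * √(T : ℝ))) by ring, h1, h2]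
  field_simp

lemma sigmaU_isHermitian (N : ℕ) : (M.SigmaU P N).IsHermitian := by
  ext i j
  simp [SigmaU, covariance_comm (M.u i 0)]

lemma sigmaF_isHermitian : (M.SigmaF P).IsHermitian := by
  ext i j
  simp [SigmaF, covariance_comm (M.f i 0)]

lemma w_transpose (N : ℕ) : (M.W P N)ᵀ = M.W P N := by
  have := sigmaU_isHermitian (M := M) (P := P) N
  rw [Matrix.IsHermitian, conjTranspose_eq_transpose_of_trivial] at this
  rw [W, transpose_nonsing_inv, this]

/-- Bounds for the population quantities. -/
structure PopBounds (M : FactorModel r Ω) (P : Measure Ω) (c : ℝ) : Prop where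
  one_le : 1 ≤ c
  norm_lam : ∀ j, vnorm (M.lam j) ≤ c
  isUnit_S : ∀ N, IsUnit (M.SigmaU P N).det
  norm_S : ∀ N, ‖M.SigmaU P N‖ ≤ c
  norm_W : ∀ N, ‖M.W P N‖ ≤ c
  le_S : ∀ N x, c⁻¹ * (x ⬝ᵥ x) ≤ x ⬝ᵥ (M.SigmaU P N *ᵥ x)
  le_W : ∀ N x, (c ^ 3)⁻¹ * (x ⬝ᵥ x) ≤ x ⬝ᵥ (M.W P N *ᵥ x)
  isUnit_F : IsUnit (M.SigmaF P).det
  norm_F : ‖M.SigmaF P‖ ≤ c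
  norm_F_inv : ‖(M.SigmaF P)⁻¹‖ ≤ c
  isUnit_L : ∀ᶠ N in atTop, IsUnit ((M.scaledLam N)ᵀ * M.scaledLam N).det
  norm_L : ∀ᶠ N in atTop, ‖M.scaledLam N‖ ≤ c
  norm_L_inv : ∀ᶠ N in atTop, ‖((M.scaledLam N)ᵀ * M.scaledLam N)⁻¹‖ ≤ c

lemma scaledLam_transpose_mul (N : ℕ) :
    (M.scaledLam N)ᵀ * M.scaledLam N = (1 / (N : ℝ)) • ((M.Lam N)ᵀ * M.Lam N) := by
  rw [scaledLam, transpose_smul, Matrix.smul_mul, Matrix.mul_smul, smul_smul, ← sq, div_pow,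
    one_pow, Real.sq_sqrt (Nat.cast_nonneg _)]

lemma Regular.exists_popBounds (hM : M.Regular P) (hΛ : M.Pervasive) : ∃ c, M.PopBounds P c := by
  obtain ⟨c₁, hc₁, c₂, hc₂, hU, hl, hF⟩ := hM.bounds
  obtain ⟨a, ha, b, hL⟩ := hΛ
  have hSb := fun N => symm_norm_bounds (sigmaU_isHermitian (M := M) (P := P) N) hc₂
    (b := c₁) (fun x hx => ⟨(hU N x hx).1.le, (hU N x hx).2.le⟩)
  have hFb := symm_norm_bounds (sigmaF_isHermitian (M := M) (P := P)) hc₂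
    (b := c₁) (fun x hx => ⟨(hF x hx).1.le, (hF x hx).2.le⟩)
  have hLH : ∀ N, ((M.scaledLam N)ᵀ * M.scaledLam N).IsHermitian := fun N => by
    rw [Matrix.IsHermitian, conjTranspose_eq_transpose_of_trivial, transpose_mul,
      transpose_transpose]
  have hLb : ∀ᶠ N in atTop, IsUnit ((M.scaledLam N)ᵀ * M.scaledLam N).det ∧
      (0 ≤ |b| → ‖(M.scaledLam N)ᵀ * M.scaledLam N‖ ≤ |b|) ∧
      ‖((M.scaledLam N)ᵀ * M.scaledLam N)⁻¹‖ ≤ 1 / a := by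
    filter_upwards [hL] with N hN
    have := symm_norm_bounds (hLH N) ha (b := |b|) fun x hx => ?_
    · exact ⟨this.1, this.2.1, this.2.2.1⟩
    rw [scaledLam_transpose_mul] at hx
    exact ⟨(hN x hx).1, (hN x hx).2.trans (le_abs_self b)⟩
  set c := 1 + c₁ + 1 / c₂ + 1 / a + |b| with hc
  have p1 : 0 < 1 / c₂ := by positivity
  have p2 : 0 < 1 / a := by positivity
  have p3 := abs_nonneg b
  have hc1 : 1 ≤ c := by linarith
  have hcpos : 0 < c := by linarith
  have hS : ∀ N x, c⁻¹ * (x ⬝ᵥ x) ≤ x ⬝ᵥ (M.SigmaU P N *ᵥ x) := fun N x => by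
    refine le_trans ?_ ((hSb N).2.2.2 x)
    have h0 : 0 ≤ x ⬝ᵥ x := by
      rw [dotProduct]; exact Finset.sum_nonneg fun i _ => mul_self_nonneg _
    refine mul_le_mul_of_nonneg_right ?_ h0
    rw [inv_le_comm₀ hcpos hc₂, inv_eq_one_div]; linarith
  have hSn : ∀ N, ‖M.SigmaU P N‖ ≤ c := fun N => ((hSb N).2.1 hc₁.le).trans (by linarith)
  refine ⟨c, hc1, fun j => (hl j).le.trans (by linarith), fun N => (hSb N).1, hSn,
    fun N => (hSb N).2.2.1.trans (by linarith), hS, fun N x => ?_, hFb.1,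
    (hFb.2.1 hc₁.le).trans (by linarith), hFb.2.2.1.trans (by linarith),
    hLb.mono fun N h => h.1, hLb.mono fun N h => ?_, hLb.mono fun N h => h.2.2.trans (by linarith)⟩
  -- With `x = Σ z` the form `x'Wx` equals `z'Σz`, at least `|z|²/c`, whereas `|x|² ≤ c²|z|²`; hence
  -- the constant `c^(-3)`.
  · set z := M.W P N *ᵥ x with hz
    have hx : M.SigmaU P N *ᵥ z = x := by
      rw [hz, W, Matrix.mulVec_mulVec, Matrix.mul_nonsing_inv _ (hSb N).1, Matrix.one_mulVec]
    have h1 := hS N z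
    rw [hx, dotProduct_comm z x] at h1
    have h2 := sum_sq_mulVec_le (M.SigmaU P N) z
    rw [hx] at h2
    have e : ∀ y : Fin N → ℝ, y ⬝ᵥ y = ∑ i, y i ^ 2 := fun y => by simp [dotProduct, sq]
    rw [e] at h1 ⊢
    have h3 : ‖M.SigmaU P N‖ ^ 2 ≤ c ^ 2 := pow_le_pow_left₀ (norm_nonneg _) (hSn N) 2
    have h4 : ∑ i, x i ^ 2 ≤ c ^ 2 * ∑ i, z i ^ 2 :=
      h2.trans (mul_le_mul_of_nonneg_right h3 (by positivity))
    refine le_trans ?_ h1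
    calc (c ^ 3)⁻¹ * ∑ i, x i ^ 2 ≤ (c ^ 3)⁻¹ * (c ^ 2 * ∑ i, z i ^ 2) := by gcongr
      _ = _ := by field_simp
  · have h1 := h.2.1 p3
    rw [norm_transpose_mul_self] at h1
    nlinarith [norm_nonneg (M.scaledLam N)]

lemma scaledFactor_transpose_mul (T : ℕ) (ω : Ω) (k l : Fin r) :
    ((M.scaledFactor T ω)ᵀ * M.scaledFactor T ω) k l
      = 1 / (T : ℝ) * ∑ t ∈ Finset.range T, M.f k t ω * M.f l t ω := by
  have hT2 : √(T : ℝ) * √(T : ℝ) = T := Real.mul_self_sqrt (Nat.cast_nonneg _)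
  simp only [Matrix.mul_apply, transpose_apply, scaledFactor, Matrix.of_apply]
  rw [Finset.mul_sum, ← Fin.sum_univ_eq_sum_range (fun t : ℕ =>
    1 / (T : ℝ) * (M.f k (t : ℤ) ω * M.f l (t : ℤ) ω)) T]
  refine Finset.sum_congr rfl fun t _ => ?_
  rw [div_mul_div_comm, hT2]; ring

lemma scaledError_mul_transpose {N T : ℕ} (hN : 0 < N) (hT : 0 < T) (ω : Ω) (i j : Fin N) :
    (N : ℝ) * (M.scaledError N T ω * (M.scaledError N T ω)ᵀ) i j
      = 1 / (T : ℝ) * ∑ t ∈ Finset.range T, M.u i t ω * M.u j t ω := by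
  have hN2 : √(N : ℝ) * √(N : ℝ) = N := Real.mul_self_sqrt (Nat.cast_nonneg _)
  have hT2 : √(T : ℝ) * √(T : ℝ) = T := Real.mul_self_sqrt (Nat.cast_nonneg _)
  have hN' : (N : ℝ) ≠ 0 := by exact_mod_cast hN.ne'
  have hT' : (T : ℝ) ≠ 0 := by exact_mod_cast hT.ne'
  simp only [Matrix.mul_apply, transpose_apply, scaledError, Matrix.of_apply]
  rw [Finset.mul_sum, Finset.mul_sum, ← Fin.sum_univ_eq_sum_range (fun t : ℕ =>
    1 / (T : ℝ) * (M.u i (t : ℤ) ω * M.u j (t : ℤ) ω)) T]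
  refine Finset.sum_congr rfl fun t _ => ?_
  rw [div_mul_div_comm, show √(N : ℝ) * √(T : ℝ) * (√(N : ℝ) * √(T : ℝ))
    = (√(N : ℝ) * √(N : ℝ)) * (√(T : ℝ) * √(T : ℝ)) by ring, hN2, hT2]
  field_simp

lemma scaledError_mul_scaledFactor {N T : ℕ} (hN : 0 < N) (ω : Ω) (i : Fin N) (a : Unit)
    (k : Fin r) : (√(N : ℝ) • rowM (M.scaledError N T ω) i * M.scaledFactor T ω) a k
      = 1 / (T : ℝ) * ∑ t ∈ Finset.range T, M.u i t ω * M.f k t ω := by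
  have hsN : √(N : ℝ) ≠ 0 := (Real.sqrt_pos.2 (by exact_mod_cast hN)).ne'
  have hT2 : √(T : ℝ) * √(T : ℝ) = T := Real.mul_self_sqrt (Nat.cast_nonneg _)
  simp only [Matrix.mul_apply, Matrix.smul_apply, rowM, scaledError, scaledFactor,
    Matrix.of_apply, smul_eq_mul]
  rw [Finset.mul_sum, ← Fin.sum_univ_eq_sum_range (fun t : ℕ =>
    1 / (T : ℝ) * (M.u i (t : ℤ) ω * M.f k (t : ℤ) ω)) T]
  refine Finset.sum_congr rfl fun t _ => ?_
  rw [show 1 / (T : ℝ) = 1 / (√(T : ℝ) * √(T : ℝ)) by rw [hT2]]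
  field_simp

lemma norm_row_scaledLam {N : ℕ} (hN : 0 < N) (i : Fin N) :
    ‖√(N : ℝ) • rowM (M.scaledLam N) i‖ = vnorm (M.lam i) := by
  have hsN : 0 < √(N : ℝ) := Real.sqrt_pos.2 (by exact_mod_cast hN)
  have hv : vnorm (M.lam i) ^ 2 = ∑ k, M.lam i k ^ 2 := Real.sq_sqrt (by positivity)
  have hv0 : 0 ≤ vnorm (M.lam i) := Real.sqrt_nonneg _
  refine (pow_left_inj₀ (norm_nonneg _) hv0 two_ne_zero).1 ?_
  rw [norm_smul, mul_pow, norm_rowM_sq, Real.norm_of_nonneg hsN.le, hv,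
    Real.sq_sqrt (Nat.cast_nonneg N), Finset.mul_sum]
  refine Finset.sum_congr rfl fun k _ => ?_
  simp only [scaledLam, Lam, Matrix.smul_apply, Matrix.of_apply, smul_eq_mul]
  rw [mul_pow, ← mul_assoc, div_pow, one_pow, Real.sq_sqrt (Nat.cast_nonneg N)]
  have : (N : ℝ) ≠ 0 := by exact_mod_cast hN.ne'
  field_simp

lemma PopBounds.mono {c d : ℝ} (h : M.PopBounds P c) (hcd : c ≤ d) : M.PopBounds P d := by
  have hdot : ∀ {n : ℕ} (x : Fin n → ℝ), 0 ≤ x ⬝ᵥ x := fun x => by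
    rw [dotProduct]; exact Finset.sum_nonneg fun i _ => mul_self_nonneg _
  have hc : 0 < c := one_pos.trans_le h.one_le
  refine ⟨h.one_le.trans hcd, fun j => (h.norm_lam j).trans hcd, h.isUnit_S,
    fun N => (h.norm_S N).trans hcd, fun N => (h.norm_W N).trans hcd,
    fun N x => le_trans ?_ (h.le_S N x), fun N x => le_trans ?_ (h.le_W N x), h.isUnit_F,
    h.norm_F.trans hcd, h.norm_F_inv.trans hcd, h.isUnit_L, h.norm_L.mono fun N h => h.trans hcd,
    h.norm_L_inv.mono fun N h => h.trans hcd⟩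
  · have := hdot x
    gcongr
  · have := hdot x
    gcongr

variable (hM : M.Regular P)
include hM

/-- With high probability the scaled data form a good sample. -/
lemma Regular.exists_isSample (hΛ : M.Pervasive) : ∃ c, M.PopBounds P c ∧
    ∀ N T : ℕ → ℕ, PolyGrowth N T → ∀ᶠ x in whp P,
      IsSample c (omegaRate (N x.1) (T x.1)) (M.scaledLam (N x.1)) (M.scaledFactor (T x.1) x.2)
        (M.scaledError (N x.1) (T x.1) x.2) (M.SigmaU P (N x.1)) ∧
      ‖(M.scaledFactor (T x.1) x.2)ᵀ * M.scaledFactor (T x.1) x.2 - M.SigmaF P‖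
        ≤ c * omegaRate (N x.1) (T x.1) := by
  obtain ⟨c₀, h₀⟩ := hM.exists_popBounds hΛ
  obtain ⟨κ, hκ, hdev⟩ := hM.exists_sample_moment_deviation
  -- The constant depends on the model only. The part `2 * c₀` covers the sample factors and their
  -- inverse Gram matrix; `κ * (r + 1)` covers the passage from entries to norms in dimension `r`.
  set c := 2 * c₀ + κ * (r + 1) with hc
  have hr0 : (0 : ℝ) ≤ r := Nat.cast_nonneg r
  have h1c₀ := h₀.one_le
  have p1 : 0 ≤ κ * r := by positivity
  have hcc : c₀ ≤ c := by rw [hc]; nlinarith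
  have hκc : κ ≤ c := by rw [hc]; nlinarith
  have hκrc : κ * r ≤ c := by rw [hc]; nlinarith
  have hκrc' : κ * (r + 1) ≤ c := by rw [hc]; nlinarith
  have h2c : 2 * c₀ ≤ c := by rw [hc]; nlinarith
  clear_value c
  have hc1 : 1 ≤ c := h1c₀.trans hcc
  have hcpos : 0 < c := by linarith
  refine ⟨c, h₀.mono hcc, fun N T hNT => ?_⟩
  have hω := hNT.tendsto_omegaRate
  have hsm : Tendsto (fun n => 64 * c ^ 17 * √(2 * c * omegaRate (N n) (T n))) atTop (𝓝 0) := by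
    have := ((hω.const_mul (2 * c)).sqrt).const_mul (64 * c ^ 17)
    simpa using this
  have hω2 := (hω.const_mul (κ * r * (c₀ + 1)))
  rw [mul_zero] at hω2
  filter_upwards [hdev N T hNT, tendsto_fst_whp.eventually (hsm.eventually (ge_mem_nhds one_pos)),
    tendsto_fst_whp.eventually (hω2.eventually (ge_mem_nhds (by norm_num : (0 : ℝ) < 1 / 2))),
    tendsto_fst_whp.eventually (hNT.tendsto_N.eventually_ge_atTop (r + 1)),
    tendsto_fst_whp.eventually (hNT.tendsto_T.eventually_ge_atTop (r + 1)),
    tendsto_fst_whp.eventually (hNT.tendsto_N.eventually h₀.norm_L),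
    tendsto_fst_whp.eventually (hNT.tendsto_N.eventually h₀.isUnit_L),
    tendsto_fst_whp.eventually (hNT.tendsto_N.eventually h₀.norm_L_inv)]
    with x hx hs hω2 hN hT hL1 hL2 hL3
  obtain ⟨n, ω⟩ := x
  simp only at hx hs hω2 hN hT hL1 hL2 hL3 ⊢
  generalize N n = N, T n = T at *
  set w := omegaRate N T with hw
  have hw0 : 0 ≤ w := omegaRate_nonneg _ _
  have hN0 : 0 < N := by omega
  have hT0 : 0 < T := by omega
  have hT0' : (0 : ℝ) < T := by exact_mod_cast hT0
  have hdev' : ∀ a ∈ compIndex r N, ∀ b ∈ compIndex r N,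
      |1 / (T : ℝ) * ∑ t ∈ Finset.range T, M.comp a t ω * M.comp b t ω
        - ∫ ω, M.comp a 0 ω * M.comp b 0 ω ∂P| ≤ κ * w := by
    intro a ha b hb
    refine le_trans (le_of_eq ?_) ((hx a ha b hb).trans
      (mul_le_mul_of_nonneg_left (logRate_le_omegaRate _ _) hκ.le))
    rw [Finset.sum_sub_distrib, mul_sub]
    simp only [Finset.sum_const, Finset.card_range, nsmul_eq_mul]
    congr 2
    field_simp
  have hXX : ‖(M.scaledFactor T ω)ᵀ * M.scaledFactor T ω - M.SigmaF P‖ ≤ κ * r * w := by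
    have : ∀ k l, |((M.scaledFactor T ω)ᵀ * M.scaledFactor T ω - M.SigmaF P) k l| ≤ κ * w := by
      intro k l
      have h1 := hdev' (Sum.inr k) (inr_mem_compIndex k) (Sum.inr l) (inr_mem_compIndex l)
      rw [Matrix.sub_apply, hM.sigmaF_eq k l 0, scaledFactor_transpose_mul]
      exact h1
    have h2 := norm_le_of_abs_entry_le (by positivity) this
    simp only [Fintype.card_fin, Real.sqrt_mul_self hr0] at h2
    linarith
  have hXX0 : 0 ≤ κ * r * w := by positivity
  have hXX1 : κ * r * w ≤ 1 / 2 := by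
    refine le_trans ?_ hω2
    nlinarith
  obtain ⟨hXu, hXi, -⟩ := inv_perturbation h₀.isUnit_F h₀.norm_F_inv hXX (by nlinarith)
  refine ⟨⟨hc1, hL1.trans hcc, ?_, hL2, hXu, hL3.trans hcc, hXi.trans h2c,
    (h₀.norm_S _).trans hcc, fun i => ?_, fun i j => ?_, fun i => ?_, ?_, hN0, by omega, by omega,
    hs⟩, hXX.trans (by gcongr)⟩
  · have h1 : ‖(M.scaledFactor T ω)ᵀ * M.scaledFactor T ω‖ ≤ c₀ + 1 / 2 := by
      have := norm_add_le ((M.scaledFactor T ω)ᵀ * M.scaledFactor T ω - M.SigmaF P) (M.SigmaF P)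
      rw [sub_add_cancel] at this
      linarith [h₀.norm_F]
    rw [norm_transpose_mul_self] at h1
    have : ‖M.scaledFactor T ω‖ ≤ 2 * c₀ := by nlinarith [norm_nonneg (M.scaledFactor T ω)]
    exact this.trans h2c
  · rw [norm_row_scaledLam hN0]
    exact (h₀.norm_lam i).trans hcc
  · have h1 := hdev' (Sum.inl i) (inl_mem_compIndex.2 i.2) (Sum.inl j) (inl_mem_compIndex.2 j.2)
    rw [hM.sigmaU_eq i j 0, scaledError_mul_transpose hN0 hT0]
    exact h1.trans (by gcongr)
  · have : ∀ a k, |(√(N : ℝ) • rowM (M.scaledError N T ω) i * M.scaledFactor T ω) a k| ≤ κ * w := by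
      intro a k
      have h1 := hdev' (Sum.inl i) (inl_mem_compIndex.2 i.2) (Sum.inr k) (inr_mem_compIndex k)
      have h2 : ∫ ω, M.comp (Sum.inl (i : ℕ)) 0 ω * M.comp (Sum.inr k) 0 ω ∂P = 0 :=
        hM.mean_uf i k 0
      rw [h2, sub_zero] at h1
      rw [scaledError_mul_scaledFactor hN0]
      exact h1
    have h2 := norm_le_of_abs_entry_le (by positivity) this
    simp only [Fintype.card_fin, Fintype.card_unit, Nat.cast_one, one_mul] at h2
    have h3 : √(r : ℝ) ≤ r + 1 := by
      rw [Real.sqrt_le_left (by linarith)]; nlinarith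
    refine h2.trans ?_
    calc √(r : ℝ) * (κ * w) ≤ (r + 1) * (κ * w) := by gcongr
      _ = (κ * (r + 1)) * w := by ring
      _ ≤ c * w := by gcongr
  · rw [hw, omegaRate]
    have := Real.sqrt_nonneg (Real.log N / T)
    linarith

end FactorModel

end SampleMatrices

/-! ### Thresholding -/

section Thresholding

/-- The threshold is at least twice the estimation error. If `σ` vanishes or is below `τ / 2`, the
entry is set to zero and the error is `|σ| = |σ|^(1-q) |σ|^q`; otherwise the error is at most
`3τ/2`, and `τ^q ≤ 2|σ|^q`. The zero case is exact, which is what makes the sparsity measure with `q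
= 0` work. -/
lemma IsThresholding.abs_sub_le {s : ℕ → ℕ → ℝ → ℝ → ℝ} (hs : IsThresholding s) {i j : ℕ}
    {τ η z σ q A : ℝ} (h : |z - σ| ≤ η) (hη : 0 < η) (hητ : 2 * η ≤ τ) (hτA : τ ≤ A)
    (hq : 0 ≤ q) (hq1 : q ≤ 1) :
    |s i j τ z - σ| ≤ 3 * A ^ (1 - q) * (if σ = 0 then 0 else |σ| ^ q) := by
  have hτ : 0 < τ := by linarith
  have hA : 0 < A := hτ.trans_le hτA
  split_ifs with h0
  · rw [h0, sub_zero] at h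
    rw [hs.zero i j τ z hτ (by linarith), h0]
    simp
  have hσ : 0 < |σ| := abs_pos.2 h0
  rcases lt_or_ge |σ| (τ / 2) with hlt | hge
  · have hz : |z| < τ := by
      have : |z| ≤ |z - σ| + |σ| := by simpa using abs_add_le (z - σ) σ
      linarith
    rw [hs.zero i j τ z hτ hz, zero_sub, abs_neg]
    have e : |σ| = |σ| ^ (1 - q) * |σ| ^ q := by
      rw [← Real.rpow_add hσ]; simp
    have h1 : |σ| ^ (1 - q) ≤ A ^ (1 - q) :=
      Real.rpow_le_rpow hσ.le (by linarith) (by linarith)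
    have h2 : 0 ≤ |σ| ^ q := by positivity
    have h3 : 0 ≤ A ^ (1 - q) := by positivity
    calc |σ| = |σ| ^ (1 - q) * |σ| ^ q := e
      _ ≤ A ^ (1 - q) * |σ| ^ q := by gcongr
      _ ≤ _ := by nlinarith [mul_nonneg h3 h2]
  · have h1 : |s i j τ z - σ| ≤ 3 / 2 * τ := by
      have := _root_.abs_sub_le (s i j τ z) z σ
      have := hs.close i j τ z hτ
      linarith
    have e : τ = τ ^ (1 - q) * τ ^ q := by
      rw [← Real.rpow_add hτ]; simp
    have h2 : τ ^ q ≤ 2 * |σ| ^ q := by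
      calc τ ^ q ≤ (2 * |σ|) ^ q := Real.rpow_le_rpow hτ.le (by linarith) hq
        _ = 2 ^ q * |σ| ^ q := Real.mul_rpow (by norm_num) hσ.le
        _ ≤ 2 ^ (1 : ℝ) * |σ| ^ q := by
          gcongr
          norm_num
        _ = _ := by rw [Real.rpow_one]
    have h3 : τ ^ (1 - q) ≤ A ^ (1 - q) := Real.rpow_le_rpow hτ.le hτA (by linarith)
    calc |s i j τ z - σ| ≤ 3 / 2 * (τ ^ (1 - q) * τ ^ q) := by rw [← e]; exact h1
      _ ≤ 3 / 2 * (A ^ (1 - q) * (2 * |σ| ^ q)) := by gcongr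
      _ = _ := by ring

lemma residCov_transpose {r : ℕ} (y : ℕ → ℕ → ℝ) (N T : ℕ) (E : Matrix (Fin N) (Fin r) ℝ) :
    (residCov y N T E)ᵀ = residCov y N T E := by
  simp only [residCov, sampleCov, transpose_sub, transpose_smul, transpose_mul,
    transpose_transpose, diagonal_transpose, Matrix.mul_assoc]

lemma sigmaHat_transpose {r : ℕ} {s : ℕ → ℕ → ℝ → ℝ → ℝ} (hs : IsThresholding s) (C : ℝ)
    (y : ℕ → ℕ → ℝ) (N T : ℕ) (E : Matrix (Fin N) (Fin r) ℝ) :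
    (sigmaHat s C y N T E)ᵀ = sigmaHat s C y N T E := by
  ext i j
  have hR : residCov y N T E j i = residCov y N T E i j := by
    conv_lhs => rw [← residCov_transpose]
    rfl
  simp only [transpose_apply, sigmaHat, Matrix.of_apply]
  rcases eq_or_ne i j with rfl | hij
  · simp
  · rw [if_neg hij, if_neg hij.symm, hs.symm j i, hR, mul_comm (residCov y N T E j j)]

open scoped Matrix.Norms.L2Operator

namespace FactorModel

variable {r : ℕ} {Ω : Type*} [mΩ : MeasurableSpace Ω] {P : Measure Ω} [IsProbabilityMeasure P]
  {M : FactorModel r Ω}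

lemma sum_le_sparsity (q : ℝ) {N : ℕ} (i : Fin N) :
    ∑ j : Fin N, (if M.SigmaU P N i j = 0 then 0 else |M.SigmaU P N i j| ^ q)
      ≤ M.sparsity P q N :=
  le_ciSup (f := fun i : Fin N => ∑ j : Fin N,
    if M.SigmaU P N i j = 0 then 0 else |M.SigmaU P N i j| ^ q) (Set.finite_range _).bddAbove i

lemma sparsity_nonneg (q : ℝ) (N : ℕ) : 0 ≤ M.sparsity P q N :=
  Real.iSup_nonneg fun i => Finset.sum_nonneg fun j _ => by split_ifs <;> positivity

lemma PopBounds.diag_bounds {c : ℝ} (h : M.PopBounds P c) {N : ℕ} (i : Fin N) :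
    c⁻¹ ≤ M.SigmaU P N i i ∧ M.SigmaU P N i i ≤ c := by
  refine ⟨?_, (le_abs_self _).trans ((abs_entry_le _ i i).trans (h.norm_S N))⟩
  have := h.le_S N (Pi.single i 1)
  simpa using this

/-- The thresholded covariance estimator is close to the error covariance matrix as soon as the
residual covariances are uniformly close. -/
lemma PopBounds.norm_sigmaHat_sub_le {c : ℝ} (h : M.PopBounds P c) {s : ℕ → ℕ → ℝ → ℝ → ℝ}
    (hs : IsThresholding s) {C κ q : ℝ} {y : ℕ → ℕ → ℝ} {N T : ℕ} {E : Matrix (Fin N) (Fin r) ℝ}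
    (hκ : 0 < κ) (hω : 0 < omegaRate N T) (hC : 4 * c * κ ≤ C)
    (hκω : κ * omegaRate N T ≤ c⁻¹ / 2)
    (hR : ∀ i j, |residCov y N T E i j - M.SigmaU P N i j| ≤ κ * omegaRate N T)
    (hq : 0 ≤ q) (hq1 : q ≤ 1) :
    ‖sigmaHat s C y N T E - M.SigmaU P N‖
      ≤ 3 * (2 * c * C * omegaRate N T) ^ (1 - q) * M.sparsity P q N := by
  have hc := one_pos.trans_le h.one_le
  have hC0 : 0 < C := lt_of_lt_of_le (by positivity) hC
  set ω := omegaRate N T with hωdef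
  set R := residCov y N T E with hRdef
  have hsp := sparsity_nonneg (M := M) (P := P) q N
  have hdiag : ∀ i, c⁻¹ / 2 ≤ R i i ∧ R i i ≤ 2 * c := fun i => by
    obtain ⟨h1, h2⟩ := h.diag_bounds i
    obtain ⟨h3, h4⟩ := abs_le.1 (hR i i)
    have h5 : c⁻¹ ≤ 1 := inv_le_one_of_one_le₀ h.one_le
    have := h.one_le
    exact ⟨by linarith, by linarith⟩
  have hsymm : (sigmaHat s C y N T E - M.SigmaU P N)ᵀ = sigmaHat s C y N T E - M.SigmaU P N := by
    have := sigmaU_isHermitian (M := M) (P := P) N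
    rw [Matrix.IsHermitian, conjTranspose_eq_transpose_of_trivial] at this
    rw [transpose_sub, sigmaHat_transpose hs, this]
  refine norm_le_of_row_sum_le hsymm (by positivity) fun i => ?_
  refine le_trans ?_ (mul_le_mul_of_nonneg_left (sum_le_sparsity (M := M) (P := P) q i)
    (by positivity))
  rw [Finset.mul_sum]
  refine Finset.sum_le_sum fun j _ => ?_
  have hη : 0 < κ * ω := by positivity
  have hci : 0 < c⁻¹ := by positivity
  simp only [Matrix.sub_apply, sigmaHat, Matrix.of_apply, ← hRdef]
  split_ifs with hij h0 h0
  · subst hij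
    have := (h.diag_bounds i).1
    rw [h0] at this
    exact absurd this (not_le.2 hci)
  -- Diagonal entries are not thresholded. As variances are bounded below, their error obeys the
  -- same form of bound.
  · subst hij
    have h1 := (h.diag_bounds i).1
    have h2 : κ * ω ≤ |M.SigmaU P N i i| := by
      rw [abs_of_pos (hci.trans_le h1)]; linarith
    have h3 : κ * ω ≤ 2 * c * C * ω := by
      have h1 := h.one_le
      have : κ ≤ 2 * c * C := by nlinarith
      gcongr
    have e : κ * ω = (κ * ω) ^ (1 - q) * (κ * ω) ^ q := by
      rw [← Real.rpow_add hη]; simp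
    refine (hR i i).trans ?_
    have a1 : (κ * ω) ^ (1 - q) ≤ (2 * c * C * ω) ^ (1 - q) :=
      Real.rpow_le_rpow hη.le h3 (by linarith)
    have a2 : (κ * ω) ^ q ≤ |M.SigmaU P N i i| ^ q := Real.rpow_le_rpow hη.le h2 hq
    calc κ * ω = (κ * ω) ^ (1 - q) * (κ * ω) ^ q := e
      _ ≤ (2 * c * C * ω) ^ (1 - q) * |M.SigmaU P N i i| ^ q := by gcongr
      _ ≤ _ := by
        have : 0 ≤ (2 * c * C * ω) ^ (1 - q) * |M.SigmaU P N i i| ^ q := by positivity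
        linarith
  all_goals
    -- The scale factor in the threshold lies between `c⁻¹ / 2` and `2c`. So `C ≥ 4cκ` makes the
    -- threshold at least twice the error `κ ω`, and it is at most `2cCω`.
    have hl : c⁻¹ / 2 ≤ √(R i i * R j j) := by
      rw [← Real.sqrt_mul_self (show 0 ≤ c⁻¹ / 2 by positivity)]
      exact Real.sqrt_le_sqrt (mul_le_mul (hdiag i).1 (hdiag j).1 (by positivity)
        (le_trans (by positivity) (hdiag i).1))
    have hu : √(R i i * R j j) ≤ 2 * c := by
      rw [← Real.sqrt_mul_self (show 0 ≤ 2 * c by positivity)]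
      exact Real.sqrt_le_sqrt (mul_le_mul (hdiag i).2 (hdiag j).2
        (le_trans (by positivity) (hdiag j).1) (by positivity))
    have hkey := hs.abs_sub_le (i := i) (j := j) (τ := C * √(R i i * R j j) * ω) (η := κ * ω)
      (A := 2 * c * C * ω) (q := q) (hR i j) hη ?_ ?_ hq hq1
    · simpa [h0] using hkey
    · have : 2 * κ ≤ C * √(R i i * R j j) := by
        calc 2 * κ = 4 * c * κ * (c⁻¹ / 2) := by field_simp; ring
          _ ≤ C * √(R i i * R j j) := by gcongr
      nlinarith
    · have : C * √(R i i * R j j) ≤ C * (2 * c) := by gcongr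
      nlinarith

/-- Properties of the estimated weight matrix. -/
lemma PopBounds.inv_estimate {c : ℝ} (h : M.PopBounds P c) {N : ℕ} {S : Matrix (Fin N) (Fin N) ℝ}
    (hS : Sᵀ = S) {ε : ℝ} (hε : ‖S - M.SigmaU P N‖ ≤ ε) (hsmall : 4 * c ^ 5 * ε ≤ 1) :
    (S⁻¹)ᵀ = S⁻¹ ∧ ‖S⁻¹‖ ≤ 2 * c ∧ ‖S⁻¹ - M.W P N‖ ≤ 2 * c ^ 2 * ε ∧
      ∀ x, (2 * c ^ 3)⁻¹ * (x ⬝ᵥ x) ≤ x ⬝ᵥ (S⁻¹ *ᵥ x) := by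
  have hc1 := h.one_le
  have hc := one_pos.trans_le hc1
  have hε0 : 0 ≤ ε := (norm_nonneg _).trans hε
  have h1 : c * ε ≤ c ^ 5 * ε := by
    have := pow_le_pow_right₀ hc1 (show 1 ≤ 5 by norm_num)
    rw [pow_one] at this
    gcongr
  obtain ⟨-, hn, hd⟩ := inv_perturbation (h.isUnit_S N) (h.norm_W N) hε (by linarith)
  refine ⟨by rw [transpose_nonsing_inv, hS], hn, hd, fun x => ?_⟩
  have h2 := abs_dotProduct_mulVec_le (S⁻¹ - M.W P N) x
  have h3 := h.le_W N x
  have hx : 0 ≤ x ⬝ᵥ x := by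
    rw [dotProduct]; exact Finset.sum_nonneg fun i _ => mul_self_nonneg _
  -- The smallness assumption is exactly that the error of the inverse is at most half of the lower
  -- bound `c^(-3)` for the true weight.
  have h4 : ‖S⁻¹ - M.W P N‖ * (x ⬝ᵥ x) ≤ (2 * c ^ 3)⁻¹ * (x ⬝ᵥ x) := by
    refine mul_le_mul_of_nonneg_right (hd.trans ?_) hx
    rw [← one_div, le_div_iff₀ (by positivity)]
    linarith
  rw [Matrix.sub_mulVec, dotProduct_sub] at h2
  have h5 := (abs_le.1 h2).1
  have h6 : (c ^ 3)⁻¹ * (x ⬝ᵥ x) = 2 * ((2 * c ^ 3)⁻¹ * (x ⬝ᵥ x)) := by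
    field_simp
  linarith

/-- The error of the thresholded covariance estimator tends to zero fast enough. -/
lemma tendsto_threshold_error {N T : ℕ → ℕ} {q : ℝ} (a : ℝ) (ha : 0 ≤ a)
    (h : Tendsto (fun n => √(N n : ℝ) * M.sparsity P q (N n) ^ 2
        * omegaRate (N n) (T n) ^ (2 - 2 * q)) atTop (𝓝 0)) :
    Tendsto (fun n => (N n : ℝ) ^ (1 / 4 : ℝ) *
      (3 * (a * omegaRate (N n) (T n)) ^ (1 - q) * M.sparsity P q (N n))) atTop (𝓝 0) := by
  -- The hypothesis is, up to a constant, the square of the claim.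
  have h1 := (h.sqrt).const_mul (3 * a ^ (1 - q))
  rw [Real.sqrt_zero, mul_zero] at h1
  refine h1.congr fun n => ?_
  have hω := omegaRate_nonneg (N n) (T n)
  have hsp := sparsity_nonneg (M := M) (P := P) q (N n)
  have hN : (0 : ℝ) ≤ N n := Nat.cast_nonneg _
  have e1 : (N n : ℝ) ^ (1 / 4 : ℝ) = √(√(N n : ℝ)) := by
    rw [Real.sqrt_eq_rpow, Real.sqrt_eq_rpow, ← Real.rpow_mul hN]; norm_num
  have e2 : omegaRate (N n) (T n) ^ (2 - 2 * q) = (omegaRate (N n) (T n) ^ (1 - q)) ^ 2 := by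
    rw [← Real.rpow_natCast, ← Real.rpow_mul hω]
    congr 1; push_cast; ring
  rw [Real.mul_rpow ha hω, e1, e2, Real.sqrt_mul (by positivity), Real.sqrt_mul (by positivity),
    Real.sqrt_sq hsp, Real.sqrt_sq (by positivity)]
  ring

end FactorModel

end Thresholding

/-! ### Weighted principal components with an estimated weight matrix -/

section WeightedPC

open scoped Matrix.Norms.L2Operator

/-- A sample on which the principal components with weight matrix `W` are accurate up to `δ`. -/
structure IsPCSample {N T r : ℕ} (c δ : ℝ) (L : Matrix (Fin N) (Fin r) ℝ)
    (X : Matrix (Fin T) (Fin r) ℝ) (U : Matrix (Fin N) (Fin T) ℝ) (W : Matrix (Fin N) (Fin N) ℝ)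
    (Z : Matrix (Fin T) (Fin r) ℝ) (v : Fin r → ℝ) (S : Matrix (Fin r) (Fin r) ℝ) : Prop
    extends IsApproxPC c L X U W Z v where
  cross : ‖Uᵀ * W * L‖ ≤ c * δ
  norm_U_sq : ‖U‖ ^ 2 ≤ c * δ
  cov : ‖Xᵀ * X - S‖ ≤ c * δ
  small : 4 * c ^ 3 * δ ≤ 1
  anti : Antitone v

namespace IsPCSample

variable {N T r : ℕ} {c δ : ℝ} {L : Matrix (Fin N) (Fin r) ℝ}
    {X : Matrix (Fin T) (Fin r) ℝ} {U : Matrix (Fin N) (Fin T) ℝ} {W : Matrix (Fin N) (Fin N) ℝ}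
    {Z : Matrix (Fin T) (Fin r) ℝ} {v : Fin r → ℝ} {S : Matrix (Fin r) (Fin r) ℝ}

section

variable (h : IsPCSample c δ L X U W Z v S)
include h

lemma delta_nonneg : 0 ≤ δ := by
  have := (norm_nonneg _).trans h.cross
  exact nonneg_of_mul_nonneg_right this h.c_pos

lemma norm_pcErr_le : ‖pcErr L X U W Z v‖ ≤ 2 * c ^ 3 * δ := by
  refine h.norm_pcErr.trans ?_
  have := h.cross
  have := h.norm_U_sq
  have := h.c_pos
  calc _ ≤ c ^ 2 * (c * δ + c * δ) := by gcongr
    _ = _ := by ring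

lemma norm_pcErr_le_half : ‖pcErr L X U W Z v‖ ≤ 1 / 2 := by
  have := h.norm_pcErr_le; have := h.small; linarith

lemma isUnit_H : IsUnit (Zᵀ * X).det := (h.rotation h.norm_pcErr_le_half).1

lemma norm_BH : ‖(rotB L X U W Z v)ᵀ * (Zᵀ * X) - 1‖ ≤ 8 * c ^ 9 * δ := by
  have := (h.rotation h.norm_pcErr_le_half).2.2.1
  have hc := h.c_pos
  calc _ ≤ 4 * c ^ 6 * (2 * c ^ 3 * δ) := this.trans (by gcongr; exact h.norm_pcErr_le)
    _ = _ := by ring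

lemma norm_X_sub : ‖X - Z * (Zᵀ * X)‖ ≤ 10 * c ^ 10 * δ := by
  have := (h.rotation h.norm_pcErr_le_half).2.2.2
  have hc := h.c_pos
  calc _ ≤ 5 * c ^ 7 * (2 * c ^ 3 * δ) := this.trans (by gcongr; exact h.norm_pcErr_le)
    _ = _ := by ring

/-- `HᵀH` is the Gram matrix of the projection of `X` on the estimated factors, and `X` is close to
its projection. -/
lemma norm_HH : ‖(Zᵀ * X)ᵀ * (Zᵀ * X) - S‖ ≤ 11 * c ^ 11 * δ := by
  have e : (Zᵀ * X)ᵀ * (Zᵀ * X) - S = (Xᵀ * X - S) - Xᵀ * (X - Z * (Zᵀ * X)) := by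
    simp only [transpose_mul, transpose_transpose, Matrix.mul_sub, Matrix.mul_assoc]
    abel
  rw [e]
  refine (norm_sub_le _ _).trans ?_
  have h1 := l2_norm_mul_le_of_le ((l2_norm_transpose X).trans_le h.norm_X) h.norm_X_sub
  have h2 := h.cov
  have h3 := pow_le_pow_right₀ h.one_le (show 1 ≤ 11 by norm_num)
  rw [pow_one] at h3
  have h4 := h.delta_nonneg
  have h5 := mul_le_mul_of_nonneg_right h3 h4
  linarith

lemma YZ_eq : (L * Xᵀ + U) * Z = L * (Zᵀ * X)ᵀ + U * Z := by
  simp only [transpose_mul, transpose_transpose, Matrix.add_mul, Matrix.mul_assoc]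

/-- Multiply the eigenvalue equation by `Zᵀ`. In terms of the estimators this says that the weighted
Gram matrix of the estimated loadings is exactly the matrix of eigenvalues. -/
lemma diagonal_eq : diagonal v = ((L * Xᵀ + U) * Z)ᵀ * W * ((L * Xᵀ + U) * Z) := by
  have : ((L * Xᵀ + U) * Z)ᵀ * W * ((L * Xᵀ + U) * Z)
      = Zᵀ * ((L * Xᵀ + U)ᵀ * W * (L * Xᵀ + U) * Z) := by
    simp only [transpose_mul, Matrix.mul_assoc]
  rw [this, h.eigen, ← Matrix.mul_assoc, h.orth, Matrix.one_mul]

/-- Insert `Y Z = L Hᵀ + U Z` in the formula for the eigenvalues: two cross terms with `U'WL` and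
one term with `U'WU` remain. -/
lemma norm_diagonal_sub :
    ‖diagonal v - Zᵀ * X * (Lᵀ * W * L) * (Zᵀ * X)ᵀ‖ ≤ 3 * c ^ 2 * δ := by
  set H := Zᵀ * X with hH
  have e : diagonal v - H * (Lᵀ * W * L) * Hᵀ
      = H * (Uᵀ * W * L)ᵀ * Z + Zᵀ * (Uᵀ * W * L) * Hᵀ + Zᵀ * (Uᵀ * W * U) * Z := by
    rw [h.diagonal_eq, h.YZ_eq, ← hH]
    simp only [transpose_add, transpose_mul, transpose_transpose, h.symm, Matrix.add_mul,
      Matrix.mul_add, Matrix.mul_assoc]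
    abel
  rw [e]
  have hZ := h.norm_Z
  have hZ' := (l2_norm_transpose Z).trans_le hZ
  have hHn := h.norm_H
  have hHn' := (l2_norm_transpose H).trans_le hHn
  have a1 := l2_norm_mul_le_of_le (l2_norm_mul_le_of_le hHn ((l2_norm_transpose _).trans_le h.cross)) hZ
  have a2 := l2_norm_mul_le_of_le (l2_norm_mul_le_of_le hZ' h.cross) hHn'
  have a3 := l2_norm_mul_le_of_le (l2_norm_mul_le_of_le hZ'
    (l2_norm_mul_le_of_le (l2_norm_mul_le_of_le (l2_norm_transpose U).le h.norm_W)
      (le_refl ‖U‖))) hZ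
  have a4 : 1 * (‖U‖ * c * ‖U‖) * 1 ≤ c * (c * δ) := by
    calc _ = c * ‖U‖ ^ 2 := by ring
      _ ≤ _ := mul_le_mul_of_nonneg_left h.norm_U_sq h.c_pos.le
  refine (norm_add₃_le).trans ?_
  linarith

end

end IsPCSample

lemma IsTopEigenvectors.of_smul {m : Type*} [Fintype m] [DecidableEq m] {r : ℕ}
    {A : Matrix m m ℝ} {U : Matrix m (Fin r) ℝ} {c : ℝ} (hA : A.IsHermitian) (hc : 0 < c)
    (hr : r ≤ Fintype.card m) (h : IsTopEigenvectors (c • A) U) : IsTopEigenvectors A U := by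
  refine ⟨h.orthonormal, fun k => ?_⟩
  have := h.eigen k
  rw [eigDesc_smul hA hc.le (k.2.trans_le hr), smul_mulVec, mul_smul] at this
  exact smul_right_injective _ hc.ne' this

namespace FactorModel

variable {r : ℕ} {Ω : Type*} [mΩ : MeasurableSpace Ω] {P : Measure Ω} [IsProbabilityMeasure P]
  {M : FactorModel r Ω}

/-- Second moments of linear combinations of the errors. -/
lemma Regular.integral_sq_sum_u (hM : M.Regular P) {N : ℕ} (a : Fin N → ℝ) (t : ℤ) :
    Integrable (fun ω => (∑ i, a i * M.u i t ω) ^ 2) P ∧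
      ∫ ω, (∑ i, a i * M.u i t ω) ^ 2 ∂P = a ⬝ᵥ (M.SigmaU P N *ᵥ a) := by
  have e : (fun ω => (∑ i, a i * M.u i t ω) ^ 2)
      = fun ω => ∑ i, ∑ j, a i * a j * (M.u i t ω * M.u j t ω) := by
    ext ω
    rw [sq, Finset.sum_mul_sum]
    exact Finset.sum_congr rfl fun i _ => Finset.sum_congr rfl fun j _ => by ring
  have hi : ∀ i j : Fin N, Integrable (fun ω => a i * a j * (M.u i t ω * M.u j t ω)) P :=
    fun i j => ((hM.memLp_u i t).integrable_mul (hM.memLp_u j t)).const_mul _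
  rw [e]
  refine ⟨integrable_finsetSum _ fun i _ => integrable_finsetSum _ fun j _ => hi i j, ?_⟩
  rw [integral_finsetSum _ fun i _ => integrable_finsetSum _ fun j _ => hi i j]
  simp only [dotProduct, mulVec, Finset.mul_sum]
  refine Finset.sum_congr rfl fun i _ => ?_
  rw [integral_finsetSum _ fun j _ => hi i j]
  refine Finset.sum_congr rfl fun j _ => ?_
  rw [integral_const_mul, hM.sigmaU_eq i j t]
  ring

/-- The estimated factors scaled by `T ^ (-1/2)`. -/
noncomputable def _root_.scaledHat (T : ℕ) (F : ℕ → Fin r → ℝ) : Matrix (Fin T) (Fin r) ℝ :=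
  Matrix.of fun (t : Fin T) (k : Fin r) => F t k / √(T : ℝ)

/-- The eigenvalues belonging to the estimated factors. -/
noncomputable def pcVal (M : FactorModel r Ω) (N T : ℕ) (ω : Ω) (S : Matrix (Fin N) (Fin N) ℝ) :
    Fin r → ℝ :=
  fun k => eigDesc ((M.scaledData N T ω)ᵀ * S⁻¹ * M.scaledData N T ω) k

lemma dataMat_weighted {N T : ℕ} (hN : 0 < N) (hT : 0 < T) (ω : Ω)
    (S : Matrix (Fin N) (Fin N) ℝ) :
    (dataMat (M.y ω) N T)ᵀ * S⁻¹ * dataMat (M.y ω) N T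
      = ((T : ℝ) * N) • ((M.scaledData N T ω)ᵀ * S⁻¹ * M.scaledData N T ω) := by
  rw [dataMat_eq hN hT, transpose_smul, Matrix.smul_mul, Matrix.smul_mul, Matrix.mul_smul,
    smul_smul]
  congr 1
  have h1 := Real.mul_self_sqrt (Nat.cast_nonneg N : (0 : ℝ) ≤ N)
  have h2 := Real.mul_self_sqrt (Nat.cast_nonneg T : (0 : ℝ) ≤ T)
  rw [show √(N : ℝ) * √(T : ℝ) * (√(N : ℝ) * √(T : ℝ))
    = (√(N : ℝ) * √(N : ℝ)) * (√(T : ℝ) * √(T : ℝ)) by ring, h1, h2, mul_comm]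

lemma vhat_eq {N T : ℕ} (hN : 0 < N) (hT : 0 < T) (ω : Ω) (S : Matrix (Fin N) (Fin N) ℝ) :
    Vhat r (M.y ω) N T S = diagonal (M.pcVal N T ω S) := by
  have hN' : (N : ℝ) ≠ 0 := by exact_mod_cast hN.ne'
  have hT' : (T : ℝ) ≠ 0 := by exact_mod_cast hT.ne'
  rw [Vhat, dataMat_weighted hN hT, smul_smul, one_div_mul_cancel (by positivity), one_smul]
  rfl

/-- The outcome of the first estimation stage: a consistent estimate `S` of the error covariance
matrix, and the resulting weighted principal components `F`. -/
structure FirstStage (M : FactorModel r Ω) (P : Measure Ω) (c : ℝ) (N T : ℕ → ℕ)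
    (S : ∀ n, Ω → Matrix (Fin (N n)) (Fin (N n)) ℝ) (F : ℕ → Ω → ℕ → Fin r → ℝ) : Prop where
  pop : M.PopBounds P c
  growth : PolyGrowth N T
  sample : ∀ᶠ x in whp P,
      IsSample c (omegaRate (N x.1) (T x.1)) (M.scaledLam (N x.1)) (M.scaledFactor (T x.1) x.2)
        (M.scaledError (N x.1) (T x.1) x.2) (M.SigmaU P (N x.1)) ∧
      ‖(M.scaledFactor (T x.1) x.2)ᵀ * M.scaledFactor (T x.1) x.2 - M.SigmaF P‖
        ≤ c * omegaRate (N x.1) (T x.1)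
  weight : ∃ ε : ℕ → ℝ, Tendsto (fun n => (N n : ℝ) ^ (1 / 4 : ℝ) * ε n) atTop (𝓝 0) ∧
    ∀ᶠ x in whp P, (S x.1 x.2)ᵀ = S x.1 x.2 ∧ ‖S x.1 x.2 - M.SigmaU P (N x.1)‖ ≤ ε x.1
  wpc : ∀ᶠ n in atTop, ∀ ω, IsWPC (M.y ω) (N n) (T n) (S n ω) (F n ω)

/-- The rate of convergence of the estimated factors. -/
noncomputable def _root_.pcRate (N T : ℕ) : ℝ := ((min N T : ℕ) : ℝ) ^ (-(19 / 40) : ℝ)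

/-- With the true, nonrandom weight each entry is a linear combination of errors, of variance at
most `c^5 / (NT)`. The `rT` entries give an expected squared Frobenius norm of order `1/N`, and
Markov's inequality applies. -/
lemma Regular.eventually_norm_cross_le (hM : M.Regular P) {c : ℝ} (hP : M.PopBounds P c)
    {N T : ℕ → ℕ} (hNT : PolyGrowth N T) :
    ∀ᶠ x in whp P, ‖(M.scaledError (N x.1) (T x.1) x.2)ᵀ * M.W P (N x.1) * M.scaledLam (N x.1)‖
      ≤ pcRate (N x.1) (T x.1) := by
  have hc := one_pos.trans_le hP.one_le
  set Y : ℕ → Ω → ℝ := fun n ω => ∑ t : Fin (T n), ∑ k : Fin r,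
    ((M.scaledError (N n) (T n) ω)ᵀ * M.W P (N n) * M.scaledLam (N n)) t k ^ 2 with hY
  have hentry : ∀ n ω (t : Fin (T n)) (k : Fin r),
      ((M.scaledError (N n) (T n) ω)ᵀ * M.W P (N n) * M.scaledLam (N n)) t k ^ 2
        = (√(N n : ℝ) * √(T n : ℝ))⁻¹ ^ 2 *
          (∑ i, (M.W P (N n) * M.scaledLam (N n)) i k * M.u i (t : ℕ) ω) ^ 2 := by
    intro n ω t k
    rw [Matrix.mul_assoc, Matrix.mul_apply, ← mul_pow, Finset.mul_sum]
    congr 1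
    refine Finset.sum_congr rfl fun i _ => ?_
    simp only [transpose_apply, scaledError, Matrix.of_apply]
    ring
  have hint : ∀ n, Integrable (Y n) P := fun n => by
    simp only [hY, hentry]
    exact integrable_finsetSum _ fun t _ => integrable_finsetSum _ fun k _ =>
      (hM.integral_sq_sum_u _ _).1.const_mul _
  have hle : ∀ᶠ n in atTop, ∫ ω, Y n ω ∂P ≤ r * c ^ 5 / N n := by
    filter_upwards [hNT.tendsto_N.eventually hP.norm_L, hNT.tendsto_N.eventually_ge_atTop 1,
      hNT.tendsto_T.eventually_ge_atTop 1] with n hL hN hT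
    have hN0 : (0 : ℝ) < N n := by exact_mod_cast hN
    have hT0 : (0 : ℝ) < T n := by exact_mod_cast hT
    simp only [hY, hentry]
    rw [integral_finsetSum _ fun t _ => integrable_finsetSum _ fun k _ =>
      (hM.integral_sq_sum_u _ _).1.const_mul _]
    have hterm : ∀ (t : Fin (T n)) (k : Fin r), ∫ ω, (√(N n : ℝ) * √(T n : ℝ))⁻¹ ^ 2 *
          (∑ i, (M.W P (N n) * M.scaledLam (N n)) i k * M.u i (t : ℕ) ω) ^ 2 ∂P
        ≤ (N n * T n : ℝ)⁻¹ * c ^ 5 := by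
      intro t k
      rw [integral_const_mul, (hM.integral_sq_sum_u _ _).2, inv_pow, mul_pow,
        Real.sq_sqrt hN0.le, Real.sq_sqrt hT0.le]
      refine mul_le_mul_of_nonneg_left ?_ (by positivity)
      refine (le_abs_self _).trans ((abs_dotProduct_mulVec_le _ _).trans ?_)
      have h1 := l2_norm_mul_le_of_le (hP.norm_W (N n)) hL
      have h2 : (fun i => (M.W P (N n) * M.scaledLam (N n)) i k) ⬝ᵥ
          (fun i => (M.W P (N n) * M.scaledLam (N n)) i k) ≤ (c * c) ^ 2 := by
        have := sum_sq_col_le (M.W P (N n) * M.scaledLam (N n)) k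
        refine le_trans (le_of_eq ?_) (this.trans (pow_le_pow_left₀ (norm_nonneg _) h1 2))
        simp [dotProduct, sq]
      calc _ ≤ c * (c * c) ^ 2 := mul_le_mul (hP.norm_S _) h2 (by
            rw [dotProduct]; exact Finset.sum_nonneg fun i _ => mul_self_nonneg _) hc.le
        _ = c ^ 5 := by ring
    calc _ ≤ ∑ t : Fin (T n), ∑ k : Fin r, (N n * T n : ℝ)⁻¹ * c ^ 5 := by
          refine Finset.sum_le_sum fun t _ => ?_
          rw [integral_finsetSum _ fun k _ => (hM.integral_sq_sum_u _ _).1.const_mul _]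
          exact Finset.sum_le_sum fun k _ => hterm t k
      _ = _ := by
          simp
          field_simp
  have hmain := eventually_whp_le_of_integral (P := P) (X := Y)
    (c := fun n => pcRate (N n) (T n) ^ 2)
    (Eventually.of_forall fun n ω => Finset.sum_nonneg fun t _ => Finset.sum_nonneg fun k _ =>
      sq_nonneg _) (Eventually.of_forall hint) ?_ ?_
  · filter_upwards [hmain] with x hx
    have h1 := (norm_sq_le_sum_sq ((M.scaledError (N x.1) (T x.1) x.2)ᵀ * M.W P (N x.1)
      * M.scaledLam (N x.1))).trans hx
    exact le_of_sq_le_sq h1 (by unfold pcRate; positivity)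
  · filter_upwards [hNT.tendsto_min.eventually_ge_atTop 1] with n hn
    have : (0 : ℝ) < (min (N n) (T n) : ℕ) := by exact_mod_cast hn
    unfold pcRate; positivity
  -- The squared rate is `m^(-38/40)` while the expectation is at most of order `m^(-1)`; the
  -- quotient is `m^(-1/20)`.
  · have hlim := (hNT.tendsto_min_rpow (a := 1 / 20) (by norm_num)).const_mul (r * c ^ 5)
    rw [mul_zero] at hlim
    refine squeeze_zero' (Eventually.of_forall fun n => ?_) ?_ hlim
    · exact div_nonneg (integral_nonneg fun ω => Finset.sum_nonneg fun t _ =>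
        Finset.sum_nonneg fun k _ => sq_nonneg _) (sq_nonneg _)
    · filter_upwards [hle, hNT.tendsto_min.eventually_ge_atTop 1] with n hn hm
      have hm0 : (0 : ℝ) < (min (N n) (T n) : ℕ) := by exact_mod_cast hm
      have hmN : ((min (N n) (T n) : ℕ) : ℝ) ≤ N n := by exact_mod_cast min_le_left _ _
      have e1 : pcRate (N n) (T n) ^ 2 = ((min (N n) (T n) : ℕ) : ℝ) ^ (-(38 / 40) : ℝ) := by
        rw [pcRate, ← Real.rpow_natCast, ← Real.rpow_mul hm0.le]; norm_num
      rw [e1, div_le_iff₀ (by positivity), mul_assoc, ← Real.rpow_add hm0]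
      refine hn.trans ?_
      rw [div_eq_mul_inv, show (-(1 / 20) + -(38 / 40) : ℝ) = -1 by norm_num, Real.rpow_neg_one]
      gcongr

/-- The estimated factors are accurate with high probability. -/
lemma FirstStage.exists_isPCSample (hM : M.Regular P) {c : ℝ} {N T : ℕ → ℕ}
    {S : ∀ n, Ω → Matrix (Fin (N n)) (Fin (N n)) ℝ} {F : ℕ → Ω → ℕ → Fin r → ℝ}
    (h : M.FirstStage P c N T S F) : ∃ C, c ≤ C ∧ ∀ᶠ x in whp P,
      IsPCSample C (pcRate (N x.1) (T x.1)) (M.scaledLam (N x.1)) (M.scaledFactor (T x.1) x.2)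
        (M.scaledError (N x.1) (T x.1) x.2) (S x.1 x.2)⁻¹ (scaledHat (T x.1) (F x.1 x.2))
        (M.pcVal (N x.1) (T x.1) x.2 (S x.1 x.2)) (M.SigmaF P) := by
  obtain ⟨ε, hε, hS⟩ := h.weight
  have hP := h.pop
  have hc1 := hP.one_le
  have hc := one_pos.trans_le hc1
  have hNT := h.growth
  -- The estimated weight is bounded below by `(2c³)⁻¹`, and `4c^8 · 2c³ = 8c^11` is the inverse of
  -- the resulting eigenvalue bound.
  set C := 8 * c ^ 11 with hC
  have hcp : ∀ k ≤ 11, c ^ k ≤ c ^ 11 := fun k hk => pow_le_pow_right₀ hc1 hk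
  have hcC : c ≤ C := by have := hcp 1 (by norm_num); rw [pow_one] at this; nlinarith
  have hC0 : 0 < C := by positivity
  have hε0 : Tendsto ε atTop (𝓝 0) := by
    have hn := hε.norm
    rw [norm_zero] at hn
    refine squeeze_zero_norm' ?_ hn
    filter_upwards [hNT.tendsto_N.eventually_ge_atTop 1] with n hn
    have h1 : (1 : ℝ) ≤ (N n : ℝ) ^ (1 / 4 : ℝ) :=
      Real.one_le_rpow (by exact_mod_cast hn) (by norm_num)
    rw [norm_mul, Real.norm_of_nonneg (by linarith : 0 ≤ (N n : ℝ) ^ (1 / 4 : ℝ))]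
    nlinarith [norm_nonneg (ε n)]
  have hsm1 := hε0.const_mul (4 * c ^ 5)
  have hsm2 := (hNT.tendsto_min_rpow (a := 19 / 40) (by norm_num)).const_mul (4 * C ^ 3)
  rw [mul_zero] at hsm1 hsm2
  refine ⟨C, hcC, ?_⟩
  filter_upwards [h.sample, hS, hM.eventually_norm_cross_le hP hNT, eventually_whp_of_forall h.wpc,
    tendsto_fst_whp.eventually hNT.omegaRate_le,
    tendsto_fst_whp.eventually (hsm1.eventually (ge_mem_nhds one_pos)),
    tendsto_fst_whp.eventually (hsm2.eventually (ge_mem_nhds one_pos)),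
    tendsto_fst_whp.eventually (hε.eventually (ge_mem_nhds one_pos)),
    tendsto_fst_whp.eventually (hNT.tendsto_T.eventually_ge_atTop (r + 1)),
    tendsto_fst_whp.eventually (hNT.tendsto_min.eventually_ge_atTop 1)]
    with x hs hSx hcross hwpc hω he hδ hNε hT hm
  obtain ⟨n, ω⟩ := x
  simp only at hs hSx hcross hwpc hω he hδ hNε hT hm ⊢
  change 4 * C ^ 3 * pcRate (N n) (T n) ≤ 1 at hδ
  change omegaRate (N n) (T n) ≤ pcRate (N n) (T n) at hω
  obtain ⟨hs, hcov⟩ := hs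
  obtain ⟨hWt, hWn, hWd, hWl⟩ := hP.inv_estimate hSx.1 hSx.2 he
  set δ := pcRate (N n) (T n) with hδdef
  set w := omegaRate (N n) (T n) with hw
  have hw0 := hs.omega_pos
  have hδ0 : 0 ≤ δ := hw0.le.trans hω
  have hherm : ((M.scaledData (N n) (T n) ω)ᵀ * (S n ω)⁻¹ * M.scaledData (N n) (T n) ω).IsHermitian := by
    rw [Matrix.IsHermitian, conjTranspose_eq_transpose_of_trivial, transpose_mul, transpose_mul,
      transpose_transpose, hWt, Matrix.mul_assoc]
  have htop : IsTopEigenvectors ((M.scaledData (N n) (T n) ω)ᵀ * (S n ω)⁻¹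
      * M.scaledData (N n) (T n) ω) (scaledHat (T n) (F n ω)) := by
    have hT0 : (0 : ℝ) < T n := by exact_mod_cast (by omega : 0 < T n)
    have hN0 : (0 : ℝ) < N n := by exact_mod_cast hs.pos
    refine IsTopEigenvectors.of_smul (c := (T n : ℝ) * N n) hherm (by positivity)
      (by simpa using hs.le_T) ?_
    rw [← dataMat_weighted hs.pos (by omega)]
    exact hwpc
  refine ⟨hs.isApproxPC hWt (w := (2 * c ^ 3)⁻¹) (by positivity) hWl hcC (hWn.trans ?_) ?_ htop,
    ?_, ?_, hcov.trans (by gcongr), hδ, fun i j hij => ?_⟩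
  · have := hcp 1 (by norm_num); rw [pow_one] at this; nlinarith
  · rw [div_inv_eq_mul]
    exact le_of_eq (by ring)
  · set U := M.scaledError (N n) (T n) ω
    set L := M.scaledLam (N n)
    -- The cross term with the true weight is already controlled. The rest is bounded by `‖U‖`, of
    -- order `m^(-19/80)`, times the weight error, at most `m^(-1/4)`; the exponents add up to
    -- `-39/80`, just below `-19/40`. This is where the rate `o(N^(-1/4))` of the weight is needed.
    have e : Uᵀ * (S n ω)⁻¹ * L = Uᵀ * M.W P (N n) * L + Uᵀ * ((S n ω)⁻¹ - M.W P (N n)) * L := by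
      rw [Matrix.mul_sub, Matrix.sub_mul]; abel
    rw [e]
    have h1 : ‖Uᵀ * ((S n ω)⁻¹ - M.W P (N n)) * L‖ ≤ √(2 * c * w) * (2 * c ^ 2 * ε n) * c :=
      l2_norm_mul_le_of_le (l2_norm_mul_le_of_le ((l2_norm_transpose U).trans_le hs.norm_U) hWd)
        hs.norm_L
    have hm0 : (0 : ℝ) < ((min (N n) (T n) : ℕ) : ℝ) := by exact_mod_cast hm
    set m : ℝ := ((min (N n) (T n) : ℕ) : ℝ) with hmdef
    have hε0 : 0 ≤ ε n := (norm_nonneg _).trans hSx.2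
    have h2 : ε n ≤ m ^ (-(1 / 4) : ℝ) := by
      have h3 : m ^ (1 / 4 : ℝ) ≤ (N n : ℝ) ^ (1 / 4 : ℝ) :=
        Real.rpow_le_rpow hm0.le (by rw [hmdef]; exact_mod_cast min_le_left _ _) (by norm_num)
      rw [Real.rpow_neg hm0.le, ← one_div, le_div_iff₀ (by positivity)]
      nlinarith
    have h3 : √(2 * c * w) ≤ 2 * c * m ^ (-(19 / 80) : ℝ) := by
      rw [Real.sqrt_le_left (by positivity)]
      have e1 : (m ^ (-(19 / 80) : ℝ)) ^ 2 = δ := by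
        rw [hδdef, pcRate, ← Real.rpow_natCast, ← Real.rpow_mul hm0.le, ← hmdef]
        congr 1; norm_num
      rw [mul_pow, e1]
      calc 2 * c * w ≤ 2 * c * δ := by gcongr
        _ ≤ (2 * c) ^ 2 * δ := by gcongr; nlinarith
    have h4 : √(2 * c * w) * (2 * c ^ 2 * ε n) * c ≤ 4 * c ^ 4 * δ := by
      calc _ ≤ 2 * c * m ^ (-(19 / 80) : ℝ) * (2 * c ^ 2 * m ^ (-(1 / 4) : ℝ)) * c := by gcongr
        _ = 4 * c ^ 4 * (m ^ (-(19 / 80) : ℝ) * m ^ (-(1 / 4) : ℝ)) := by ring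
        _ ≤ 4 * c ^ 4 * δ := by
          rw [← Real.rpow_add hm0, hδdef, pcRate]
          gcongr
          · rw [hmdef]; exact_mod_cast hm
          · norm_num
    refine (norm_add_le _ _).trans ?_
    have h5 := hcp 4 (by norm_num)
    have h6 : (1 : ℝ) ≤ c ^ 11 := one_le_pow₀ hc1
    have h7 : δ + 4 * c ^ 4 * δ ≤ C * δ := by
      rw [hC]; nlinarith
    linarith
  · have h1 := pow_le_pow_left₀ (norm_nonneg _) hs.norm_U 2
    rw [hs.sq_sqrt] at h1
    refine h1.trans ?_
    have := hcp 1 (by norm_num)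
    rw [pow_one] at this
    have : 2 * c ≤ C := by nlinarith
    gcongr
  · exact eigDesc_antitone hherm hij (by simpa using j.2.trans_le hs.le_T)

end FactorModel

end WeightedPC

/-! ### Growth of the sample sizes and success of the first stage. -/

section FirstStageProof

open scoped Matrix.Norms.L2Operator

/-- As `q ≥ 0`, the exponent `1/(2-2q)` is at least `1/2`, and `log N ≥ 1` from `N = 3` on; hence
`√N ≤ T` eventually. -/
lemma PolyGrowth.of_isLittleO {N T : ℕ → ℕ} {q : ℝ} (hN : Tendsto N atTop atTop)
    (hT : Tendsto T atTop atTop) (hq : 0 ≤ q) (hq1 : q < 1 / 2)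
    (h1 : (fun n => (N n : ℝ) ^ (1 / (2 - 2 * q)) * Real.log (N n)) =o[atTop]
        (fun n => (T n : ℝ)))
    (h2 : (fun n => (T n : ℝ)) =o[atTop] (fun n => (N n : ℝ) ^ 2)) : PolyGrowth N T := by
  refine ⟨hN, hT, ?_, ?_⟩
  · filter_upwards [h1.bound one_pos, hN.eventually_ge_atTop 3] with n hn h3
    have hN3 : (3 : ℝ) ≤ N n := by exact_mod_cast h3
    have hlog : 1 ≤ Real.log (N n) := by
      rw [Real.le_log_iff_exp_le (by linarith)]
      exact Real.exp_one_lt_three.le.trans hN3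
    have hpow : √(N n : ℝ) ≤ (N n : ℝ) ^ (1 / (2 - 2 * q)) := by
      rw [Real.sqrt_eq_rpow]
      refine Real.rpow_le_rpow_of_exponent_le (by linarith) ?_
      exact one_div_le_one_div_of_le (by linarith) (by linarith)
    have h0 : 0 ≤ √(N n : ℝ) := Real.sqrt_nonneg _
    rw [Real.norm_of_nonneg (by nlinarith), Real.norm_of_nonneg (Nat.cast_nonneg _), one_mul] at hn
    have h4 : √(N n : ℝ) ≤ T n := by nlinarith
    have h5 := pow_le_pow_left₀ h0 h4 2
    rw [Real.sq_sqrt (Nat.cast_nonneg _)] at h5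
    exact_mod_cast h5
  · filter_upwards [h2.bound one_pos] with n hn
    rw [Real.norm_of_nonneg (Nat.cast_nonneg _), Real.norm_of_nonneg (by positivity), one_mul] at hn
    exact_mod_cast hn

namespace FactorModel

variable {r : ℕ} {Ω : Type*} [mΩ : MeasurableSpace Ω] {P : Measure Ω} [IsProbabilityMeasure P]
  {M : FactorModel r Ω}

lemma abs_residCov_sub_le {c w : ℝ} {N T : ℕ} {ω : Ω} {E : Matrix (Fin N) (Fin r) ℝ} (hT : 0 < T)
    (h : IsSample c w (M.scaledLam N) (M.scaledFactor T ω) (M.scaledError N T ω) (M.SigmaU P N))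
    (hE : IsTopEigenvectors (sampleCov (M.y ω) N T) E) (i j : Fin N) :
    |residCov (M.y ω) N T E i j - M.SigmaU P N i j| ≤ 1000 * (4 * c ^ 8) ^ 23 * w := by
  have hN0 : (0 : ℝ) < N := by exact_mod_cast h.pos
  have hherm : (M.scaledData N T ω * (M.scaledData N T ω)ᵀ).IsHermitian := by
    rw [Matrix.IsHermitian, conjTranspose_eq_transpose_of_trivial, transpose_mul,
      transpose_transpose]
  rw [sampleCov_eq h.pos hT] at hE
  have hE' := hE.of_smul hherm hN0 (by simpa using h.le_N)
  refine le_trans (le_of_eq ?_) (h.abs_resid_cov_sub_le hE' i j)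
  congr 2
  have e : (fun k : Fin r => eigDesc ((N : ℝ) • (M.scaledData N T ω * (M.scaledData N T ω)ᵀ)) k)
      = (N : ℝ) • fun k : Fin r => eigDesc (M.scaledData N T ω * (M.scaledData N T ω)ᵀ) k := by
    ext k
    exact eigDesc_smul hherm hN0.le (by simpa using k.2.trans_le h.le_N)
  rw [residCov, sampleCov_eq h.pos hT, e, diagonal_smul, Matrix.mul_smul, Matrix.smul_mul,
    ← smul_sub, Matrix.smul_apply, smul_eq_mul]
  rfl

/-- The first stage succeeds if the threshold constant is large enough. -/
lemma Regular.exists_firstStage (hM : M.Regular P) (hΛ : M.Pervasive) : ∃ c, ∃ C₀ > 0, ∀ C ≥ C₀,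
    ∀ s : ℕ → ℕ → ℝ → ℝ → ℝ, IsThresholding s → ∀ (N T : ℕ → ℕ) (q : ℝ), PolyGrowth N T → 0 ≤ q →
      q ≤ 1 → Tendsto (fun n => √(N n : ℝ) * M.sparsity P q (N n) ^ 2
        * omegaRate (N n) (T n) ^ (2 - 2 * q)) atTop (𝓝 0) →
      ∀ (E : ∀ n, Ω → Matrix (Fin (N n)) (Fin r) ℝ) (F : ℕ → Ω → ℕ → Fin r → ℝ)
        (S : ∀ n, Ω → Matrix (Fin (N n)) (Fin (N n)) ℝ),
      (∀ᶠ n in atTop, ∀ ω, IsTopEigenvectors (sampleCov (M.y ω) (N n) (T n)) (E n ω)) →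
      (∀ n ω, S n ω = sigmaHat s C (M.y ω) (N n) (T n) (E n ω)) →
      (∀ᶠ n in atTop, ∀ ω, IsWPC (M.y ω) (N n) (T n) (S n ω) (F n ω)) →
      M.FirstStage P c N T S F := by
  obtain ⟨c, hP, hsample⟩ := hM.exists_isSample hΛ
  have hc := one_pos.trans_le hP.one_le
  -- The constant of the uniform bound for residual covariances; the threshold constant `4cκ` is
  -- computed from it before any sample sizes are chosen.
  set κ := 1000 * (4 * c ^ 8) ^ 23 with hκdef
  have hκ : 0 < κ := by positivity
  clear_value κ
  refine ⟨c, 4 * c * κ, by positivity, fun C hC s hs N T q hNT hq hq1 hsp E F S hE hS hF =>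
    ⟨hP, hNT, hsample N T hNT, ?_, hF⟩⟩
  have hC0 : 0 < C := lt_of_lt_of_le (by positivity) hC
  refine ⟨_, tendsto_threshold_error (M := M) (P := P) (2 * c * C) (by positivity) hsp, ?_⟩
  have hsm := hNT.tendsto_omegaRate.const_mul κ
  rw [mul_zero] at hsm
  filter_upwards [hsample N T hNT, eventually_whp_of_forall hE,
    tendsto_fst_whp.eventually (hsm.eventually (ge_mem_nhds (show 0 < c⁻¹ / 2 by positivity))),
    tendsto_fst_whp.eventually (hNT.tendsto_T.eventually_ge_atTop 1)] with x h1 h2 h3 h4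
  refine ⟨by rw [hS]; exact sigmaHat_transpose hs _ _ _ _ _, ?_⟩
  rw [hS]
  refine hP.norm_sigmaHat_sub_le hs hκ h1.1.omega_pos hC h3 (fun i j => ?_) hq hq1
  rw [hκdef]
  exact abs_residCov_sub_le (by omega) h1.1 h2 i j

end FactorModel

end FirstStageProof

/-! ### Limits of principal components -/

section PrincipalLimits

lemma isHermitian_of_transpose {m : Type*} {A : Matrix m m ℝ} (h : Aᵀ = A) : A.IsHermitian := by
  rw [Matrix.IsHermitian, conjTranspose_eq_transpose_of_trivial, h]

/-- The signs of the diagonal entries. -/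
noncomputable def diagSign {r : ℕ} (A : Matrix (Fin r) (Fin r) ℝ) (k : Fin r) : ℝ :=
  if 0 ≤ A k k then 1 else -1

lemma diagSign_eq {r : ℕ} (A : Matrix (Fin r) (Fin r) ℝ) (k : Fin r) :
    diagSign A k = 1 ∨ diagSign A k = -1 := by
  unfold diagSign; split_ifs <;> simp

/-- Asymptotic uniqueness of the matrix that diagonalizes two quadratic forms simultaneously. -/
lemma tendsto_simultaneous_diagonalization {α : Type*} {𝓛 : Filter α} {r : ℕ}
    {H A : α → Matrix (Fin r) (Fin r) ℝ} {v : α → Fin r → ℝ} {S₁ S₂ Q : Matrix (Fin r) (Fin r) ℝ}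
    {w : Fin r → ℝ} {c : ℝ} (hH : Tendsto (fun x => (H x)ᵀ * H x) 𝓛 (𝓝 S₁))
    (hA : Tendsto A 𝓛 (𝓝 S₂))
    (hv : Tendsto (fun x => diagonal (v x) - H x * A x * (H x)ᵀ) 𝓛 (𝓝 0))
    (hanti : ∀ᶠ x in 𝓛, Antitone (v x)) (hbd : ∀ᶠ x in 𝓛, ∀ i j, |H x i j| ≤ c)
    (hQ : Qᵀ * Q = S₁) (hQS : Q * S₂ * Qᵀ = diagonal w) (hQu : IsUnit Q.det) (hw : Antitone w)
    (hwi : Function.Injective w) :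
    Tendsto v 𝓛 (𝓝 w) ∧
      Tendsto (fun x => diagonal (diagSign (H x * Q⁻¹)) * H x) 𝓛 (𝓝 Q) := by
  -- Convergence is tested along ultrafilters: since `H` is bounded it has a limit `G` along each of
  -- them, and `G` satisfies the limiting equations exactly.
  suffices key : ∀ g : Ultrafilter α, ↑g ≤ 𝓛 → Tendsto v g (𝓝 w) ∧
      Tendsto (fun x => diagonal (diagSign (H x * Q⁻¹)) * H x) g (𝓝 Q) from
    ⟨(tendsto_iff_ultrafilter _ _ _).2 fun g hg => (key g hg).1,
      (tendsto_iff_ultrafilter _ _ _).2 fun g hg => (key g hg).2⟩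
  intro g hg
  set K : Set (Matrix (Fin r) (Fin r) ℝ) := {B | ∀ i j, B i j ∈ Set.Icc (-c) c} with hK
  have hcomp : IsCompact K := by
    have h1 : IsCompact (Set.pi Set.univ fun _ : Fin r => Set.pi Set.univ fun _ : Fin r =>
        Set.Icc (-c) c) :=
      isCompact_univ_pi fun _ => isCompact_univ_pi fun _ => isCompact_Icc
    have h2 : K = Set.pi Set.univ fun _ : Fin r => Set.pi Set.univ fun _ : Fin r =>
        Set.Icc (-c) c := by
      ext B
      exact ⟨fun h i _ j _ => h i j, fun h i j => h i trivial j trivial⟩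
    rw [h2]; exact h1
  obtain ⟨G, -, hG⟩ := hcomp.ultrafilter_le_nhds' (g.map H) (by
    rw [Ultrafilter.mem_map]
    exact mem_of_superset (hg hbd) fun x hx i j => abs_le.1 (hx i j))
  have hG' : Tendsto H g (𝓝 G) := hG
  have h1 : Gᵀ * G = S₁ := tendsto_nhds_unique
    (((continuous_id.matrix_transpose.tendsto G).comp hG').mul hG') (hH.mono_left hg)
  have h2 : Tendsto (fun x => H x * A x * (H x)ᵀ) g (𝓝 (G * S₂ * Gᵀ)) :=
    (hG'.mul (hA.mono_left hg)).mul ((continuous_id.matrix_transpose.tendsto G).comp hG')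
  have h3 : Tendsto (fun x => diagonal (v x)) g (𝓝 (G * S₂ * Gᵀ)) := by
    have := (hv.mono_left hg).add h2
    simpa using this
  have h4 : ∀ i j, Tendsto (fun x => diagonal (v x) i j) g (𝓝 ((G * S₂ * Gᵀ) i j)) :=
    fun i j => tendsto_pi_nhds.1 (tendsto_pi_nhds.1 h3 i) j
  set v' : Fin r → ℝ := fun k => (G * S₂ * Gᵀ) k k with hv'
  have h5 : Tendsto v g (𝓝 v') := tendsto_pi_nhds.2 fun k => by
    simpa using h4 k k
  have h6 : G * S₂ * Gᵀ = diagonal v' := by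
    ext i j
    rcases eq_or_ne i j with rfl | hij
    · simp [hv']
    · have := h4 i j
      simp only [diagonal_apply_ne _ hij] at this ⊢
      exact tendsto_nhds_unique this tendsto_const_nhds
  have h7 : Antitone v' := fun i j hij =>
    le_of_tendsto_of_tendsto (tendsto_pi_nhds.1 h5 j) (tendsto_pi_nhds.1 h5 i)
      (Eventually.mono (hg hanti) fun x hx => hx hij)
  -- `G` and `Q` have the same Gram matrix, so `O` is orthogonal; it conjugates one ordered diagonal
  -- matrix into another, which must therefore be equal.
  set O := G * Q⁻¹ with hO
  have hQ1 : Q * Q⁻¹ = 1 := Matrix.mul_nonsing_inv Q hQu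
  have hQ2 : Q⁻¹ * Q = 1 := Matrix.nonsing_inv_mul Q hQu
  have hOQ : O * Q = G := by rw [hO, Matrix.mul_assoc, hQ2, Matrix.mul_one]
  have hOO : Oᵀ * O = 1 := by
    calc Oᵀ * O = Q⁻¹ᵀ * (Gᵀ * G) * Q⁻¹ := by
          rw [hO, transpose_mul]; simp only [Matrix.mul_assoc]
      _ = (Q * Q⁻¹)ᵀ * (Q * Q⁻¹) := by
          rw [h1, ← hQ, transpose_mul]; simp only [Matrix.mul_assoc]
      _ = 1 := by rw [hQ1, transpose_one, Matrix.mul_one]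
  have hOw : O * diagonal w * Oᵀ = diagonal v' := by
    rw [← hQS, ← h6]
    conv_rhs => rw [← hOQ, transpose_mul O Q]
    simp only [Matrix.mul_assoc]
  have hvw : v' = w := by
    refine antitone_eq_of_prod_eq h7 hw ?_
    rw [← charpoly_conj_diagonal hOO w, hOw, charpoly_diagonal]
  rw [hvw] at hOw h5
  refine ⟨h5, ?_⟩
  -- An orthogonal matrix commuting with a diagonal matrix with distinct entries is diagonal, with
  -- entries `±1`.
  have hcomm : O * diagonal w = diagonal w * O := by
    rw [← hOw, Matrix.mul_assoc (O * diagonal w), hOO, Matrix.mul_one]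
    rw [hOw]
  have hdiag : ∀ i j, i ≠ j → O i j = 0 := fun i j hij => by
    have := congrFun (congrFun hcomm i) j
    rw [mul_diagonal, diagonal_mul] at this
    have hne : w j - w i ≠ 0 := sub_ne_zero.2 fun h => hij (hwi h).symm
    have : O i j * (w j - w i) = 0 := by linarith
    exact (mul_eq_zero.1 this).resolve_right hne
  have hsq : ∀ k, O k k * O k k = 1 := fun k => by
    have := congrFun (congrFun hOO k) k
    rw [Matrix.mul_apply, Finset.sum_eq_single k, one_apply_eq] at this
    · exact this
    · intro j _ hjk
      rw [hdiag j k hjk, mul_zero]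
    · simp
  have hOd : O = diagonal fun k => O k k := by
    ext i j
    rcases eq_or_ne i j with rfl | hij
    · simp
    · rw [diagonal_apply_ne _ hij, hdiag i j hij]
  have hHO : Tendsto (fun x => H x * Q⁻¹) g (𝓝 O) := hG'.mul tendsto_const_nhds
  -- The diagonal entries of the limit are `±1`, away from zero, so the signs along the ultrafilter
  -- are eventually those of the limit.
  have hsign : Tendsto (fun x => diagSign (H x * Q⁻¹)) g (𝓝 fun k => O k k) := by
    refine tendsto_pi_nhds.2 fun k => ?_
    have hk : Tendsto (fun x => (H x * Q⁻¹) k k) g (𝓝 (O k k)) :=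
      tendsto_pi_nhds.1 (tendsto_pi_nhds.1 hHO k) k
    refine tendsto_nhds_of_eventually_eq ?_
    rcases mul_self_eq_one_iff.1 (hsq k) with h | h
    · filter_upwards [hk.eventually (lt_mem_nhds (by rw [h]; exact one_pos))] with x hx
      rw [diagSign, if_pos hx.le, h]
    · filter_upwards [hk.eventually (gt_mem_nhds (by rw [h]; norm_num : O k k < 0))] with x hx
      rw [diagSign, if_neg (not_le.2 hx), h]
  have hlim : Tendsto (fun x => diagonal (diagSign (H x * Q⁻¹)) * H x) g
      (𝓝 (diagonal (fun k => O k k) * G)) :=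
    ((continuous_id.matrix_diagonal.tendsto _).comp hsign).mul hG'
  have e : diagonal (fun k => O k k) * G = Q := by
    have : diagonal (fun k => O k k) * O = 1 := by
      conv_lhs => rw [hOd]
      rw [diagonal_mul_diagonal, ← diagonal_one]
      congr 1; ext k
      simpa using hsq k
    rw [← hOQ, ← Matrix.mul_assoc, this, Matrix.one_mul]
  rwa [e] at hlim

lemma matSqrt_transpose {m : Type*} [Fintype m] [DecidableEq m] (A : Matrix m m ℝ) :
    (matSqrt A)ᵀ = matSqrt A := by
  have : IsSelfAdjoint (matSqrt A) := cfc_predicate _ _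
  rw [IsSelfAdjoint, star_eq_conjTranspose, conjTranspose_eq_transpose_of_trivial] at this
  exact this

lemma matSqrt_mul_self {m : Type*} [Fintype m] [DecidableEq m] {A : Matrix m m ℝ}
    (hA : A.IsHermitian) (h : ∀ x ∈ spectrum ℝ A, 0 ≤ x) : matSqrt A * matSqrt A = A := by
  have hA' : IsSelfAdjoint A := hA
  rw [matSqrt, ← cfc_mul Real.sqrt Real.sqrt A]
  conv_rhs => rw [← cfc_id ℝ A hA']
  exact cfc_congr fun x hx => Real.mul_self_sqrt (h x hx)

namespace FactorModel

variable {r : ℕ} {Ω : Type*} [mΩ : MeasurableSpace Ω] {P : Measure Ω} [IsProbabilityMeasure P]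
  {M : FactorModel r Ω}

/-- Properties of the matrices `V_e` and `Q_e`. -/
lemma qe_properties {SigLam Γ : Matrix (Fin r) (Fin r) ℝ} {c : ℝ} (hc : 0 < c)
    (hF : ∀ x, c * (x ⬝ᵥ x) ≤ x ⬝ᵥ (M.SigmaF P *ᵥ x)) (hFu : IsUnit (M.SigmaF P).det)
    (hS : SigLamᵀ = SigLam) (hSpos : ∀ x ∈ spectrum ℝ SigLam, 0 ≤ x) (hSu : IsUnit SigLam.det)
    (hd : (SigLam * M.SigmaF P).charpoly.roots.Nodup)
    (hΓ : IsTopEigenvectors (M.limitMat P SigLam) Γ) :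
    (M.Qe P SigLam Γ)ᵀ * M.Qe P SigLam Γ = M.SigmaF P ∧
    M.Qe P SigLam Γ * SigLam * (M.Qe P SigLam Γ)ᵀ = M.Ve P SigLam ∧
    IsUnit (M.Qe P SigLam Γ).det ∧
    (Antitone fun k : Fin r => eigDesc (M.limitMat P SigLam) k) ∧
    (Function.Injective fun k : Fin r => eigDesc (M.limitMat P SigLam) k) := by
  set s := matSqrt SigLam with hs
  set w := fun k : Fin r => eigDesc (M.limitMat P SigLam) k with hw
  have hst : sᵀ = s := matSqrt_transpose _
  have hss : s * s = SigLam := matSqrt_mul_self (isHermitian_of_transpose hS) hSpos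
  have hsu : IsUnit s.det := by
    have : IsUnit (s * s).det := by rwa [hss]
    rw [det_mul] at this
    exact isUnit_of_mul_isUnit_left this
  have hs1 : s * s⁻¹ = 1 := Matrix.mul_nonsing_inv s hsu
  have hs2 : s⁻¹ * s = 1 := Matrix.nonsing_inv_mul s hsu
  have hsit : (s⁻¹)ᵀ = s⁻¹ := by rw [transpose_nonsing_inv, hst]
  have hFt : (M.SigmaF P)ᵀ = M.SigmaF P := by
    have := sigmaF_isHermitian (M := M) (P := P)
    rwa [Matrix.IsHermitian, conjTranspose_eq_transpose_of_trivial] at this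
  have hLH : (M.limitMat P SigLam).IsHermitian := by
    refine isHermitian_of_transpose ?_
    rw [limitMat, ← hs, transpose_mul, transpose_mul, hst, hFt, Matrix.mul_assoc]
  have hΓ1 := hΓ.orthonormal
  have hΓ2 : Γ * Γᵀ = 1 := mul_eq_one_comm.1 hΓ1
  have hΓw : M.limitMat P SigLam * Γ = Γ * diagonal w := hΓ.mul_eq
  have hΓw' : M.limitMat P SigLam = Γ * diagonal w * Γᵀ := by
    rw [← hΓw, Matrix.mul_assoc, hΓ2, Matrix.mul_one]
  have hwd : diagonal w = Γᵀ * s * M.SigmaF P * s * Γ := by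
    have : Γᵀ * (M.limitMat P SigLam * Γ) = diagonal w := by
      rw [hΓw, ← Matrix.mul_assoc, hΓ1, Matrix.one_mul]
    rw [← this, limitMat, ← hs]
    simp only [Matrix.mul_assoc]
  -- Each eigenvalue is a value of the quadratic form of `cov(f)`; nonnegativity is needed for the
  -- square root of `V_e` to square back to it.
  have hw0 : ∀ k, 0 ≤ w k := fun k => by
    have e : w k = (s *ᵥ (Γ *ᵥ Pi.single k 1)) ⬝ᵥ (M.SigmaF P *ᵥ (s *ᵥ (Γ *ᵥ Pi.single k 1))) := by
      have h1 : w k = Pi.single k 1 ⬝ᵥ ((Γᵀ * s * M.SigmaF P * s * Γ) *ᵥ Pi.single k 1) := by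
        rw [← hwd]; simp
      rw [h1]
      simp only [← Matrix.mulVec_mulVec]
      rw [Matrix.dotProduct_mulVec _ Γᵀ, ← Matrix.mulVec_transpose, transpose_transpose,
        Matrix.dotProduct_mulVec _ s, ← Matrix.mulVec_transpose, hst]
    rw [e]
    refine le_trans (mul_nonneg hc.le ?_) (hF _)
    rw [dotProduct]; exact Finset.sum_nonneg fun i _ => mul_self_nonneg _
  set v := matSqrt (M.Ve P SigLam) with hv
  have hVe : M.Ve P SigLam = diagonal w := rfl
  have hvt : vᵀ = v := matSqrt_transpose _
  have hvv : v * v = diagonal w := by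
    rw [hv, hVe]
    refine matSqrt_mul_self (isHermitian_of_transpose (diagonal_transpose _)) fun x hx => ?_
    rw [spectrum_diagonal] at hx
    obtain ⟨k, rfl⟩ := hx
    exact hw0 k
  have hQ : M.Qe P SigLam Γ = v * Γᵀ * s⁻¹ := rfl
  have hQQ : (M.Qe P SigLam Γ)ᵀ * M.Qe P SigLam Γ = M.SigmaF P := by
    calc _ = s⁻¹ * (Γ * (v * v) * Γᵀ) * s⁻¹ := by
          rw [hQ]
          simp only [transpose_mul, transpose_transpose, hvt, hsit, Matrix.mul_assoc]
      _ = (s⁻¹ * s) * M.SigmaF P * (s * s⁻¹) := by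
          rw [hvv, ← hΓw', limitMat, ← hs]; simp only [Matrix.mul_assoc]
      _ = _ := by rw [hs1, hs2, Matrix.one_mul, Matrix.mul_one]
  refine ⟨hQQ, ?_, ?_, fun i j hij => eigDesc_antitone hLH hij (by simp), ?_⟩
  · calc _ = v * Γᵀ * ((s⁻¹ * s) * (s * s⁻¹)) * Γ * v := by
          rw [hQ, ← hss]
          simp only [transpose_mul, transpose_transpose, hvt, hsit, Matrix.mul_assoc]
      _ = v * (Γᵀ * Γ) * v := by
          rw [hs1, hs2, Matrix.one_mul, Matrix.mul_one]; simp only [Matrix.mul_assoc]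
      _ = _ := by rw [hΓ1, Matrix.mul_one, hvv, hVe]
  · have : IsUnit ((M.Qe P SigLam Γ)ᵀ * M.Qe P SigLam Γ).det := by rwa [hQQ]
    rw [det_mul] at this
    exact isUnit_of_mul_isUnit_right this
  -- Since `AB` and `BA` have the same characteristic polynomial, distinctness of the eigenvalues
  -- passes from `Σ_Λ cov(f)` to the symmetric matrix.
  · have h1 : (SigLam * M.SigmaF P).charpoly = ∏ i, (Polynomial.X - Polynomial.C (w i)) := by
      rw [← charpoly_conj_diagonal hΓ1 w, ← hΓw', limitMat, ← hs, Matrix.mul_assoc,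
        charpoly_mul_comm s, Matrix.mul_assoc, hss, charpoly_mul_comm]
    have h2 : (∏ i, (Polynomial.X - Polynomial.C (w i))).roots = Finset.univ.val.map w := by
      rw [← Polynomial.roots_multiset_prod_X_sub_C (Finset.univ.val.map w), Multiset.map_map]
      rfl
    rw [h1, h2] at hd
    exact fun i j hij => Multiset.inj_on_of_nodup_map hd i (Finset.mem_univ_val i) j
      (Finset.mem_univ_val j) hij

end FactorModel

end PrincipalLimits

/-! ### Limits of the second stage estimators -/

section SecondStage

lemma tendsto_matrix_inv {α : Type*} {l : Filter α} {r : ℕ} {A : α → Matrix (Fin r) (Fin r) ℝ}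
    {B : Matrix (Fin r) (Fin r) ℝ} (h : Tendsto A l (𝓝 B)) (hB : IsUnit B.det) :
    Tendsto (fun x => (A x)⁻¹) l (𝓝 B⁻¹) := by
  simp only [Matrix.inv_def, Ring.inverse_eq_inv']
  have h1 : Tendsto (fun x => (A x).det) l (𝓝 B.det) :=
    (continuous_id.matrix_det.tendsto B).comp h
  exact (h1.inv₀ hB.ne_zero).smul ((continuous_id.matrix_adjugate.tendsto B).comp h)

open scoped Matrix.Norms.L2Operator

lemma tendsto_matrix_of_norm_sub_le {α : Type*} {l : Filter α} {r s : ℕ}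
    {A : α → Matrix (Fin r) (Fin s) ℝ} {B : Matrix (Fin r) (Fin s) ℝ} {e : α → ℝ}
    (h : ∀ᶠ x in l, ‖A x - B‖ ≤ e x) (he : Tendsto e l (𝓝 0)) : Tendsto A l (𝓝 B) :=
  tendsto_iff_norm_sub_tendsto_zero.2
    (squeeze_zero' (Eventually.of_forall fun _ => norm_nonneg _) h he)

namespace FactorModel

variable {r : ℕ} {Ω : Type*} [mΩ : MeasurableSpace Ω] {P : Measure Ω} [IsProbabilityMeasure P]
  {M : FactorModel r Ω}

lemma weightedLam_eq (N : ℕ) :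
    M.weightedLam P N = (M.scaledLam N)ᵀ * M.W P N * M.scaledLam N := by
  rw [weightedLam, scaledLam, transpose_smul, Matrix.smul_mul, Matrix.smul_mul, Matrix.mul_smul,
    smul_smul, ← sq, div_pow, one_pow, Real.sq_sqrt (Nat.cast_nonneg _)]

/-- The limit of `Λ' Σ_u⁻¹ Λ / N` is positive definite. -/
lemma PopBounds.sigLam_properties {c : ℝ} (hP : M.PopBounds P c) {N : ℕ → ℕ}
    {SigLam : Matrix (Fin r) (Fin r) ℝ} (hN : Tendsto N atTop atTop)
    (h : Tendsto (fun n => M.weightedLam P (N n)) atTop (𝓝 SigLam)) :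
    SigLamᵀ = SigLam ∧ (∀ x ∈ spectrum ℝ SigLam, 0 ≤ x) ∧ IsUnit SigLam.det := by
  have hc := one_pos.trans_le hP.one_le
  have hsymm : SigLamᵀ = SigLam := by
    have h1 := (continuous_id.matrix_transpose.tendsto SigLam).comp h
    refine tendsto_nhds_unique h1 (h.congr fun n => ?_)
    rw [Function.comp_apply, id_eq, weightedLam_eq, transpose_mul, transpose_mul,
      transpose_transpose, w_transpose, Matrix.mul_assoc]
  -- A uniform lower bound survives the limit. The power `c^7` combines `c³` from the weight and
  -- `(c²)²` from recovering `x` out of `L x` by `(L'L)⁻¹L'`.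
  have hpos : ∀ x : Fin r → ℝ, (c ^ 7)⁻¹ * (x ⬝ᵥ x) ≤ x ⬝ᵥ (SigLam *ᵥ x) := by
    intro x
    have h1 : Tendsto (fun n => x ⬝ᵥ (M.weightedLam P (N n) *ᵥ x)) atTop
        (𝓝 (x ⬝ᵥ (SigLam *ᵥ x))) :=
      ((continuous_const.dotProduct (continuous_id.matrix_mulVec continuous_const)).tendsto
        SigLam).comp h
    refine ge_of_tendsto h1 ?_
    filter_upwards [hN.eventually hP.norm_L, hN.eventually hP.isUnit_L,
      hN.eventually hP.norm_L_inv] with n a1 a2 a3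
    set L := M.scaledLam (N n)
    have e1 : x ⬝ᵥ (M.weightedLam P (N n) *ᵥ x) = (L *ᵥ x) ⬝ᵥ (M.W P (N n) *ᵥ (L *ᵥ x)) := by
      rw [weightedLam_eq, ← Matrix.mulVec_mulVec, ← Matrix.mulVec_mulVec,
        Matrix.dotProduct_mulVec x, ← Matrix.mulVec_transpose, transpose_transpose]
    rw [e1]
    refine le_trans ?_ (hP.le_W _ _)
    have e2 : x = ((Lᵀ * L)⁻¹ * Lᵀ) *ᵥ (L *ᵥ x) := by
      rw [Matrix.mulVec_mulVec, Matrix.mul_assoc, Matrix.nonsing_inv_mul _ a2, Matrix.one_mulVec]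
    have e3 : ∀ {k : ℕ} (y : Fin k → ℝ), y ⬝ᵥ y = ∑ i, y i ^ 2 := fun y => by
      simp [dotProduct, sq]
    have h3 := sum_sq_mulVec_le ((Lᵀ * L)⁻¹ * Lᵀ) (L *ᵥ x)
    rw [← e2, ← e3, ← e3] at h3
    have h4 := pow_le_pow_left₀ (norm_nonneg _)
      (l2_norm_mul_le_of_le a3 ((l2_norm_transpose L).trans_le a1)) 2
    have h5 : 0 ≤ (L *ᵥ x) ⬝ᵥ (L *ᵥ x) := by rw [e3]; positivity
    have h6 : x ⬝ᵥ x ≤ (c * c) ^ 2 * ((L *ᵥ x) ⬝ᵥ (L *ᵥ x)) := h3.trans (by gcongr)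
    calc (c ^ 7)⁻¹ * (x ⬝ᵥ x) ≤ (c ^ 7)⁻¹ * ((c * c) ^ 2 * ((L *ᵥ x) ⬝ᵥ (L *ᵥ x))) := by gcongr
      _ = _ := by field_simp
  have hpd : SigLam.PosDef := by
    refine PosDef.of_dotProduct_mulVec_pos (isHermitian_of_transpose hsymm) fun x hx => ?_
    rw [star_trivial]
    refine lt_of_lt_of_le ?_ (hpos x)
    have : 0 < x ⬝ᵥ x := by
      refine lt_of_le_of_ne ?_ fun h0 => hx (dotProduct_self_eq_zero.1 h0.symm)
      rw [dotProduct]; exact Finset.sum_nonneg fun i _ => mul_self_nonneg _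
    positivity
  refine ⟨hsymm, fun x hx => ?_, hpd.det_pos.ne'.isUnit⟩
  rw [hpd.1.spectrum_real_eq_range_eigenvalues] at hx
  obtain ⟨i, rfl⟩ := hx
  exact hpd.posSemidef.eigenvalues_nonneg i

/-- The matrix rotating the true factors into the estimated ones. -/
noncomputable def rotH (M : FactorModel r Ω) (T : ℕ) (ω : Ω) (F : ℕ → Fin r → ℝ) :
    Matrix (Fin r) (Fin r) ℝ :=
  (scaledHat T F)ᵀ * M.scaledFactor T ω

/-- The coefficient matrix of the true factors in the estimated ones. -/
noncomputable def rotFactor (M : FactorModel r Ω) (N T : ℕ) (ω : Ω)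
    (S : Matrix (Fin N) (Fin N) ℝ) (F : ℕ → Fin r → ℝ) : Matrix (Fin r) (Fin r) ℝ :=
  rotB (M.scaledLam N) (M.scaledFactor T ω) (M.scaledError N T ω) S⁻¹ (scaledHat T F)
    (M.pcVal N T ω S)

/-- Limits of eigenvalues and rotations in the second estimation stage. -/
structure SecondStage (M : FactorModel r Ω) (P : Measure Ω) (c : ℝ) (N T : ℕ → ℕ)
    (S : ∀ n, Ω → Matrix (Fin (N n)) (Fin (N n)) ℝ) (F : ℕ → Ω → ℕ → Fin r → ℝ)
    (Q : Matrix (Fin r) (Fin r) ℝ) (w : Fin r → ℝ) (D : ℕ → Ω → Fin r → ℝ) : Prop where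
  first : M.FirstStage P c N T S F
  sample : ∃ C, c ≤ C ∧ ∀ᶠ x in whp P,
      IsPCSample C (pcRate (N x.1) (T x.1)) (M.scaledLam (N x.1)) (M.scaledFactor (T x.1) x.2)
        (M.scaledError (N x.1) (T x.1) x.2) (S x.1 x.2)⁻¹ (scaledHat (T x.1) (F x.1 x.2))
        (M.pcVal (N x.1) (T x.1) x.2 (S x.1 x.2)) (M.SigmaF P)
  weight : ∃ ε : ℕ → ℝ, Tendsto (fun n => (N n : ℝ) ^ (1 / 4 : ℝ) * ε n) atTop (𝓝 0) ∧
    ∀ᶠ x in whp P, ‖(S x.1 x.2)⁻¹ - M.W P (N x.1)‖ ≤ ε x.1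
  w_pos : ∀ k, 0 < w k
  val : Tendsto (fun x : ℕ × Ω => M.pcVal (N x.1) (T x.1) x.2 (S x.1 x.2)) (whp P) (𝓝 w)
  sign : ∀ n ω k, D n ω k = 1 ∨ D n ω k = -1
  Q_mul : Qᵀ * Q = M.SigmaF P
  Q_unit : IsUnit Q.det
  rot : Tendsto (fun x : ℕ × Ω => diagonal (D x.1 x.2) * M.rotH (T x.1) x.2 (F x.1 x.2)) (whp P)
    (𝓝 Q)
  rotFactor : Tendsto (fun x : ℕ × Ω => diagonal (D x.1 x.2) *
    M.rotFactor (N x.1) (T x.1) x.2 (S x.1 x.2) (F x.1 x.2)) (whp P) (𝓝 (Qᵀ)⁻¹)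

lemma _root_.diagonal_sign_mul_self {d : Fin r → ℝ} (h : ∀ k, d k = 1 ∨ d k = -1) :
    diagonal d * diagonal d = 1 := by
  rw [diagonal_mul_diagonal, ← diagonal_one]
  congr 1; ext k
  rcases h k with h | h <;> rw [h] <;> norm_num

lemma _root_.tendsto_of_norm_ratio {N : ℕ → ℕ} {ε : ℕ → ℝ} (hN : Tendsto N atTop atTop)
    (h : Tendsto (fun n => (N n : ℝ) ^ (1 / 4 : ℝ) * ε n) atTop (𝓝 0)) :
    Tendsto ε atTop (𝓝 0) := by
  have hn := h.norm
  rw [norm_zero] at hn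
  refine squeeze_zero_norm' ?_ hn
  filter_upwards [hN.eventually_ge_atTop 1] with n hn
  have h1 : (1 : ℝ) ≤ (N n : ℝ) ^ (1 / 4 : ℝ) :=
    Real.one_le_rpow (by exact_mod_cast hn) (by norm_num)
  rw [norm_mul, Real.norm_of_nonneg (by linarith : 0 ≤ (N n : ℝ) ^ (1 / 4 : ℝ))]
  nlinarith [norm_nonneg (ε n)]

lemma FirstStage.weight_inv {c : ℝ} {N T : ℕ → ℕ}
    {S : ∀ n, Ω → Matrix (Fin (N n)) (Fin (N n)) ℝ} {F : ℕ → Ω → ℕ → Fin r → ℝ}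
    (h : M.FirstStage P c N T S F) : ∃ ε : ℕ → ℝ,
    Tendsto (fun n => (N n : ℝ) ^ (1 / 4 : ℝ) * ε n) atTop (𝓝 0) ∧
    ∀ᶠ x in whp P, ‖(S x.1 x.2)⁻¹ - M.W P (N x.1)‖ ≤ ε x.1 := by
  obtain ⟨ε, hε, hS⟩ := h.weight
  have h1 := hε.const_mul (2 * c ^ 2)
  rw [mul_zero] at h1
  have h2 := (tendsto_of_norm_ratio h.growth.tendsto_N hε).const_mul (4 * c ^ 5)
  rw [mul_zero] at h2
  refine ⟨fun n => 2 * c ^ 2 * ε n, h1.congr fun n => by ring, ?_⟩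
  filter_upwards [hS, tendsto_fst_whp.eventually (h2.eventually (ge_mem_nhds one_pos))]
    with x hx hx2
  exact (h.pop.inv_estimate hx.1 hx.2 hx2).2.2.1

lemma FirstStage.tendsto_rate {c : ℝ} {N T : ℕ → ℕ}
    {S : ∀ n, Ω → Matrix (Fin (N n)) (Fin (N n)) ℝ} {F : ℕ → Ω → ℕ → Fin r → ℝ}
    (h : M.FirstStage P c N T S F) (a : ℝ) :
    Tendsto (fun x : ℕ × Ω => a * pcRate (N x.1) (T x.1)) (whp P) (𝓝 0) := by
  have := ((h.growth.tendsto_min_rpow (a := 19 / 40) (by norm_num)).const_mul a).comp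
    (tendsto_fst_whp (P := P))
  rw [mul_zero] at this
  exact this

/-- The perturbation bounds are exactly the hypotheses of the simultaneous diagonalization, with the
limits `cov(f)` and `Σ_Λ`. The same signs then align the rotation of the factors. -/
lemma FirstStage.secondStage (hM : M.Regular P) {c : ℝ} {N T : ℕ → ℕ}
    {S : ∀ n, Ω → Matrix (Fin (N n)) (Fin (N n)) ℝ} {F : ℕ → Ω → ℕ → Fin r → ℝ}
    (h : M.FirstStage P c N T S F) {SigLam Q : Matrix (Fin r) (Fin r) ℝ} {w : Fin r → ℝ}
    (hlam : Tendsto (fun n => M.weightedLam P (N n)) atTop (𝓝 SigLam))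
    (hQ : Qᵀ * Q = M.SigmaF P) (hQS : Q * SigLam * Qᵀ = diagonal w) (hQu : IsUnit Q.det)
    (hw : Antitone w) (hwi : Function.Injective w) :
    ∃ D : ℕ → Ω → Fin r → ℝ, M.SecondStage P c N T S F Q w D := by
  obtain ⟨C, hcC, hs⟩ := h.exists_isPCSample hM
  obtain ⟨ε, hε, hW⟩ := h.weight_inv
  have hrate := h.tendsto_rate
  have hA : Tendsto (fun x : ℕ × Ω => (M.scaledLam (N x.1))ᵀ * (S x.1 x.2)⁻¹
      * M.scaledLam (N x.1)) (whp P) (𝓝 SigLam) := by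
    have h1 : Tendsto (fun x : ℕ × Ω => (M.scaledLam (N x.1))ᵀ * (S x.1 x.2)⁻¹
      * M.scaledLam (N x.1) - M.weightedLam P (N x.1)) (whp P) (𝓝 0) := by
      have h2 := (((tendsto_of_norm_ratio h.growth.tendsto_N hε).const_mul (C ^ 2)).comp
        (tendsto_fst_whp (P := P)))
      rw [mul_zero] at h2
      refine tendsto_matrix_of_norm_sub_le ?_ h2
      filter_upwards [hs, hW] with x hx hWx
      rw [sub_zero, weightedLam_eq, ← Matrix.sub_mul, ← Matrix.mul_sub]
      refine (l2_norm_mul_le_of_le (l2_norm_mul_le_of_le ((l2_norm_transpose _).trans_le hx.norm_L)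
        hWx) hx.norm_L).trans (le_of_eq ?_)
      simp only [Function.comp_apply]
      ring
    have h3 := h1.add (hlam.comp (tendsto_fst_whp (P := P)))
    simpa using h3
  have key := tendsto_simultaneous_diagonalization (𝓛 := whp P)
    (H := fun x => M.rotH (T x.1) x.2 (F x.1 x.2))
    (A := fun x => (M.scaledLam (N x.1))ᵀ * (S x.1 x.2)⁻¹ * M.scaledLam (N x.1))
    (v := fun x => M.pcVal (N x.1) (T x.1) x.2 (S x.1 x.2)) (S₁ := M.SigmaF P) (S₂ := SigLam)
    (Q := Q) (w := w) (c := C) ?_ hA ?_ (hs.mono fun x hx => hx.anti) ?_ hQ hQS hQu hw hwi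
  · obtain ⟨k1, k2⟩ := key
    set D : ℕ → Ω → Fin r → ℝ := fun n ω => diagSign (M.rotH (T n) ω (F n ω) * Q⁻¹) with hD
    have hDs : ∀ n ω k, D n ω k = 1 ∨ D n ω k = -1 := fun n ω k => diagSign_eq _ _
    refine ⟨D, h, ⟨C, hcC, hs⟩, ⟨ε, hε, hW⟩, fun k => ?_, k1, hDs, hQ, hQu, k2, ?_⟩
    · have hC : 0 < C := (one_pos.trans_le h.pop.one_le).trans_le hcC
      have h1 : Tendsto (fun x : ℕ × Ω => M.pcVal (N x.1) (T x.1) x.2 (S x.1 x.2) k) (whp P)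
          (𝓝 (w k)) := tendsto_pi_nhds.1 k1 k
      -- Passing a lower bound to the limit requires a nontrivial filter; `whp P` is nontrivial
      -- because `P` has mass one.
      rcases (whp P).eq_or_neBot with hbot | hne
      · exfalso
        have h2 : ∀ᶠ x : ℕ × Ω in whp P, False := by rw [hbot]; exact eventually_bot
        rw [eventually_whp] at h2
        simp only [not_false_eq_true, Set.ofPred_true, measure_univ] at h2
        exact one_ne_zero (tendsto_nhds_unique tendsto_const_nhds h2)
      · have : 1 / C ≤ w k := ge_of_tendsto h1 (hs.mono fun x hx => hx.val k)
        exact lt_of_lt_of_le (by positivity) this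
    -- As `Bᵀ H → 1` and `D H → Q`, the product of `Bᵀ H` with `(D H)⁻¹` is `Bᵀ D` and tends to
    -- `Q⁻¹`; transposition gives the claim.
    · have h1 : Tendsto (fun x : ℕ × Ω => (M.rotFactor (N x.1) (T x.1) x.2 (S x.1 x.2)
          (F x.1 x.2))ᵀ * M.rotH (T x.1) x.2 (F x.1 x.2)) (whp P) (𝓝 1) :=
        tendsto_matrix_of_norm_sub_le (hs.mono fun x hx => hx.norm_BH) (hrate _)
      have h2 := h1.mul (tendsto_matrix_inv k2 hQu)
      rw [Matrix.one_mul] at h2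
      have h3 := (continuous_id.matrix_transpose.tendsto _).comp h2
      rw [id_eq, transpose_nonsing_inv] at h3
      refine h3.congr' ?_
      filter_upwards [hs] with x hx
      set H := M.rotH (T x.1) x.2 (F x.1 x.2) with hH
      have hHu : IsUnit H.det := hx.isUnit_H
      have hDD := diagonal_sign_mul_self (hDs x.1 x.2)
      have e1 : (diagonal (D x.1 x.2) * H)⁻¹ = H⁻¹ * diagonal (D x.1 x.2) := by
        refine Matrix.inv_eq_right_inv ?_
        rw [Matrix.mul_assoc, ← Matrix.mul_assoc H, Matrix.mul_nonsing_inv _ hHu, Matrix.one_mul,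
          hDD]
      simp only [Function.comp_apply, id_eq]
      change (_ * (diagonal (D x.1 x.2) * H)⁻¹)ᵀ = _
      rw [e1, Matrix.mul_assoc, ← Matrix.mul_assoc H, Matrix.mul_nonsing_inv _ hHu, Matrix.one_mul,
        transpose_mul, transpose_transpose, diagonal_transpose]
  · exact tendsto_matrix_of_norm_sub_le (hs.mono fun x hx => hx.norm_HH) (hrate _)
  · refine tendsto_matrix_of_norm_sub_le (hs.mono fun x hx => ?_) (hrate (3 * C ^ 2))
    rw [sub_zero]; exact hx.norm_diagonal_sub
  · filter_upwards [hs] with x hx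
    exact fun i j => (abs_entry_le _ _ _).trans hx.norm_H

end FactorModel

end SecondStage

/-! ### Limits of the estimated eigenvalues and loadings -/

section LoadingLimits

open scoped Matrix.Norms.L2Operator

namespace FactorModel

variable {r : ℕ} {Ω : Type*} [mΩ : MeasurableSpace Ω] {P : Measure Ω} [IsProbabilityMeasure P]
  {M : FactorModel r Ω}

lemma LamHat_eq {N T : ℕ} (hN : 0 < N) (hT : 0 < T) (ω : Ω) (F : ℕ → Fin r → ℝ) :
    LamHat (M.y ω) N T F = √(N : ℝ) • (M.scaledData N T ω * scaledHat T F) := by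
  have hN' : √(N : ℝ) ≠ 0 := (Real.sqrt_pos.2 (by exact_mod_cast hN)).ne'
  have hT' : √(T : ℝ) ≠ 0 := (Real.sqrt_pos.2 (by exact_mod_cast hT)).ne'
  have hT2 : √(T : ℝ) * √(T : ℝ) = T := Real.mul_self_sqrt (Nat.cast_nonneg _)
  have e1 : √(N : ℝ) • M.scaledData N T ω = (1 / √(T : ℝ)) • dataMat (M.y ω) N T := by
    rw [dataMat_eq hN hT, smul_smul]
    congr 1
    field_simp
  rw [← Matrix.smul_mul, e1]
  ext i k
  simp only [LamHat, lamHat, Matrix.of_apply, Matrix.mul_apply, Matrix.smul_apply, dataMat,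
    scaledHat, smul_eq_mul]
  rw [Finset.mul_sum, ← Fin.sum_univ_eq_sum_range (fun t : ℕ => 1 / (T : ℝ) * (M.y ω i t * F t k))]
  refine Finset.sum_congr rfl fun t _ => ?_
  rw [show 1 / (T : ℝ) = 1 / (√(T : ℝ) * √(T : ℝ)) by rw [hT2]]
  field_simp

/-- The estimated loading is the rotated true loading plus the sample covariance of the error with
the estimated factors, which is the right-hand side. -/
lemma lamHat_sub {N T : ℕ} (hN : 0 < N) (hT : 0 < T) (ω : Ω) (F : ℕ → Fin r → ℝ) (i : Fin N)
    (k : Fin r) : lamHat (M.y ω) T F i k - (M.rotH T ω F *ᵥ M.lam i) k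
      = (√(N : ℝ) • rowM (M.scaledError N T ω) i * scaledHat T F) () k := by
  have hN' : √(N : ℝ) ≠ 0 := (Real.sqrt_pos.2 (by exact_mod_cast hN)).ne'
  have e1 : lamHat (M.y ω) T F i k = LamHat (M.y ω) N T F i k := rfl
  have e2 : M.scaledData N T ω * scaledHat T F
      = M.scaledLam N * (M.rotH T ω F)ᵀ + M.scaledError N T ω * scaledHat T F := by
    rw [scaledData, rotH, transpose_mul, transpose_transpose, Matrix.add_mul, Matrix.mul_assoc]
  rw [e1, LamHat_eq hN hT, e2, smul_add, Matrix.add_apply]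
  have e3 : (√(N : ℝ) • (M.scaledLam N * (M.rotH T ω F)ᵀ)) i k = (M.rotH T ω F *ᵥ M.lam i) k := by
    simp only [Matrix.smul_apply, Matrix.mul_apply, transpose_apply, scaledLam, Lam,
      Matrix.of_apply, smul_eq_mul, mulVec, dotProduct, Finset.mul_sum]
    refine Finset.sum_congr rfl fun l _ => ?_
    field_simp
  rw [e3, Matrix.smul_mul, ← rowM_mul]
  simp [rowM]

/-- Good samples for the second estimation stage. -/
structure GoodSample (M : FactorModel r Ω) (P : Measure Ω) (C : ℝ) (N T : ℕ) (ω : Ω)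
    (S : Matrix (Fin N) (Fin N) ℝ) (F : ℕ → Fin r → ℝ) : Prop where
  pc : IsPCSample C (pcRate N T) (M.scaledLam N) (M.scaledFactor T ω)
        (M.scaledError N T ω) S⁻¹ (scaledHat T F) (M.pcVal N T ω S) (M.SigmaF P)
  pos_N : 0 < N
  pos_T : 0 < T
  norm_lam : ∀ j, vnorm (M.lam j) ≤ C
  norm_row_hat : ∀ i, ‖√(N : ℝ) • rowM (M.scaledError N T ω) i * scaledHat T F‖
    ≤ 6 * C ^ 6 * pcRate N T

/-- The rowwise bound splits the estimated factors: the error row is nearly orthogonal to the true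
factors at rate `ω_T`, and has bounded norm against the factor error. -/
lemma SecondStage.exists_goodSample {c : ℝ} {N T : ℕ → ℕ}
    {S : ∀ n, Ω → Matrix (Fin (N n)) (Fin (N n)) ℝ} {F : ℕ → Ω → ℕ → Fin r → ℝ}
    {Q : Matrix (Fin r) (Fin r) ℝ} {w : Fin r → ℝ} {D : ℕ → Ω → Fin r → ℝ}
    (h : M.SecondStage P c N T S F Q w D) :
    ∃ C, c ≤ C ∧ ∀ᶠ x in whp P, M.GoodSample P C (N x.1) (T x.1) x.2 (S x.1 x.2) (F x.1 x.2) := by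
  obtain ⟨C, hcC, hs⟩ := h.sample
  have hP := h.first.pop
  refine ⟨C, hcC, ?_⟩
  filter_upwards [hs, h.first.sample, tendsto_fst_whp.eventually h.first.growth.omegaRate_le,
    tendsto_fst_whp.eventually (h.first.growth.tendsto_T.eventually_ge_atTop 1)] with x hx hy hω hT
  obtain ⟨n, ω⟩ := x
  simp only at hx hy hω hT ⊢
  generalize hSS : S n ω = SS at *
  change omegaRate (N n) (T n) ≤ pcRate (N n) (T n) at hω
  have hy := hy.1
  have hc1 := hy.one_le
  have hC1 := hx.one_le
  have hrow : ∀ i, ‖√(N n : ℝ) • rowM (M.scaledError (N n) (T n) ω) i‖ ≤ 2 * c := by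
    intro i
    refine le_of_sq_le_sq ?_ (by positivity)
    rw [norm_smul, mul_pow, norm_rowM_sq, Real.norm_of_nonneg (Real.sqrt_nonneg _),
      Real.sq_sqrt (Nat.cast_nonneg _)]
    have h1 := (abs_le.1 (hy.cov i i)).2
    have h2 := (le_abs_self _).trans ((abs_entry_le (M.SigmaU P (N n)) i i).trans hy.norm_S)
    have h3 : (M.scaledError (N n) (T n) ω * (M.scaledError (N n) (T n) ω)ᵀ) i i
        = ∑ j, M.scaledError (N n) (T n) ω i j ^ 2 := by
      simp [Matrix.mul_apply, sq]
    rw [h3] at h1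
    have h4 := hy.omega_le
    nlinarith
  refine ⟨hx, hy.pos, hT, fun j => (hP.norm_lam j).trans hcC, fun i => ?_⟩
  refine (hx.norm_row_mul_Z _).trans ?_
  have h1 := l2_norm_mul_le_of_le (hrow i) hx.norm_pcErr_le
  have h2 := hy.cross i
  have hδ := hx.delta_nonneg
  have hc0 : 0 ≤ c := by linarith
  have hω0 := hy.omega_pos.le
  calc _ ≤ 2 * C ^ 5 * (c * omegaRate (N n) (T n)) + 2 * c * (2 * C ^ 3 * pcRate (N n) (T n)) := by
        gcongr
    _ ≤ 2 * C ^ 5 * (C * pcRate (N n) (T n)) + 2 * C * (2 * C ^ 3 * pcRate (N n) (T n)) := by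
        gcongr
    _ = (2 * C ^ 6 + 4 * C ^ 4) * pcRate (N n) (T n) := by ring
    _ ≤ _ := by
        have := pow_le_pow_right₀ hC1 (show 4 ≤ 6 by norm_num)
        gcongr
        linarith

/-- The inner Gram matrix of estimated loadings is exactly the eigenvalue matrix, so the sandwich
collapses to its inverse and no approximation is involved. -/
lemma GoodSample.veInvHat_eq {C : ℝ} {N T : ℕ} {ω : Ω} {S : Matrix (Fin N) (Fin N) ℝ}
    {F : ℕ → Fin r → ℝ} (h : M.GoodSample P C N T ω S F) :
    VeInvHat (M.y ω) N T S F = diagonal (fun k => (M.pcVal N T ω S k)⁻¹) := by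
  have hN' : (N : ℝ) ≠ 0 := by exact_mod_cast h.pos_N.ne'
  have hN2 : √(N : ℝ) * √(N : ℝ) = N := Real.mul_self_sqrt (Nat.cast_nonneg _)
  have hinv : (diagonal (M.pcVal N T ω S))⁻¹ = diagonal (fun k => (M.pcVal N T ω S k)⁻¹) :=
    Matrix.inv_eq_right_inv h.pc.diag_mul_inv
  rw [VeInvHat, vhat_eq h.pos_N h.pos_T, LamHat_eq h.pos_N h.pos_T, hinv, transpose_smul,
    Matrix.mul_smul, Matrix.mul_smul, Matrix.smul_mul, Matrix.smul_mul, Matrix.smul_mul, Matrix.smul_mul,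
    smul_smul, smul_smul, mul_assoc, hN2, one_div_mul_cancel hN', one_smul]
  have h1 := h.pc.diagonal_eq
  change diagonal _ = (M.scaledData N T ω * scaledHat T F)ᵀ * S⁻¹
    * (M.scaledData N T ω * scaledHat T F) at h1
  rw [Matrix.mul_assoc _ _ S⁻¹, Matrix.mul_assoc _ _ (M.scaledData N T ω * scaledHat T F), ← h1,
    Matrix.mul_assoc, h.pc.diag_mul_inv, Matrix.mul_one]

section

variable {c : ℝ} {N T : ℕ → ℕ}
    {S : ∀ n, Ω → Matrix (Fin (N n)) (Fin (N n)) ℝ} {F : ℕ → Ω → ℕ → Fin r → ℝ}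
    {Q : Matrix (Fin r) (Fin r) ℝ} {w : Fin r → ℝ} {D : ℕ → Ω → Fin r → ℝ}
    (h : M.SecondStage P c N T S F Q w D)
include h

lemma SecondStage.tendsto_val_inv (k : Fin r) :
    Tendsto (fun x : ℕ × Ω => (M.pcVal (N x.1) (T x.1) x.2 (S x.1 x.2) k)⁻¹) (whp P)
      (𝓝 (w k)⁻¹) :=
  (tendsto_pi_nhds.1 h.val k).inv₀ (h.w_pos k).ne'

/-- Consistency of the estimator of the inverse eigenvalue matrix. -/
lemma SecondStage.tendsto_veInvHat :
    Tendsto (fun x : ℕ × Ω => VeInvHat (M.y x.2) (N x.1) (T x.1) (S x.1 x.2) (F x.1 x.2)) (whp P)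
      (𝓝 (diagonal w)⁻¹) := by
  obtain ⟨C, hcC, hg⟩ := h.exists_goodSample
  have hinv : (diagonal w)⁻¹ = diagonal (fun k => (w k)⁻¹) := by
    refine Matrix.inv_eq_right_inv ?_
    rw [diagonal_mul_diagonal, ← diagonal_one]
    congr 1; ext k; exact mul_inv_cancel₀ (h.w_pos k).ne'
  rw [hinv]
  have h1 : Tendsto (fun x : ℕ × Ω => diagonal (fun k =>
      (M.pcVal (N x.1) (T x.1) x.2 (S x.1 x.2) k)⁻¹)) (whp P) (𝓝 (diagonal fun k => (w k)⁻¹)) :=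
    (continuous_id.matrix_diagonal.tendsto _).comp (tendsto_pi_nhds.2 fun k => h.tendsto_val_inv k)
  exact h1.congr' (hg.mono fun x hx => hx.veInvHat_eq.symm)

/-- Estimated loadings are consistent up to signs. -/
lemma SecondStage.tendsto_lamHat (i : ℕ) (k : Fin r) :
    Tendsto (fun x : ℕ × Ω => D x.1 x.2 k * lamHat (M.y x.2) (T x.1) (F x.1 x.2) i k) (whp P)
      (𝓝 ((Q *ᵥ M.lam i) k)) := by
  obtain ⟨C, hcC, hg⟩ := h.exists_goodSample
  have h1 : Tendsto (fun x : ℕ × Ω => D x.1 x.2 k * (lamHat (M.y x.2) (T x.1) (F x.1 x.2) i k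
      - (M.rotH (T x.1) x.2 (F x.1 x.2) *ᵥ M.lam i) k)) (whp P) (𝓝 0) := by
    refine squeeze_zero_norm' ?_ (h.first.tendsto_rate (6 * C ^ 6))
    filter_upwards [hg,
      tendsto_fst_whp.eventually (h.first.growth.tendsto_N.eventually_gt_atTop i)] with x hx hN
    have hD : |D x.1 x.2 k| = 1 := by
      rcases h.sign x.1 x.2 k with e | e <;> rw [e] <;> norm_num
    rw [Real.norm_eq_abs, abs_mul, hD, one_mul, lamHat_sub hx.pos_N hx.pos_T x.2 _ ⟨i, hN⟩ k]
    exact (abs_entry_le _ _ _).trans (hx.norm_row_hat _)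
  have h2 : Tendsto (fun x : ℕ × Ω =>
      ((diagonal (D x.1 x.2) * M.rotH (T x.1) x.2 (F x.1 x.2)) *ᵥ M.lam i) k) (whp P)
      (𝓝 ((Q *ᵥ M.lam i) k)) :=
    ((continuous_apply k).comp (continuous_id.matrix_mulVec continuous_const)).tendsto Q
      |>.comp h.rot
  have h3 := h1.add h2
  rw [zero_add] at h3
  refine h3.congr fun x => ?_
  rw [← Matrix.mulVec_mulVec, mulVec_diagonal]
  ring

/-- Consistency of the first component of the variance of the estimated common component. -/
lemma SecondStage.tendsto_theta1Hat {SigLam : Matrix (Fin r) (Fin r) ℝ}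
    (hlam : Tendsto (fun n => M.weightedLam P (N n)) atTop (𝓝 SigLam))
    (hQS : Q * SigLam * Qᵀ = diagonal w) (hS : IsUnit SigLam.det) (i : ℕ) :
    Tendsto (fun x : ℕ × Ω => Theta1Hat (M.y x.2) (N x.1) (T x.1) (S x.1 x.2) (F x.1 x.2) i
      - M.lam i ⬝ᵥ (M.XiE P (N x.1) *ᵥ M.lam i)) (whp P) (𝓝 0) := by
  obtain ⟨C, hcC, hg⟩ := h.exists_goodSample
  have hQu := h.Q_unit
  have hQT : IsUnit (Qᵀ).det := by rwa [det_transpose]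
  have h1 : Tendsto (fun x : ℕ × Ω => ∑ k, (M.pcVal (N x.1) (T x.1) x.2 (S x.1 x.2) k)⁻¹ *
      (D x.1 x.2 k * lamHat (M.y x.2) (T x.1) (F x.1 x.2) i k) ^ 2) (whp P)
      (𝓝 (∑ k, (w k)⁻¹ * (Q *ᵥ M.lam i) k ^ 2)) :=
    tendsto_finsetSum _ fun k _ => (h.tendsto_val_inv k).mul ((h.tendsto_lamHat i k).pow 2)
  have h2 : Tendsto (fun x : ℕ × Ω => M.lam i ⬝ᵥ (M.XiE P (N x.1) *ᵥ M.lam i)) (whp P)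
      (𝓝 (M.lam i ⬝ᵥ (SigLam⁻¹ *ᵥ M.lam i))) :=
    ((continuous_const.dotProduct (continuous_id.matrix_mulVec continuous_const)).tendsto
        _).comp ((tendsto_matrix_inv hlam hS).comp tendsto_fst_whp)
  -- Inversion of `Q Σ_Λ Qᵀ = V_e`; the limit of the quadratic form thus no longer depends on `Q`.
  have e1 : SigLam⁻¹ = Qᵀ * diagonal (fun k => (w k)⁻¹) * Q := by
    refine Matrix.inv_eq_right_inv ?_
    have e2 : SigLam * Qᵀ = Q⁻¹ * diagonal w := by
      rw [← hQS, Matrix.mul_assoc, ← Matrix.mul_assoc Q⁻¹, Matrix.nonsing_inv_mul _ hQu,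
        Matrix.one_mul]
    have e3 : diagonal w * diagonal (fun k => (w k)⁻¹) = 1 := by
      rw [diagonal_mul_diagonal, ← diagonal_one]
      congr 1; ext k; exact mul_inv_cancel₀ (h.w_pos k).ne'
    rw [← Matrix.mul_assoc, ← Matrix.mul_assoc, e2, Matrix.mul_assoc Q⁻¹, e3, Matrix.mul_one,
      Matrix.nonsing_inv_mul _ hQu]
  have e4 : M.lam i ⬝ᵥ (SigLam⁻¹ *ᵥ M.lam i) = ∑ k, (w k)⁻¹ * (Q *ᵥ M.lam i) k ^ 2 := by
    rw [e1, ← Matrix.mulVec_mulVec, ← Matrix.mulVec_mulVec, Matrix.dotProduct_mulVec,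
      ← Matrix.mulVec_transpose, transpose_transpose, dotProduct]
    refine Finset.sum_congr rfl fun k _ => ?_
    rw [mulVec_diagonal]; ring
  rw [e4] at h2
  have h3 := h1.sub h2
  rw [sub_self] at h3
  refine h3.congr' ?_
  filter_upwards [hg] with x hx
  congr 1
  rw [Theta1Hat, hx.veInvHat_eq, dotProduct]
  refine Finset.sum_congr rfl fun k _ => ?_
  rw [mulVec_diagonal, mul_pow]
  -- The weight matrix is diagonal, so signs enter the form only squared.
  have hD : D x.1 x.2 k ^ 2 = 1 := by
    rcases h.sign x.1 x.2 k with e | e <;> rw [e] <;> norm_num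
  rw [hD]; ring

end

end FactorModel

end LoadingLimits

/-! ### Newey–West sums -/

section NeweyWest

/-- Sample cross moment at lag `h`. -/
noncomputable def lagSum (a b : ℕ → ℝ) (T h : ℕ) : ℝ :=
  1 / (T : ℝ) * ∑ t ∈ Finset.Ico h T, a t * b (t - h)

/-- Newey–West sum with bandwidth `K`. -/
noncomputable def nwSum (a b : ℕ → ℝ) (T K : ℕ) : ℝ :=
  lagSum a b T 0 + ∑ h ∈ Finset.range K,
    (1 - ((h + 1 : ℕ) : ℝ) / (K + 1)) * (lagSum a b T (h + 1) + lagSum b a T (h + 1))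

lemma lagSum_add_left (a a' b : ℕ → ℝ) (T h : ℕ) :
    lagSum (a + a') b T h = lagSum a b T h + lagSum a' b T h := by
  simp only [lagSum, Pi.add_apply, add_mul, Finset.sum_add_distrib, mul_add]

lemma lagSum_add_right (a b b' : ℕ → ℝ) (T h : ℕ) :
    lagSum a (b + b') T h = lagSum a b T h + lagSum a b' T h := by
  simp only [lagSum, Pi.add_apply, Finset.sum_add_distrib, mul_add]

lemma lagSum_smul_left (c : ℝ) (a b : ℕ → ℝ) (T h : ℕ) :
    lagSum (c • a) b T h = c * lagSum a b T h := by
  simp only [lagSum, Pi.smul_apply, smul_eq_mul, Finset.mul_sum]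
  exact Finset.sum_congr rfl fun t _ => by ring

lemma lagSum_smul_right (c : ℝ) (a b : ℕ → ℝ) (T h : ℕ) :
    lagSum a (c • b) T h = c * lagSum a b T h := by
  simp only [lagSum, Pi.smul_apply, smul_eq_mul, Finset.mul_sum]
  exact Finset.sum_congr rfl fun t _ => by ring

/-- Newey–West sums as a bilinear form. -/
noncomputable def nwForm (T K : ℕ) : (ℕ → ℝ) →ₗ[ℝ] (ℕ → ℝ) →ₗ[ℝ] ℝ :=
  LinearMap.mk₂ ℝ (fun a b => nwSum a b T K)
    (fun a a' b => by
      simp only [nwSum, lagSum_add_left, lagSum_add_right]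
      rw [add_add_add_comm, ← Finset.sum_add_distrib]
      congr 1
      exact Finset.sum_congr rfl fun h _ => by ring)
    (fun c a b => by
      simp only [nwSum, lagSum_smul_left, lagSum_smul_right, smul_eq_mul]
      rw [mul_add, Finset.mul_sum]
      congr 1
      exact Finset.sum_congr rfl fun h _ => by ring)
    (fun a b b' => by
      simp only [nwSum, lagSum_add_left, lagSum_add_right]
      rw [add_add_add_comm, ← Finset.sum_add_distrib]
      congr 1
      exact Finset.sum_congr rfl fun h _ => by ring)
    (fun c a b => by
      simp only [nwSum, lagSum_smul_left, lagSum_smul_right, smul_eq_mul]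
      rw [mul_add, Finset.mul_sum]
      congr 1
      exact Finset.sum_congr rfl fun h _ => by ring)

lemma nwForm_apply (T K : ℕ) (a b : ℕ → ℝ) : nwForm T K a b = nwSum a b T K := rfl

lemma abs_lagSum_le {a b : ℕ → ℝ} {T : ℕ} {A B : ℝ} (hA : 0 ≤ A) (hB : 0 ≤ B)
    (ha : ∑ t ∈ Finset.range T, a t ^ 2 ≤ T * A ^ 2)
    (hb : ∑ t ∈ Finset.range T, b t ^ 2 ≤ T * B ^ 2) (h : ℕ) : |lagSum a b T h| ≤ A * B := by
  have h1 := Finset.sum_mul_sq_le_sq_mul_sq (Finset.Ico h T) a (fun t => b (t - h))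
  have h2 : ∑ t ∈ Finset.Ico h T, a t ^ 2 ≤ T * A ^ 2 := by
    refine le_trans (Finset.sum_le_sum_of_subset_of_nonneg (fun t ht => ?_)
      fun t _ _ => sq_nonneg _) ha
    exact Finset.mem_range.2 (Finset.mem_Ico.1 ht).2
  have h3 : ∑ t ∈ Finset.Ico h T, b (t - h) ^ 2 ≤ T * B ^ 2 := by
    rw [Finset.sum_Ico_eq_sum_range]
    refine le_trans ?_ hb
    simp only [add_tsub_cancel_left]
    exact Finset.sum_le_sum_of_subset_of_nonneg (Finset.range_mono (Nat.sub_le _ _))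
      fun t _ _ => sq_nonneg _
  have h4 : |∑ t ∈ Finset.Ico h T, a t * b (t - h)| ≤ T * (A * B) := by
    refine abs_le_of_sq_le_sq ?_ (by positivity)
    calc _ ≤ (T * A ^ 2) * (T * B ^ 2) := h1.trans
          (mul_le_mul h2 h3 (Finset.sum_nonneg fun t _ => sq_nonneg _) (by positivity))
      _ = _ := by ring
  rw [lagSum, abs_mul, abs_of_nonneg (by positivity)]
  rcases Nat.eq_zero_or_pos T with rfl | hT
  · simp; positivity
  · have : (0 : ℝ) < T := by exact_mod_cast hT
    rw [one_div, inv_mul_le_iff₀ this]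
    exact h4

/-- The weights have absolute value at most one and there are `1 + 2K` lag sums, each bounded by
Cauchy–Schwarz. -/
lemma abs_nwSum_le {a b : ℕ → ℝ} {T : ℕ} {A B : ℝ} (hA : 0 ≤ A) (hB : 0 ≤ B)
    (ha : ∑ t ∈ Finset.range T, a t ^ 2 ≤ T * A ^ 2)
    (hb : ∑ t ∈ Finset.range T, b t ^ 2 ≤ T * B ^ 2) (K : ℕ) :
    |nwSum a b T K| ≤ (1 + 2 * K) * (A * B) := by
  have hw : ∀ h ∈ Finset.range K, |1 - ((h + 1 : ℕ) : ℝ) / (K + 1)| ≤ 1 := by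
    intro h hh
    have hK : ((h + 1 : ℕ) : ℝ) ≤ K := by exact_mod_cast Finset.mem_range.1 hh
    have h1 : ((h + 1 : ℕ) : ℝ) / (K + 1) ≤ 1 := by
      rw [div_le_one (by positivity)]; linarith
    have h2 : 0 ≤ ((h + 1 : ℕ) : ℝ) / (K + 1) := by positivity
    rw [abs_le]; constructor <;> linarith
  rw [nwSum]
  refine (abs_add_le _ _).trans ?_
  have h1 : |∑ h ∈ Finset.range K, (1 - ((h + 1 : ℕ) : ℝ) / (K + 1)) *
      (lagSum a b T (h + 1) + lagSum b a T (h + 1))| ≤ ∑ h ∈ Finset.range K, 2 * (A * B) := by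
    refine (Finset.abs_sum_le_sum_abs _ _).trans (Finset.sum_le_sum fun h hh => ?_)
    rw [abs_mul]
    have e1 := abs_lagSum_le hA hB ha hb (h + 1)
    have e2 := abs_lagSum_le hB hA hb ha (h + 1)
    have e3 := abs_add_le (lagSum a b T (h + 1)) (lagSum b a T (h + 1))
    have e4 : |lagSum a b T (h + 1) + lagSum b a T (h + 1)| ≤ 2 * (A * B) := by linarith
    exact (mul_le_mul (hw h hh) e4 (abs_nonneg _) zero_le_one).trans_eq (one_mul _)
  rw [Finset.sum_const, Finset.card_range, nsmul_eq_mul] at h1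
  have := abs_lagSum_le hA hB ha hb 0
  linarith

/-- Entrywise, the estimator is the Newey–West cross sum of two estimated scores, hence a value of a
bilinear form. The lag index is shifted to start at zero. -/
lemma hac_apply {r : ℕ} (y : ℕ → ℕ → ℝ) (T K : ℕ) (F : ℕ → Fin r → ℝ) (j : ℕ) (k l : Fin r) :
    hac y T K F j k l
      = nwSum (fun t => uHat y T F j t * F t k) (fun t => uHat y T F j t * F t l) T K := by
  have e : Finset.Icc 1 K = Finset.Ico 1 (K + 1) := by ext; simp
  rw [hac, nwSum, e, Finset.sum_Ico_eq_sum_range]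
  simp only [Matrix.add_apply, Matrix.smul_apply, Matrix.sum_apply, vecMulVec_apply, smul_eq_mul,
    lagSum, add_tsub_cancel_right, add_comm 1, tsub_zero, Finset.range_eq_Ico]
  congr 1
  · congr 1
    exact Finset.sum_congr rfl fun t _ => by ring
  · refine Finset.sum_congr rfl fun h _ => ?_
    congr 1
    rw [← mul_add, ← Finset.sum_add_distrib]
    congr 1
    exact Finset.sum_congr rfl fun t _ => by ring

variable {Ω : Type*} {mΩ : MeasurableSpace Ω} {P : Measure Ω} [IsProbabilityMeasure P]

lemma abs_integral_mul_le {X Y : Ω → ℝ} {C : ℝ}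
    (hX : Integrable (fun ω => |X ω| ^ 2) P ∧ ∫ ω, |X ω| ^ 2 ∂P ≤ C)
    (hY : Integrable (fun ω => |Y ω| ^ 2) P ∧ ∫ ω, |Y ω| ^ 2 ∂P ≤ C) :
    |∫ ω, X ω * Y ω ∂P| ≤ C := by
  refine abs_integral_le_integral_abs.trans ?_
  have hi := (hX.1.add hY.1).div_const 2
  have h2 : ∫ ω, |X ω * Y ω| ∂P ≤ ∫ ω, (|X ω| ^ 2 + |Y ω| ^ 2) / 2 ∂P := by
    refine integral_mono_of_nonneg (ae_of_all _ fun ω => abs_nonneg _) hi (ae_of_all _ fun ω => ?_)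
    simp only [abs_mul]
    nlinarith [sq_nonneg (|X ω| - |Y ω|)]
  rw [integral_div, integral_add hX.1 hY.1] at h2
  linarith [hX.2, hY.2]

lemma integrable_mul_of_moments {X Y : Ω → ℝ} (hX : Measurable X) (hY : Measurable Y)
    (hX2 : Integrable (fun ω => |X ω| ^ 2) P) (hY2 : Integrable (fun ω => |Y ω| ^ 2) P) :
    Integrable (fun ω => X ω * Y ω) P := by
  simp only [sq_abs] at hX2 hY2
  exact ((memLp_two_iff_integrable_sq hX.aestronglyMeasurable).2 hX2).integrable_mul
    ((memLp_two_iff_integrable_sq hY.aestronglyMeasurable).2 hY2)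

/-- A process adapted to a mixing pair of filtrations, with moments of all orders. -/
structure IsMixingProcess (P : Measure Ω) (ℱ 𝓖 : ℕ → MeasurableSpace Ω) (C : ℕ → ℝ)
    (x : ℕ → Ω → ℝ) : Prop where
  past : ∀ t, Measurable[ℱ t] (x t)
  future : ∀ t, Measurable[𝓖 t] (x t)
  moment : ∀ t k, Integrable (fun ω => |x t ω| ^ k) P ∧ ∫ ω, |x t ω| ^ k ∂P ≤ C k

/-- The products `x (t + l) * y t` occupy a time window of length `l`, so they decorrelate only
beyond lag `l`; this produces the factor `l + 1`. The constant is uniform over processes with the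
same moment bounds. -/
lemma IsMixing.integral_sq_lagSum_sub_le {ℱ 𝓖 : ℕ → MeasurableSpace Ω} {c ρ : ℝ} (hc : 0 < c)
    (hρ : 0 < ρ) (h : IsMixing P ℱ 𝓖 (expRate c ρ)) (C : ℕ → ℝ) :
    ∃ D, 0 ≤ D ∧ ∀ x y : ℕ → Ω → ℝ, IsMixingProcess P ℱ 𝓖 C x → IsMixingProcess P ℱ 𝓖 C y →
      ∀ (e : ℝ) (l : ℕ), (∀ t, ∫ ω, x (t + l) ω * y t ω ∂P = e) → ∀ T : ℕ,
      Integrable (fun ω => (lagSum (fun t => x t ω) (fun t => y t ω) T l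
        - ((T - l : ℕ) : ℝ) / T * e) ^ 2) P ∧
      ∫ ω, (lagSum (fun t => x t ω) (fun t => y t ω) T l - ((T - l : ℕ) : ℝ) / T * e) ^ 2 ∂P
        ≤ D * (l + 1) / T := by
  set C' : ℕ → ℝ := fun k => 2 ^ (k - 1) * (2 * C (2 * k) + C 2 ^ k) with hC'
  set D₁ : ℝ := 4 + 6 * (1 + C' 4) ^ 2 with hD₁
  have hD₁0 : 0 ≤ D₁ := by positivity
  have hsum : Summable fun i => expRate (c / 3) ρ (i + 1) :=
    (summable_expRate (by positivity : 0 < c / 3) hρ).comp_injective (add_left_injective 1)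
  set G := ∑' i, expRate (c / 3) ρ (i + 1) with hG
  have hG0 : 0 ≤ G := tsum_nonneg fun i => (expRate_pos _ _ _).le
  refine ⟨2 * (|C' 2| + D₁ * G), by positivity, fun x y hx hy e l he T => ?_⟩
  have mx : ∀ t, Measurable (x t) := fun t => (hx.past t).mono (h.past_le t) le_rfl
  have my : ∀ t, Measurable (y t) := fun t => (hy.past t).mono (h.past_le t) le_rfl
  have heC : |e| ≤ C 2 := by
    rw [← he 0]; exact abs_integral_mul_le (hx.moment _ 2) (hy.moment _ 2)
  set X : ℕ → Ω → ℝ := fun t ω => x (t + l) ω * y t ω - e with hX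
  have hmom : ∀ t k, Integrable (fun ω => |X t ω| ^ k) P ∧ ∫ ω, |X t ω| ^ k ∂P ≤ C' k := fun t k =>
    moment_mul_sub (mx _) (my _) (hx.moment _) (hy.moment _) heC k
  have mX : ∀ t, Measurable (X t) := fun t => ((mx _).mul (my _)).sub_const _
  have hC2 : 0 ≤ C' 2 := (integral_nonneg fun ω => by positivity).trans (hmom 0 2).2
  have h4 : ∀ t, Integrable (fun ω => X t ω ^ 4) P ∧ ∫ ω, X t ω ^ 4 ∂P ≤ C' 4 := fun t => by
    have := hmom t 4
    simpa only [Even.pow_abs (show Even 4 by decide)] using this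
  have hmean : ∀ t, ∫ ω, X t ω ∂P = 0 := fun t => by
    simp only [hX]
    rw [integral_sub (integrable_mul_of_moments (mx _) (my _) (hx.moment _ 2).1 (hy.moment _ 2).1)
      (integrable_const _), he t]
    simp
  have hii : ∀ s t, Integrable (fun ω => X s ω * X t ω) P := fun s t =>
    integrable_mul_of_moments (mX s) (mX t) (hmom s 2).1 (hmom t 2).1
  -- At lags up to `l` the windows overlap and second moments are used; at larger lags the gap is `d
  -- - l`.
  set g : ℕ → ℝ := fun d => if d ≤ l then C' 2 else D₁ * expRate (c / 3) ρ (d - l) with hg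
  have hg0 : ∀ d, 0 ≤ g d := fun d => by
    simp only [hg]
    split_ifs
    · exact hC2
    · exact mul_nonneg hD₁0 (expRate_pos _ _ _).le
  have hcov : ∀ s d, ∫ ω, X s ω * X (s + d) ω ∂P ≤ g d := by
    intro s d
    simp only [hg]
    split_ifs with hd
    · exact (le_abs_self _).trans (abs_integral_mul_le (hmom _ 2) (hmom _ 2))
    · have hk : 0 < d - l := by omega
      have hX1 : Measurable[ℱ (s + l)] (X s) :=
        ((hx.past _).mul ((hy.past s).mono (h.past_mono (by omega)) le_rfl)).sub_const _
      have hX2 : Measurable[𝓖 (s + l + (d - l))] (X (s + d)) := by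
        rw [show s + l + (d - l) = s + d by omega]
        exact (((hx.future _).mono (h.future_anti (by omega)) le_rfl).mul (hy.future _)).sub_const _
      have := h.abs_cov_le hk hX1 hX2 (h4 _).1 (h4 _).1 (h4 _).2 (h4 _).2
      rw [hmean, zero_mul, sub_zero] at this
      exact (le_abs_self _).trans this
  have hlag : ∀ ω, lagSum (fun t => x t ω) (fun t => y t ω) T l - ((T - l : ℕ) : ℝ) / T * e
      = 1 / (T : ℝ) * ∑ i ∈ Finset.range (T - l), X (0 + i) ω := by
    intro ω
    have e1 : ∀ i, x (l + i) ω * y (l + i - l) ω = X (0 + i) ω + e := fun i => by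
      simp only [hX, zero_add, add_tsub_cancel_left, add_comm i l, sub_add_cancel]
    simp only [lagSum, Finset.sum_Ico_eq_sum_range, e1, Finset.sum_add_distrib, Finset.sum_const,
      Finset.card_range, nsmul_eq_mul]
    ring
  have hgs : ∑ d ∈ Finset.range (T - l), g d ≤ (l + 1) * (|C' 2| + D₁ * G) := by
    have e1 : ∑ d ∈ Finset.range (T - l), g d ≤ ∑ d ∈ Finset.range (l + 1 + (T - l)), g d :=
      Finset.sum_le_sum_of_subset_of_nonneg (Finset.range_mono (by omega)) fun d _ _ => hg0 d
    rw [Finset.sum_range_add] at e1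
    have e2 : ∑ d ∈ Finset.range (l + 1), g d = (l + 1) * C' 2 := by
      rw [Finset.sum_congr rfl fun d hd => (show g d = C' 2 from
        if_pos (by have := Finset.mem_range.1 hd; omega))]
      simp
    have e3 : ∑ d ∈ Finset.range (T - l), g (l + 1 + d) ≤ D₁ * G := by
      have : ∀ d, g (l + 1 + d) = D₁ * expRate (c / 3) ρ (d + 1) := fun d => by
        simp only [hg]
        rw [if_neg (by omega), show l + 1 + d - l = d + 1 by omega]
      simp only [this, ← Finset.mul_sum]
      exact mul_le_mul_of_nonneg_left (hsum.sum_le_tsum _ fun i _ => (expRate_pos _ _ _).le) hD₁0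
    have e4 : 0 ≤ D₁ * G := by positivity
    have e5 : (0 : ℝ) ≤ l := Nat.cast_nonneg _
    have e6 := le_abs_self (C' 2)
    nlinarith
  simp only [hlag, mul_pow]
  constructor
  · refine Integrable.const_mul ?_ _
    simp only [sq (Finset.sum _ _), Finset.sum_mul_sum]
    exact integrable_finsetSum _ fun i _ => integrable_finsetSum _ fun j _ => hii _ _
  · rw [integral_const_mul]
    have e1 := integral_sq_sum_le hg0 hii hcov 0 (T - l)
    have e2 : ((T - l : ℕ) : ℝ) ≤ T := by exact_mod_cast Nat.sub_le _ _
    have e3 : 2 * ((T - l : ℕ) : ℝ) * ∑ d ∈ Finset.range (T - l), g d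
        ≤ 2 * T * ((l + 1) * (|C' 2| + D₁ * G)) := by
      have : 0 ≤ ∑ d ∈ Finset.range (T - l), g d := Finset.sum_nonneg fun d _ => hg0 d
      gcongr
    rcases Nat.eq_zero_or_pos T with rfl | hT
    · simp
    · have hT : (0 : ℝ) < T := by exact_mod_cast hT
      calc _ ≤ (1 / (T : ℝ)) ^ 2 * (2 * T * ((l + 1) * (|C' 2| + D₁ * G))) :=
            mul_le_mul_of_nonneg_left (e1.trans e3) (by positivity)
        _ = _ := by field_simp

/-- Autocovariances of a mixing process are summable. -/
lemma IsMixing.summable_autocov {ℱ 𝓖 : ℕ → MeasurableSpace Ω} {c ρ : ℝ} (hc : 0 < c)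
    (hρ : 0 < ρ) (h : IsMixing P ℱ 𝓖 (expRate c ρ)) {C : ℕ → ℝ} {x y : ℕ → Ω → ℝ}
    (hx : IsMixingProcess P ℱ 𝓖 C x) (hy : IsMixingProcess P ℱ 𝓖 C y)
    (hx0 : ∀ t, ∫ ω, x t ω ∂P = 0) :
    Summable fun l : ℕ => ∫ ω, x (l + 1) ω * y 0 ω ∂P := by
  have h4 : ∀ {z : ℕ → Ω → ℝ}, IsMixingProcess P ℱ 𝓖 C z → ∀ t,
      Integrable (fun ω => z t ω ^ 4) P ∧ ∫ ω, z t ω ^ 4 ∂P ≤ C 4 := fun hz t => by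
    have := hz.moment t 4
    simpa only [Even.pow_abs (show Even 4 by decide)] using this
  have hsum : Summable fun i => (4 + 6 * (1 + C 4) ^ 2) * expRate (c / 3) ρ (i + 1) :=
    ((summable_expRate (by positivity : 0 < c / 3) hρ).comp_injective
      (add_left_injective 1)).mul_left _
  refine Summable.of_norm_bounded hsum fun l => ?_
  have := h.abs_cov_le (X := y 0) (Y := x (l + 1)) (n := 0) (k := l + 1) (by omega) (hy.past 0)
    (by rw [zero_add]; exact hx.future _) (h4 hy 0).1 (h4 hx _).1 (h4 hy 0).2 (h4 hx _).2
  rw [hx0, mul_zero, sub_zero] at this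
  simp only [mul_comm (y 0 _)] at this
  exact this

/-- Consistency of Newey–West sums of a mixing process. -/
theorem IsMixing.tendsto_nwSum {ℱ 𝓖 : ℕ → MeasurableSpace Ω} {c ρ : ℝ} (hc : 0 < c)
    (hρ : 0 < ρ) (h : IsMixing P ℱ 𝓖 (expRate c ρ)) {C : ℕ → ℝ} {x y : ℕ → Ω → ℝ}
    (hx : IsMixingProcess P ℱ 𝓖 C x) (hy : IsMixingProcess P ℱ 𝓖 C y)
    (hx0 : ∀ t, ∫ ω, x t ω ∂P = 0) (hy0 : ∀ t, ∫ ω, y t ω ∂P = 0)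
    (hxy : ∀ t l, ∫ ω, x (t + l) ω * y t ω ∂P = ∫ ω, x l ω * y 0 ω ∂P)
    (hyx : ∀ t l, ∫ ω, y (t + l) ω * x t ω ∂P = ∫ ω, y l ω * x 0 ω ∂P) {T K : ℕ → ℕ}
    (hT : Tendsto T atTop atTop) (hK : Tendsto K atTop atTop)
    (hKT : Tendsto (fun n => ((K n : ℝ) + 1) ^ 3 / T n) atTop (𝓝 0)) :
    Tendsto (fun p : ℕ × Ω => nwSum (fun t => x t p.2) (fun t => y t p.2) (T p.1) (K p.1)) (whp P)
      (𝓝 (∫ ω, x 0 ω * y 0 ω ∂P + ∑' l : ℕ, (∫ ω, x (l + 1) ω * y 0 ω ∂P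
        + ∫ ω, y (l + 1) ω * x 0 ω ∂P))) := by
  set ψ : ℕ → ℝ := fun l => ∫ ω, x l ω * y 0 ω ∂P with hψ
  set φ : ℕ → ℝ := fun l => ∫ ω, y l ω * x 0 ω ∂P with hφ
  have hsum : Summable fun l => ψ (l + 1) + φ (l + 1) :=
    (h.summable_autocov hc hρ hx hy hx0).add (h.summable_autocov hc hρ hy hx hy0)
  obtain ⟨D, hD, hvar⟩ := h.integral_sq_lagSum_sub_le hc hρ C
  set lxy : ℕ → ℕ → Ω → ℝ := fun n l ω => lagSum (fun t => x t ω) (fun t => y t ω) (T n) l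
    - ((T n - l : ℕ) : ℝ) / T n * ψ l with hlxy
  set lyx : ℕ → ℕ → Ω → ℝ := fun n l ω => lagSum (fun t => y t ω) (fun t => x t ω) (T n) l
    - ((T n - l : ℕ) : ℝ) / T n * φ l with hlyx
  have vxy := fun n l => hvar x y hx hy (ψ l) l (fun t => hxy t l) (T n)
  have vyx := fun n l => hvar y x hy hx (φ l) l (fun t => hyx t l) (T n)
  set wt : ℕ → ℕ → ℝ := fun n l => 1 - ((l + 1 : ℕ) : ℝ) / (K n + 1) with hwt
  have hwt1 : ∀ n, ∀ l ∈ Finset.range (K n), |wt n l| ≤ 1 := by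
    intro n l hl
    have hK : ((l + 1 : ℕ) : ℝ) ≤ K n := by exact_mod_cast Finset.mem_range.1 hl
    have h1 : ((l + 1 : ℕ) : ℝ) / (K n + 1) ≤ 1 := by
      rw [div_le_one (by positivity)]; linarith
    have h2 : 0 ≤ ((l + 1 : ℕ) : ℝ) / (K n + 1) := by positivity
    simp only [hwt]
    rw [abs_le]; constructor <;> linarith
  -- The mean of the Newey–West sum; a lag sum has `T - l` terms but is divided by `T`. The
  -- fluctuation and the bias are treated separately.
  set mean : ℕ → ℝ := fun n => ((T n - 0 : ℕ) : ℝ) / T n * ψ 0 + ∑ l ∈ Finset.range (K n),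
    wt n l * (((T n - (l + 1) : ℕ) : ℝ) / T n * (ψ (l + 1) + φ (l + 1))) with hmean
  set Z : ℕ → Ω → ℝ := fun n ω => nwSum (fun t => x t ω) (fun t => y t ω) (T n) (K n) - mean n
    with hZ
  have hZeq : ∀ n ω, Z n ω = lxy n 0 ω + ∑ l ∈ Finset.range (K n),
      wt n l * (lxy n (l + 1) ω + lyx n (l + 1) ω) := by
    intro n ω
    have : ∀ l, wt n l * (lxy n (l + 1) ω + lyx n (l + 1) ω)
        = wt n l * (lagSum (fun t => x t ω) (fun t => y t ω) (T n) (l + 1)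
          + lagSum (fun t => y t ω) (fun t => x t ω) (T n) (l + 1))
          - wt n l * (((T n - (l + 1) : ℕ) : ℝ) / T n * (ψ (l + 1) + φ (l + 1))) := fun l => by
      simp only [hlxy, hlyx]; ring
    rw [Finset.sum_congr rfl fun l _ => this l, Finset.sum_sub_distrib]
    exact add_sub_add_comm _ _ _ _
  have mx : ∀ t, Measurable (x t) := fun t => (hx.past t).mono (h.past_le t) le_rfl
  have my : ∀ t, Measurable (y t) := fun t => (hy.past t).mono (h.past_le t) le_rfl
  have mlag : ∀ {a b : ℕ → Ω → ℝ}, (∀ t, Measurable (a t)) → (∀ t, Measurable (b t)) → ∀ S l,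
      Measurable fun ω => lagSum (fun t => a t ω) (fun t => b t ω) S l := fun ha hb S l =>
    (Finset.measurable_sum _ fun t _ => (ha _).mul (hb _)).const_mul _
  have mZ : ∀ n, Measurable (Z n) := fun n =>
    ((mlag mx my _ _).add (Finset.measurable_sum _ fun l _ =>
      ((mlag mx my _ _).add (mlag my mx _ _)).const_mul _)).sub_const _
  -- Cauchy–Schwarz over the `K + 1` lags. With variances of order `(K + 1)/T` the expectation of
  -- this bound has order `(K + 1)³/T`.
  set B : ℕ → Ω → ℝ := fun n ω => (K n + 1) * ∑ l ∈ Finset.range (K n + 1),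
    2 * (lxy n l ω ^ 2 + lyx n l ω ^ 2) with hB
  have hZB : ∀ n ω, Z n ω ^ 2 ≤ B n ω := by
    intro n ω
    have e1 : |Z n ω| ≤ ∑ l ∈ Finset.range (K n + 1), (|lxy n l ω| + |lyx n l ω|) := by
      rw [hZeq, Finset.sum_range_succ', add_comm]
      refine (abs_add_le _ _).trans (add_le_add ?_ ?_)
      · refine (Finset.abs_sum_le_sum_abs _ _).trans (Finset.sum_le_sum fun l hl => ?_)
        rw [abs_mul]
        exact (mul_le_mul (hwt1 n l hl) (abs_add_le _ _) (abs_nonneg _) zero_le_one).trans_eq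
          (one_mul _)
      · linarith [abs_nonneg (lyx n 0 ω)]
    rw [← sq_abs]
    refine (pow_le_pow_left₀ (abs_nonneg _) e1 2).trans (sq_sum_le_card_mul_sum_sq.trans ?_)
    simp only [hB, Finset.card_range]
    push_cast
    refine mul_le_mul_of_nonneg_left (Finset.sum_le_sum fun l _ => ?_) (by positivity)
    have := sq_nonneg (|lxy n l ω| - |lyx n l ω|)
    have := sq_abs (lxy n l ω)
    have := sq_abs (lyx n l ω)
    nlinarith
  have hterm : ∀ n l, Integrable (fun ω => 2 * (lxy n l ω ^ 2 + lyx n l ω ^ 2)) P := fun n l =>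
    ((vxy n l).1.add (vyx n l).1).const_mul 2
  have hadd : ∀ n l, ∫ ω, (lxy n l ω ^ 2 + lyx n l ω ^ 2) ∂P
      = ∫ ω, lxy n l ω ^ 2 ∂P + ∫ ω, lyx n l ω ^ 2 ∂P := fun n l =>
    integral_add (vxy n l).1 (vyx n l).1
  have hBi : ∀ n, Integrable (B n) P := fun n =>
    (integrable_finsetSum _ fun l _ => hterm n l).const_mul _
  have hBint : ∀ n, ∫ ω, B n ω ∂P ≤ 4 * D * (((K n : ℝ) + 1) ^ 3 / T n) := by
    intro n
    simp only [hB]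
    rw [integral_const_mul, integral_finsetSum _ fun l _ => hterm n l]
    have e1 : ∀ l ∈ Finset.range (K n + 1), ∫ ω, 2 * (lxy n l ω ^ 2 + lyx n l ω ^ 2) ∂P
        ≤ 4 * D * ((K n + 1) / T n) := by
      intro l hl
      rw [integral_const_mul, hadd]
      have hl' : (l : ℝ) + 1 ≤ K n + 1 := by
        exact_mod_cast Finset.mem_range.1 hl
      have e2 : D * (l + 1) / T n ≤ D * (K n + 1) / T n := by gcongr
      have e3 := (vxy n l).2
      have e4 := (vyx n l).2
      rw [mul_div_assoc] at e2
      calc _ ≤ 2 * (D * (l + 1) / T n + D * (l + 1) / T n) := by gcongr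
        _ ≤ 2 * (D * ((K n + 1) / T n) + D * ((K n + 1) / T n)) := by
          rw [← mul_div_assoc D]; gcongr
        _ = _ := by ring
    calc _ ≤ (K n + 1 : ℝ) * ∑ l ∈ Finset.range (K n + 1), 4 * D * ((K n + 1) / T n) :=
          mul_le_mul_of_nonneg_left (Finset.sum_le_sum e1) (by positivity)
      _ = _ := by
          rw [Finset.sum_const, Finset.card_range, nsmul_eq_mul]; push_cast; ring
  have hZi : ∀ n, Integrable (fun ω => Z n ω ^ 2) P := fun n =>
    (hBi n).mono' ((mZ n).pow_const 2).aestronglyMeasurable (ae_of_all _ fun ω => by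
      rw [Real.norm_of_nonneg (sq_nonneg _)]; exact hZB n ω)
  have hZ0 : Tendsto (fun p : ℕ × Ω => Z p.1 p.2) (whp P) (𝓝 0) := by
    refine tendsto_whp_zero_of_integral_sq (Eventually.of_forall hZi) ?_
    have := hKT.const_mul (4 * D)
    rw [mul_zero] at this
    refine squeeze_zero (fun n => integral_nonneg fun ω => sq_nonneg _) (fun n => ?_) this
    exact (integral_mono (hZi n) (hBi n) (hZB n)).trans (hBint n)
  have hTR : Tendsto (fun n => (T n : ℝ)) atTop atTop := tendsto_natCast_atTop_atTop.comp hT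
  have hKR : Tendsto (fun n => (K n : ℝ) + 1) atTop atTop :=
    tendsto_atTop_add_const_right _ _ (tendsto_natCast_atTop_atTop.comp hK)
  have hfrac : ∀ l : ℕ, Tendsto (fun n => ((T n - l : ℕ) : ℝ) / T n) atTop (𝓝 1) := by
    intro l
    have h1 : Tendsto (fun n => 1 - (l : ℝ) / T n) atTop (𝓝 (1 - 0)) :=
      tendsto_const_nhds.sub (tendsto_const_nhds.div_atTop hTR)
    rw [sub_zero] at h1
    refine h1.congr' ?_
    filter_upwards [hT.eventually_ge_atTop (l + 1)] with n hn
    have : (T n : ℝ) ≠ 0 := by exact_mod_cast (by omega : T n ≠ 0)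
    rw [Nat.cast_sub (by omega)]
    field_simp
  have hm : Tendsto mean atTop (𝓝 (ψ 0 + ∑' l : ℕ, (ψ (l + 1) + φ (l + 1)))) := by
    refine Tendsto.add (by simpa using (hfrac 0).mul_const (ψ 0)) ?_
    -- Weights and fractions tend to one at each fixed lag and never exceed one in absolute value
    -- inside the bandwidth, so the bias vanishes by dominated convergence against the summable
    -- autocovariances.
    have hdct := tendsto_tsum_of_dominated_convergence (𝓕 := atTop)
      (f := fun n l => if l < K n then
        wt n l * (((T n - (l + 1) : ℕ) : ℝ) / T n * (ψ (l + 1) + φ (l + 1))) else 0)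
      (g := fun l => ψ (l + 1) + φ (l + 1)) hsum.norm (fun l => ?_)
      (Eventually.of_forall fun n l => ?_)
    · refine hdct.congr fun n => ?_
      rw [tsum_eq_sum (s := Finset.range (K n))]
      · exact Finset.sum_congr rfl fun l hl => if_pos (Finset.mem_range.1 hl)
      · exact fun l hl => if_neg fun h => hl (Finset.mem_range.2 h)
    · have h1 : Tendsto (fun n => wt n l) atTop (𝓝 (1 - 0)) :=
        tendsto_const_nhds.sub (tendsto_const_nhds.div_atTop hKR)
      have h2 := h1.mul ((hfrac (l + 1)).mul_const (ψ (l + 1) + φ (l + 1)))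
      rw [sub_zero, one_mul, one_mul] at h2
      refine h2.congr' ?_
      filter_upwards [hK.eventually_gt_atTop l] with n hn
      rw [if_pos hn]
    · split_ifs with hl
      · rw [norm_mul, norm_mul]
        have e1 := hwt1 n l (Finset.mem_range.2 hl)
        have e2 : ‖((T n - (l + 1) : ℕ) : ℝ) / T n‖ ≤ 1 := by
          rw [Real.norm_of_nonneg (by positivity)]
          exact div_le_one_of_le₀ (by exact_mod_cast Nat.sub_le _ _) (by positivity)
        rw [← Real.norm_eq_abs] at e1
        calc _ ≤ 1 * (1 * ‖ψ (l + 1) + φ (l + 1)‖) := by gcongr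
          _ = _ := by ring
      · simp
  have := hZ0.add (hm.comp (tendsto_fst_whp (P := P)))
  rw [zero_add] at this
  refine this.congr fun p => ?_
  simp [hZ]

end NeweyWest

/-! ### Newey–West estimation in the factor model -/

section FactorNeweyWest

open scoped Matrix.Norms.L2Operator

namespace FactorModel

variable {r : ℕ} {Ω : Type*} [mΩ : MeasurableSpace Ω] {P : Measure Ω} [IsProbabilityMeasure P]
  {M : FactorModel r Ω}

/-- The products `u_{jt} f_{kt}`. -/
def score (M : FactorModel r Ω) (j : ℕ) (k : Fin r) (t : ℕ) (ω : Ω) : ℝ :=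
  M.u j t ω * M.f k t ω

namespace Regular

variable (hM : M.Regular P)
include hM

lemma exists_isMixingProcess_score : ∃ C : ℕ → ℝ, ∀ j k,
    IsMixingProcess P M.pastUpTo (fun n => M.future (n : ℤ)) C (M.score j k) := by
  obtain ⟨C, hu, hf⟩ := hM.exists_moments
  refine ⟨fun k => 2 ^ (k - 1) * (2 * C (2 * k) + 0 ^ k), fun j k => ⟨fun t => ?_, fun t => ?_,
    fun t p => ?_⟩⟩
  · exact (measurable_u_of_state (measurable_state_past le_rfl) _).mul
      (measurable_f_of_state (measurable_state_past le_rfl) _)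
  · exact (measurable_u_of_state (measurable_state_future le_rfl) _).mul
      (measurable_f_of_state (measurable_state_future le_rfl) _)
  · have := moment_mul_sub (hM.measurable_u j t) (hM.measurable_f k t) (hu j t) (hf k t) (e := 0)
      (D := 0) (by simp) p
    simp only [sub_zero] at this
    exact this

lemma integral_score (j : ℕ) (k : Fin r) (t : ℕ) : ∫ ω, M.score j k t ω ∂P = 0 :=
  hM.mean_uf j k t

lemma integral_score_mul (j : ℕ) (k l : Fin r) (t h : ℕ) :
    ∫ ω, M.score j k (t + h) ω * M.score j l t ω ∂P
      = ∫ ω, M.score j k h ω * M.score j l 0 ω ∂P := by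
  have := hM.integral_path t (g := fun p => (p h).2 j * (p h).1 k * ((p 0).2 j * (p 0).1 l))
    (by fun_prop)
  simp only [path, state, zero_add, add_zero] at this
  simp only [score]
  push_cast
  simp only [add_comm (t : ℤ)]
  exact this

lemma integrable_score_mul (j : ℕ) (k l : Fin r) (s t : ℕ) :
    Integrable (fun ω => M.score j k s ω * M.score j l t ω) P := by
  obtain ⟨C, hC⟩ := hM.exists_isMixingProcess_score
  exact integrable_mul_of_moments ((hM.measurable_u _ _).mul (hM.measurable_f _ _))
    ((hM.measurable_u _ _).mul (hM.measurable_f _ _)) ((hC j k).moment s 2).1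
    ((hC j l).moment t 2).1

lemma phiTerm_apply (j h : ℕ) (k l : Fin r) : M.PhiTerm P j h k l
    = ∫ ω, M.score j k h ω * M.score j l 0 ω ∂P
      + ∫ ω, M.score j l h ω * M.score j k 0 ω ∂P := by
  rw [← integral_add (hM.integrable_score_mul _ _ _ _ _) (hM.integrable_score_mul _ _ _ _ _)]
  simp only [PhiTerm, Matrix.of_apply, score]
  refine integral_congr_ae (ae_of_all _ fun ω => ?_)
  simp only [Nat.cast_zero]
  ring

/-- The series defining the long-run covariance converges. -/
theorem summable_phiTerm (j : ℕ) : Summable fun h : ℕ => M.PhiTerm P j (h + 1) := by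
  obtain ⟨ρ, hρ, c, hc, hmix⟩ := hM.isMixing
  obtain ⟨C, hC⟩ := hM.exists_isMixingProcess_score
  refine Pi.summable.2 fun k => Pi.summable.2 fun l => ?_
  simp only [hM.phiTerm_apply]
  exact (hmix.summable_autocov hc hρ (hC j k) (hC j l) (hM.integral_score j k)).add
    (hmix.summable_autocov hc hρ (hC j l) (hC j k) (hM.integral_score j l))

/-- Consistency of Newey–West sums of the true scores. -/
theorem tendsto_nwSum_score (j : ℕ) (k l : Fin r) {T K : ℕ → ℕ} (hT : Tendsto T atTop atTop)
    (hK : Tendsto K atTop atTop) (hKT : Tendsto (fun n => ((K n : ℝ) + 1) ^ 3 / T n) atTop (𝓝 0)) :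
    Tendsto (fun p : ℕ × Ω => nwSum (fun t => M.score j k t p.2) (fun t => M.score j l t p.2)
      (T p.1) (K p.1)) (whp P) (𝓝 (M.Phi P j k l)) := by
  obtain ⟨ρ, hρ, c, hc, hmix⟩ := hM.isMixing
  obtain ⟨C, hC⟩ := hM.exists_isMixingProcess_score
  have h1 := hmix.tendsto_nwSum hc hρ (hC j k) (hC j l) (hM.integral_score j k)
    (hM.integral_score j l) (fun t h => hM.integral_score_mul j k l t h)
    (fun t h => hM.integral_score_mul j l k t h) hT hK hKT
  have h2 : (∑' h : ℕ, M.PhiTerm P j (h + 1)) k l = ∑' h : ℕ, M.PhiTerm P j (h + 1) k l :=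
    (((Pi.hasSum.1 ((Pi.hasSum.1 (hM.summable_phiTerm j).hasSum) k)) l).tsum_eq).symm
  have h3 : M.Phi P j k l = ∫ ω, M.score j k 0 ω * M.score j l 0 ω ∂P
      + ∑' h : ℕ, (∫ ω, M.score j k (h + 1) ω * M.score j l 0 ω ∂P
        + ∫ ω, M.score j l (h + 1) ω * M.score j k 0 ω ∂P) := by
    rw [Phi, Matrix.add_apply, h2]
    simp only [hM.phiTerm_apply, Matrix.of_apply]
    congr 1
    refine integral_congr_ae (ae_of_all _ fun ω => ?_)
    simp only [score, Nat.cast_zero]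
    ring
  rw [h3]
  exact h1

end Regular

section

variable {C : ℝ} {N T : ℕ} {ω : Ω} {S : Matrix (Fin N) (Fin N) ℝ} {F : ℕ → Fin r → ℝ}
  (h : M.GoodSample P C N T ω S F)
include h

lemma GoodSample.sqrt_T_pos : 0 < √(T : ℝ) := Real.sqrt_pos.2 (by exact_mod_cast h.pos_T)

lemma GoodSample.sqrt_N_pos : 0 < √(N : ℝ) := Real.sqrt_pos.2 (by exact_mod_cast h.pos_N)

/-- Error of the estimated factors at a fixed time. -/
lemma GoodSample.hat_sub (t : Fin T) (k : Fin r) :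
    F t k - (M.rotFactor N T ω S F *ᵥ M.fvec (t : ℕ) ω) k
      = √(T : ℝ) * pcErr (M.scaledLam N) (M.scaledFactor T ω) (M.scaledError N T ω) S⁻¹
        (scaledHat T F) (M.pcVal N T ω S) t k := by
  have hT := h.sqrt_T_pos
  have h1 := congrFun (congrFun h.pc.Z_eq t) k
  rw [Matrix.add_apply] at h1
  have h2 : F t k = √(T : ℝ) * scaledHat T F t k := by
    simp only [scaledHat, Matrix.of_apply]; field_simp
  have h3 : (M.rotFactor N T ω S F *ᵥ M.fvec (t : ℕ) ω) k
      = √(T : ℝ) * (M.scaledFactor T ω * (M.rotFactor N T ω S F)ᵀ) t k := by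
    simp only [mulVec, dotProduct, Matrix.mul_apply, transpose_apply, scaledFactor,
      Matrix.of_apply, fvec, Finset.mul_sum]
    refine Finset.sum_congr rfl fun m _ => ?_
    field_simp
  rw [h2, h3, ← mul_sub]
  congr 1
  rw [h1]
  exact add_sub_cancel_left _ _

/-- Error of the estimated errors. -/
lemma GoodSample.uHat_sub (j : Fin N) (t : Fin T) :
    uHat (M.y ω) T F j t - M.u j (t : ℕ) ω
      = √(T : ℝ) * IsApproxPC.residDiff (M.scaledFactor T ω) (scaledHat T F)
        (√(N : ℝ) • rowM (M.scaledLam N) j) (√(N : ℝ) • rowM (M.scaledError N T ω) j) () t := by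
  have hT := h.sqrt_T_pos
  have hN := h.sqrt_N_pos
  set l := √(N : ℝ) • rowM (M.scaledLam N) j with hl
  set u := √(N : ℝ) • rowM (M.scaledError N T ω) j with hu
  set X := M.scaledFactor T ω with hX
  set Z := scaledHat T F with hZ
  have e0 : l * Xᵀ + u = √(N : ℝ) • rowM (M.scaledData N T ω) j := by
    rw [scaledData, rowM_add, rowM_mul, smul_add, Matrix.smul_mul]
  have e1 : ((l * Xᵀ + u : Matrix Unit (Fin T) ℝ) () t) = M.y ω j t / √(T : ℝ) := by
    have h1 := congrFun (congrFun (dataMat_eq (M := M) h.pos_N h.pos_T ω) j) t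
    simp only [dataMat, Matrix.of_apply, Matrix.smul_apply, smul_eq_mul] at h1
    rw [e0, h1]
    simp only [Matrix.smul_apply, rowM, Matrix.of_apply, smul_eq_mul]
    field_simp
  have e2 : ∀ k, ((l * Xᵀ + u) * Z : Matrix Unit (Fin r) ℝ) () k = lamHat (M.y ω) T F j k := by
    intro k
    have h1 : lamHat (M.y ω) T F j k = LamHat (M.y ω) N T F j k := rfl
    rw [h1, LamHat_eq h.pos_N h.pos_T, e0, Matrix.smul_mul, ← rowM_mul]
    rfl
  have e3 : ((l * Xᵀ + u) * (1 - Z * Zᵀ : Matrix (Fin T) (Fin T) ℝ) : Matrix Unit (Fin T) ℝ) () t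
      = uHat (M.y ω) T F j t / √(T : ℝ) := by
    rw [Matrix.mul_sub, Matrix.mul_one, ← Matrix.mul_assoc, Matrix.sub_apply, e1, uHat, sub_div]
    congr 1
    rw [Matrix.mul_apply, dotProduct, Finset.sum_div]
    refine Finset.sum_congr rfl fun k _ => ?_
    rw [e2, transpose_apply, hZ]
    simp only [scaledHat, Matrix.of_apply]
    ring
  rw [IsApproxPC.resid_eq, Matrix.add_apply] at e3
  have e4 : u () t = M.u j (t : ℕ) ω / √(T : ℝ) := by
    simp only [hu, Matrix.smul_apply, rowM, scaledError, Matrix.of_apply, smul_eq_mul]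
    field_simp
  rw [e4] at e3
  have e5 : IsApproxPC.residDiff X Z l u () t = (uHat (M.y ω) T F j t - M.u j (t : ℕ) ω) / √(T : ℝ) := by
    rw [sub_div, ← e3]; ring
  rw [e5]; field_simp

lemma GoodSample.sum_sq_hat_sub (k : Fin r) : ∑ t ∈ Finset.range T,
    (F t k - (M.rotFactor N T ω S F *ᵥ M.fvec t ω) k) ^ 2
      ≤ T * (2 * C ^ 3 * pcRate N T) ^ 2 := by
  rw [← Fin.sum_univ_eq_sum_range (fun t : ℕ =>
    (F t k - (M.rotFactor N T ω S F *ᵥ M.fvec (t : ℤ) ω) k) ^ 2)]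
  simp only [h.hat_sub, mul_pow, Real.sq_sqrt (Nat.cast_nonneg T), ← Finset.mul_sum]
  rw [← mul_pow, ← mul_pow]
  refine mul_le_mul_of_nonneg_left ((sum_sq_col_le _ _).trans ?_) (Nat.cast_nonneg _)
  exact pow_le_pow_left₀ (norm_nonneg _) h.pc.norm_pcErr_le 2

/-- The residual differs from the error through the part of the loading that multiplies `X - Z H`
and through the projection of the error row on the estimated factors; both have norm of order
`pcRate`. -/
lemma GoodSample.sum_sq_uHat_sub {j : ℕ} (hj : j < N) : ∑ t ∈ Finset.range T,
    (uHat (M.y ω) T F j t - M.u j t ω) ^ 2 ≤ T * (16 * C ^ 11 * pcRate N T) ^ 2 := by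
  rw [← Fin.sum_univ_eq_sum_range (fun t : ℕ =>
    (uHat (M.y ω) T F j t - M.u j (t : ℤ) ω) ^ 2)]
  have h1 := fun t => h.uHat_sub ⟨j, hj⟩ t
  simp only at h1
  simp only [h1, mul_pow, Real.sq_sqrt (Nat.cast_nonneg T), ← Finset.mul_sum]
  rw [← mul_pow, ← mul_pow]
  refine mul_le_mul_of_nonneg_left ((sum_sq_row_le _ _).trans ?_) (Nat.cast_nonneg _)
  refine pow_le_pow_left₀ (norm_nonneg _) ?_ 2
  refine (h.pc.norm_residDiff _ _).trans ?_
  rw [norm_row_scaledLam h.pos_N]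
  have h2 := h.norm_lam j
  have h3 := h.norm_row_hat ⟨j, hj⟩
  have h4 := h.pc.norm_X_sub
  have hδ := h.pc.delta_nonneg
  have hC := h.pc.c_pos
  have h5 : vnorm (M.lam j) * ‖M.scaledFactor T ω - scaledHat T F * ((scaledHat T F)ᵀ
      * M.scaledFactor T ω)‖ ≤ C * (10 * C ^ 10 * pcRate N T) := by gcongr
  have h6 := mul_le_mul_of_nonneg_right (pow_le_pow_right₀ h.pc.one_le (show 6 ≤ 11 by norm_num)) hδ
  refine (add_le_add h5 h3).trans ?_
  linarith

lemma GoodSample.norm_row_error {b : ℝ} (hb : ∀ i < N, ∀ t < T, |M.u i t ω| ≤ b) (hb0 : 0 ≤ b)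
    (t : Fin T) : ‖√(T : ℝ) • rowM (M.scaledError N T ω)ᵀ t‖ ≤ b := by
  refine le_of_sq_le_sq ?_ hb0
  have hT := h.sqrt_T_pos
  have hN : (0 : ℝ) < N := by exact_mod_cast h.pos_N
  have hT' : (0 : ℝ) < T := by exact_mod_cast h.pos_T
  rw [norm_smul, mul_pow, norm_rowM_sq, Real.norm_of_nonneg hT.le, Real.sq_sqrt hT'.le]
  have h1 : ∀ i : Fin N, (M.scaledError N T ω)ᵀ t i ^ 2 ≤ b ^ 2 / (N * T) := by
    intro i
    simp only [transpose_apply, scaledError, Matrix.of_apply]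
    rw [div_pow, mul_pow, Real.sq_sqrt hN.le, Real.sq_sqrt hT'.le, ← sq_abs]
    have := hb i i.2 t t.2
    gcongr
  calc _ ≤ (T : ℝ) * ∑ i : Fin N, b ^ 2 / (N * T) := by gcongr with i _; exact h1 i
    _ = b ^ 2 := by simp; field_simp

/-- No smallness is obtained here; the point is that the estimated factors are bounded by a multiple
of `b` at every time simultaneously. -/
lemma GoodSample.abs_hat_sub_le {b : ℝ} (hb : ∀ i < N, ∀ t < T, |M.u i t ω| ≤ b) (hb0 : 0 ≤ b)
    {t : ℕ} (ht : t < T) (k : Fin r) :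
    |F t k - (M.rotFactor N T ω S F *ᵥ M.fvec t ω) k| ≤ 2 * C ^ 4 * b := by
  have h1 := h.hat_sub ⟨t, ht⟩ k
  simp only at h1
  have h2 : √(T : ℝ) * pcErr (M.scaledLam N) (M.scaledFactor T ω) (M.scaledError N T ω) S⁻¹
      (scaledHat T F) (M.pcVal N T ω S) ⟨t, ht⟩ k
      = (√(T : ℝ) • rowM (M.scaledError N T ω)ᵀ ⟨t, ht⟩ * S⁻¹ * ((M.scaledLam N *
        (M.scaledFactor T ω)ᵀ + M.scaledError N T ω) * scaledHat T F)
        * diagonal (fun k => (M.pcVal N T ω S k)⁻¹)) () k := by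
    rw [pcErr, Matrix.smul_mul, Matrix.smul_mul, Matrix.smul_mul, ← rowM_mul, ← rowM_mul,
      ← rowM_mul]
    rfl
  rw [h1, h2]
  refine (abs_entry_le _ _ _).trans ((l2_norm_mul_le_of_le (l2_norm_mul_le_of_le
    (l2_norm_mul_le_of_le (h.norm_row_error hb hb0 ⟨t, ht⟩) h.pc.norm_W) h.pc.norm_YZ)
    h.pc.norm_inv).trans (le_of_eq (by ring)))

lemma GoodSample.abs_rotFactor_le (k m : Fin r) : |M.rotFactor N T ω S F k m| ≤ 2 * C ^ 5 :=
  (abs_entry_le _ _ _).trans h.pc.norm_B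

/-- The Newey–West estimator is close to the rotated infeasible one. -/
lemma GoodSample.abs_hac_sub_le {b : ℝ} (hb1 : 1 ≤ b)
    (hb : ∀ a ∈ compIndex r N, ∀ t < T, |M.comp a t ω| ≤ b) {j : ℕ} (hj : j < N) (K : ℕ)
    (k l : Fin r) : |hac (M.y ω) T K F j k l
      - ∑ m, ∑ n, M.rotFactor N T ω S F k m * M.rotFactor N T ω S F l n
        * nwSum (fun t => M.score j m t ω) (fun t => M.score j n t ω) T K|
      ≤ (1 + 2 * K) * ((8 * (r + 1) * C ^ 5 * (100 * (r + 1) * C ^ 16)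
        + (100 * (r + 1) * C ^ 16) ^ 2) * b ^ 3 * pcRate N T) := by
  set B := M.rotFactor N T ω S F with hB
  set δ := pcRate N T with hδ
  have hC := h.pc.c_pos
  have hC1 := h.pc.one_le
  have hδ0 : 0 ≤ δ := h.pc.delta_nonneg
  have hr0 : (0 : ℝ) ≤ r := Nat.cast_nonneg r
  have hb0 : 0 ≤ b := by linarith
  have hu : ∀ i < N, ∀ t < T, |M.u i t ω| ≤ b := fun i hi t ht =>
    hb (Sum.inl i) (inl_mem_compIndex.2 hi) t ht
  have hf : ∀ m : Fin r, ∀ t < T, |M.f m t ω| ≤ b := fun m t ht =>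
    hb (Sum.inr m) (inr_mem_compIndex m) t ht
  set g : Fin r → ℕ → ℝ := fun k t => uHat (M.y ω) T F j t * F t k with hg
  set x : Fin r → ℕ → ℝ := fun k t => M.score j k t ω with hx
  -- `z` are the rotated true scores, `d` the errors of the estimated scores.
  set z : Fin r → ℕ → ℝ := fun k => ∑ m, B k m • x m with hz
  set d : Fin r → ℕ → ℝ := fun k => g k - z k with hd
  have hBf : ∀ k, ∀ t < T, |(B *ᵥ M.fvec t ω) k| ≤ 2 * r * C ^ 5 * b := by
    intro k t ht
    rw [mulVec, dotProduct]
    refine (Finset.abs_sum_le_sum_abs _ _).trans ?_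
    refine (Finset.sum_le_sum (g := fun _ => 2 * C ^ 5 * b) fun m _ => ?_).trans ?_
    · rw [abs_mul]
      exact mul_le_mul (h.abs_rotFactor_le k m) (hf m t ht) (abs_nonneg _) (by positivity)
    · simp; linarith
  have hzt : ∀ k t, z k t = M.u j t ω * (B *ᵥ M.fvec t ω) k := by
    intro k t
    simp only [hz, Finset.sum_apply, Pi.smul_apply, smul_eq_mul, hx, score, mulVec, dotProduct,
      fvec, Finset.mul_sum]
    exact Finset.sum_congr rfl fun m _ => by ring
  have hzs : ∀ k, ∑ t ∈ Finset.range T, z k t ^ 2 ≤ T * (2 * (r + 1) * C ^ 5 * b ^ 2) ^ 2 := by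
    intro k
    refine (Finset.sum_le_sum (g := fun _ => (2 * (r + 1) * C ^ 5 * b ^ 2) ^ 2)
      fun t ht => ?_).trans (by simp)
    have ht := Finset.mem_range.1 ht
    rw [← sq_abs, hzt, abs_mul]
    refine pow_le_pow_left₀ (by positivity) ?_ 2
    calc _ ≤ b * (2 * r * C ^ 5 * b) := mul_le_mul (hu j hj t ht) (hBf k t ht) (abs_nonneg _) hb0
      _ ≤ b * (2 * (r + 1) * C ^ 5 * b) := by gcongr; linarith
      _ = _ := by ring
  set α := (2 * r * C ^ 5 + 2 * C ^ 4) * b with hα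
  have hα0 : 0 ≤ α := by positivity
  have hds : ∀ k, ∑ t ∈ Finset.range T, d k t ^ 2 ≤ T * (100 * (r + 1) * C ^ 16 * (b * δ)) ^ 2 := by
    intro k
    have hpt : ∀ t ∈ Finset.range T, d k t ^ 2 ≤ 2 * α ^ 2 * (uHat (M.y ω) T F j t - M.u j t ω) ^ 2
        + 2 * b ^ 2 * (F t k - (B *ᵥ M.fvec t ω) k) ^ 2 := by
      intro t ht
      have ht := Finset.mem_range.1 ht
      -- Product rule: in each term one factor is bounded pointwise by a multiple of `b`, the other
      -- is small in mean square.
      have e : d k t = (uHat (M.y ω) T F j t - M.u j t ω) * F t k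
          + M.u j t ω * (F t k - (B *ᵥ M.fvec t ω) k) := by
        simp only [hd, Pi.sub_apply, hzt, hg]; ring
      have e1 : F t k ^ 2 ≤ α ^ 2 := by
        rw [← sq_abs (F t k)]
        refine pow_le_pow_left₀ (abs_nonneg _) ?_ 2
        have h1 := h.abs_hat_sub_le hu hb0 ht k
        have h2 := hBf k t ht
        have h3 := abs_add_le (F t k - (B *ᵥ M.fvec t ω) k) ((B *ᵥ M.fvec t ω) k)
        rw [sub_add_cancel] at h3
        rw [hα]; linarith
      have e2 : M.u j t ω ^ 2 ≤ b ^ 2 := by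
        rw [← sq_abs]; exact pow_le_pow_left₀ (abs_nonneg _) (hu j hj t ht) 2
      rw [e]
      refine add_sq_le.trans ?_
      rw [mul_pow, mul_pow, mul_add]
      have e3 := mul_le_mul_of_nonneg_left e1 (sq_nonneg (uHat (M.y ω) T F j t - M.u j t ω))
      have e4 := mul_le_mul_of_nonneg_right e2 (sq_nonneg (F t k - (B *ᵥ M.fvec t ω) k))
      linarith
    refine (Finset.sum_le_sum hpt).trans ?_
    rw [Finset.sum_add_distrib, ← Finset.mul_sum, ← Finset.mul_sum]
    have h1 := h.sum_sq_uHat_sub hj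
    have h2 := h.sum_sq_hat_sub k
    have hT0 : (0 : ℝ) ≤ T := Nat.cast_nonneg T
    calc _ ≤ 2 * α ^ 2 * (T * (16 * C ^ 11 * δ) ^ 2) + 2 * b ^ 2 * (T * (2 * C ^ 3 * δ) ^ 2) := by
          gcongr
      _ ≤ T * (2 * (α * (16 * C ^ 11 * δ) + b * (2 * C ^ 3 * δ))) ^ 2 := by
          have p1 : 0 ≤ α * (16 * C ^ 11 * δ) := by positivity
          have p2 : 0 ≤ b * (2 * C ^ 3 * δ) := by positivity
          have : 2 * (α * (16 * C ^ 11 * δ)) ^ 2 + 2 * (b * (2 * C ^ 3 * δ)) ^ 2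
              ≤ (2 * (α * (16 * C ^ 11 * δ) + b * (2 * C ^ 3 * δ))) ^ 2 := by nlinarith
          calc _ = T * (2 * (α * (16 * C ^ 11 * δ)) ^ 2 + 2 * (b * (2 * C ^ 3 * δ)) ^ 2) := by ring
            _ ≤ _ := mul_le_mul_of_nonneg_left this hT0
      _ ≤ _ := by
          refine mul_le_mul_of_nonneg_left (pow_le_pow_left₀ (by positivity) ?_ 2) hT0
          have q1 : C ^ 15 ≤ C ^ 16 := pow_le_pow_right₀ hC1 (by norm_num)
          have q2 : C ^ 3 ≤ C ^ 16 := pow_le_pow_right₀ hC1 (by norm_num)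
          have q3 : (64 * r * C ^ 16 + 64 * C ^ 15 + 4 * C ^ 3) ≤ 100 * (r + 1) * C ^ 16 := by
            have : 0 ≤ r * C ^ 16 := by positivity
            have : 0 ≤ C ^ 16 := by positivity
            linarith
          calc _ = (64 * r * C ^ 16 + 64 * C ^ 15 + 4 * C ^ 3) * (b * δ) := by rw [hα]; ring
            _ ≤ _ := mul_le_mul_of_nonneg_right q3 (by positivity)
  -- Bilinear expansion at `z + d`: the term in `z` alone is the infeasible estimator, and every
  -- other term contains `d`.
  have hmain : hac (M.y ω) T K F j k l - ∑ m, ∑ n, B k m * B l n * nwSum (x m) (x n) T K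
      = nwSum (z k) (d l) T K + nwSum (d k) (z l) T K + nwSum (d k) (d l) T K := by
    have e1 : hac (M.y ω) T K F j k l = nwForm T K (z k + d k) (z l + d l) := by
      rw [hac_apply, nwForm_apply]
      simp only [hd, add_sub_cancel]
      rfl
    have e2 : nwForm T K (z k) (z l) = ∑ m, ∑ n, B k m * B l n * nwSum (x m) (x n) T K := by
      simp only [hz, map_sum, LinearMap.sum_apply, map_smul, LinearMap.smul_apply, smul_eq_mul,
        nwForm_apply]
      rw [Finset.sum_comm]
      exact Finset.sum_congr rfl fun m _ => by
        rw [Finset.mul_sum]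
        exact Finset.sum_congr rfl fun n _ => by ring
    rw [e1, ← e2]
    simp only [map_add, LinearMap.add_apply, nwForm_apply]
    ring
  rw [hmain]
  set A := 2 * (r + 1) * C ^ 5 * b ^ 2 with hA
  set E := 100 * (r + 1) * C ^ 16 * (b * δ) with hE
  have hA0 : 0 ≤ A := by positivity
  have hE0 : 0 ≤ E := by positivity
  have b1 := abs_nwSum_le hA0 hE0 (hzs k) (hds l) K
  have b2 := abs_nwSum_le hE0 hA0 (hds k) (hzs l) K
  have b3 := abs_nwSum_le hE0 hE0 (hds k) (hds l) K
  refine (abs_add_three _ _ _).trans ((add_le_add (add_le_add b1 b2) b3).trans ?_)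
  -- This makes the term quadratic in the score errors at most linear in `δ`.
  have hδ1 : δ ≤ 1 := by
    have h1 := h.pc.small
    have h2 : 1 ≤ C ^ 3 := one_le_pow₀ hC1
    nlinarith
  have hfin : A * E + E * A + E * E ≤ (8 * (r + 1) * C ^ 5 * (100 * (r + 1) * C ^ 16)
        + (100 * (r + 1) * C ^ 16) ^ 2) * b ^ 3 * δ := by
    have e1 : E * E ≤ (100 * (r + 1) * C ^ 16) ^ 2 * b ^ 3 * δ := by
      calc E * E = (100 * (r + 1) * C ^ 16) ^ 2 * (b ^ 2 * (δ * δ)) := by rw [hE]; ring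
        _ ≤ (100 * (r + 1) * C ^ 16) ^ 2 * (b ^ 3 * (δ * 1)) := by
          gcongr
          norm_num
        _ = _ := by ring
    have e2 : A * E + E * A = 4 * (r + 1) * C ^ 5 * (100 * (r + 1) * C ^ 16) * b ^ 3 * δ := by
      rw [hE, hA]; ring
    have e3 : 0 ≤ 4 * (r + 1) * C ^ 5 * (100 * (r + 1) * C ^ 16) * b ^ 3 * δ := by positivity
    linarith
  calc _ = (1 + 2 * (K : ℝ)) * (A * E + E * A + E * E) := by ring
    _ ≤ _ := mul_le_mul_of_nonneg_left hfin (by positivity)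

end

end FactorModel

end FactorNeweyWest

/-! ### Consistency of the covariance estimators -/

section Consistency

/-- Products of variables approximated by fixed random variables. -/
lemma tendsto_whp_mul_sub {Ω : Type*} {mΩ : MeasurableSpace Ω} {P : Measure Ω}
    [IsFiniteMeasure P] {X X' : ℕ × Ω → ℝ} {Y Y' : Ω → ℝ} (hY : Measurable Y) (hY' : Measurable Y')
    (h : Tendsto (fun x => X x - Y x.2) (whp P) (𝓝 0))
    (h' : Tendsto (fun x => X' x - Y' x.2) (whp P) (𝓝 0)) :
    Tendsto (fun x => X x * X' x - Y x.2 * Y' x.2) (whp P) (𝓝 0) := by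
  have h1 := ((h.mul h').add (tendsto_whp_mul_fixed hY' h)).add (tendsto_whp_mul_fixed hY h')
  simp only [mul_zero, add_zero] at h1
  refine h1.congr fun x => ?_
  ring

lemma dotProduct_mulVec_eq_sum {m : Type*} [Fintype m] (v : m → ℝ) (A : Matrix m m ℝ) :
    v ⬝ᵥ (A *ᵥ v) = ∑ k, ∑ l, v k * A k l * v l := by
  simp only [dotProduct, mulVec, Finset.mul_sum, mul_assoc]

/-- Estimated factors and covariance converge only after alignment of signs, but the quadratic form
combining them is insensitive to signs. -/
lemma dotProduct_mulVec_sign {r : ℕ} (v : Fin r → ℝ) (A : Matrix (Fin r) (Fin r) ℝ)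
    {d : Fin r → ℝ} (hd : ∀ k, d k = 1 ∨ d k = -1) :
    v ⬝ᵥ (A *ᵥ v) = (fun k => d k * v k) ⬝ᵥ ((diagonal d * A * diagonal d) *ᵥ fun k => d k * v k) := by
  have hd2 : ∀ k, d k * d k = 1 := fun k => by
    rcases hd k with e | e <;> rw [e] <;> norm_num
  rw [dotProduct_mulVec_eq_sum, dotProduct_mulVec_eq_sum]
  refine Finset.sum_congr rfl fun k _ => Finset.sum_congr rfl fun l _ => ?_
  rw [mul_diagonal, diagonal_mul]
  calc _ = (d k * d k) * (d l * d l) * (v k * A k l * v l) := by rw [hd2, hd2, one_mul, one_mul]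
    _ = _ := by ring

/-- Quadratic forms in variables approximated by fixed random variables. -/
lemma tendsto_whp_dotProduct_mulVec {Ω : Type*} {mΩ : MeasurableSpace Ω} {P : Measure Ω}
    [IsFiniteMeasure P] {m : Type*} [Fintype m] {v : ℕ × Ω → m → ℝ} {q : Ω → m → ℝ}
    {H : ℕ × Ω → Matrix m m ℝ} {A : Matrix m m ℝ} (hq : ∀ k, Measurable fun ω => q ω k)
    (hv : ∀ k, Tendsto (fun x => v x k - q x.2 k) (whp P) (𝓝 0))
    (hH : ∀ k l, Tendsto (fun x => H x k l) (whp P) (𝓝 (A k l))) :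
    Tendsto (fun x => v x ⬝ᵥ (H x *ᵥ v x) - q x.2 ⬝ᵥ (A *ᵥ q x.2)) (whp P) (𝓝 0) := by
  have h1 : ∀ k l, Tendsto (fun x : ℕ × Ω => v x k * H x k l * v x l
      - q x.2 k * A k l * q x.2 l) (whp P) (𝓝 0) := fun k l =>
    tendsto_whp_mul_sub (X := fun x => v x k * H x k l) (X' := fun x => v x l)
      (Y := fun ω => q ω k * A k l) (Y' := fun ω => q ω l) ((hq k).mul_const _) (hq l)
      (tendsto_whp_mul_sub (X := fun x => v x k) (X' := fun x => H x k l) (Y := fun ω => q ω k)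
        (Y' := fun _ => A k l) (hq k) measurable_const (hv k)
        (tendsto_sub_nhds_zero_iff.2 (hH k l))) (hv l)
  have h2 : Tendsto (fun x : ℕ × Ω => ∑ k, ∑ l, (v x k * H x k l * v x l
      - q x.2 k * A k l * q x.2 l)) (whp P) (𝓝 (∑ _k : m, ∑ _l : m, 0)) :=
    tendsto_finsetSum _ fun k _ => tendsto_finsetSum _ fun l _ => h1 k l
  simp only [Finset.sum_const_zero, Finset.sum_sub_distrib] at h2
  simpa only [dotProduct_mulVec_eq_sum] using h2

/-- With `m` the smaller sample size and `K ≤ m^(1/4)`, the exponents of `m` are `3/4 - 1 = -1/4`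
and `1/4 + 3/40 - 19/40 = -3/20`. -/
lemma PolyGrowth.tendsto_bandwidth {N T K : ℕ → ℕ} (h : PolyGrowth N T)
    (hK : ∀ᶠ n in atTop, (K n : ℝ) ≤ ((min (N n) (T n) : ℕ) : ℝ) ^ (1 / 4 : ℝ)) :
    Tendsto (fun n => ((K n : ℝ) + 1) ^ 3 / T n) atTop (𝓝 0) ∧
    Tendsto (fun n => (1 + 2 * (K n : ℝ)) * ((((min (N n) (T n) : ℕ) : ℝ) ^ (1 / 40 : ℝ)) ^ 3
      * pcRate (N n) (T n))) atTop (𝓝 0) := by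
  have hm := h.tendsto_min.eventually_ge_atTop 1
  constructor
  · have h1 := (h.tendsto_min_rpow (a := 1 / 4) (by norm_num)).const_mul 8
    rw [mul_zero] at h1
    refine squeeze_zero' (Eventually.of_forall fun n => by positivity) ?_ h1
    filter_upwards [hK, hm] with n hK hm
    set m : ℝ := ((min (N n) (T n) : ℕ) : ℝ) with hmdef
    have hm1 : 1 ≤ m := by rw [hmdef]; exact_mod_cast hm
    have hmT : m ≤ T n := by rw [hmdef]; exact_mod_cast min_le_right _ _
    have hm0 : 0 < m := by linarith
    have h2 : 1 ≤ m ^ (1 / 4 : ℝ) := Real.one_le_rpow hm1 (by norm_num)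
    have h3 : (K n : ℝ) + 1 ≤ 2 * m ^ (1 / 4 : ℝ) := by linarith
    have e : m ^ (-(1 / 4) : ℝ) = (m ^ (1 / 4 : ℝ)) ^ 3 / m := by
      rw [← Real.rpow_natCast, ← Real.rpow_mul hm0.le, eq_div_iff hm0.ne']
      nth_rewrite 2 [← Real.rpow_one m]
      rw [← Real.rpow_add hm0]
      norm_num
    calc ((K n : ℝ) + 1) ^ 3 / T n ≤ (2 * m ^ (1 / 4 : ℝ)) ^ 3 / m := by gcongr
      _ = _ := by rw [e]; ring
  · have h1 := (h.tendsto_min_rpow (a := 3 / 20) (by norm_num)).const_mul 3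
    rw [mul_zero] at h1
    refine squeeze_zero' (Eventually.of_forall fun n => by unfold pcRate; positivity) ?_ h1
    filter_upwards [hK, hm] with n hK hm
    unfold pcRate
    set m : ℝ := ((min (N n) (T n) : ℕ) : ℝ) with hmdef
    have hm1 : 1 ≤ m := by rw [hmdef]; exact_mod_cast hm
    have hm0 : 0 < m := by linarith
    have h2 : 1 ≤ m ^ (1 / 4 : ℝ) := Real.one_le_rpow hm1 (by norm_num)
    have h3 : 1 + 2 * (K n : ℝ) ≤ 3 * m ^ (1 / 4 : ℝ) := by linarith
    have e : m ^ (-(3 / 20) : ℝ)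
        = m ^ (1 / 4 : ℝ) * ((m ^ (1 / 40 : ℝ)) ^ 3 * m ^ (-(19 / 40) : ℝ)) := by
      rw [← Real.rpow_natCast, ← Real.rpow_mul hm0.le, ← Real.rpow_add hm0, ← Real.rpow_add hm0]
      norm_num
    calc _ ≤ 3 * m ^ (1 / 4 : ℝ) * ((m ^ (1 / 40 : ℝ)) ^ 3 * m ^ (-(19 / 40) : ℝ)) := by gcongr
      _ = _ := by rw [e]; ring

open scoped Matrix.Norms.L2Operator

namespace FactorModel

variable {r : ℕ} {Ω : Type*} [mΩ : MeasurableSpace Ω] {P : Measure Ω} [IsProbabilityMeasure P]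
  {M : FactorModel r Ω}

/-- Weighted averages of the errors at a fixed time are negligible. -/
lemma Regular.tendsto_weighted_error (hM : M.Regular P) {c : ℝ} (hP : M.PopBounds P c)
    {N : ℕ → ℕ} (hN : Tendsto N atTop atTop) (t : ℤ) (k : Fin r) :
    Tendsto (fun x : ℕ × Ω => 1 / √(N x.1 : ℝ) *
      ∑ i : Fin (N x.1), (M.W P (N x.1) * M.scaledLam (N x.1)) i k * M.u i t x.2) (whp P) (𝓝 0) := by
  have hc := one_pos.trans_le hP.one_le
  refine tendsto_whp_zero_of_integral_sq (X := fun n ω => 1 / √(N n : ℝ) *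
      ∑ i : Fin (N n), (M.W P (N n) * M.scaledLam (N n)) i k * M.u i t ω)
    (Eventually.of_forall fun n => ?_) ?_
  · simp only [mul_pow]
    exact (hM.integral_sq_sum_u _ _).1.const_mul _
  · have h1 : Tendsto (fun n => c ^ 5 / (N n : ℝ)) atTop (𝓝 0) :=
      tendsto_const_nhds.div_atTop (tendsto_natCast_atTop_atTop.comp hN)
    refine squeeze_zero' (Eventually.of_forall fun n => integral_nonneg fun ω => sq_nonneg _) ?_ h1
    filter_upwards [hN.eventually hP.norm_L] with n hL
    simp only [mul_pow]
    rw [integral_const_mul, (hM.integral_sq_sum_u _ _).2, div_pow, one_pow,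
      Real.sq_sqrt (Nat.cast_nonneg _), div_mul_eq_mul_div, one_mul]
    gcongr
    refine (le_abs_self _).trans ((abs_dotProduct_mulVec_le _ _).trans ?_)
    have h1 := l2_norm_mul_le_of_le (hP.norm_W (N n)) hL
    have h2 : (fun i => (M.W P (N n) * M.scaledLam (N n)) i k) ⬝ᵥ
        (fun i => (M.W P (N n) * M.scaledLam (N n)) i k) ≤ (c * c) ^ 2 := by
      have := sum_sq_col_le (M.W P (N n) * M.scaledLam (N n)) k
      refine le_trans (le_of_eq ?_) (this.trans (pow_le_pow_left₀ (norm_nonneg _) h1 2))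
      simp [dotProduct, sq]
    calc _ ≤ c * (c * c) ^ 2 := mul_le_mul (hP.norm_S _) h2 (by
          rw [dotProduct]; exact Finset.sum_nonneg fun i _ => mul_self_nonneg _) hc.le
      _ = c ^ 5 := by ring

/-- Error of the estimated factors at a fixed time. -/
lemma GoodSample.abs_hat_sub_le_weighted {C : ℝ} {N T : ℕ} {ω : Ω}
    {S : Matrix (Fin N) (Fin N) ℝ} {F : ℕ → Fin r → ℝ} (h : M.GoodSample P C N T ω S F) {b ε : ℝ}
    (hb : ∀ i < N, ∀ t < T, |M.u i t ω| ≤ b) (hb0 : 0 ≤ b) (hε : ‖S⁻¹ - M.W P N‖ ≤ ε)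
    {t : ℕ} (ht : t < T) (k : Fin r) :
    |F t k - (M.rotFactor N T ω S F *ᵥ M.fvec t ω) k|
      ≤ ((‖(Matrix.of fun (_ : Unit) (k : Fin r) => 1 / √(N : ℝ) *
        ∑ i : Fin N, (M.W P N * M.scaledLam N) i k * M.u i t ω)‖ + b * ε * C) * C
        + b * C * √(C * pcRate N T)) * C := by
  have hT := h.sqrt_T_pos
  have hC := h.pc.c_pos
  have h1 := h.hat_sub ⟨t, ht⟩ k
  simp only at h1
  set U := M.scaledError N T ω with hU
  set L := M.scaledLam N with hL
  set Z := scaledHat T F with hZ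
  set X := M.scaledFactor T ω with hX
  set a : Matrix Unit (Fin N) ℝ := √(T : ℝ) • rowM Uᵀ ⟨t, ht⟩ with ha
  have h2 : √(T : ℝ) * pcErr L X U S⁻¹ Z (M.pcVal N T ω S) ⟨t, ht⟩ k
      = ((a * S⁻¹ * L * (Zᵀ * X)ᵀ + a * S⁻¹ * U * Z)
        * diagonal (fun k => (M.pcVal N T ω S k)⁻¹)) () k := by
    rw [h.pc.pcErr_eq, ha]
    simp only [Matrix.smul_mul, ← smul_add, ← rowM_mul, ← rowM_add]
    rfl
  have h3 : a * M.W P N * L = Matrix.of fun (_ : Unit) (k : Fin r) => 1 / √(N : ℝ) *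
        ∑ i : Fin N, (M.W P N * L) i k * M.u i t ω := by
    ext x k
    rw [Matrix.mul_assoc, Matrix.mul_apply]
    simp only [ha, hU, Matrix.smul_apply, rowM, Matrix.of_apply, transpose_apply, scaledError,
      smul_eq_mul, Finset.mul_sum]
    refine Finset.sum_congr rfl fun i _ => ?_
    field_simp
  rw [h1, h2, ← h3]
  have han : ‖a‖ ≤ b := h.norm_row_error hb hb0 ⟨t, ht⟩
  -- The true weight is split off, so that the leading term is a nonrandomly weighted average of the
  -- errors at time `t`, to which a law of large numbers applies.
  have b1 : ‖a * S⁻¹ * L‖ ≤ ‖a * M.W P N * L‖ + b * ε * C := by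
    have e : a * S⁻¹ * L = a * M.W P N * L + a * (S⁻¹ - M.W P N) * L := by
      rw [Matrix.mul_sub, Matrix.sub_mul]; abel
    rw [e]
    exact (norm_add_le _ _).trans (add_le_add le_rfl
      (l2_norm_mul_le_of_le (l2_norm_mul_le_of_le han hε) h.pc.norm_L))
  have hUn : ‖U‖ ≤ √(C * pcRate N T) := Real.le_sqrt_of_sq_le h.pc.norm_U_sq
  have b2 := l2_norm_mul_le_of_le (l2_norm_mul_le_of_le (l2_norm_mul_le_of_le han h.pc.norm_W) hUn)
    h.pc.norm_Z
  rw [mul_one] at b2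
  have b3 := l2_norm_mul_le_of_le b1 ((l2_norm_transpose _).trans_le h.pc.norm_H)
  exact (abs_entry_le _ _ _).trans (l2_norm_mul_le_of_le ((norm_add_le _ _).trans
    (add_le_add b3 b2)) h.pc.norm_inv)

section

variable {c : ℝ} {N T : ℕ → ℕ}
    {S : ∀ n, Ω → Matrix (Fin (N n)) (Fin (N n)) ℝ} {F : ℕ → Ω → ℕ → Fin r → ℝ}
    {Q : Matrix (Fin r) (Fin r) ℝ} {w : Fin r → ℝ} {D : ℕ → Ω → Fin r → ℝ}
    (h : M.SecondStage P c N T S F Q w D) (hM : M.Regular P)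
include h

lemma SecondStage.tendsto_rotFactor_apply (k m : Fin r) :
    Tendsto (fun x : ℕ × Ω => D x.1 x.2 k * M.rotFactor (N x.1) (T x.1) x.2 (S x.1 x.2)
      (F x.1 x.2) k m) (whp P) (𝓝 ((Qᵀ)⁻¹ k m)) := by
  have h1 := tendsto_pi_nhds.1 (tendsto_pi_nhds.1 h.rotFactor k) m
  refine h1.congr fun x => ?_
  rw [diagonal_mul]

lemma SecondStage.abs_sign (n : ℕ) (ω : Ω) (k : Fin r) : |D n ω k| = 1 := by
  rcases h.sign n ω k with e | e <;> rw [e] <;> norm_num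

include hM

/-- Consistency of the Newey–West estimator up to signs. -/
theorem SecondStage.tendsto_hac {K : ℕ → ℕ} (hK : Tendsto K atTop atTop)
    (hKm : ∀ᶠ n in atTop, (K n : ℝ) ≤ ((min (N n) (T n) : ℕ) : ℝ) ^ (1 / 4 : ℝ)) (j : ℕ)
    (k l : Fin r) :
    Tendsto (fun x : ℕ × Ω => (diagonal (D x.1 x.2) * hac (M.y x.2) (T x.1) (K x.1) (F x.1 x.2) j
      * diagonal (D x.1 x.2)) k l) (whp P) (𝓝 (((Qᵀ)⁻¹ * M.Phi P j * Q⁻¹) k l)) := by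
  obtain ⟨C, hcC, hg⟩ := h.exists_goodSample
  have hNT := h.first.growth
  obtain ⟨hK1, hK2⟩ := hNT.tendsto_bandwidth hKm
  -- The infeasible estimator in aligned coordinates: a finite sum of products of converging
  -- rotation entries and Newey–West sums of true scores.
  have h1 : Tendsto (fun x : ℕ × Ω => ∑ m, ∑ n,
      (D x.1 x.2 k * M.rotFactor (N x.1) (T x.1) x.2 (S x.1 x.2) (F x.1 x.2) k m) *
      (D x.1 x.2 l * M.rotFactor (N x.1) (T x.1) x.2 (S x.1 x.2) (F x.1 x.2) l n) *
      nwSum (fun t => M.score j m t x.2) (fun t => M.score j n t x.2) (T x.1) (K x.1)) (whp P)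
      (𝓝 (∑ m, ∑ n, (Qᵀ)⁻¹ k m * (Qᵀ)⁻¹ l n * M.Phi P j m n)) :=
    tendsto_finsetSum _ fun m _ => tendsto_finsetSum _ fun n _ =>
      ((h.tendsto_rotFactor_apply k m).mul (h.tendsto_rotFactor_apply l n)).mul
        (hM.tendsto_nwSum_score j m n hNT.tendsto_T hK hK1)
  have e1 : ((Qᵀ)⁻¹ * M.Phi P j * Q⁻¹) k l
      = ∑ m, ∑ n, (Qᵀ)⁻¹ k m * (Qᵀ)⁻¹ l n * M.Phi P j m n := by
    rw [Matrix.mul_apply, Finset.sum_comm]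
    refine Finset.sum_congr rfl fun n _ => ?_
    rw [Matrix.mul_apply, Finset.sum_mul]
    refine Finset.sum_congr rfl fun m _ => ?_
    rw [show Q⁻¹ n l = (Qᵀ)⁻¹ l n by rw [← transpose_nonsing_inv, transpose_apply]]
    ring
  set κ := 8 * (r + 1) * C ^ 5 * (100 * (r + 1) * C ^ 16) + (100 * (r + 1) * C ^ 16) ^ 2 with hκ
  -- Signs have modulus one, so the approximation error is that of the unsigned matrices, with all
  -- components bounded by `min(N,T)^(1/40)`.
  have h2 : Tendsto (fun x : ℕ × Ω => D x.1 x.2 k * D x.1 x.2 l *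
      (hac (M.y x.2) (T x.1) (K x.1) (F x.1 x.2) j k l - ∑ m, ∑ n,
      M.rotFactor (N x.1) (T x.1) x.2 (S x.1 x.2) (F x.1 x.2) k m *
      M.rotFactor (N x.1) (T x.1) x.2 (S x.1 x.2) (F x.1 x.2) l n *
      nwSum (fun t => M.score j m t x.2) (fun t => M.score j n t x.2) (T x.1) (K x.1))) (whp P)
      (𝓝 0) := by
    have h3 := (hK2.const_mul κ).comp (tendsto_fst_whp (P := P))
    rw [mul_zero] at h3
    refine squeeze_zero_norm' ?_ h3
    filter_upwards [hg, hM.eventually_abs_comp_le hNT,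
      tendsto_fst_whp.eventually (hNT.tendsto_N.eventually_gt_atTop j),
      tendsto_fst_whp.eventually (hNT.tendsto_min.eventually_ge_atTop 1)] with x hx hb hj hm
    have hb1 : 1 ≤ ((min (N x.1) (T x.1) : ℕ) : ℝ) ^ (1 / 40 : ℝ) :=
      Real.one_le_rpow (by exact_mod_cast hm) (by norm_num)
    rw [Real.norm_eq_abs, abs_mul, abs_mul, h.abs_sign, h.abs_sign, one_mul, one_mul]
    refine (hx.abs_hac_sub_le hb1 hb hj (K x.1) k l).trans (le_of_eq ?_)
    simp only [Function.comp_apply, hκ]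
    ring
  have h3 := h2.add h1
  rw [zero_add, ← e1] at h3
  refine h3.congr fun x => ?_
  rw [mul_diagonal, diagonal_mul, mul_sub, Finset.mul_sum]
  simp only [Finset.mul_sum]
  have : ∀ m n, D x.1 x.2 k * D x.1 x.2 l *
      (M.rotFactor (N x.1) (T x.1) x.2 (S x.1 x.2) (F x.1 x.2) k m *
      M.rotFactor (N x.1) (T x.1) x.2 (S x.1 x.2) (F x.1 x.2) l n *
      nwSum (fun t => M.score j m t x.2) (fun t => M.score j n t x.2) (T x.1) (K x.1))
      = (D x.1 x.2 k * M.rotFactor (N x.1) (T x.1) x.2 (S x.1 x.2) (F x.1 x.2) k m) *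
      (D x.1 x.2 l * M.rotFactor (N x.1) (T x.1) x.2 (S x.1 x.2) (F x.1 x.2) l n) *
      nwSum (fun t => M.score j m t x.2) (fun t => M.score j n t x.2) (T x.1) (K x.1) :=
    fun m n => by ring
  simp only [this]
  ring

/-- Estimated factors at a fixed time are consistent up to a rotation. -/
theorem SecondStage.tendsto_hat (t : ℕ) (k : Fin r) :
    Tendsto (fun x : ℕ × Ω => D x.1 x.2 k * F x.1 x.2 t k - ((Qᵀ)⁻¹ *ᵥ M.fvec t x.2) k) (whp P)
      (𝓝 0) := by
  obtain ⟨C, hcC, hg⟩ := h.exists_goodSample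
  obtain ⟨ε, hε, hW⟩ := h.weight
  have hNT := h.first.growth
  have hC : 0 < C := (one_pos.trans_le h.first.pop.one_le).trans_le hcC
  -- The row at time `t` of the cross term with the true weight. At a fixed time it vanishes in the
  -- limit by its own variance bound; the mean square accuracy over all times would not give this.
  set G : ℕ × Ω → Matrix Unit (Fin r) ℝ := fun x => Matrix.of fun (_ : Unit) (k : Fin r) =>
    1 / √(N x.1 : ℝ) * ∑ i : Fin (N x.1),
      (M.W P (N x.1) * M.scaledLam (N x.1)) i k * M.u i (t : ℤ) x.2 with hGdef
  have hG : Tendsto G (whp P) (𝓝 0) := tendsto_pi_nhds.2 fun _ => tendsto_pi_nhds.2 fun k =>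
    hM.tendsto_weighted_error h.first.pop hNT.tendsto_N t k
  have hGn : Tendsto (fun x => ‖G x‖) (whp P) (𝓝 0) := by simpa using hG.norm
  set b : ℕ → ℝ := fun n => ((min (N n) (T n) : ℕ) : ℝ) ^ (1 / 40 : ℝ) with hb
  -- `b` is at most `N^(1/4)`, so the weight rate `o(N^(-1/4))` outweighs the growing bound for the
  -- errors.
  have hbε : Tendsto (fun n => b n * |ε n|) atTop (𝓝 0) := by
    have h1 := hε.abs
    rw [abs_zero] at h1
    refine squeeze_zero' (Eventually.of_forall fun n => by positivity) ?_ h1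
    filter_upwards [hNT.tendsto_min.eventually_ge_atTop 1] with n hn
    rw [abs_mul, abs_of_nonneg (by positivity : (0 : ℝ) ≤ (N n : ℝ) ^ (1 / 4 : ℝ))]
    refine mul_le_mul_of_nonneg_right ?_ (abs_nonneg _)
    have h2 : ((min (N n) (T n) : ℕ) : ℝ) ≤ N n := by exact_mod_cast min_le_left _ _
    have h3 : (1 : ℝ) ≤ ((min (N n) (T n) : ℕ) : ℝ) := by exact_mod_cast hn
    exact (Real.rpow_le_rpow (by linarith) h2 (by norm_num)).trans
      (Real.rpow_le_rpow_of_exponent_le (h3.trans h2) (by norm_num))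
  have hbδ : Tendsto (fun n => b n * √(C * pcRate (N n) (T n))) atTop (𝓝 0) := by
    have h1 := (hNT.tendsto_min_rpow (a := 17 / 80) (by norm_num)).const_mul √C
    rw [mul_zero] at h1
    refine h1.congr' ?_
    filter_upwards [hNT.tendsto_min.eventually_ge_atTop 1] with n hn
    have h3 : (0 : ℝ) < ((min (N n) (T n) : ℕ) : ℝ) := by exact_mod_cast hn
    simp only [hb, pcRate]
    rw [Real.sqrt_mul hC.le, Real.sqrt_eq_rpow (_ ^ _), ← Real.rpow_mul h3.le, mul_left_comm,
      ← Real.rpow_add h3]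
    norm_num
  have hbound : Tendsto (fun x : ℕ × Ω => ((‖G x‖ + b x.1 * |ε x.1| * C) * C
        + b x.1 * C * √(C * pcRate (N x.1) (T x.1))) * C) (whp P) (𝓝 0) := by
    have h1 := hbε.comp (tendsto_fst_whp (P := P))
    have h2 := hbδ.comp (tendsto_fst_whp (P := P))
    have h3 := (((hGn.add (h1.mul_const C)).mul_const C).add (h2.mul_const C)).mul_const C
    simp only [zero_mul, add_zero] at h3
    refine h3.congr fun x => ?_
    simp only [Function.comp_apply]
    ring
  have h1 : Tendsto (fun x : ℕ × Ω => D x.1 x.2 k * (F x.1 x.2 t k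
      - (M.rotFactor (N x.1) (T x.1) x.2 (S x.1 x.2) (F x.1 x.2) *ᵥ M.fvec t x.2) k)) (whp P)
      (𝓝 0) := by
    refine squeeze_zero_norm' ?_ hbound
    filter_upwards [hg, hW, hM.eventually_abs_comp_le hNT,
      tendsto_fst_whp.eventually (hNT.tendsto_T.eventually_gt_atTop t)] with x hx hWx hbx ht
    rw [Real.norm_eq_abs, abs_mul, h.abs_sign, one_mul]
    exact hx.abs_hat_sub_le_weighted
      (fun i hi t ht => hbx (Sum.inl i) (inl_mem_compIndex.2 hi) t ht) (by positivity)
      (hWx.trans (le_abs_self _)) ht k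
  have h2 : Tendsto (fun x : ℕ × Ω => ∑ m, (D x.1 x.2 k * M.rotFactor (N x.1) (T x.1) x.2
      (S x.1 x.2) (F x.1 x.2) k m - (Qᵀ)⁻¹ k m) * M.f m t x.2) (whp P) (𝓝 0) := by
    have := tendsto_finsetSum (f := fun (m : Fin r) (x : ℕ × Ω) =>
      (D x.1 x.2 k * M.rotFactor (N x.1) (T x.1) x.2
      (S x.1 x.2) (F x.1 x.2) k m - (Qᵀ)⁻¹ k m) * M.f m t x.2) Finset.univ fun m _ =>
      tendsto_whp_mul_fixed (hM.measurable_f m t)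
        (tendsto_sub_nhds_zero_iff.2 (h.tendsto_rotFactor_apply k m))
    simpa using this
  have h3 := h1.add h2
  rw [add_zero] at h3
  refine h3.congr fun x => ?_
  simp only [mulVec, dotProduct, fvec, sub_mul, Finset.sum_sub_distrib, mul_sub, Finset.mul_sum,
    mul_assoc]
  ring

/-- Consistency of the second component of the variance of the estimated common component. -/
theorem SecondStage.tendsto_theta2Hat {K : ℕ → ℕ} (hK : Tendsto K atTop atTop)
    (hKm : ∀ᶠ n in atTop, (K n : ℝ) ≤ ((min (N n) (T n) : ℕ) : ℝ) ^ (1 / 4 : ℝ)) (i t : ℕ) :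
    Tendsto (fun x : ℕ × Ω => Theta2Hat (M.y x.2) (T x.1) (K x.1) (F x.1 x.2) i t
      - M.fvec t x.2 ⬝ᵥ (M.OmegaMat P i *ᵥ M.fvec t x.2)) (whp P) (𝓝 0) := by
  have hqm : ∀ k, Measurable fun ω => ((Qᵀ)⁻¹ *ᵥ M.fvec t ω) k := fun k =>
    by
      simp only [mulVec, dotProduct, fvec]
      exact Finset.measurable_sum _ fun m _ => (hM.measurable_f m t).const_mul _
  refine (tendsto_whp_dotProduct_mulVec hqm (h.tendsto_hat hM t)
    (h.tendsto_hac hM hK hKm i)).congr fun x => ?_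
  congr 1
  · exact (dotProduct_mulVec_sign _ _ (h.sign x.1 x.2)).symm
  -- Since `QᵀQ = cov(f)`, the inverse covariance is `Q⁻¹(Qᵀ)⁻¹`, and the rotations of the factors
  -- and of `Φ_i` combine to `Ω_i`.
  · have e1 : M.OmegaMat P i = Q⁻¹ * ((Qᵀ)⁻¹ * M.Phi P i * Q⁻¹) * (Qᵀ)⁻¹ := by
      rw [OmegaMat, ← h.Q_mul, Matrix.mul_inv_rev]
      simp only [Matrix.mul_assoc]
    rw [e1, ← Matrix.mulVec_mulVec _ _ (Qᵀ)⁻¹, ← Matrix.mulVec_mulVec _ Q⁻¹,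
      Matrix.dotProduct_mulVec _ Q⁻¹, ← Matrix.mulVec_transpose, transpose_nonsing_inv]

end

end FactorModel

end Consistency

lemma PolyGrowth.bandwidth_le {N T K : ℕ → ℕ}
    (h : (fun n => (K n : ℝ)) =o[atTop]
        (fun n => min ((T n : ℝ) ^ (1 / 4 : ℝ)) ((N n : ℝ) ^ (1 / 4 : ℝ)))) :
    ∀ᶠ n in atTop, (K n : ℝ) ≤ ((min (N n) (T n) : ℕ) : ℝ) ^ (1 / 4 : ℝ) := by
  filter_upwards [h.bound one_pos] with n hn
  rw [one_mul, Real.norm_of_nonneg (by positivity), Real.norm_of_nonneg (by positivity)] at hn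
  rcases le_total (N n) (T n) with hab | hab
  · rw [min_eq_left hab]; exact hn.trans (min_le_right _ _)
  · rw [min_eq_right hab]; exact hn.trans (min_le_left _ _)

theorem theorem4p4 {r : ℕ} {Ω : Type*} [MeasurableSpace Ω] (P : Measure Ω)
    [IsProbabilityMeasure P] (M : FactorModel r Ω) (hM : M.Regular P) (hΛ : M.Pervasive)
    (hW : M.BoundedRowSums P) :
    ∃ C₀ > 0, ∀ C ≥ C₀, ∀ (s : ℕ → ℕ → ℝ → ℝ → ℝ), IsThresholding s →
    ∀ (N T K : ℕ → ℕ) (q : ℝ) (SU : ∀ n, Finset (Fin (N n) × Fin (N n)))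
      (SigLam Γ : Matrix (Fin r) (Fin r) ℝ),
      -- sample sizes and bandwidth
      Tendsto N atTop atTop → Tendsto T atTop atTop → Tendsto K atTop atTop →
      (fun n => (K n : ℝ)) =o[atTop]
        (fun n => min ((T n : ℝ) ^ (1 / 4 : ℝ)) ((N n : ℝ) ^ (1 / 4 : ℝ))) →
      (fun n => (N n : ℝ) ^ (1 / (2 - 2 * q)) * Real.log (N n)) =o[atTop]
        (fun n => (T n : ℝ)) →
      (fun n => (T n : ℝ)) =o[atTop] (fun n => (N n : ℝ) ^ 2) →
      -- assumptions on the model along the sample sizes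
      M.CondSparse P q N T SU →
      Tendsto (fun n => √(N n : ℝ) * M.sparsity P q (N n) ^ 2
        * omegaRate (N n) (T n) ^ (2 - 2 * q)) atTop (𝓝 0) →
      M.MomentConditions P N T → M.LimitConditions P N SigLam →
      M.WeightedConditions P N T SU →
      -- eigenvectors of the limit matrix
      IsTopEigenvectors (M.limitMat P SigLam) Γ →
      -- leading eigenvectors of the sample covariance, and estimated factors
      ∀ (E : ∀ n, Ω → Matrix (Fin (N n)) (Fin r) ℝ) (F : ℕ → Ω → ℕ → Fin r → ℝ)
        (S : ∀ n, Ω → Matrix (Fin (N n)) (Fin (N n)) ℝ),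
      (∀ᶠ n in atTop, ∀ ω, IsTopEigenvectors (sampleCov (M.y ω) (N n) (T n)) (E n ω)) →
      (∀ n ω, S n ω = sigmaHat s C (M.y ω) (N n) (T n) (E n ω)) →
      (∀ᶠ n in atTop, ∀ ω, IsWPC (M.y ω) (N n) (T n) (S n ω) (F n ω)) →
      -- conclusion
      MatTendstoInProb P (fun n ω => VeInvHat (M.y ω) (N n) (T n) (S n ω) (F n ω))
          (M.Ve P SigLam)⁻¹ ∧
      (∀ j : ℕ, Summable fun h : ℕ => M.PhiTerm P j (h + 1)) ∧
      -- the signs of the eigenvectors are aligned by a diagonal matrix of signs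
      (∃ D : ℕ → Ω → Fin r → ℝ, (∀ n ω k, D n ω k = 1 ∨ D n ω k = -1) ∧
        ∀ j : ℕ, MatTendstoInProb P
          (fun n ω => Matrix.diagonal (D n ω) * hac (M.y ω) (T n) (K n) (F n ω) j
            * Matrix.diagonal (D n ω))
          (((M.Qe P SigLam Γ)ᵀ)⁻¹ * M.Phi P j * (M.Qe P SigLam Γ)⁻¹)) ∧
      (∀ i : ℕ, TendstoInMeasure P
        (fun n ω => Theta1Hat (M.y ω) (N n) (T n) (S n ω) (F n ω) i
          - M.lam i ⬝ᵥ (M.XiE P (N n) *ᵥ M.lam i)) atTop (fun _ => 0)) ∧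
      (∀ i t : ℕ, TendstoInMeasure P
        (fun n ω => Theta2Hat (M.y ω) (T n) (K n) (F n ω) i t) atTop
        (fun ω => M.fvec t ω ⬝ᵥ (M.OmegaMat P i *ᵥ M.fvec t ω))) := by

  -- The threshold constant is fixed by the model alone, ahead of the thresholding functions and the
  -- sample sizes.
  obtain ⟨c, C₀, hC₀, hfirst⟩ := hM.exists_firstStage hΛ
  refine ⟨C₀, hC₀, ?_⟩
  intro C hC s hs N T K q SU SigLam Γ hN hT hK hKo hNT hTN hsp hrate hmom hlim hwc hΓ E F S hE hS hF
  have hgrow := PolyGrowth.of_isLittleO hN hT hsp.q_nonneg hsp.q_lt hNT hTN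
  have h1 := hfirst C hC s hs N T q hgrow hsp.q_nonneg (by linarith [hsp.q_lt]) hrate E F S hE hS hF
  obtain ⟨hSs, hSpos, hSu⟩ := h1.pop.sigLam_properties hN hlim.tendsto
  obtain ⟨c₁, -, c₂, hc₂, -, -, hFb⟩ := hM.bounds
  have hF' := (symm_norm_bounds (FactorModel.sigmaF_isHermitian (M := M) (P := P)) hc₂ (b := c₁)
    fun x hx => ⟨(hFb x hx).1.le, (hFb x hx).2.le⟩).2.2.2
  obtain ⟨hQ, hQS, hQu, hw, hwi⟩ := FactorModel.qe_properties hc₂ hF' h1.pop.isUnit_F hSs hSpos hSu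
    hlim.distinct hΓ
  obtain ⟨D, h2⟩ := h1.secondStage hM hlim.tendsto hQ hQS hQu hw hwi
  have hKm := PolyGrowth.bandwidth_le hKo
  refine ⟨fun i j => tendstoInMeasure_const_iff_whp.2 ?_, hM.summable_phiTerm,
    ⟨D, h2.sign, fun j k l => tendstoInMeasure_const_iff_whp.2 (h2.tendsto_hac hM hK hKm j k l)⟩,
    fun i => tendstoInMeasure_const_iff_whp.2 (h2.tendsto_theta1Hat hlim.tendsto hQS hSu i),
    fun i t => tendstoInMeasure_iff_whp.2 (h2.tendsto_theta2Hat hM hK hKm i t)⟩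
  exact tendsto_pi_nhds.1 (tendsto_pi_nhds.1 h2.tendsto_veInvHat i) j
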